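/- **Theorem.** Fix $\eta=\tfrac{99}{100}$, write $D_R=R\partial_R$, $D_\theta=\sin(2\theta)\partial_\theta$, $w(R)=\frac{(1+R)^2}{R^2}$, and for $\gamma>1$ and an integer $k\ge 0$ let $\mathcal H^k=\mathcal H^k([0,\infty)\times[0,\pi/2])$ be the space of functions $f(R,\theta)$ whose weak derivatives below exist on $(0,\infty)\times(0,\pi/2)$ and for which $$|f|_{\mathcal H^k}^2=\sum_{j=0}^k\Big|D_R^jf\,\frac{w}{\sin(2\theta)^{\eta/2}}\Big|_{L^2}^2+\sum_{i\ge1,\ i+j\le k}\Big|D_R^jD_\theta^if\,\frac{w}{\sin(2\theta)^{\gamma/2}}\Big|_{L^2}^2<\infty ,$$ where $L^2$ is taken with respect to $dR\,d\theta$. Put $$L_{12}(F)(R)=\int_R^\infty\int_0^{\pi/2}F(r,\theta)\,\frac{3\sin\theta\cos^2\theta}{r}\,d\theta\,dr .$$ For every $k\ge 0$ there is a constant $C_k$, depending only on $k$, such that the following holds for all $0<\alpha\le\frac14$, all $1<\gamma\le\frac54$ (in particular for $\gamma=1+\frac{\alpha}{10}$) and all $F\in\mathcal H^k$. Let $\Psi$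 be a $C^2$ solution on $(0,\infty)\times(0,\pi/2)$, continuous on $[0,\infty)\times[0,\pi/2]$, of the polar axisymmetric Biot–Savart equation $$-\alpha^2R^2\partial_{RR}\Psi-\alpha(5+\alpha)R\partial_R\Psi-\partial_{\theta\theta}\Psi+\partial_\theta\big(\tan(\theta)\Psi\big)-6\Psi=F,$$ with $\Psi(R,0)=\Psi(R,\pi/2)=0$ for all $R\ge0$ and $\Psi(R,\theta)\to0$ as $R\to\infty$, uniformly in $\theta$. Then $$\alpha^2\,|R^2\partial_{RR}\Psi|_{\mathcal H^k}+\Big|\partial_{\theta\theta}\Big(\Psi-\frac1{4\alpha}\sin(2\theta)L_{12}(F)\Big)\Big|_{\mathcal H^k}\le C_k\,|F|_{\mathcal H^k}.$$ In particular $C_k$ is independent of $\alpha$, $\gamma$, $F$ and $\Psi$. -/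

import Mathlib

open MeasureTheory Set Filter Topology
open scoped ENNReal NNReal ContDiff

noncomputable section

namespace PolarBS

/-! The variables are `p = (R, θ)`, so `p.1 = R` and `p.2 = θ`. -/

/-- The open domain `(0, ∞) × (0, π/2)`. -/
def dom : Set (ℝ × ℝ) := Ioi 0 ×ˢ Ioo 0 (Real.pi / 2)

/-- The closed domain `[0, ∞) × [0, π/2]`. -/
def closedDom : Set (ℝ × ℝ) := Ici 0 ×ˢ Icc 0 (Real.pi / 2)

/-! ### Classical partial derivatives -/

/-- `∂_R f`. -/
def partialR (f : ℝ × ℝ → ℝ) (p : ℝ × ℝ) : ℝ := deriv (fun r => f (r, p.2)) p.1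

/-- `∂_θ f`. -/
def partialTheta (f : ℝ × ℝ → ℝ) (p : ℝ × ℝ) : ℝ := deriv (fun t => f (p.1, t)) p.2

/-! ### The weak derivatives `D_R^j D_θ^i`, where `D_R = R ∂_R` and `D_θ = sin(2θ) ∂_θ` -/

/-- The formal adjoint of `D_R` : `φ ↦ -∂_R (R φ)`. -/
def adjointDR (φ : ℝ × ℝ → ℝ) (p : ℝ × ℝ) : ℝ :=
  -partialR (fun q => q.1 * φ q) p

/-- The formal adjoint of `D_θ` : `φ ↦ -∂_θ (sin(2θ) φ)`. -/
def adjointDTheta (φ : ℝ × ℝ → ℝ) (p : ℝ × ℝ) : ℝ :=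
  -partialTheta (fun q => Real.sin (2 * q.2) * φ q) p

/-- `φ ∈ C_c^∞((0, ∞) × (0, π/2))`. -/
structure IsTest (φ : ℝ × ℝ → ℝ) : Prop where
  smooth : ContDiff ℝ ∞ φ
  compact : HasCompactSupport φ
  support : tsupport φ ⊆ dom

/-- `g = D_R^j D_θ^i f` in the sense of distributions on `(0, ∞) × (0, π/2)`,
with `f` and `g` locally integrable. -/
structure IsWeakDeriv (i j : ℕ) (f g : ℝ × ℝ → ℝ) : Prop where
  locInt_left : LocallyIntegrableOn f dom
  locInt_right : LocallyIntegrableOn g dom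
  integral_eq : ∀ φ : ℝ × ℝ → ℝ, IsTest φ →
    ∫ p in dom, g p * φ p = ∫ p in dom, f p * (adjointDTheta^[i] (adjointDR^[j] φ)) p

/-! ### The weighted Sobolev norm -/

/-- The exponent `η = 99/100`. -/
def eta : ℝ := 99 / 100

/-- The radial weight `w(R) = (1 + R)² / R²`. -/
def radialWeight (R : ℝ) : ℝ := (1 + R) ^ 2 / R ^ 2

/-- `|(D_R^j D_θ^i f) w sin(2θ)^{-σ/2}|²_{L²}`, for the measure `dR dθ`. A weak derivative is unique
up to a null set, so the infimum is the value at the weak derivative; it is `∞` if there is none. -/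
def weightedSq (σ : ℝ) (i j : ℕ) (f : ℝ × ℝ → ℝ) : ℝ≥0∞ :=
  ⨅ (g : ℝ × ℝ → ℝ) (_ : IsWeakDeriv i j f g),
    ∫⁻ p in dom, ENNReal.ofReal
      ((g p * (radialWeight p.1 * Real.sin (2 * p.2) ^ (-σ / 2))) ^ 2)

/-- The norm of `𝓗^k`, whose square is
`∑_{j ≤ k} |D_R^j f w sin(2θ)^{-η/2}|² + ∑_{i + j ≤ k, i ≥ 1} |D_R^j D_θ^i f w sin(2θ)^{-γ/2}|²`.
It is finite exactly on the space `𝓗^k`. -/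
def hNorm (γ : ℝ) (k : ℕ) (f : ℝ × ℝ → ℝ) : ℝ≥0∞ :=
  ((∑ j ∈ Finset.range (k + 1), weightedSq eta 0 j f) +
    ∑ ij ∈ (Finset.range (k + 1) ×ˢ Finset.range (k + 1)).filter
        (fun ij => 1 ≤ ij.1 ∧ ij.1 + ij.2 ≤ k),
      weightedSq γ ij.1 ij.2 f) ^ (1 / 2 : ℝ)

/-! ### The operator `L₁₂` and the polar Biot–Savart equation -/

/-- `K(θ) = 3 sin θ cos² θ`. -/
def kernelK (θ : ℝ) : ℝ := 3 * Real.sin θ * Real.cos θ ^ 2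

/-- `L₁₂(f)(R) = ∫_R^∞ ∫_0^{π/2} f(r, θ) K(θ) / r dθ dr`. -/
def L12 (f : ℝ × ℝ → ℝ) (R : ℝ) : ℝ :=
  ∫ r in Ioi R, ∫ θ in (0 : ℝ)..(Real.pi / 2), f (r, θ) * kernelK θ / r

/-- `L(Ψ) = -α² R² ∂_RR Ψ - α (5 + α) R ∂_R Ψ - ∂_θθ Ψ + ∂_θ (tan θ Ψ) - 6 Ψ`. -/
def polarL (α : ℝ) (Ψ : ℝ × ℝ → ℝ) (p : ℝ × ℝ) : ℝ :=
  -α ^ 2 * p.1 ^ 2 * partialR (partialR Ψ) p - α * (5 + α) * p.1 * partialR Ψ p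
    - partialTheta (partialTheta Ψ) p
    + partialTheta (fun q => Real.tan q.2 * Ψ q) p - 6 * Ψ p

/-- `Ψ` is a `C²` solution of `L(Ψ) = F` on `(0, ∞) × (0, π/2)`, continuous up to the boundary of
`[0, ∞) × [0, π/2]`, that vanishes on `θ = 0`, on `θ = π/2`, and as `R → ∞`
(uniformly in `θ`). -/
structure IsSolution (α : ℝ) (F Ψ : ℝ × ℝ → ℝ) : Prop where
  contDiffOn : ContDiffOn ℝ 2 Ψ dom
  continuousOn : ContinuousOn Ψ closedDom
  equation : ∀ᵐ p ∂(volume.restrict dom), polarL α Ψ p = F p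
  zero_left : ∀ R : ℝ, 0 ≤ R → Ψ (R, 0) = 0
  zero_right : ∀ R : ℝ, 0 ≤ R → Ψ (R, Real.pi / 2) = 0
  decay : TendstoUniformlyOn (fun R θ => Ψ (R, θ)) (fun _ => 0) atTop (Icc 0 (Real.pi / 2))

end PolarBS

end

/-!
Put `R = e^s` and `tan θ = e^{2τ}`. Then `D_R = ∂_s` and `D_θ = ∂_τ`, the domain becomes the whole
plane, weak derivatives become distributional derivatives (`isWeakDeriv_iff`), and the weights become
`wt s * sn τ ^ (1 - σ)` up to bounded factors, where `sn`, `cs`, `co` are `sin 2θ`, `cos 2θ`, `cos θ`.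
With `u` for `Ψ`, the equation reads `-α² u_ss - 5α u_s + A u = F`, where the angular operator `A` is
written as a first order system: if `w = (u_τ - 2 cs u) / sn²`, then `y = A u` satisfies
`w_τ + (5 cs - 1) w = -y` (`IsSolution.exists_planeSol`). The quantities to be estimated are
`α² (u_ss - u_s)` and `-4 Z + (1 - cs) w - y`, with `Z = u - (4α)⁻¹ sn L₁₂(F)`; both are combinations,
with bounded coefficients, of `Z`, `α u_s`, `α² u_ss`, `w` and `y`.

*One ray.* The boundary conditions force `∫ sn² co y = 0` (`AngSys.integral_flux_deriv`): the range of
`A` is orthogonal to `3 sin θ cos² θ`. The kernel of `A` is spanned by `sn`. On its complement the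
next eigenvalue is `14` (`AngSys.poincare`), and adding a large multiple of the natural weight to
`sin(2θ)^{-η}` makes `A` coercive there (`AngSys.coercive`). Moreover `w` is bounded by `y`, by a
Hardy inequality for the transport equation (`hardy_lintegral`).

*The radial estimate.* The projection `p` of `u` to the kernel satisfies `α² p'' + 5α p' = -h`, with `h`
the projection of `F`. This is a first order equation for `α p'`, so `α p'` and `α² p''` are bounded
uniformly in `α`; integrated once from infinity it says that `p - (4α)⁻¹ L₁₂(F) = -(α / 5) p'`, which
is where the singular part of the solution comes from (`PlaneSol.mode_sub_ell`). On the
complement of the kernel, pairing the equation with `u` and with `-α² u_ss` gives bounds uniform in `α`,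
because the spectral gap absorbs the derivatives of the radial weight (`RadWeight.energy`). As the
solution has no a priori decay in the weighted spaces, this is done for `u` convolved with a kernel
in `s`, which makes all `s`-derivatives bounded, and for truncated radial weights; the truncation
is then removed (`PlaneSol.mollified_estimate`). Bounds uniform in the mollifier are bounds for the
distributions (`bdd_of_sconv`), and the derivatives of a mollifier are kernels too, so all the
`s`-derivatives are covered with the exponent `η`.

*Angular derivatives.* They are added one at a time (`Fam.Hierarchy.regularity`). By
`u_τ = 2 cs u + sn² w` and its analogues, a `τ`-derivative is traded for terms of lower order and a
factor `sn²`, and this factor is what improves the exponent from `η` to `γ ≤ 2` (`Fam.UBM.pm_sn_sq`).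
The derivative of `w` solves a transport equation again, for which the Hardy inequality holds in
every one of the weighted spaces (`Bdd.of_transport`). The only term with too many derivatives,
`α² sn² ∂_s² w` in the derivative of `α² u_ss`, is bounded by the coercive part of the radial estimate
for `u_s`.
-/

open MeasureTheory Set Filter Topology
open scoped ENNReal NNReal ContDiff Convolution

noncomputable section

namespace PolarBS

/-! ### The angular coordinate `τ`, with `tan θ = exp (2τ)` and `D_θ = ∂_τ` -/

/-- The angle `θ = arctan (exp (2τ))`, which solves `dθ/dτ = sin 2θ`. -/
def ang (τ : ℝ) : ℝ := Real.arctan (Real.exp (2 * τ))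

/-- `sin 2θ` as a function of `τ`. -/
def sn (τ : ℝ) : ℝ := 2 * Real.exp (2 * τ) / (1 + Real.exp (2 * τ) ^ 2)

/-- `cos 2θ` as a function of `τ`. -/
def cs (τ : ℝ) : ℝ := (1 - Real.exp (2 * τ) ^ 2) / (1 + Real.exp (2 * τ) ^ 2)

/-- `cos θ` as a function of `τ`. -/
def co (τ : ℝ) : ℝ := 1 / √(1 + Real.exp (2 * τ) ^ 2)

lemma one_add_exp_sq_pos (τ : ℝ) : 0 < 1 + Real.exp (2 * τ) ^ 2 := by positivity

lemma sn_pos (τ : ℝ) : 0 < sn τ := by unfold sn; positivity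

lemma co_pos (τ : ℝ) : 0 < co τ := by unfold co; positivity

lemma sn_sq (τ : ℝ) : sn τ ^ 2 = 1 - cs τ ^ 2 := by
  have := one_add_exp_sq_pos τ
  unfold sn cs; field_simp; ring

lemma co_sq (τ : ℝ) : co τ ^ 2 = (1 + cs τ) / 2 := by
  have := one_add_exp_sq_pos τ
  unfold co cs
  rw [div_pow, Real.sq_sqrt this.le]; field_simp; ring

lemma cs_lt_one (τ : ℝ) : cs τ < 1 := by
  nlinarith [sn_pos τ, sn_sq τ, sq_nonneg (cs τ - 1), pow_pos (sn_pos τ) 2]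

lemma neg_one_lt_cs (τ : ℝ) : -1 < cs τ := by
  nlinarith [sn_pos τ, sn_sq τ, sq_nonneg (cs τ + 1), pow_pos (sn_pos τ) 2]

lemma abs_cs_le_one (τ : ℝ) : |cs τ| ≤ 1 :=
  abs_le.2 ⟨(neg_one_lt_cs τ).le, (cs_lt_one τ).le⟩

lemma sn_le_one (τ : ℝ) : sn τ ≤ 1 := by
  nlinarith [sn_pos τ, sn_sq τ, sq_nonneg (cs τ)]

lemma co_le_one (τ : ℝ) : co τ ≤ 1 := by
  nlinarith [co_pos τ, co_sq τ, cs_lt_one τ]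

lemma cs_nonneg {τ : ℝ} (h : τ ≤ 0) : 0 ≤ cs τ := by
  have : Real.exp (2 * τ) ≤ 1 := Real.exp_le_one_iff.2 (by linarith)
  have h2 := Real.exp_pos (2 * τ)
  unfold cs
  exact div_nonneg (by nlinarith) (by positivity)

lemma cs_nonpos {τ : ℝ} (h : 0 ≤ τ) : cs τ ≤ 0 := by
  have : 1 ≤ Real.exp (2 * τ) := Real.one_le_exp (by linarith)
  unfold cs
  exact div_nonpos_of_nonpos_of_nonneg (by nlinarith) (by positivity)

lemma hasDerivAt_exp_two (τ : ℝ) :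
    HasDerivAt (fun x => Real.exp (2 * x)) (2 * Real.exp (2 * τ)) τ := by
  have := ((hasDerivAt_id τ).const_mul 2).exp
  simpa [mul_comm] using this

lemma hasDerivAt_ang (τ : ℝ) : HasDerivAt ang (sn τ) τ := by
  have := (hasDerivAt_exp_two τ).arctan
  refine this.congr_deriv ?_
  unfold sn; ring

lemma hasDerivAt_sn (τ : ℝ) : HasDerivAt sn (2 * cs τ * sn τ) τ := by
  have h := hasDerivAt_exp_two τ
  have hp := one_add_exp_sq_pos τ
  have := (h.const_mul 2).div ((h.pow 2).const_add 1) hp.ne'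
  refine this.congr_deriv ?_
  unfold sn cs; simp only [Pi.pow_apply]; field_simp; ring

lemma hasDerivAt_cs (τ : ℝ) : HasDerivAt cs (-2 * sn τ ^ 2) τ := by
  have h := hasDerivAt_exp_two τ
  have hp := one_add_exp_sq_pos τ
  have := ((h.pow 2).const_sub 1).div ((h.pow 2).const_add 1) hp.ne'
  refine this.congr_deriv ?_
  unfold sn; simp only [Pi.pow_apply]; field_simp; ring

lemma hasDerivAt_co (τ : ℝ) : HasDerivAt co (-(1 - cs τ) * co τ) τ := by
  have h := hasDerivAt_exp_two τ
  have hp := one_add_exp_sq_pos τ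
  have hs : 0 < √(1 + Real.exp (2 * τ) ^ 2) := Real.sqrt_pos.2 hp
  have := ((((h.pow 2).const_add 1).sqrt hp.ne').inv hs.ne')
  have h2 : co = (fun x => √(1 + Real.exp (2 * x) ^ 2))⁻¹ := by
    ext x; simp [co]
  rw [h2]
  refine this.congr_deriv ?_
  unfold cs; simp only [Pi.pow_apply, Pi.inv_apply]
  rw [Real.sq_sqrt hp.le]; field_simp; ring

lemma continuous_sn : Continuous sn := continuous_iff_continuousAt.2 fun τ => (hasDerivAt_sn τ).continuousAt
lemma continuous_cs : Continuous cs := continuous_iff_continuousAt.2 fun τ => (hasDerivAt_cs τ).continuousAt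
lemma continuous_co : Continuous co := continuous_iff_continuousAt.2 fun τ => (hasDerivAt_co τ).continuousAt

attribute [fun_prop] continuous_sn continuous_cs continuous_co

lemma contDiff_ang : ContDiff ℝ ∞ ang := by
  unfold ang; exact Real.contDiff_arctan.comp (by fun_prop)
lemma contDiff_sn : ContDiff ℝ ∞ sn := by
  unfold sn
  exact ContDiff.div (by fun_prop) (by fun_prop) fun x => (one_add_exp_sq_pos x).ne'
lemma contDiff_cs : ContDiff ℝ ∞ cs := by
  unfold cs
  exact ContDiff.div (by fun_prop) (by fun_prop) fun x => (one_add_exp_sq_pos x).ne'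

lemma cos_ang (τ : ℝ) : Real.cos (ang τ) = co τ := by
  rw [ang, Real.cos_arctan, co]

lemma sin_ang (τ : ℝ) : Real.sin (ang τ) = Real.exp (2 * τ) * co τ := by
  rw [ang, Real.sin_arctan, co]; ring

lemma sin_two_ang (τ : ℝ) : Real.sin (2 * ang τ) = sn τ := by
  rw [Real.sin_two_mul, sin_ang, cos_ang]
  have : 2 * (Real.exp (2 * τ) * co τ) * co τ = 2 * Real.exp (2 * τ) * co τ ^ 2 := by ring
  rw [this, co, div_pow, Real.sq_sqrt (one_add_exp_sq_pos τ).le, sn]; ring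

lemma ang_mem (τ : ℝ) : ang τ ∈ Ioo 0 (Real.pi / 2) :=
  ⟨Real.arctan_pos.2 (Real.exp_pos _), Real.arctan_lt_pi_div_two _⟩

lemma strictMono_ang : StrictMono ang := fun a b h => by
  unfold ang; exact Real.arctan_strictMono (Real.exp_lt_exp.2 (by linarith))

lemma range_ang : range ang = Ioo 0 (Real.pi / 2) := by
  ext θ; constructor
  · rintro ⟨τ, rfl⟩; exact ang_mem τ
  · rintro ⟨h0, h1⟩
    have ht : 0 < Real.tan θ := Real.tan_pos_of_pos_of_lt_pi_div_two h0 h1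
    refine ⟨Real.log (Real.tan θ) / 2, ?_⟩
    rw [ang, mul_div_cancel₀ _ two_ne_zero, Real.exp_log ht, Real.arctan_tan (by linarith) h1]

lemma sn_le_exp (τ : ℝ) : sn τ ≤ 2 * Real.exp (-(2 * |τ|)) := by
  have hp := one_add_exp_sq_pos τ
  have he := Real.exp_pos (2 * τ)
  unfold sn
  rcases le_total τ 0 with h | h
  · rw [abs_of_nonpos h, div_le_iff₀ hp]
    have : -(2 * -τ) = 2 * τ := by ring
    rw [this]; nlinarith [sq_nonneg (Real.exp (2 * τ)), mul_pos he (pow_pos he 2)]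
  · rw [abs_of_nonneg h, div_le_iff₀ hp, Real.exp_neg]
    field_simp; nlinarith

lemma sn_comparable (τ x : ℝ) : sn τ ≤ Real.exp (2 * |x|) * sn (τ - x) := by
  have key : ∀ σ : ℝ, sn σ = 2 / (Real.exp (-(2 * σ)) + Real.exp (2 * σ)) := by
    intro σ
    have := Real.exp_pos (2 * σ)
    rw [sn, Real.exp_neg]; field_simp
  rw [key, key, mul_div_assoc', div_le_div_iff₀ (by positivity) (by positivity)]
  have h1 : Real.exp (-(2 * (τ - x))) ≤ Real.exp (2 * |x|) * Real.exp (-(2 * τ)) := by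
    rw [← Real.exp_add]; exact Real.exp_le_exp.2 (by linarith [le_abs_self x])
  have h2 : Real.exp (2 * (τ - x)) ≤ Real.exp (2 * |x|) * Real.exp (2 * τ) := by
    rw [← Real.exp_add]; exact Real.exp_le_exp.2 (by linarith [neg_abs_le x])
  nlinarith

/-! ### Powers of `sin 2θ` -/

lemma sn_rpow_pos (a τ : ℝ) : 0 < sn τ ^ a := Real.rpow_pos_of_pos (sn_pos τ) a

lemma continuous_sn_rpow (a : ℝ) : Continuous fun τ => sn τ ^ a :=
  continuous_sn.rpow_const fun τ => Or.inl (sn_pos τ).ne'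

attribute [fun_prop] continuous_sn_rpow

lemma hasDerivAt_sn_rpow (a τ : ℝ) : HasDerivAt (fun x => sn x ^ a) (2 * a * cs τ * sn τ ^ a) τ := by
  refine ((hasDerivAt_sn τ).rpow_const (p := a) (Or.inl (sn_pos τ).ne')).congr_deriv ?_
  rw [Real.rpow_sub_one (sn_pos τ).ne']
  field_simp [(sn_pos τ).ne']

lemma sn_rpow_le_rpow {a b : ℝ} (h : a ≤ b) (τ : ℝ) : sn τ ^ b ≤ sn τ ^ a :=
  Real.rpow_le_rpow_of_exponent_ge (sn_pos τ) (sn_le_one τ) h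

lemma sn_rpow_le_one {a : ℝ} (h : 0 ≤ a) (τ : ℝ) : sn τ ^ a ≤ 1 :=
  Real.rpow_le_one (sn_pos τ).le (sn_le_one τ) h

lemma sn_rpow_add (a b τ : ℝ) : sn τ ^ (a + b) = sn τ ^ a * sn τ ^ b :=
  Real.rpow_add (sn_pos τ) a b

lemma integrable_exp_neg_mul_abs {a : ℝ} (ha : 0 < a) :
    Integrable fun x : ℝ => Real.exp (-(a * |x|)) := by
  rw [← integrableOn_univ, ← Iic_union_Ioi (a := (0 : ℝ))]
  refine IntegrableOn.union ?_ ?_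
  · refine (integrableOn_exp_mul_Iic ha 0).congr_fun (fun x hx => ?_) measurableSet_Iic
    simp only [abs_of_nonpos (show x ≤ 0 from hx)]; ring_nf
  · refine (integrableOn_exp_mul_Ioi (neg_lt_zero.2 ha) 0).congr_fun (fun x hx => ?_) measurableSet_Ioi
    simp only [abs_of_pos (show 0 < x from hx)]; ring_nf

lemma integrable_sn_rpow {a : ℝ} (ha : 0 < a) : Integrable fun τ => sn τ ^ a := by
  refine ((integrable_exp_neg_mul_abs (a := 2 * a) (by positivity)).const_mul (2 ^ a)).mono'
    (continuous_sn_rpow a).aestronglyMeasurable (Eventually.of_forall fun τ => ?_)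
  rw [Real.norm_of_nonneg (sn_rpow_pos a τ).le]
  calc sn τ ^ a ≤ (2 * Real.exp (-(2 * |τ|))) ^ a :=
        Real.rpow_le_rpow (sn_pos τ).le (sn_le_exp τ) ha.le
    _ = _ := by
        rw [Real.mul_rpow (by norm_num) (Real.exp_pos _).le, ← Real.exp_mul]; ring_nf

lemma tendsto_sn_atTop : Tendsto sn atTop (𝓝 0) := by
  have h2 : Tendsto (fun τ : ℝ => 2 * Real.exp (-(2 * |τ|))) atTop (𝓝 (2 * 0)) :=
    (Real.tendsto_exp_neg_atTop_nhds_zero.comp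
      (tendsto_abs_atTop_atTop.const_mul_atTop two_pos)).const_mul 2
  rw [mul_zero] at h2
  exact squeeze_zero (fun τ => (sn_pos τ).le) sn_le_exp h2

lemma tendsto_sn_atBot : Tendsto sn atBot (𝓝 0) := by
  have h2 : Tendsto (fun τ : ℝ => 2 * Real.exp (-(2 * |τ|))) atBot (𝓝 (2 * 0)) :=
    (Real.tendsto_exp_neg_atTop_nhds_zero.comp
      (tendsto_abs_atBot_atTop.const_mul_atTop two_pos)).const_mul 2
  rw [mul_zero] at h2
  exact squeeze_zero (fun τ => (sn_pos τ).le) sn_le_exp h2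

/-! ### Auxiliary facts on integrals over the line -/

lemma lintegral_le_of_tendsto {X : Type*} [MeasurableSpace X] {μ : Measure X}
    {f : ℕ → X → ℝ≥0∞} {g : X → ℝ≥0∞} {C : ℝ≥0∞} (hf : ∀ n, Measurable (f n))
    (hC : ∀ n, ∫⁻ x, f n x ∂μ ≤ C) (h : ∀ᵐ x ∂μ, Tendsto (fun n => f n x) atTop (𝓝 (g x))) :
    ∫⁻ x, g x ∂μ ≤ C := by
  calc ∫⁻ x, g x ∂μ = ∫⁻ x, liminf (fun n => f n x) atTop ∂μ :=
        lintegral_congr_ae (h.mono fun x hx => hx.liminf_eq.symm)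
    _ ≤ liminf (fun n => ∫⁻ x, f n x ∂μ) atTop := lintegral_liminf_le hf
    _ ≤ C := liminf_le_of_le (by isBoundedDefault) fun b hb => by
        obtain ⟨n, hn⟩ := hb.exists
        exact hn.trans (hC n)

lemma integrable_fun_sub {X : Type*} [MeasurableSpace X] {μ : Measure X} {f g : X → ℝ}
    (hf : Integrable f μ) (hg : Integrable g μ) : Integrable (fun x => f x - g x) μ := hf.sub hg

lemma integrable_fun_add {X : Type*} [MeasurableSpace X] {μ : Measure X} {f g : X → ℝ}
    (hf : Integrable f μ) (hg : Integrable g μ) : Integrable (fun x => f x + g x) μ := hf.add hg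

lemma exists_primitive {f : ℝ → ℝ} (hc : Continuous f) (hi : Integrable f) :
    ∃ F : ℝ → ℝ, (∀ x, HasDerivAt F (f x) x) ∧ Tendsto F atBot (𝓝 0) ∧
      Tendsto F atTop (𝓝 (∫ x, f x)) := by
  refine ⟨fun x => (∫ t in Iic 0, f t) + ∫ t in (0 : ℝ)..x, f t, fun x => ?_, ?_, ?_⟩
  · exact (intervalIntegral.integral_hasDerivAt_right (hc.intervalIntegrable _ _)
      (hc.stronglyMeasurableAtFilter _ _) hc.continuousAt).const_add _
  · have h := intervalIntegral_tendsto_integral_Iic 0 hi.integrableOn tendsto_id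
    have h2 := (tendsto_const_nhds (x := ∫ t in Iic 0, f t)).sub h
    rw [sub_self] at h2
    refine h2.congr fun x => ?_
    rw [intervalIntegral.integral_symm x 0]; simp [sub_eq_add_neg]
  · have h := intervalIntegral_tendsto_integral_Ioi 0 hi.integrableOn tendsto_id
    have h2 := (tendsto_const_nhds (x := ∫ t in Iic 0, f t)).add h
    rw [intervalIntegral.integral_Iic_add_Ioi hi.integrableOn hi.integrableOn] at h2
    exact h2

/-- Comparison of derivatives on a half-line where both functions vanish at infinity. -/
lemma abs_le_of_deriv_le_of_tendsto_atBot {f F f' F' : ℝ → ℝ} {a : ℝ}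
    (hf : ∀ x, HasDerivAt f (f' x) x) (hF : ∀ x, HasDerivAt F (F' x) x)
    (h : ∀ x ≤ a, |f' x| ≤ F' x) (h0 : Tendsto f atBot (𝓝 0)) (H0 : Tendsto F atBot (𝓝 0)) :
    |f a| ≤ F a := by
  have key : ∀ e : ℝ, |e| = 1 → 0 ≤ F a - e * f a := by
    intro e he
    have hm : MonotoneOn (fun x => F x - e * f x) (Iic a) := by
      refine monotoneOn_of_hasDerivWithinAt_nonneg (convex_Iic a)
        (fun x _ => ((hF x).sub ((hf x).const_mul e)).continuousAt.continuousWithinAt)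
        (fun x _ => ((hF x).sub ((hf x).const_mul e)).hasDerivWithinAt) fun x hx => ?_
      rw [interior_Iic] at hx
      have := h x (le_of_lt hx)
      have h3 : |e * f' x| = |f' x| := by rw [abs_mul, he, one_mul]
      linarith [le_abs_self (e * f' x)]
    have hl : Tendsto (fun x => F x - e * f x) atBot (𝓝 (0 - e * 0)) := H0.sub (h0.const_mul e)
    rw [mul_zero, sub_zero] at hl
    refine le_of_tendsto hl ?_
    filter_upwards [Iic_mem_atBot a] with x hx
    exact hm hx self_mem_Iic hx
  have h1 := key 1 (by simp)
  have h2 := key (-1) (by simp)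
  exact abs_le.2 ⟨by linarith, by linarith⟩

lemma abs_le_of_deriv_le_of_tendsto_atTop {f F f' F' : ℝ → ℝ} {a : ℝ}
    (hf : ∀ x, HasDerivAt f (f' x) x) (hF : ∀ x, HasDerivAt F (F' x) x)
    (h : ∀ x, a ≤ x → |f' x| ≤ -F' x) (h0 : Tendsto f atTop (𝓝 0)) (H0 : Tendsto F atTop (𝓝 0)) :
    |f a| ≤ F a := by
  have := abs_le_of_deriv_le_of_tendsto_atBot (f := fun x => f (-x)) (F := fun x => F (-x))
    (f' := fun x => -f' (-x)) (F' := fun x => -F' (-x)) (a := -a)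
    (fun x => ((hf (-x)).comp x (hasDerivAt_neg x)).congr_deriv (by simp))
    (fun x => ((hF (-x)).comp x (hasDerivAt_neg x)).congr_deriv (by simp))
    (fun x hx => by rw [abs_neg]; exact h (-x) (by linarith))
    (h0.comp tendsto_neg_atBot_atTop) (H0.comp tendsto_neg_atBot_atTop)
  simpa using this

/-! ### The first order equation `z' + (5 cos 2θ - 1) z = h` -/

/-- A weighted Hardy inequality. It comes from the multiplier `cos 2θ · z`: the resulting quadratic
form has the coefficient `3 cos² 2θ - cos 2θ + 1 ≥ 11/12`. -/
lemma hardy_lintegral {z h : ℝ → ℝ} {σ : ℝ} (hσ : 0 ≤ σ)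
    (hz : ∀ τ, HasDerivAt z ((1 - 5 * cs τ) * z τ + h τ) τ) (hh : Continuous h)
    (h0 : Integrable fun τ => z τ ^ 2 * sn τ) :
    ∫⁻ τ, ENNReal.ofReal (z τ ^ 2 * sn τ ^ (1 - σ)) ≤
      2 * ∫⁻ τ, ENNReal.ofReal (h τ ^ 2 * sn τ ^ (1 - σ)) := by
  have hzc : Continuous z := continuous_iff_continuousAt.2 fun τ => (hz τ).continuousAt
  have hpow : ∀ τ, sn τ ^ (1 - σ) = sn τ ^ (-σ) * sn τ := fun τ => by
    rw [show (1 : ℝ) - σ = -σ + 1 by ring, sn_rpow_add, Real.rpow_one]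
  by_cases hfin : ∫⁻ τ, ENNReal.ofReal (h τ ^ 2 * sn τ ^ (1 - σ)) = ⊤
  · rw [hfin]; simp
  have hhi : Integrable fun τ => h τ ^ 2 * sn τ ^ (1 - σ) := by
    refine ⟨(by fun_prop : Continuous _).aestronglyMeasurable, ?_⟩
    rw [hasFiniteIntegral_iff_ofReal
      (Eventually.of_forall fun τ => mul_nonneg (sq_nonneg _) (sn_rpow_pos _ τ).le)]
    exact lt_top_iff_ne_top.2 hfin
  -- the weight is regularized by the shift `δ`, for which the a priori integrability of `z² sn` is
  -- enough to discard the boundary terms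
  let k : ℝ → ℝ → ℝ := fun δ τ => (sn τ + δ) ^ (-σ) * sn τ
  have hpos : ∀ δ > 0, ∀ τ, 0 < sn τ + δ := fun δ hδ τ => add_pos (sn_pos τ) hδ
  have hkpos : ∀ δ > 0, ∀ τ, 0 < k δ τ := fun δ hδ τ =>
    mul_pos (Real.rpow_pos_of_pos (hpos δ hδ τ) _) (sn_pos τ)
  have hkc : ∀ δ > 0, Continuous (k δ) := fun δ hδ =>
    ((continuous_sn.add continuous_const).rpow_const fun τ => Or.inl (hpos δ hδ τ).ne').mul
      continuous_sn
  have main : ∀ δ > 0, ∫⁻ τ, ENNReal.ofReal (z τ ^ 2 * k δ τ) ≤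
      2 * ∫⁻ τ, ENNReal.ofReal (h τ ^ 2 * sn τ ^ (1 - σ)) := by
    intro δ hδ
    have hk1 : ∀ τ, k δ τ ≤ δ ^ (-σ) * sn τ := fun τ => mul_le_mul_of_nonneg_right
      (Real.rpow_le_rpow_of_nonpos hδ (by linarith [sn_pos τ]) (by linarith)) (sn_pos τ).le
    have hk2 : ∀ τ, k δ τ ≤ sn τ ^ (1 - σ) := fun τ => by
      rw [hpow]
      exact mul_le_mul_of_nonneg_right
        (Real.rpow_le_rpow_of_nonpos (sn_pos τ) (by linarith) (by linarith)) (sn_pos τ).le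
    let r : ℝ → ℝ := fun τ => σ * sn τ / (sn τ + δ)
    have hkd : ∀ τ, HasDerivAt (k δ) (2 * cs τ * k δ τ * (1 - r τ)) τ := by
      intro τ
      have := (((hasDerivAt_sn τ).add_const δ).rpow_const (p := -σ)
        (Or.inl (hpos δ hδ τ).ne')).mul (hasDerivAt_sn τ)
      refine this.congr_deriv ?_
      rw [Real.rpow_sub_one (hpos δ hδ τ).ne']
      simp only [k, r]
      field_simp [(hpos δ hδ τ).ne']
      ring
    let J' : ℝ → ℝ := fun τ =>
      2 * z τ * h τ * cs τ * k δ τ - 2 * z τ ^ 2 * k δ τ * (3 * cs τ ^ 2 - cs τ + 1 + r τ * cs τ ^ 2)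
    have hJ : ∀ τ, HasDerivAt (fun τ => z τ ^ 2 * (cs τ * k δ τ)) (J' τ) τ := by
      intro τ
      refine (((hz τ).pow 2).mul ((hasDerivAt_cs τ).mul (hkd τ))).congr_deriv ?_
      simp only [J', sn_sq, Pi.pow_apply, Pi.mul_apply]; push_cast; ring
    have hzk : Integrable fun τ => z τ ^ 2 * k δ τ := by
      refine (h0.const_mul (δ ^ (-σ))).mono' ((hzc.pow 2).mul (hkc δ hδ)).aestronglyMeasurable
        (Eventually.of_forall fun τ => ?_)
      rw [Real.norm_of_nonneg (mul_nonneg (sq_nonneg _) (hkpos δ hδ τ).le)]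
      nlinarith [mul_le_mul_of_nonneg_left (hk1 τ) (sq_nonneg (z τ))]
    have hhk : Integrable fun τ => h τ ^ 2 * k δ τ := by
      refine hhi.mono' ((hh.pow 2).mul (hkc δ hδ)).aestronglyMeasurable
        (Eventually.of_forall fun τ => ?_)
      rw [Real.norm_of_nonneg (mul_nonneg (sq_nonneg _) (hkpos δ hδ τ).le)]
      exact mul_le_mul_of_nonneg_left (hk2 τ) (sq_nonneg _)
    have hr0 : ∀ τ, 0 ≤ r τ ∧ r τ ≤ σ := fun τ => by
      have h1 := sn_pos τ
      refine ⟨by positivity, ?_⟩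
      rw [div_le_iff₀ (hpos δ hδ τ)]; nlinarith
    have hrc : Continuous r := (continuous_const.mul continuous_sn).div
      (continuous_sn.add continuous_const) fun τ => (hpos δ hδ τ).ne'
    have hcs : ∀ τ, cs τ ^ 2 ≤ 1 := fun τ => by nlinarith [sn_sq τ, sq_nonneg (sn τ)]
    have hJi : Integrable fun τ => z τ ^ 2 * (cs τ * k δ τ) := by
      refine hzk.mono' (((hzc.pow 2).mul (continuous_cs.mul (hkc δ hδ))).aestronglyMeasurable)
        (Eventually.of_forall fun τ => ?_)
      rw [show z τ ^ 2 * (cs τ * k δ τ) = (z τ ^ 2 * k δ τ) * cs τ by ring, norm_mul,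
        Real.norm_of_nonneg (mul_nonneg (sq_nonneg _) (hkpos δ hδ τ).le)]
      exact mul_le_of_le_one_right (mul_nonneg (sq_nonneg _) (hkpos δ hδ τ).le) (abs_cs_le_one τ)
    have hJi' : Integrable J' := by
      have hc : Continuous J' := by
        have := hkc δ hδ
        fun_prop
      refine ((hzk.const_mul (11 + 2 * σ)).add hhk).mono' hc.aestronglyMeasurable
        (Eventually.of_forall fun τ => ?_)
      have hkp := (hkpos δ hδ τ).le
      have e : J' τ = k δ τ * (2 * (z τ * h τ) * cs τ -
        z τ ^ 2 * (2 * (3 * cs τ ^ 2 - cs τ + 1 + r τ * cs τ ^ 2))) := by simp only [J']; ring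
      have e2 : (fun τ => (11 + 2 * σ) * (z τ ^ 2 * k δ τ)) τ + h τ ^ 2 * k δ τ =
        k δ τ * ((11 + 2 * σ) * z τ ^ 2 + h τ ^ 2) := by ring
      rw [Pi.add_apply, e2, e, norm_mul, Real.norm_of_nonneg hkp]
      refine mul_le_mul_of_nonneg_left ?_ hkp
      have a1 : |2 * (z τ * h τ) * cs τ| ≤ z τ ^ 2 + h τ ^ 2 := by
        rw [abs_mul]
        calc _ ≤ |2 * (z τ * h τ)| * 1 :=
              mul_le_mul_of_nonneg_left (abs_cs_le_one τ) (abs_nonneg _)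
          _ ≤ _ := by
              rw [mul_one, abs_le]
              constructor <;> nlinarith [sq_nonneg (z τ + h τ), sq_nonneg (z τ - h τ)]
      have a2 : |z τ ^ 2 * (2 * (3 * cs τ ^ 2 - cs τ + 1 + r τ * cs τ ^ 2))| ≤
          z τ ^ 2 * (10 + 2 * σ) := by
        have hcs1 := abs_le.1 (abs_cs_le_one τ)
        have hr1 : r τ * cs τ ^ 2 ≤ σ := by
          nlinarith [hr0 τ, hcs τ, mul_le_mul_of_nonneg_left (hcs τ) (hr0 τ).1]
        have hr2 : 0 ≤ r τ * cs τ ^ 2 := mul_nonneg (hr0 τ).1 (sq_nonneg _)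
        rw [abs_of_nonneg (mul_nonneg (sq_nonneg _) (by nlinarith [sq_nonneg (cs τ)]))]
        exact mul_le_mul_of_nonneg_left (by nlinarith [hcs τ]) (sq_nonneg _)
      rw [Real.norm_eq_abs]
      linarith [abs_sub (2 * (z τ * h τ) * cs τ)
        (z τ ^ 2 * (2 * (3 * cs τ ^ 2 - cs τ + 1 + r τ * cs τ ^ 2)))]
    have hzero := integral_eq_zero_of_hasDerivAt_of_integrable hJ hJi' hJi
    have hle : ∫ τ, z τ ^ 2 * k δ τ ≤ ∫ τ, (2 * (h τ ^ 2 * k δ τ) - 6 / 5 * J' τ) := by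
      refine integral_mono hzk ((hhk.const_mul 2).sub (hJi'.const_mul _)) fun τ => ?_
      have hkp := (hkpos δ hδ τ).le
      have hr2 : 0 ≤ r τ * cs τ ^ 2 := mul_nonneg (hr0 τ).1 (sq_nonneg _)
      have e : 2 * (h τ ^ 2 * k δ τ) - 6 / 5 * J' τ = k δ τ * (2 * h τ ^ 2 - 6 / 5 *
        (2 * (z τ * h τ) * cs τ - z τ ^ 2 * (2 * (3 * cs τ ^ 2 - cs τ + 1 + r τ * cs τ ^ 2)))) := by
        simp only [J']; ring
      simp only [e, mul_comm (z τ ^ 2)]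
      refine mul_le_mul_of_nonneg_left ?_ hkp
      have a1 : 2 * (z τ * h τ) * cs τ ≤ z τ ^ 2 + h τ ^ 2 := by
        nlinarith [sq_nonneg (z τ - cs τ * h τ),
          mul_le_mul_of_nonneg_left (hcs τ) (sq_nonneg (h τ))]
      have a2 : 11 / 12 * z τ ^ 2 ≤ (3 * cs τ ^ 2 - cs τ + 1 + r τ * cs τ ^ 2) * z τ ^ 2 :=
        mul_le_mul_of_nonneg_right (by nlinarith [sq_nonneg (cs τ - 1 / 6)]) (sq_nonneg _)
      nlinarith [sq_nonneg (h τ)]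
    rw [integral_sub (hhk.const_mul 2) (hJi'.const_mul _), integral_const_mul, integral_const_mul,
      hzero, mul_zero, sub_zero] at hle
    rw [← ofReal_integral_eq_lintegral_ofReal hzk
      (Eventually.of_forall fun τ => mul_nonneg (sq_nonneg _) (hkpos δ hδ τ).le),
      ← ofReal_integral_eq_lintegral_ofReal hhi
      (Eventually.of_forall fun τ => mul_nonneg (sq_nonneg _) (sn_rpow_pos _ τ).le),
      show (2 : ℝ≥0∞) = ENNReal.ofReal 2 by simp, ← ENNReal.ofReal_mul (by norm_num)]
    refine ENNReal.ofReal_le_ofReal (hle.trans (mul_le_mul_of_nonneg_left ?_ (by norm_num)))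
    exact integral_mono hhk hhi fun τ => mul_le_mul_of_nonneg_left (hk2 τ) (sq_nonneg _)
  refine lintegral_le_of_tendsto (f := fun (n : ℕ) τ =>
    ENNReal.ofReal (z τ ^ 2 * k (1 / ((n : ℝ) + 1)) τ)) (fun n => ?_)
    (fun n => main _ Nat.one_div_pos_of_nat) (Eventually.of_forall fun τ => ?_)
  · exact (((hzc.pow 2).mul (hkc _ Nat.one_div_pos_of_nat)).measurable).ennreal_ofReal
  · refine ENNReal.tendsto_ofReal (Tendsto.const_mul _ ?_)
    rw [hpow]
    refine Tendsto.mul_const _ ?_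
    have h1 : Tendsto (fun n : ℕ => sn τ + 1 / ((n : ℝ) + 1)) atTop (𝓝 (sn τ + 0)) :=
      tendsto_one_div_add_atTop_nhds_zero_nat.const_add _
    rw [add_zero] at h1
    exact h1.rpow_const (Or.inl (sn_pos τ).ne')

lemma hardy_integral {z h : ℝ → ℝ} {σ : ℝ} (hσ : 0 ≤ σ)
    (hz : ∀ τ, HasDerivAt z ((1 - 5 * cs τ) * z τ + h τ) τ) (hh : Continuous h)
    (h0 : Integrable fun τ => z τ ^ 2 * sn τ)
    (hi : Integrable fun τ => h τ ^ 2 * sn τ ^ (1 - σ)) :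
    Integrable (fun τ => z τ ^ 2 * sn τ ^ (1 - σ)) := by
  have hzc : Continuous z := continuous_iff_continuousAt.2 fun τ => (hz τ).continuousAt
  have h1 := hardy_lintegral hσ hz hh h0
  refine ⟨(by fun_prop : Continuous _).aestronglyMeasurable, ?_⟩
  rw [hasFiniteIntegral_iff_ofReal
      (Eventually.of_forall fun τ => mul_nonneg (sq_nonneg _) (sn_rpow_pos _ τ).le)]
  refine h1.trans_lt (ENNReal.mul_lt_top (by simp) ?_)
  rw [← hasFiniteIntegral_iff_ofReal
      (Eventually.of_forall fun τ => mul_nonneg (sq_nonneg _) (sn_rpow_pos _ τ).le)]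
  exact hi.2

/-! ### The angular operator on one ray of constant `R` -/

lemma eta_pos : 0 < eta := by norm_num [eta]
lemma eta_lt_one : eta < 1 := by norm_num [eta]

/-- The angular part of the Biot–Savart equation as a first order system, on a fixed `R`:
`w sin 2θ` is the derivative of `u / sin 2θ`, and `y = -∂_θθ u + ∂_θ (tan θ u) - 6 u`. -/
structure AngSys (u w y : ℝ → ℝ) : Prop where
  du : ∀ τ, HasDerivAt u (2 * cs τ * u τ + sn τ ^ 2 * w τ) τ
  dw : ∀ τ, HasDerivAt w ((1 - 5 * cs τ) * w τ - y τ) τ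
  cont : Continuous y
  atBot : Tendsto u atBot (𝓝 0)
  atTop : Tendsto u atTop (𝓝 0)

/-- Square integrability with the weight `sin(2θ)^{-η} dθ`. -/
def SqInt (f : ℝ → ℝ) : Prop := Integrable fun τ => f τ ^ 2 * sn τ ^ (1 - eta)

lemma SqInt.mul {f g a : ℝ → ℝ} (hf : SqInt f) (hg : SqInt g) (hfc : Continuous f)
    (hgc : Continuous g) (hac : Continuous a) (C : ℝ) (h : ∀ τ, |a τ| ≤ C * sn τ ^ (1 - eta)) :
    Integrable fun τ => a τ * (f τ * g τ) := by
  have hf' : Integrable fun τ => f τ ^ 2 * sn τ ^ (1 - eta) := hf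
  have hg' : Integrable fun τ => g τ ^ 2 * sn τ ^ (1 - eta) := hg
  refine ((hf'.add hg').const_mul C).mono'
    (hac.mul (hfc.mul hgc)).aestronglyMeasurable (Eventually.of_forall fun τ => ?_)
  have hp := sn_rpow_pos (1 - eta) τ
  have h1 : |f τ * g τ| ≤ f τ ^ 2 + g τ ^ 2 := by
    rw [abs_le]; constructor <;> nlinarith [sq_nonneg (f τ + g τ), sq_nonneg (f τ - g τ)]
  rw [norm_mul, Real.norm_eq_abs, Real.norm_eq_abs, Pi.add_apply]
  calc |a τ| * |f τ * g τ| ≤ (C * sn τ ^ (1 - eta)) * (f τ ^ 2 + g τ ^ 2) :=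
        mul_le_mul (h τ) h1 (abs_nonneg _) ((abs_nonneg _).trans (h τ))
    _ = _ := by ring

lemma SqInt.of_bounded {f : ℝ → ℝ} (hf : Continuous f) (C : ℝ) (h : ∀ τ, |f τ| ≤ C) : SqInt f := by
  refine ((integrable_sn_rpow (a := 1 - eta) (by linarith [eta_lt_one])).const_mul (C ^ 2)).mono'
    (by fun_prop : Continuous _).aestronglyMeasurable (Eventually.of_forall fun τ => ?_)
  rw [Real.norm_of_nonneg (mul_nonneg (sq_nonneg _) (sn_rpow_pos _ τ).le)]
  refine mul_le_mul_of_nonneg_right ?_ (sn_rpow_pos _ τ).le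
  exact sq_le_sq' (by linarith [(abs_le.1 (h τ)).1]) (abs_le.1 (h τ)).2

lemma sn_pow_eq_rpow (n : ℕ) (τ : ℝ) : sn τ ^ n = sn τ ^ (n : ℝ) := (Real.rpow_natCast _ _).symm

lemma sn_pow_le {n : ℕ} {a : ℝ} (h : a ≤ n) (τ : ℝ) : sn τ ^ n ≤ sn τ ^ a := by
  rw [sn_pow_eq_rpow]; exact sn_rpow_le_rpow h τ

namespace AngSys

variable {u w y : ℝ → ℝ}

lemma continuous_u (h : AngSys u w y) : Continuous u :=
  continuous_iff_continuousAt.2 fun τ => (h.du τ).continuousAt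

lemma continuous_w (h : AngSys u w y) : Continuous w :=
  continuous_iff_continuousAt.2 fun τ => (h.dw τ).continuousAt

lemma neg (h : AngSys u w y) : AngSys (-u) (-w) (-y) where
  du τ := (h.du τ).neg.congr_deriv (by simp; ring)
  dw τ := (h.dw τ).neg.congr_deriv (by simp; ring)
  cont := h.cont.neg
  atBot := by have := h.atBot.neg; rw [neg_zero] at this; exact this
  atTop := by have := h.atTop.neg; rw [neg_zero] at this; exact this

lemma hasDerivAt_flux (h : AngSys u w y) (τ : ℝ) :
    HasDerivAt (fun τ => sn τ ^ 2 * co τ * w τ) (-(sn τ ^ 2 * co τ * y τ)) τ := by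
  refine ((((hasDerivAt_sn τ).pow 2).mul (hasDerivAt_co τ)).mul (h.dw τ)).congr_deriv ?_
  simp only [Pi.pow_apply, Pi.mul_apply]; push_cast; ring

lemma hasDerivAt_quot (h : AngSys u w y) (τ : ℝ) :
    HasDerivAt (fun τ => u τ / sn τ) (sn τ * w τ) τ := by
  refine ((h.du τ).div (hasDerivAt_sn τ) (sn_pos τ).ne').congr_deriv ?_
  field_simp [(sn_pos τ).ne']; ring

lemma hasDerivAt_inv_sn (τ : ℝ) : HasDerivAt (fun τ => 1 / sn τ) (-(2 * cs τ) / sn τ) τ := by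
  refine ((hasDerivAt_const τ (1 : ℝ)).div (hasDerivAt_sn τ) (sn_pos τ).ne').congr_deriv ?_
  field_simp [(sn_pos τ).ne']; ring

/-- If the flux stayed positive near an end, `u / sin 2θ` would be as large as `1 / sin 2θ`, and `u`
would not vanish there. -/
lemma flux_not_pos_atTop (h : AngSys u w y) {ε : ℝ} (hε : 0 < ε)
    (hev : ∀ᶠ τ in Filter.atTop, ε ≤ sn τ ^ 2 * co τ * w τ) : False := by
  obtain ⟨T, hT⟩ := eventually_atTop.1 hev
  have hd : ∀ τ, HasDerivAt (fun τ => u τ / sn τ - ε / 2 * (1 / sn τ))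
      (sn τ * w τ - ε / 2 * (-(2 * cs τ) / sn τ)) τ := fun τ =>
    (h.hasDerivAt_quot τ).sub ((hasDerivAt_inv_sn τ).const_mul _)
  have hm : MonotoneOn (fun τ => u τ / sn τ - ε / 2 * (1 / sn τ)) (Ici T) := by
    refine monotoneOn_of_hasDerivWithinAt_nonneg (convex_Ici T)
      (fun x _ => (hd x).continuousAt.continuousWithinAt)
      (fun x _ => (hd x).hasDerivWithinAt) fun x hx => ?_
    rw [interior_Ici] at hx
    have h1 := hT x (le_of_lt hx)
    have hs := sn_pos x
    have h2 : ε / sn x ≤ sn x * w x := by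
      rw [div_le_iff₀ hs]
      nlinarith [co_pos x, co_le_one x, sn_pos x]
    have : sn x * w x - ε / 2 * (-(2 * cs x) / sn x) = (sn x * w x - ε / sn x) +
      (1 + cs x) * (ε / sn x) := by field_simp; ring
    rw [this]
    have := neg_one_lt_cs x
    have h3 : 0 < ε / sn x := by positivity
    nlinarith
  set c := u T / sn T - ε / 2 * (1 / sn T)
  have hge : ∀ᶠ τ in Filter.atTop, ε / 2 + c * sn τ ≤ u τ := by
    filter_upwards [Ici_mem_atTop T] with τ hτ
    have h1 := hm self_mem_Ici hτ hτ
    have hs := sn_pos τ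
    have h2 : c ≤ (u τ - ε / 2) / sn τ := by
      refine h1.trans_eq ?_
      simp only; ring
    rw [le_div_iff₀ hs] at h2
    linarith
  have hl : Tendsto (fun τ => ε / 2 + c * sn τ) Filter.atTop (𝓝 (ε / 2 + c * 0)) :=
    (tendsto_sn_atTop.const_mul c).const_add _
  have := le_of_tendsto_of_tendsto hl h.atTop hge
  linarith

lemma flux_not_pos_atBot (h : AngSys u w y) {ε : ℝ} (hε : 0 < ε)
    (hev : ∀ᶠ τ in Filter.atBot, ε ≤ sn τ ^ 2 * co τ * w τ) : False := by
  obtain ⟨T, hT⟩ := eventually_atBot.1 hev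
  have hd : ∀ τ, HasDerivAt (fun τ => u τ / sn τ + ε / 2 * (1 / sn τ))
      (sn τ * w τ + ε / 2 * (-(2 * cs τ) / sn τ)) τ := fun τ =>
    (h.hasDerivAt_quot τ).add ((hasDerivAt_inv_sn τ).const_mul _)
  have hm : MonotoneOn (fun τ => u τ / sn τ + ε / 2 * (1 / sn τ)) (Iic T) := by
    refine monotoneOn_of_hasDerivWithinAt_nonneg (convex_Iic T)
      (fun x _ => (hd x).continuousAt.continuousWithinAt)
      (fun x _ => (hd x).hasDerivWithinAt) fun x hx => ?_
    rw [interior_Iic] at hx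
    have h1 := hT x (le_of_lt hx)
    have hs := sn_pos x
    have h2 : ε / sn x ≤ sn x * w x := by
      rw [div_le_iff₀ hs]
      nlinarith [co_pos x, co_le_one x, sn_pos x]
    have : sn x * w x + ε / 2 * (-(2 * cs x) / sn x) = (sn x * w x - ε / sn x) +
      (1 - cs x) * (ε / sn x) := by field_simp; ring
    rw [this]
    have := cs_lt_one x
    have h3 : 0 < ε / sn x := by positivity
    nlinarith
  set c := u T / sn T + ε / 2 * (1 / sn T)
  have hge : ∀ᶠ τ in Filter.atBot, u τ ≤ -(ε / 2) + c * sn τ := by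
    filter_upwards [Iic_mem_atBot T] with τ hτ
    have h1 := hm hτ self_mem_Iic hτ
    have hs := sn_pos τ
    have h2 : (u τ + ε / 2) / sn τ ≤ c := by
      refine Eq.trans_le ?_ h1
      simp only; ring
    rw [div_le_iff₀ hs] at h2
    linarith
  have hl : Tendsto (fun τ => -(ε / 2) + c * sn τ) Filter.atBot (𝓝 (-(ε / 2) + c * 0)) :=
    (tendsto_sn_atBot.const_mul c).const_add _
  have := le_of_tendsto_of_tendsto h.atBot hl hge
  linarith

lemma integrable_flux_deriv (h : AngSys u w y) (hy : SqInt y) :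
    Integrable fun τ => sn τ ^ 2 * co τ * y τ := by
  have h1 : SqInt (fun _ => (1 : ℝ)) := .of_bounded continuous_const 1 (by simp)
  have := hy.mul h1 h.cont continuous_const (a := fun τ => sn τ ^ 2 * co τ) (by fun_prop) 1
    fun τ => ?_
  · simpa using this
  · rw [abs_of_nonneg (mul_nonneg (sq_nonneg _) (co_pos τ).le), one_mul]
    exact (mul_le_of_le_one_right (sq_nonneg _) (co_le_one τ)).trans
      (sn_pow_le (by norm_num [eta]) τ)

lemma tendsto_flux_atTop (h : AngSys u w y) (hy : SqInt y) :
    Tendsto (fun τ => sn τ ^ 2 * co τ * w τ) Filter.atTop (𝓝 0) := by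
  have hl := tendsto_limUnder_of_hasDerivAt_of_integrableOn_Ioi (a := 0)
    (fun x _ => h.hasDerivAt_flux x) (h.integrable_flux_deriv hy).neg.integrableOn
  set l := limUnder Filter.atTop fun τ => sn τ ^ 2 * co τ * w τ
  rcases lt_trichotomy l 0 with h0 | h0 | h0
  · exfalso
    refine h.neg.flux_not_pos_atTop (ε := -l / 2) (by linarith) ?_
    filter_upwards [hl.eventually (gt_mem_nhds (show l < l / 2 by linarith))] with τ hτ
    simp only [Pi.neg_apply]; linarith
  · rwa [h0] at hl
  · exfalso
    refine h.flux_not_pos_atTop (ε := l / 2) (by linarith) ?_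
    filter_upwards [hl.eventually (lt_mem_nhds (show l / 2 < l by linarith))] with τ hτ
    exact hτ.le

lemma tendsto_flux_atBot (h : AngSys u w y) (hy : SqInt y) :
    Tendsto (fun τ => sn τ ^ 2 * co τ * w τ) Filter.atBot (𝓝 0) := by
  have hl := tendsto_limUnder_of_hasDerivAt_of_integrableOn_Iic (a := 0)
    (fun x _ => h.hasDerivAt_flux x) (h.integrable_flux_deriv hy).neg.integrableOn
  set l := limUnder Filter.atBot fun τ => sn τ ^ 2 * co τ * w τ
  rcases lt_trichotomy l 0 with h0 | h0 | h0
  · exfalso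
    refine h.neg.flux_not_pos_atBot (ε := -l / 2) (by linarith) ?_
    filter_upwards [hl.eventually (gt_mem_nhds (show l < l / 2 by linarith))] with τ hτ
    simp only [Pi.neg_apply]; linarith
  · rwa [h0] at hl
  · exfalso
    refine h.flux_not_pos_atBot (ε := l / 2) (by linarith) ?_
    filter_upwards [hl.eventually (lt_mem_nhds (show l / 2 < l by linarith))] with τ hτ
    exact hτ.le

/-- Solvability: `y` is orthogonal to `K(θ) = 3 sin θ cos² θ`. -/
lemma integral_flux_deriv (h : AngSys u w y) (hy : SqInt y) :
    ∫ τ, sn τ ^ 2 * co τ * y τ = 0 := by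
  have := integral_of_hasDerivAt_of_tendsto h.hasDerivAt_flux
    (h.integrable_flux_deriv hy).neg (h.tendsto_flux_atBot hy) (h.tendsto_flux_atTop hy)
  rw [integral_neg] at this
  linarith

lemma le_co_sq_of_nonpos {τ : ℝ} (h : τ ≤ 0) : 1 / 2 ≤ co τ ^ 2 := by
  rw [co_sq]; linarith [cs_nonneg h]

lemma hasDerivAt_sn_co_inv (a τ : ℝ) : HasDerivAt (fun τ => sn τ ^ a / co τ ^ 2)
    ((2 * a * cs τ + 2 * (1 - cs τ)) * (sn τ ^ a / co τ ^ 2)) τ := by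
  refine ((hasDerivAt_sn_rpow a τ).div ((hasDerivAt_co τ).pow 2)
    (pow_ne_zero 2 (co_pos τ).ne')).congr_deriv ?_
  simp only [Pi.pow_apply]; push_cast
  field_simp [(co_pos τ).ne']
  ring

lemma tendsto_sn_co_inv {a : ℝ} (ha : 0 < a) :
    Tendsto (fun τ => sn τ ^ a / co τ ^ 2) Filter.atBot (𝓝 0) := by
  have h1 : Tendsto (fun τ => 2 * sn τ ^ a) Filter.atBot (𝓝 (2 * 0 ^ a)) :=
    (tendsto_sn_atBot.rpow_const (Or.inr ha.le)).const_mul 2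
  rw [Real.zero_rpow ha.ne', mul_zero] at h1
  refine squeeze_zero' (Eventually.of_forall fun τ => div_nonneg (sn_rpow_pos _ τ).le
    (sq_nonneg _)) ?_ h1
  filter_upwards [Iic_mem_atBot 0] with τ hτ
  rw [div_le_iff₀ (pow_pos (co_pos τ) 2)]
  nlinarith [le_co_sq_of_nonpos hτ, sn_rpow_pos a τ]

lemma hasDerivAt_sn_co_sq (a τ : ℝ) : HasDerivAt (fun τ => sn τ ^ a * co τ ^ 2)
    ((2 * a * cs τ - 2 * (1 - cs τ)) * (sn τ ^ a * co τ ^ 2)) τ := by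
  refine ((hasDerivAt_sn_rpow a τ).mul ((hasDerivAt_co τ).pow 2)).congr_deriv ?_
  simp only [Pi.pow_apply]; push_cast
  ring

lemma tendsto_sn_co_sq {a : ℝ} (ha : 0 < a) :
    Tendsto (fun τ => sn τ ^ a * co τ ^ 2) Filter.atTop (𝓝 0) := by
  have h1 : Tendsto (fun τ => sn τ ^ a) Filter.atTop (𝓝 (0 ^ a)) :=
    (tendsto_sn_atTop.rpow_const (Or.inr ha.le))
  rw [Real.zero_rpow ha.ne'] at h1
  refine squeeze_zero (fun τ => mul_nonneg (sn_rpow_pos _ τ).le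
    (sq_nonneg _)) (fun τ => ?_) h1
  exact mul_le_of_le_one_right (sn_rpow_pos _ τ).le (by nlinarith [co_pos τ, co_le_one τ])

/-- An a priori bound for `w`, of Cauchy–Schwarz type, from integrating the flux from either end. The
integral of `sn^{3+η} co²` that it involves is bounded through the explicit comparison functions
`sn^{3+η} / co²` for `τ ≤ 0` and `sn^{3+η} co²` for `0 ≤ τ`. -/
lemma abs_w_le (h : AngSys u w y) (hy : SqInt y) :
    ∃ C, ∀ τ, |w τ| ≤ C * sn τ ^ ((eta - 1) / 2) := by
  have hyc := h.cont
  have hy' : Integrable fun τ => y τ ^ 2 * sn τ ^ (1 - eta) := hy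
  obtain ⟨I, hI, hI0, hI1⟩ := exists_primitive (by fun_prop) hy'
  set Y := ∫ τ, y τ ^ 2 * sn τ ^ (1 - eta)
  have hImono : Monotone I := monotone_of_hasDerivAt_nonneg hI
    fun τ => mul_nonneg (sq_nonneg _) (sn_rpow_pos _ τ).le
  have hI2 : ∀ τ, I τ ≤ Y := fun τ => ge_of_tendsto hI1
    ((Ici_mem_atTop τ : _)|> fun h => by filter_upwards [h] with x hx using hImono hx)
  have hI3 : ∀ τ, 0 ≤ I τ := fun τ => le_of_tendsto hI0
    (by filter_upwards [Iic_mem_atBot τ] with x hx using hImono hx)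
  have hsplit : ∀ x, sn x ^ (1 - eta) * sn x ^ (3 + eta) = sn x ^ 4 := fun x => by
    rw [← sn_rpow_add, sn_pow_eq_rpow]; congr 1; push_cast; ring
  -- the weighted arithmetic-geometric mean inequality behind both halves
  have amgm : ∀ e > 0, ∀ x, sn x ^ 2 * co x * |y x| ≤
      e / 2 * (y x ^ 2 * sn x ^ (1 - eta)) + 1 / (2 * e) * (sn x ^ (3 + eta) * co x ^ 2) := by
    intro e he x
    have h1 := sn_rpow_pos (1 - eta) x
    have h2 := sn_rpow_pos (3 + eta) x
    have e1 : sn x ^ 2 = √(sn x ^ (1 - eta)) * √(sn x ^ (3 + eta)) := by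
      rw [← Real.sqrt_mul h1.le, hsplit, show sn x ^ 4 = (sn x ^ 2) ^ 2 by ring,
        Real.sqrt_sq (sq_nonneg _)]
    set p := √(sn x ^ (1 - eta)) with hp
    set q := √(sn x ^ (3 + eta)) with hq
    have hp2 : sn x ^ (1 - eta) = p ^ 2 := (Real.sq_sqrt h1.le).symm
    have hq2 : sn x ^ (3 + eta) = q ^ 2 := (Real.sq_sqrt h2.le).symm
    rw [hp2, hq2, e1, ← sq_abs (y x)]
    have : 0 ≤ (e * (|y x| * p) - q * co x) ^ 2 / (2 * e) := by positivity
    have e3 : (e * (|y x| * p) - q * co x) ^ 2 / (2 * e) = e / 2 * (|y x| ^ 2 * p ^ 2) +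
      1 / (2 * e) * (q ^ 2 * co x ^ 2) - p * q * co x * |y x| := by field_simp; ring
    linarith
  have hab : ∀ x, |-(sn x ^ 2 * co x * y x)| = sn x ^ 2 * co x * |y x| := fun x => by
    rw [abs_neg, abs_mul, abs_of_nonneg (mul_nonneg (sq_nonneg _) (co_pos x).le)]
  have hsq : ∀ x, sn x ^ (3 + eta) = sn x ^ ((3 + eta) / 2) * sn x ^ ((3 + eta) / 2) := fun x => by
    rw [← sn_rpow_add]; ring_nf
  have hw : ∀ x, sn x ^ ((3 + eta) / 2) = sn x ^ 2 * sn x ^ ((eta - 1) / 2) := fun x => by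
    rw [sn_pow_eq_rpow, ← sn_rpow_add]; congr 1; push_cast; ring
  have hY : 0 ≤ Y := (hI3 0).trans (hI2 0)
  refine ⟨2 * (Y + 2), fun τ => ?_⟩
  have hs := sn_pos τ
  have hc := co_pos τ
  have hc1 := co_le_one τ
  have hE := sn_rpow_pos ((eta - 1) / 2) τ
  have hflux : |sn τ ^ 2 * co τ * w τ| = sn τ ^ 2 * co τ * |w τ| := by
    rw [abs_mul, abs_of_nonneg (mul_nonneg (sq_nonneg _) hc.le)]
  rcases le_total τ 0 with hτ | hτ
  · set e := sn τ ^ ((3 + eta) / 2) with he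
    have he0 : 0 < e := sn_rpow_pos _ _
    have key := abs_le_of_deriv_le_of_tendsto_atBot (a := τ) h.hasDerivAt_flux
      (fun x => ((hI x).const_mul (e / 2)).add
        ((hasDerivAt_sn_co_inv (3 + eta) x).const_mul (1 / (2 * e)))) (fun x hx => ?_)
      (h.tendsto_flux_atBot hy) ?_
    · rw [hflux] at key
      have hco := le_co_sq_of_nonpos hτ
      have h1 : sn τ ^ (3 + eta) / co τ ^ 2 ≤ 2 * (e * e) := by
        rw [div_le_iff₀ (by positivity), hsq]; nlinarith [mul_pos he0 he0]
      have h2 : sn τ ^ 2 * co τ * |w τ| ≤ e * (Y / 2 + 1) := by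
        have a1 : 1 / (2 * e) * (sn τ ^ (3 + eta) / co τ ^ 2) ≤ 1 / (2 * e) * (2 * (e * e)) :=
          mul_le_mul_of_nonneg_left h1 (by positivity)
        have a2 : 1 / (2 * e) * (2 * (e * e)) = e := by field_simp
        have a3 : e / 2 * I τ ≤ e / 2 * Y := mul_le_mul_of_nonneg_left (hI2 τ) (by positivity)
        simp only [Pi.add_apply] at key
        linarith
      rw [he, hw] at h2
      have hco2 : 1 / 2 ≤ co τ := by nlinarith
      have h3 : co τ * |w τ| ≤ sn τ ^ ((eta - 1) / 2) * (Y / 2 + 1) := by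
        have : sn τ ^ 2 * (co τ * |w τ|) ≤ sn τ ^ 2 * (sn τ ^ ((eta - 1) / 2) * (Y / 2 + 1)) := by
          linarith
        exact le_of_mul_le_mul_left this (by positivity)
      nlinarith [abs_nonneg (w τ), mul_nonneg hE.le hY]
    · rw [hab]
      have h1 := cs_nonneg (hx.trans hτ)
      have h2 := amgm e he0 x
      have h3 : sn x ^ (3 + eta) * co x ^ 2 ≤ (2 * (3 + eta) * cs x + 2 * (1 - cs x)) *
          (sn x ^ (3 + eta) / co x ^ 2) := by
        have b1 : sn x ^ (3 + eta) * co x ^ 2 ≤ sn x ^ (3 + eta) / co x ^ 2 := by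
          rw [le_div_iff₀ (pow_pos (co_pos x) 2), mul_assoc]
          have : co x ^ 2 ≤ 1 := by nlinarith [co_pos x, co_le_one x]
          exact mul_le_of_le_one_right (sn_rpow_pos _ x).le
            (by nlinarith [sq_nonneg (co x)])
        have b2 : 0 < sn x ^ (3 + eta) / co x ^ 2 :=
          div_pos (sn_rpow_pos _ x) (pow_pos (co_pos x) 2)
        nlinarith [eta_pos, mul_nonneg h1 eta_pos.le]
      have h4 := mul_le_mul_of_nonneg_left h3 (show 0 ≤ 1 / (2 * e) by positivity)
      linarith
    · have := (hI0.const_mul (e / 2)).add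
        ((tendsto_sn_co_inv (a := 3 + eta) (by linarith [eta_pos])).const_mul (1 / (2 * e)))
      simp only [mul_zero, add_zero] at this
      exact this
  · set e := sn τ ^ ((3 + eta) / 2) * co τ with he
    have he1 : 0 < sn τ ^ ((3 + eta) / 2) := sn_rpow_pos _ _
    have he0 : 0 < e := mul_pos he1 hc
    have key := abs_le_of_deriv_le_of_tendsto_atTop (a := τ) h.hasDerivAt_flux
      (fun x => ((((hI x).const_sub Y).const_mul (e / 2)).add
        ((hasDerivAt_sn_co_sq (3 + eta) x).const_mul (1 / (2 * e))))) (fun x hx => ?_)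
      (h.tendsto_flux_atTop hy) ?_
    · rw [hflux] at key
      have h1 : sn τ ^ (3 + eta) * co τ ^ 2 = e * e := by rw [hsq]; simp only [he]; ring
      simp only [Pi.add_apply] at key
      rw [h1] at key
      have a2 : 1 / (2 * e) * (e * e) = e / 2 := by field_simp
      have a3 : e / 2 * (Y - I τ) ≤ e / 2 * Y :=
        mul_le_mul_of_nonneg_left (by linarith [hI3 τ]) (by positivity)
      have h2 : sn τ ^ 2 * co τ * |w τ| ≤ e * (Y / 2 + 1) := by linarith
      rw [he, hw] at h2
      have h3 : |w τ| ≤ sn τ ^ ((eta - 1) / 2) * (Y / 2 + 1) := by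
        have : (sn τ ^ 2 * co τ) * |w τ| ≤
          (sn τ ^ 2 * co τ) * (sn τ ^ ((eta - 1) / 2) * (Y / 2 + 1)) := by linarith
        exact le_of_mul_le_mul_left this (by positivity)
      nlinarith [abs_nonneg (w τ), mul_nonneg hE.le hY]
    · rw [hab]
      have h1 := cs_nonpos (hτ.trans hx)
      have h2 := amgm e he0 x
      have b2 : 0 < sn x ^ (3 + eta) * co x ^ 2 :=
        mul_pos (sn_rpow_pos _ x) (pow_pos (co_pos x) 2)
      have h3 : sn x ^ (3 + eta) * co x ^ 2 ≤ -((2 * (3 + eta) * cs x - 2 * (1 - cs x)) *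
          (sn x ^ (3 + eta) * co x ^ 2)) := by
        nlinarith [eta_pos, mul_nonneg (neg_nonneg.2 h1) eta_pos.le,
          mul_nonneg (mul_nonneg (neg_nonneg.2 h1) eta_pos.le) b2.le]
      have h4 := mul_le_mul_of_nonneg_left h3 (show 0 ≤ 1 / (2 * e) by positivity)
      linarith
    · have := ((hI1.const_sub Y).const_mul (e / 2)).add
        ((tendsto_sn_co_sq (a := 3 + eta) (by linarith [eta_pos])).const_mul (1 / (2 * e)))
      simp only [mul_zero, add_zero, sub_self] at this
      exact this

lemma integrable_w_sq (h : AngSys u w y) (hy : SqInt y) :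
    Integrable fun τ => w τ ^ 2 * sn τ := by
  obtain ⟨C, hC⟩ := h.abs_w_le hy
  have hwc := h.continuous_w
  refine ((integrable_sn_rpow eta_pos).const_mul (C ^ 2)).mono'
    (by fun_prop : Continuous _).aestronglyMeasurable (Eventually.of_forall fun τ => ?_)
  rw [Real.norm_of_nonneg (mul_nonneg (sq_nonneg _) (sn_pos τ).le)]
  have h1 : sn τ ^ eta = (sn τ ^ ((eta - 1) / 2)) ^ 2 * sn τ := by
    rw [← Real.rpow_mul_natCast (sn_pos τ).le]
    conv_rhs => rw [← Real.rpow_one (sn τ), ← Real.rpow_mul (sn_pos τ).le, ← sn_rpow_add]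
    congr 1; push_cast; ring
  rw [h1, ← mul_assoc, ← mul_pow]
  refine mul_le_mul_of_nonneg_right ?_ (sn_pos τ).le
  rw [← sq_abs]
  exact pow_le_pow_left₀ (abs_nonneg _) (hC τ) 2

lemma dw' (h : AngSys u w y) (τ : ℝ) : HasDerivAt w ((1 - 5 * cs τ) * w τ + (-y) τ) τ :=
  (h.dw τ).congr_deriv (by simp; ring)

lemma lintegral_w_le (h : AngSys u w y) (hy : SqInt y) :
    ∫⁻ τ, ENNReal.ofReal (w τ ^ 2 * sn τ ^ (1 - eta)) ≤
      2 * ∫⁻ τ, ENNReal.ofReal (y τ ^ 2 * sn τ ^ (1 - eta)) := by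
  simpa using hardy_lintegral eta_pos.le h.dw' h.cont.neg (h.integrable_w_sq hy)

lemma sqInt_w (h : AngSys u w y) (hy : SqInt y) : SqInt w :=
  hardy_integral eta_pos.le h.dw' h.cont.neg (h.integrable_w_sq hy) (by simpa [SqInt] using hy)

/-- `u / sin 2θ` is bounded. -/
lemma exists_abs_quot_le (h : AngSys u w y) (hy : SqInt y) : ∃ C, ∀ τ, |u τ / sn τ| ≤ C := by
  have hwc := h.continuous_w
  have hi : Integrable fun τ => |sn τ * w τ| := by
    have h1 : SqInt (fun _ => (1 : ℝ)) := .of_bounded continuous_const 1 (by simp)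
    have := (h.sqInt_w hy).mul h1 h.continuous_w continuous_const continuous_sn 1 fun τ => by
      rw [abs_of_pos (sn_pos τ), one_mul]
      simpa using sn_pow_le (n := 1) (a := 1 - eta) (by norm_num [eta]) τ
    simpa using this.abs
  refine ⟨|u 0 / sn 0| + ∫ τ, |sn τ * w τ|, fun τ => ?_⟩
  have h1 : ∫ x in (0 : ℝ)..τ, sn x * w x = u τ / sn τ - u 0 / sn 0 :=
    intervalIntegral.integral_eq_sub_of_hasDerivAt (fun x _ => h.hasDerivAt_quot x)
      ((by fun_prop : Continuous _).intervalIntegrable _ _)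
  have h2 : |∫ x in (0 : ℝ)..τ, sn x * w x| ≤ ∫ τ, |sn τ * w τ| := by
    rw [← Real.norm_eq_abs]
    refine (intervalIntegral.norm_integral_le_integral_norm_uIoc).trans ?_
    exact setIntegral_le_integral hi (Eventually.of_forall fun _ => abs_nonneg _)
  rw [h1] at h2
  linarith [abs_sub_abs_le_abs_sub (u τ / sn τ) (u 0 / sn 0)]

lemma continuous_quot (h : AngSys u w y) : Continuous fun τ => u τ / sn τ :=
  h.continuous_u.div continuous_sn fun τ => (sn_pos τ).ne'

lemma sqInt_quot (h : AngSys u w y) (hy : SqInt y) : SqInt fun τ => u τ / sn τ := by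
  obtain ⟨C, hC⟩ := h.exists_abs_quot_le hy
  exact .of_bounded h.continuous_quot C hC

end AngSys

/-! ### Coercivity of the angular operator -/

/-- The size of the multiple of the natural weight `cos θ dθ` that is added to `sin(2θ)^{-η} dθ`. It has
to be large enough that `10 · bigM · sn³ co ≥ 8` wherever `sn² ≥ 1/1000`. -/
def bigM : ℝ := 2000000

/-- The angular weight `sin(2θ)^{-η} + bigM · cos θ`, with respect to `dτ`. For it the angular
operator is coercive on the orthogonal complement of its kernel. -/
def dens (τ : ℝ) : ℝ := sn τ ^ (1 - eta) + bigM * (sn τ * co τ)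

lemma continuous_dens : Continuous dens := by unfold dens; fun_prop

attribute [fun_prop] continuous_dens

lemma le_dens (τ : ℝ) : sn τ ^ (1 - eta) ≤ dens τ := by
  have := mul_pos (sn_pos τ) (co_pos τ)
  unfold dens bigM; linarith

lemma dens_pos (τ : ℝ) : 0 < dens τ := (sn_rpow_pos _ τ).trans_le (le_dens τ)

lemma dens_le (τ : ℝ) : dens τ ≤ (1 + bigM) * sn τ ^ (1 - eta) := by
  have h1 : sn τ * co τ ≤ sn τ ^ (1 - eta) :=
    (mul_le_of_le_one_right (sn_pos τ).le (co_le_one τ)).trans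
      (by simpa using sn_pow_le (n := 1) (a := 1 - eta) (by norm_num [eta]) τ)
  unfold dens bigM; linarith

lemma integrable_dens : Integrable dens := by
  refine ((integrable_sn_rpow (a := 1 - eta) (by norm_num [eta])).const_mul (1 + bigM)).mono'
    continuous_dens.aestronglyMeasurable (Eventually.of_forall fun τ => ?_)
  rw [Real.norm_of_nonneg (dens_pos τ).le]
  exact dens_le τ

/-- The pointwise positivity behind the coercivity estimate: the first term is positive where
`sin 2θ` is small, the second one dominates elsewhere. -/
lemma coercive_pointwise (τ : ℝ) :
    1 / 200 * sn τ ^ (1 - eta) + 4 * (sn τ ^ 2 * dens τ) ≤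
      sn τ ^ (1 - eta) * ((1 + 2 * eta) * (2 - eta) * cs τ ^ 2 - (1 - eta) * cs τ - (1 + 2 * eta))
        + 14 * bigM * (sn τ ^ 3 * co τ) := by
  set P := sn τ ^ (1 - eta) with hP
  have hP0 : 0 < P := sn_rpow_pos _ τ
  have hP1 : P ≤ 1 := sn_rpow_le_one (by norm_num [eta]) τ
  have hs := sn_pos τ
  have hc := co_pos τ
  have hcs := abs_le.1 (abs_cs_le_one τ)
  have hsq := sn_sq τ
  have hd : dens τ = P + bigM * (sn τ * co τ) := rfl
  rw [hd]
  have e : sn τ ^ 2 * (P + bigM * (sn τ * co τ)) = (1 - cs τ ^ 2) * P +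
      bigM * (sn τ ^ 3 * co τ) := by rw [← hsq]; ring
  rw [e]
  have hX : 0 ≤ sn τ ^ 3 * co τ := by positivity
  suffices h : 0 ≤ P * (7.0098 * cs τ ^ 2 - 0.01 * cs τ - 6.985) +
      20000000 * (sn τ ^ 3 * co τ) by
    norm_num [eta, bigM] at h ⊢
    nlinarith
  by_cases hsm : sn τ ^ 2 ≤ 1 / 1000
  · have : 0 ≤ 7.0098 * cs τ ^ 2 - 0.01 * cs τ - 6.985 := by
      norm_num; nlinarith
    have := mul_nonneg hP0.le this
    linarith
  · push Not at hsm
    have h1 : 1 / 4000 ≤ co τ ^ 2 := by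
      rw [co_sq]; nlinarith
    -- `sn ≥ 1/32` and `co ≥ 1/64`
    have h2 : 1 / 32 ≤ sn τ := by nlinarith
    have h3 : 1 / 64 ≤ co τ := by nlinarith
    have h4 : 1 / 1000 * (1 / 32) ≤ sn τ ^ 2 * sn τ := mul_le_mul hsm.le h2 (by norm_num) (sq_nonneg _)
    have h5 : 1 / 1000 * (1 / 32) * (1 / 64) ≤ sn τ ^ 2 * sn τ * co τ :=
      mul_le_mul h4 h3 (by norm_num) (by positivity)
    have h6 : -8 ≤ P * (7.0098 * cs τ ^ 2 - 0.01 * cs τ - 6.985) := by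
      have : -8 ≤ 7.0098 * cs τ ^ 2 - 0.01 * cs τ - 6.985 := by norm_num; nlinarith [sq_nonneg (cs τ)]
      nlinarith
    nlinarith

namespace AngSys

variable {u w y : ℝ → ℝ}

lemma sn_cube_co_le (τ : ℝ) : |sn τ ^ 3 * co τ| ≤ 1 * sn τ ^ (1 - eta) := by
  rw [abs_of_nonneg (mul_nonneg (pow_pos (sn_pos τ) 3).le (co_pos τ).le), one_mul]
  exact (mul_le_of_le_one_right (pow_pos (sn_pos τ) 3).le (co_le_one τ)).trans
    (sn_pow_le (by norm_num [eta]) τ)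

lemma hasDerivAt_sn_cube_co (τ : ℝ) : HasDerivAt (fun τ => sn τ ^ 3 * co τ)
    ((7 * cs τ - 1) * (sn τ ^ 3 * co τ)) τ := by
  refine (((hasDerivAt_sn τ).pow 3).mul (hasDerivAt_co τ)).congr_deriv ?_
  simp only [Pi.pow_apply]; push_cast; ring

/-- The spectral gap: `14 = 4 · 5 - 6` is the second eigenvalue of the angular operator. The proof
dualizes: with `N' = sn³ co g`, the function `sn⁶ co²` is the ground state for `N`. -/
lemma poincare (h : AngSys u w y) (hy : SqInt y) (h0 : ∫ τ, sn τ ^ 2 * co τ * u τ = 0) :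
    14 * ∫ τ, sn τ ^ 3 * co τ * (u τ / sn τ * (u τ / sn τ)) ≤
      ∫ τ, sn τ ^ 3 * co τ * (w τ * w τ) := by
  have hgc := h.continuous_quot
  have hg := h.hasDerivAt_quot
  have hgs := h.sqInt_quot hy
  have hws := h.sqInt_w hy
  have hwc := h.continuous_w
  obtain ⟨C, hC⟩ := h.exists_abs_quot_le hy
  set g := fun τ => u τ / sn τ with hgdef
  have hrho : Continuous fun τ => sn τ ^ 3 * co τ := by fun_prop
  have hrpos : ∀ τ, 0 < sn τ ^ 3 * co τ := fun τ => mul_pos (pow_pos (sn_pos τ) 3) (co_pos τ)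
  have hNi : Integrable fun τ => sn τ ^ 3 * co τ * g τ := by
    have h1 : SqInt (fun _ => (1 : ℝ)) := .of_bounded continuous_const 1 (by simp)
    simpa using hgs.mul h1 hgc continuous_const hrho 1 sn_cube_co_le
  have hC0 : 0 ≤ C := (abs_nonneg _).trans (hC 0)
  obtain ⟨N, hN, hNb, hNt⟩ := exists_primitive (by fun_prop) hNi
  have hz : ∫ τ, sn τ ^ 3 * co τ * g τ = 0 := by
    rw [← h0]; congr 1; ext τ; simp only [hgdef]; field_simp [(sn_pos τ).ne']
  rw [hz] at hNt
  have hNle : ∀ τ, |N τ| ≤ 2 * C * (sn τ ^ 3 * co τ) := by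
    intro τ
    rcases le_total τ 0 with hτ | hτ
    · have key := abs_le_of_deriv_le_of_tendsto_atBot (a := τ) hN
        (fun x => (hasDerivAt_sn_co_inv 3 x).const_mul (C / 2)) (fun x hx => ?_) hNb
        (by simpa using (tendsto_sn_co_inv (a := 3) (by norm_num)).const_mul (C / 2))
      · refine key.trans ?_
        have h1 : (sn τ : ℝ) ^ (3 : ℝ) = sn τ ^ 3 := by
          rw [sn_pow_eq_rpow]; norm_num
        rw [h1]
        have hco := le_co_sq_of_nonpos hτ
        have hc1 := co_pos τ
        have hc2 := co_le_one τ
        have : sn τ ^ 3 / co τ ^ 2 ≤ 4 * (sn τ ^ 3 * co τ) := by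
          rw [div_le_iff₀ (by positivity)]
          have hb : 1 / 2 ≤ co τ := by nlinarith
          have : 1 ≤ 4 * (co τ * co τ ^ 2) := by nlinarith
          have hs3 := pow_pos (sn_pos τ) 3
          nlinarith
        nlinarith
      · have h1 : (sn x : ℝ) ^ (3 : ℝ) = sn x ^ 3 := by
          rw [sn_pow_eq_rpow]; norm_num
        rw [abs_mul, abs_of_pos (hrpos x), h1]
        have hcs := cs_nonneg (hx.trans hτ)
        have hc1 := co_pos x
        have hc2 := co_le_one x
        have hb : sn x ^ 3 * co x ≤ sn x ^ 3 / co x ^ 2 := by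
          rw [le_div_iff₀ (by positivity), mul_assoc]
          refine mul_le_of_le_one_right (pow_pos (sn_pos x) 3).le ?_
          have : co x ^ 2 ≤ 1 := by nlinarith
          nlinarith
        have hpos : 0 ≤ sn x ^ 3 / co x ^ 2 := (hrpos x).le.trans hb
        calc sn x ^ 3 * co x * |g x| ≤ sn x ^ 3 / co x ^ 2 * C :=
              mul_le_mul hb (hC x) (abs_nonneg _) hpos
          _ ≤ C / 2 * ((2 * 3 * cs x + 2 * (1 - cs x)) * (sn x ^ 3 / co x ^ 2)) := by
              nlinarith [mul_nonneg (mul_nonneg hC0 hpos) hcs]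
    · have key := abs_le_of_deriv_le_of_tendsto_atTop (a := τ) hN
        (fun x => (hasDerivAt_sn_cube_co x).const_mul C) (fun x hx => ?_) hNt ?_
      · refine key.trans ?_
        nlinarith [mul_nonneg hC0 (hrpos τ).le]
      · rw [abs_mul, abs_of_pos (hrpos x)]
        have hcs := cs_nonpos (hτ.trans hx)
        have h1 := hrpos x
        have h2 : sn x ^ 3 * co x * |g x| ≤ sn x ^ 3 * co x * C :=
          mul_le_mul_of_nonneg_left (hC x) h1.le
        nlinarith [mul_nonneg (mul_nonneg hC0 h1.le) (neg_nonneg.2 hcs)]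
      · have h1 : Tendsto (fun τ => sn τ ^ 3) Filter.atTop (𝓝 (0 ^ 3)) := tendsto_sn_atTop.pow 3
        rw [zero_pow (by norm_num)] at h1
        have h2 : Tendsto (fun τ => sn τ ^ 3 * co τ) Filter.atTop (𝓝 0) :=
          squeeze_zero (fun τ => (hrpos τ).le)
            (fun τ => mul_le_of_le_one_right (pow_pos (sn_pos τ) 3).le (co_le_one τ)) h1
        simpa using h2.const_mul C
  have hNc : Continuous N := continuous_iff_continuousAt.2 fun τ => (hN τ).continuousAt
  -- `N = ρ₁ n` with `n` bounded
  let n : ℝ → ℝ := fun τ => N τ / (sn τ ^ 3 * co τ)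
  have hnN : ∀ τ, N τ = sn τ ^ 3 * co τ * n τ := fun τ => by
    simp only [n]; rw [mul_div_cancel₀ _ (hrpos τ).ne']
  have hnc : Continuous n := hNc.div hrho fun τ => (hrpos τ).ne'
  have hnb : ∀ τ, |n τ| ≤ 2 * C := fun τ => by
    rw [abs_div, abs_of_pos (hrpos τ), div_le_iff₀ (hrpos τ)]
    exact hNle τ
  have hns : SqInt n := .of_bounded hnc _ hnb
  have hnd : ∀ τ, HasDerivAt n (g τ - (7 * cs τ - 1) * n τ) τ := fun τ => by
    refine ((hN τ).div (hasDerivAt_sn_cube_co τ) (hrpos τ).ne').congr_deriv ?_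
    rw [hnN τ]
    have := (sn_pos τ).ne'; have := (co_pos τ).ne'
    field_simp
  have bd7 : ∀ τ, |7 * cs τ - 1| ≤ 8 := fun τ => by
    have := abs_le.1 (abs_cs_le_one τ)
    rw [abs_le]; constructor <;> linarith
  have hmulb : ∀ (a : ℝ → ℝ) (K : ℝ), (∀ τ, |a τ| ≤ K) →
      ∀ τ, |sn τ ^ 3 * co τ * a τ| ≤ K * sn τ ^ (1 - eta) := fun a K ha τ => by
    rw [abs_mul]
    calc _ ≤ (1 * sn τ ^ (1 - eta)) * K :=
          mul_le_mul (sn_cube_co_le τ) (ha τ) (abs_nonneg _) (by simpa using (sn_rpow_pos _ τ).le)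
      _ = _ := by ring
  -- the ground state identity
  have hI1 : Integrable fun τ => sn τ ^ 3 * co τ * (g τ * g τ) :=
    hgs.mul hgs hgc hgc hrho 1 sn_cube_co_le
  have hI2 : Integrable fun τ => sn τ ^ 3 * co τ * (7 * cs τ - 1) * (n τ * n τ) :=
    hns.mul hns hnc hnc (by fun_prop) 8 (hmulb _ 8 bd7)
  have hI3 : Integrable fun τ => sn τ ^ 3 * co τ * (2 * (7 * cs τ - 1)) * (n τ * g τ) :=
    hns.mul hgs hnc hgc (by fun_prop) 16 (hmulb _ 16 fun τ => by
      rw [abs_mul, abs_two]; linarith [bd7 τ])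
  have hI4 : Integrable fun τ => sn τ ^ 3 * co τ * (14 * sn τ ^ 2 + (7 * cs τ - 1) ^ 2) *
      (n τ * n τ) :=
    hns.mul hns hnc hnc (by fun_prop) 78 (hmulb _ 78 fun τ => by
      have h1 : (7 * cs τ - 1) ^ 2 ≤ 8 ^ 2 := sq_le_sq' (by linarith [(abs_le.1 (bd7 τ)).1])
        (abs_le.1 (bd7 τ)).2
      have h2 : sn τ ^ 2 ≤ 1 := by nlinarith [sn_pos τ, sn_le_one τ]
      rw [abs_of_nonneg (by positivity)]; linarith)
  have hI5 : Integrable fun τ => sn τ ^ 5 * co τ * (n τ * n τ) :=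
    hns.mul hns hnc hnc (by fun_prop) 1 fun τ => by
      have h2 : sn τ ^ 2 ≤ 1 := by nlinarith [sn_pos τ, sn_le_one τ]
      refine le_trans ?_ (sn_cube_co_le τ)
      have := hrpos τ
      rw [abs_of_pos this, abs_of_pos (mul_pos (pow_pos (sn_pos τ) 5) (co_pos τ)),
        show sn τ ^ 5 * co τ = (sn τ ^ 3 * co τ) * sn τ ^ 2 by ring]
      exact mul_le_of_le_one_right this.le h2
  have hI6 : Integrable fun τ => sn τ ^ 3 * co τ * (w τ * w τ) :=
    hws.mul hws hwc hwc hrho 1 sn_cube_co_le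
  have hJ := integral_eq_zero_of_hasDerivAt_of_integrable
    (f := fun τ => sn τ ^ 3 * co τ * (7 * cs τ - 1) * (n τ * n τ))
    (f' := fun τ => sn τ ^ 3 * co τ * (2 * (7 * cs τ - 1)) * (n τ * g τ) -
      sn τ ^ 3 * co τ * (14 * sn τ ^ 2 + (7 * cs τ - 1) ^ 2) * (n τ * n τ))
    (fun τ => by
      refine (((hasDerivAt_sn_cube_co τ).mul (((hasDerivAt_cs τ).const_mul 7).sub_const 1)).mul
        ((hnd τ).mul (hnd τ))).congr_deriv ?_
      simp only [Pi.mul_apply]; ring) (integrable_fun_sub hI3 hI4) hI2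
  have hA : 14 * ∫ τ, sn τ ^ 5 * co τ * (n τ * n τ) ≤ ∫ τ, sn τ ^ 3 * co τ * (g τ * g τ) := by
    rw [← integral_const_mul, ← sub_zero (∫ τ, sn τ ^ 3 * co τ * (g τ * g τ)), ← hJ,
      ← integral_sub hI1 (integrable_fun_sub hI3 hI4)]
    refine integral_mono (hI5.const_mul 14) (integrable_fun_sub hI1 (integrable_fun_sub hI3 hI4)) fun τ => ?_
    have : 0 ≤ sn τ ^ 3 * co τ * (g τ - (7 * cs τ - 1) * n τ) ^ 2 :=
      mul_nonneg (hrpos τ).le (sq_nonneg _)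
    nlinarith
  -- integration by parts back to `g`
  have hI7 : Integrable fun τ => sn τ ^ 3 * co τ * (n τ * g τ) :=
    hns.mul hgs hnc hgc hrho 1 sn_cube_co_le
  have hI8 : Integrable fun τ => sn τ ^ 4 * co τ * (n τ * w τ) :=
    hns.mul hws hnc hwc (by fun_prop) 1 fun τ => by
      refine le_trans ?_ (sn_cube_co_le τ)
      have := hrpos τ
      rw [abs_of_pos this, abs_of_pos (mul_pos (pow_pos (sn_pos τ) 4) (co_pos τ)),
        show sn τ ^ 4 * co τ = (sn τ ^ 3 * co τ) * sn τ by ring]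
      exact mul_le_of_le_one_right this.le (sn_le_one τ)
  have hB := integral_eq_zero_of_hasDerivAt_of_integrable
    (f := fun τ => sn τ ^ 3 * co τ * (n τ * g τ))
    (f' := fun τ => sn τ ^ 3 * co τ * (g τ * g τ) + sn τ ^ 4 * co τ * (n τ * w τ))
    (fun τ => by
      refine ((hasDerivAt_sn_cube_co τ).mul ((hnd τ).mul (hg τ))).congr_deriv ?_
      simp only [Pi.mul_apply]; ring) (integrable_fun_add hI1 hI8) hI7
  have hD : ∫ τ, sn τ ^ 3 * co τ * (g τ * g τ) ≤
      ∫ τ, (7 * (sn τ ^ 5 * co τ * (n τ * n τ)) + 1 / 28 * (sn τ ^ 3 * co τ * (w τ * w τ))) := by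
    rw [← sub_zero (∫ τ, sn τ ^ 3 * co τ * (g τ * g τ)), ← hB, ← integral_sub hI1 (integrable_fun_add hI1 hI8)]
    refine integral_mono (integrable_fun_sub hI1 (integrable_fun_add hI1 hI8)) (integrable_fun_add (hI5.const_mul 7) (hI6.const_mul _))
      fun τ => ?_
    have : 0 ≤ sn τ ^ 3 * co τ * (14 * (sn τ * n τ) + w τ) ^ 2 :=
      mul_nonneg (hrpos τ).le (sq_nonneg _)
    nlinarith
  rw [integral_add (hI5.const_mul 7) (hI6.const_mul _), integral_const_mul,
    integral_const_mul] at hD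
  linarith

lemma integrable_sq_mul_dens {f : ℝ → ℝ} (hf : SqInt f) (hfc : Continuous f) :
    Integrable fun τ => f τ ^ 2 * dens τ := by
  have := hf.mul hf hfc hfc continuous_dens (1 + bigM) fun τ => by
    rw [abs_of_pos (dens_pos τ)]; exact dens_le τ
  refine this.congr (Eventually.of_forall fun τ => ?_)
  simp only; ring

lemma integrable_mul_mul_dens {f g : ℝ → ℝ} (hf : SqInt f) (hg : SqInt g) (hfc : Continuous f)
    (hgc : Continuous g) : Integrable fun τ => f τ * g τ * dens τ := by
  have := hf.mul hg hfc hgc continuous_dens (1 + bigM) fun τ => by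
    rw [abs_of_pos (dens_pos τ)]; exact dens_le τ
  refine this.congr (Eventually.of_forall fun τ => ?_)
  simp only; ring

lemma sqInt_u (h : AngSys u w y) (hy : SqInt y) : SqInt u := by
  obtain ⟨C, hC⟩ := h.exists_abs_quot_le hy
  refine .of_bounded h.continuous_u C fun τ => ?_
  have h1 : u τ = u τ / sn τ * sn τ := by field_simp [(sn_pos τ).ne']
  rw [h1, abs_mul, abs_of_pos (sn_pos τ)]
  exact (mul_le_of_le_one_right (abs_nonneg _) (sn_le_one τ)).trans (hC τ)

lemma sqInt_sn_mul {f : ℝ → ℝ} (hf : SqInt f) (hfc : Continuous f) :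
    SqInt fun τ => sn τ * f τ := by
  have hf' : Integrable fun τ => f τ ^ 2 * sn τ ^ (1 - eta) := hf
  refine hf'.mono' (by fun_prop : Continuous _).aestronglyMeasurable
    (Eventually.of_forall fun τ => ?_)
  rw [Real.norm_of_nonneg (mul_nonneg (sq_nonneg _) (sn_rpow_pos _ τ).le)]
  refine mul_le_mul_of_nonneg_right ?_ (sn_rpow_pos _ τ).le
  have h2 : sn τ ^ 2 ≤ 1 := by nlinarith [sn_pos τ, sn_le_one τ]
  rw [mul_pow]
  exact mul_le_of_le_one_left (sq_nonneg _) h2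

/-- Coercivity of the angular operator on the orthogonal complement of its kernel `sin 2θ`, for the
weight `dens`. The gap `4` is what the radial weights need. -/
lemma coercive (h : AngSys u w y) (hy : SqInt y) (h0 : ∫ τ, sn τ ^ 2 * co τ * u τ = 0) :
    ∫ τ, (4 * (u τ ^ 2 * dens τ) + 1 / 200 * ((sn τ * w τ) ^ 2 * sn τ ^ (1 - eta) +
      (u τ / sn τ) ^ 2 * sn τ ^ (1 - eta))) ≤ ∫ τ, y τ * u τ * dens τ := by
  have hgc := h.continuous_quot
  have hg := h.hasDerivAt_quot
  have hgs := h.sqInt_quot hy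
  have hws := h.sqInt_w hy
  have hwc := h.continuous_w
  have huc := h.continuous_u
  have hyc := h.cont
  have hP := h.poincare hy h0
  have hu2 := integrable_sq_mul_dens (h.sqInt_u hy) huc
  have hyu := integrable_mul_mul_dens hy (h.sqInt_u hy) hyc huc
  have hw2 : Integrable fun τ => (sn τ * w τ) ^ 2 * sn τ ^ (1 - eta) := sqInt_sn_mul hws hwc
  have hg2 : Integrable fun τ => (u τ / sn τ) ^ 2 * sn τ ^ (1 - eta) := hgs
  have hug : ∀ τ, u τ = sn τ * (u τ / sn τ) := fun τ => by field_simp [(sn_pos τ).ne']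
  set g := fun τ => u τ / sn τ with hgdef
  have hrho : Continuous fun τ => sn τ ^ 3 * co τ := by fun_prop
  have hI1 : Integrable fun τ => sn τ ^ 3 * co τ * (g τ * g τ) :=
    hgs.mul hgs hgc hgc hrho 1 sn_cube_co_le
  have hI6 : Integrable fun τ => sn τ ^ 3 * co τ * (w τ * w τ) :=
    hws.mul hws hwc hwc hrho 1 sn_cube_co_le
  -- the coefficients of the integration by parts
  let A : ℝ → ℝ := fun τ => sn τ * dens τ
  have hsplit : ∀ τ, sn τ * sn τ ^ (1 - eta) = sn τ ^ (2 - eta) := fun τ => by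
    rw [show 2 - eta = 1 + (1 - eta) by ring, sn_rpow_add, Real.rpow_one]
  have hAd : ∀ τ, HasDerivAt A ((5 * cs τ - 1) * A τ +
      sn τ * (sn τ ^ (1 - eta) * (1 - (1 + 2 * eta) * cs τ))) τ := by
    intro τ
    refine ((hasDerivAt_sn τ).mul ((hasDerivAt_sn_rpow (1 - eta) τ).add
      (((hasDerivAt_sn τ).mul (hasDerivAt_co τ)).const_mul bigM))).congr_deriv ?_
    simp only [A, dens, Pi.add_apply, Pi.mul_apply]; ring
  let q : ℝ → ℝ := fun τ => 1 - (1 + 2 * eta) * cs τ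
  have hqb : ∀ τ, |q τ| ≤ 4 := fun τ => by
    have := abs_le.1 (abs_cs_le_one τ)
    simp only [q, eta]
    rw [abs_le]; constructor <;> linarith
  have hbd : ∀ (a : ℝ → ℝ) (K : ℝ), (∀ τ, |a τ| ≤ K) →
      ∀ τ, |sn τ ^ (1 - eta) * a τ| ≤ K * sn τ ^ (1 - eta) := fun a K ha τ => by
    rw [abs_mul, abs_of_pos (sn_rpow_pos _ τ), mul_comm]
    exact mul_le_mul_of_nonneg_right (ha τ) (sn_rpow_pos _ τ).le
  have hsqd : Continuous fun τ => sn τ ^ (1 - eta) * q τ := by fun_prop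
  let β : ℝ → ℝ := fun τ =>
    (1 + 2 * eta) * (2 - eta) * cs τ ^ 2 - (1 - eta) * cs τ - (1 + 2 * eta)
  have hβb : ∀ τ, |β τ| ≤ 10 := fun τ => by
    have := abs_le.1 (abs_cs_le_one τ)
    have h2 : cs τ ^ 2 ≤ 1 := by nlinarith
    simp only [β, eta]
    rw [abs_le]; constructor <;> nlinarith [sq_nonneg (cs τ)]
  have hK1 : Integrable fun τ => sn τ ^ (1 - eta) * q τ * (g τ * g τ) :=
    hgs.mul hgs hgc hgc hsqd 4 (hbd q 4 hqb)
  have hK2 : Integrable fun τ => sn τ ^ (1 - eta) * β τ * (g τ * g τ) :=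
    hgs.mul hgs hgc hgc (by fun_prop) 10 (hbd β 10 hβb)
  have hK3 : Integrable fun τ => sn τ ^ (1 - eta) * (sn τ * q τ) * (w τ * g τ) :=
    hws.mul hgs hwc hgc (by fun_prop) 4 (hbd _ 4 fun τ => by
      rw [abs_mul, abs_of_pos (sn_pos τ)]
      exact (mul_le_of_le_one_left (abs_nonneg _) (sn_le_one τ)).trans (hqb τ))
  have hAb : ∀ τ, |A τ| ≤ (1 + bigM) * sn τ ^ (1 - eta) := fun τ => by
    rw [abs_of_pos (mul_pos (sn_pos τ) (dens_pos τ))]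
    exact (mul_le_of_le_one_left (dens_pos τ).le (sn_le_one τ)).trans (dens_le τ)
  have hAc : Continuous A := by fun_prop
  have hK4 : Integrable fun τ => A τ * (w τ * g τ) := hws.mul hgs hwc hgc hAc _ hAb
  have hK5 : Integrable fun τ => A τ * (y τ * g τ) := hy.mul hgs hyc hgc hAc _ hAb
  have hK6 : Integrable fun τ => sn τ * A τ * (w τ * w τ) :=
    hws.mul hws hwc hwc (by fun_prop) (1 + bigM) fun τ => by
      rw [abs_mul, abs_of_pos (sn_pos τ)]
      exact (mul_le_of_le_one_left (abs_nonneg _) (sn_le_one τ)).trans (hAb τ)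
  have hJ1 := integral_eq_zero_of_hasDerivAt_of_integrable
    (f := fun τ => A τ * (w τ * g τ))
    (f' := fun τ => sn τ * A τ * (w τ * w τ) - A τ * (y τ * g τ) +
      sn τ ^ (1 - eta) * (sn τ * q τ) * (w τ * g τ))
    (fun τ => by
      refine ((hAd τ).mul ((h.dw τ).mul (hg τ))).congr_deriv ?_
      simp only [Pi.mul_apply, q]; ring) (integrable_fun_add (integrable_fun_sub hK6 hK5) hK3) hK4
  have hJ2 := integral_eq_zero_of_hasDerivAt_of_integrable
    (f := fun τ => 1 / 2 * (sn τ ^ (1 - eta) * q τ * (g τ * g τ)))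
    (f' := fun τ => sn τ ^ (1 - eta) * (sn τ * q τ) * (w τ * g τ) -
      sn τ ^ (1 - eta) * β τ * (g τ * g τ))
    (fun τ => by
      refine ((((hasDerivAt_sn_rpow (1 - eta) τ).mul
        (((hasDerivAt_cs τ).const_mul (1 + 2 * eta)).const_sub 1)).mul
        ((hg τ).mul (hg τ))).const_mul (1 / 2)).congr_deriv ?_
      simp only [Pi.mul_apply, q, β, sn_sq]; ring) (integrable_fun_sub hK3 hK2) (hK1.const_mul _)
  rw [integral_add (integrable_fun_sub hK6 hK5) hK3, integral_sub hK6 hK5] at hJ1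
  rw [integral_sub hK3 hK2] at hJ2
  have hyu' : ∫ τ, y τ * u τ * dens τ = ∫ τ, A τ * (y τ * g τ) := by
    congr 1; ext τ; rw [hug τ]; simp only [A]; ring
  have hM0 : (0 : ℝ) ≤ bigM := by norm_num [bigM]
  calc ∫ τ, (4 * (u τ ^ 2 * dens τ) + 1 / 200 * ((sn τ * w τ) ^ 2 * sn τ ^ (1 - eta) +
      g τ ^ 2 * sn τ ^ (1 - eta)))
      ≤ ∫ τ, (sn τ * A τ * (w τ * w τ) + sn τ ^ (1 - eta) * β τ * (g τ * g τ) +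
        bigM * (14 * (sn τ ^ 3 * co τ * (g τ * g τ)) - sn τ ^ 3 * co τ * (w τ * w τ))) := by
        refine integral_mono (integrable_fun_add (hu2.const_mul 4) ((integrable_fun_add hw2 hg2).const_mul _))
          (integrable_fun_add (integrable_fun_add hK6 hK2)
            ((integrable_fun_sub (hI1.const_mul 14) hI6).const_mul _)) fun τ => ?_
        have h1 := mul_le_mul_of_nonneg_right (coercive_pointwise τ) (sq_nonneg (g τ))
        have h2 : 0 ≤ (sn τ * w τ) ^ 2 * sn τ ^ (1 - eta) :=
          mul_nonneg (sq_nonneg _) (sn_rpow_pos _ τ).le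
        have h3 : u τ ^ 2 * dens τ = sn τ ^ 2 * dens τ * g τ ^ 2 := by
          conv_lhs => rw [hug τ]
          ring
        have h4 : sn τ * A τ * (w τ * w τ) = (sn τ * w τ) ^ 2 * sn τ ^ (1 - eta) +
            bigM * (sn τ ^ 3 * co τ * (w τ * w τ)) := by
          simp only [A, dens]; ring
        simp only [h3, h4]
        simp only [β]
        nlinarith
    _ ≤ ∫ τ, y τ * u τ * dens τ := by
        rw [integral_add (integrable_fun_add hK6 hK2)
            ((integrable_fun_sub (hI1.const_mul 14) hI6).const_mul _),
          integral_add hK6 hK2, integral_const_mul, integral_sub (hI1.const_mul 14) hI6,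
          integral_const_mul, hyu']
        have : bigM * (14 * ∫ τ, sn τ ^ 3 * co τ * (g τ * g τ)) ≤
          bigM * ∫ τ, sn τ ^ 3 * co τ * (w τ * w τ) := mul_le_mul_of_nonneg_left hP hM0
        linarith

end AngSys

/-- `∫ sin² 2θ cos θ dθ = 8/15`. -/
lemma integral_sn_cube_co : ∫ τ, sn τ ^ 3 * co τ = 8 / 15 := by
  have hd : ∀ τ, HasDerivAt (fun τ => Real.sin (ang τ)) (sn τ * co τ) τ := fun τ => by
    refine (hasDerivAt_ang τ).sin.congr_deriv ?_
    rw [cos_ang]; ring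
  have hss : ∀ τ, sn τ ^ 2 = 4 * (Real.sin (ang τ) ^ 2 * (1 - Real.sin (ang τ) ^ 2)) := fun τ => by
    rw [← Real.cos_sq', ← sin_two_ang, Real.sin_two_mul]; ring
  have hd2 : ∀ τ, HasDerivAt
      (fun τ => 4 * (Real.sin (ang τ) ^ 3 / 3 - Real.sin (ang τ) ^ 5 / 5)) (sn τ ^ 3 * co τ) τ := by
    intro τ
    refine (((((hd τ).pow 3).div_const 3).sub (((hd τ).pow 5).div_const 5)).const_mul 4).congr_deriv
      ?_
    rw [show sn τ ^ 3 * co τ = sn τ ^ 2 * (sn τ * co τ) by ring, hss]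
    push_cast; ring
  have hb : Tendsto (fun τ => Real.sin (ang τ)) atBot (𝓝 0) := by
    have h1 : Tendsto (fun τ : ℝ => Real.exp (2 * τ)) atBot (𝓝 0) :=
      Real.tendsto_exp_atBot.comp (tendsto_id.const_mul_atBot two_pos)
    have h2 := (Real.continuous_sin.comp Real.continuous_arctan).continuousAt.tendsto.comp h1
    simpa [Function.comp_def, ang] using h2
  have ht : Tendsto (fun τ => Real.sin (ang τ)) atTop (𝓝 1) := by
    have h1 : Tendsto (fun τ : ℝ => Real.exp (2 * τ)) atTop atTop :=
      Real.tendsto_exp_atTop.comp (tendsto_id.const_mul_atTop two_pos)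
    have h2 := (Real.tendsto_arctan_atTop.mono_right nhdsWithin_le_nhds).comp h1
    have h3 := Real.continuous_sin.continuousAt.tendsto.comp h2
    simpa [Function.comp_def, ang] using h3
  have hi : Integrable fun τ => sn τ ^ 3 * co τ := by
    refine (integrable_sn_rpow (a := 3) (by norm_num)).mono'
      (by fun_prop : Continuous _).aestronglyMeasurable (Eventually.of_forall fun τ => ?_)
    rw [Real.norm_of_nonneg (mul_nonneg (pow_pos (sn_pos τ) 3).le (co_pos τ).le)]
    have := sn_pow_eq_rpow 3 τ
    push_cast at this
    rw [← this]
    exact mul_le_of_le_one_right (pow_pos (sn_pos τ) 3).le (co_le_one τ)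
  have := integral_of_hasDerivAt_of_tendsto hd2 hi
    (((((hb.pow 3).div_const 3).sub ((hb.pow 5).div_const 5)).const_mul 4))
    (((((ht.pow 3).div_const 3).sub ((ht.pow 5).div_const 5)).const_mul 4))
  rw [this]; norm_num

/-! ### The weighted spaces in the variables `s = log R` and `τ` -/

/-- The radial weight `R⁻³ + R`, comparable with `(1 + R)⁴ R⁻³`, as a function of `s = log R`. -/
def wt (s : ℝ) : ℝ := Real.exp (-3 * s) + Real.exp s

/-- The full weight of the space with angular exponent `σ`, with respect to `ds dτ`. -/
def wgt (σ : ℝ) (p : ℝ × ℝ) : ℝ := wt p.1 * sn p.2 ^ (1 - σ)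

/-- The square of the weighted norm. -/
def wsq (σ : ℝ) (f : ℝ × ℝ → ℝ) : ℝ≥0∞ := ∫⁻ p, ENNReal.ofReal (f p ^ 2 * wgt σ p)

lemma wt_pos (s : ℝ) : 0 < wt s := by unfold wt; positivity

lemma continuous_wt : Continuous wt := by unfold wt; fun_prop

attribute [fun_prop] continuous_wt

lemma wgt_pos (σ : ℝ) (p : ℝ × ℝ) : 0 < wgt σ p := mul_pos (wt_pos _) (sn_rpow_pos _ _)

lemma continuous_wgt (σ : ℝ) : Continuous (wgt σ) :=
  (continuous_wt.comp continuous_fst).mul ((continuous_sn_rpow (1 - σ)).comp continuous_snd)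

attribute [fun_prop] continuous_wgt

lemma wt_comparable {s x : ℝ} (hx : |x| ≤ 1) : wt s ≤ Real.exp 3 * wt (s - x) := by
  have := abs_le.1 hx
  unfold wt
  rw [mul_add, ← Real.exp_add, ← Real.exp_add]
  exact add_le_add (Real.exp_le_exp.2 (by linarith)) (Real.exp_le_exp.2 (by linarith))

lemma sn_rpow_comparable {σ τ x : ℝ} (h0 : 0 ≤ σ) (h2 : σ ≤ 2) (hx : |x| ≤ 1) :
    sn τ ^ (1 - σ) ≤ Real.exp 2 * sn (τ - x) ^ (1 - σ) := by
  have h1 : sn τ ≤ Real.exp 2 * sn (τ - x) := (sn_comparable τ x).trans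
    (mul_le_mul_of_nonneg_right (Real.exp_le_exp.2 (by linarith)) (sn_pos _).le)
  have h1' : sn (τ - x) ≤ Real.exp 2 * sn τ := by
    have := sn_comparable (τ - x) (-x)
    rw [abs_neg, sub_neg_eq_add, sub_add_cancel] at this
    exact this.trans (mul_le_mul_of_nonneg_right (Real.exp_le_exp.2 (by linarith)) (sn_pos _).le)
  have hE : (1 : ℝ) ≤ Real.exp 2 := Real.one_le_exp (by norm_num)
  rcases le_total σ 1 with h | h
  · calc sn τ ^ (1 - σ) ≤ (Real.exp 2 * sn (τ - x)) ^ (1 - σ) :=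
          Real.rpow_le_rpow (sn_pos _).le h1 (by linarith)
      _ = Real.exp 2 ^ (1 - σ) * sn (τ - x) ^ (1 - σ) :=
          Real.mul_rpow (Real.exp_pos _).le (sn_pos _).le
      _ ≤ _ := by
          refine mul_le_mul_of_nonneg_right ?_ (sn_rpow_pos _ _).le
          calc Real.exp 2 ^ (1 - σ) ≤ Real.exp 2 ^ (1 : ℝ) :=
                Real.rpow_le_rpow_of_exponent_le hE (by linarith)
            _ = _ := Real.rpow_one _
  · have h3 : (Real.exp 2 * sn τ) ^ (1 - σ) ≤ sn (τ - x) ^ (1 - σ) :=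
      Real.rpow_le_rpow_of_nonpos (sn_pos _) h1' (by linarith)
    rw [Real.mul_rpow (Real.exp_pos _).le (sn_pos _).le] at h3
    have h4 : 1 ≤ Real.exp 2 * Real.exp 2 ^ (1 - σ) := by
      calc (1 : ℝ) = Real.exp 2 ^ (1 + (-1) : ℝ) := by norm_num
        _ ≤ Real.exp 2 ^ (1 + (1 - σ)) := Real.rpow_le_rpow_of_exponent_le hE (by linarith)
        _ = _ := by rw [Real.rpow_add (Real.exp_pos _), Real.rpow_one]
    calc sn τ ^ (1 - σ) ≤ (Real.exp 2 * Real.exp 2 ^ (1 - σ)) * sn τ ^ (1 - σ) :=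
          le_mul_of_one_le_left (sn_rpow_pos _ _).le h4
      _ = Real.exp 2 * (Real.exp 2 ^ (1 - σ) * sn τ ^ (1 - σ)) := by ring
      _ ≤ _ := mul_le_mul_of_nonneg_left h3 (Real.exp_pos _).le

/-- The weights change by a bounded factor under translations by vectors of size one. -/
lemma wgt_comparable {σ : ℝ} (h0 : 0 ≤ σ) (h2 : σ ≤ 2) {p q : ℝ × ℝ} (h : |q.1| ≤ 1)
    (h' : |q.2| ≤ 1) : wgt σ p ≤ Real.exp 5 * wgt σ (p - q) := by
  have := mul_le_mul (wt_comparable (s := p.1) h) (sn_rpow_comparable (τ := p.2) h0 h2 h')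
    (sn_rpow_pos _ _).le (mul_pos (Real.exp_pos _) (wt_pos _)).le
  refine this.trans_eq ?_
  rw [show (5 : ℝ) = 3 + 2 by norm_num, Real.exp_add]
  simp only [wgt, Prod.fst_sub, Prod.snd_sub]; ring

lemma sq_lintegral_le {X : Type*} [MeasurableSpace X] (m : Measure X)
    {φ : X → ℝ≥0∞} (hφ : AEMeasurable φ m) :
    (∫⁻ x, φ x ∂m) ^ 2 ≤ m univ * ∫⁻ x, φ x ^ 2 ∂m := by
  have h := ENNReal.lintegral_mul_le_Lp_mul_Lq m (p := 2) (q := 2)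
    (by rw [Real.holderConjugate_iff]; norm_num) hφ (aemeasurable_const (b := (1 : ℝ≥0∞)))
  simp only [Pi.mul_apply, mul_one, ENNReal.one_rpow, lintegral_const, one_mul] at h
  calc (∫⁻ x, φ x ∂m) ^ 2 ≤ ((∫⁻ x, φ x ^ (2 : ℝ) ∂m) ^ (1 / 2 : ℝ) *
        (m univ) ^ (1 / 2 : ℝ)) ^ 2 := pow_le_pow_left' h 2
    _ = _ := by
        rw [mul_pow, ← ENNReal.rpow_natCast, ← ENNReal.rpow_natCast, ← ENNReal.rpow_mul,
          ← ENNReal.rpow_mul]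
        norm_num [mul_comm]

/-- Young's inequality for convolution with a finite measure near the origin. -/
lemma lintegral_sq_conv_le (m : Measure (ℝ × ℝ)) [IsFiniteMeasure m]
    (hm : ∀ᵐ q ∂m, |q.1| ≤ 1 ∧ |q.2| ≤ 1) {φ : ℝ × ℝ → ℝ≥0∞} (hφ : Measurable φ) {σ : ℝ}
    (h0 : 0 ≤ σ) (h2 : σ ≤ 2) :
    ∫⁻ p, (∫⁻ q, φ (p - q) ∂m) ^ 2 * ENNReal.ofReal (wgt σ p) ≤
      m univ ^ 2 * ENNReal.ofReal (Real.exp 5) * ∫⁻ p, φ p ^ 2 * ENNReal.ofReal (wgt σ p) := by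
  have hW : Measurable fun p => ENNReal.ofReal (wgt σ p) :=
    (continuous_wgt σ).measurable.ennreal_ofReal
  have hG : Measurable fun p => φ p ^ 2 * ENNReal.ofReal (wgt σ p) := (hφ.pow_const 2).mul hW
  calc ∫⁻ p, (∫⁻ q, φ (p - q) ∂m) ^ 2 * ENNReal.ofReal (wgt σ p)
      ≤ ∫⁻ p, ∫⁻ q, m univ * ENNReal.ofReal (Real.exp 5) *
          (φ (p - q) ^ 2 * ENNReal.ofReal (wgt σ (p - q))) ∂m := by
        refine lintegral_mono fun p => ?_
        have hφp : Measurable fun q => φ (p - q) := hφ.comp (measurable_const.sub measurable_id)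
        calc _ ≤ (m univ * ∫⁻ q, φ (p - q) ^ 2 ∂m) * ENNReal.ofReal (wgt σ p) := by
              gcongr; exact sq_lintegral_le m hφp.aemeasurable
          _ = ∫⁻ q, m univ * (φ (p - q) ^ 2 * ENNReal.ofReal (wgt σ p)) ∂m := by
              rw [lintegral_const_mul _ ((hφp.pow_const 2).mul_const _),
                lintegral_mul_const _ (hφp.pow_const 2)]; ring
          _ ≤ _ := by
              refine lintegral_mono_ae (hm.mono fun q hq => ?_)
              have := ENNReal.ofReal_le_ofReal (wgt_comparable (p := p) h0 h2 hq.1 hq.2)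
              rw [ENNReal.ofReal_mul (Real.exp_pos 5).le] at this
              calc _ ≤ m univ * (φ (p - q) ^ 2 * (ENNReal.ofReal (Real.exp 5) *
                    ENNReal.ofReal (wgt σ (p - q)))) := by gcongr
                _ = _ := by ring
    _ = ∫⁻ q, (∫⁻ p, m univ * ENNReal.ofReal (Real.exp 5) *
          (φ (p - q) ^ 2 * ENNReal.ofReal (wgt σ (p - q)))) ∂m := by
        have hGm : Measurable (Function.uncurry fun p q : ℝ × ℝ =>
            m univ * ENNReal.ofReal (Real.exp 5) *
              (φ (p - q) ^ 2 * ENNReal.ofReal (wgt σ (p - q)))) :=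
          (hG.comp (measurable_fst.sub measurable_snd)).const_mul _
        exact lintegral_lintegral_swap (μ := volume) (ν := m) hGm.aemeasurable
    _ = _ := by
        have : ∀ q : ℝ × ℝ, ∫⁻ p, m univ * ENNReal.ofReal (Real.exp 5) *
            (φ (p - q) ^ 2 * ENNReal.ofReal (wgt σ (p - q))) =
            m univ * ENNReal.ofReal (Real.exp 5) * ∫⁻ p, φ p ^ 2 * ENNReal.ofReal (wgt σ p) := by
          intro q
          have hGq : Measurable fun p => φ (p - q) ^ 2 * ENNReal.ofReal (wgt σ (p - q)) :=
            hG.comp (measurable_id.sub_const q)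
          rw [lintegral_const_mul _ hGq,
            lintegral_sub_right_eq_self (fun p => φ p ^ 2 * ENNReal.ofReal (wgt σ p)) q]
        simp only [this, lintegral_const]; ring

lemma ofReal_sq_mul {x c : ℝ} : ENNReal.ofReal (x ^ 2 * c) = ‖x‖ₑ ^ 2 * ENNReal.ofReal c := by
  rw [ENNReal.ofReal_mul (sq_nonneg x), ← sq_abs, ENNReal.ofReal_pow (abs_nonneg x),
    Real.enorm_eq_ofReal_abs]

lemma wsq_eq (σ : ℝ) (f : ℝ × ℝ → ℝ) :
    wsq σ f = ∫⁻ p, ‖f p‖ₑ ^ 2 * ENNReal.ofReal (wgt σ p) := by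
  simp only [wsq, ofReal_sq_mul]

lemma wsq_mono {σ : ℝ} {f g : ℝ × ℝ → ℝ} (h : ∀ᵐ p, |f p| ≤ |g p|) : wsq σ f ≤ wsq σ g :=
  lintegral_mono_ae (h.mono fun p hp => ENNReal.ofReal_le_ofReal
    (mul_le_mul_of_nonneg_right (sq_le_sq.2 hp) (wgt_pos σ p).le))

lemma wsq_const_mul (σ c : ℝ) (f : ℝ × ℝ → ℝ) :
    wsq σ (fun p => c * f p) = ENNReal.ofReal (c ^ 2) * wsq σ f := by
  unfold wsq
  rw [← lintegral_const_mul' _ _ ENNReal.ofReal_ne_top]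
  refine lintegral_congr fun p => ?_
  rw [← ENNReal.ofReal_mul (sq_nonneg c)]; ring_nf

lemma wsq_add_le {σ : ℝ} {f g : ℝ × ℝ → ℝ} (hf : Measurable f) :
    wsq σ (fun p => f p + g p) ≤ 2 * wsq σ f + 2 * wsq σ g := by
  have hm : Measurable fun p => ENNReal.ofReal (f p ^ 2 * wgt σ p) :=
    ((hf.pow_const 2).mul (continuous_wgt σ).measurable).ennreal_ofReal
  unfold wsq
  rw [← lintegral_const_mul _ hm, ← lintegral_const_mul' _ _ (by simp),
    ← lintegral_add_left (hm.const_mul 2)]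
  refine lintegral_mono fun p => ?_
  have hw := (wgt_pos σ p).le
  rw [show (2 : ℝ≥0∞) = ENNReal.ofReal 2 by simp, ← ENNReal.ofReal_mul (by norm_num),
    ← ENNReal.ofReal_mul (by norm_num), ← ENNReal.ofReal_add (by positivity) (by positivity)]
  refine ENNReal.ofReal_le_ofReal ?_
  nlinarith [sq_nonneg (f p - g p), mul_nonneg (sq_nonneg (f p - g p)) hw]

/-! ### Convolution in the radial variable -/

/-- A smooth kernel on the line, supported in `[-1, 1]`. It need not be normalized or positive, so that
the derivatives of kernels are kernels. -/
structure IsKernel (κ : ℝ → ℝ) : Prop where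
  smooth : ContDiff ℝ ∞ κ
  supp : ∀ x, 1 < |x| → κ x = 0

namespace IsKernel

variable {κ : ℝ → ℝ}

lemma tsupport_subset (h : IsKernel κ) : tsupport κ ⊆ Icc (-1) 1 := by
  refine closure_minimal (fun x hx => ?_) isClosed_Icc
  by_contra hx'
  refine hx (h.supp x ?_)
  by_contra h1
  exact hx' (abs_le.1 (not_lt.1 h1))

lemma hasCompactSupport (h : IsKernel κ) : HasCompactSupport κ :=
  isCompact_Icc.of_isClosed_subset (isClosed_tsupport κ) h.tsupport_subset

lemma continuous (h : IsKernel κ) : Continuous κ := h.smooth.continuous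

lemma deriv (h : IsKernel κ) : IsKernel (deriv κ) where
  smooth := (contDiff_infty_iff_deriv.1 h.smooth).2
  supp x hx := by
    by_contra h1
    have h2 := h.tsupport_subset (support_deriv_subset h1)
    exact absurd (abs_le.2 h2) (not_le.2 hx)

lemma hasDerivAt (h : IsKernel κ) (x : ℝ) : HasDerivAt κ (_root_.deriv κ x) x :=
  ((contDiff_infty_iff_deriv.1 h.smooth).1 x).hasDerivAt

lemma iteratedDeriv (h : IsKernel κ) (j : ℕ) : IsKernel (iteratedDeriv j κ) := by
  induction j with
  | zero => simpa using h
  | succ j ih => rw [iteratedDeriv_succ]; exact ih.deriv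

lemma integrable_mul (h : IsKernel κ) {f : ℝ → ℝ} (hf : Continuous f) :
    Integrable fun x => κ x * f x :=
  (h.continuous.mul hf).integrable_of_hasCompactSupport h.hasCompactSupport.mul_right

lemma integrable (h : IsKernel κ) : Integrable κ :=
  h.continuous.integrable_of_hasCompactSupport h.hasCompactSupport

end IsKernel

/-- The convolution of `f` with `κ` in the variable `s`. -/
def sconv (κ : ℝ → ℝ) (f : ℝ × ℝ → ℝ) (p : ℝ × ℝ) : ℝ := ∫ x, κ x * f (p.1 - x, p.2)

section sconv

variable {κ : ℝ → ℝ} {f g : ℝ × ℝ → ℝ}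

lemma continuous_sconv (h : IsKernel κ) (hf : Continuous f) : Continuous (sconv κ f) := by
  have h1 : Continuous (Function.uncurry fun (p : ℝ × ℝ) (x : ℝ) => κ x * f (p.1 - x, p.2)) := by
    have := h.continuous
    simp only [Function.uncurry_def]; fun_prop
  have := continuous_parametric_integral_of_continuous (μ := volume) h1 (isCompact_Icc (a := -1) (b := 1))
  refine this.congr fun p => ?_
  refine setIntegral_eq_integral_of_forall_compl_eq_zero fun x hx => ?_
  rw [h.supp x, zero_mul]
  by_contra h2
  exact hx (abs_le.1 (not_lt.1 h2))

lemma integrable_sconv (h : IsKernel κ) (hf : Continuous f) (p : ℝ × ℝ) :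
    Integrable fun x => κ x * f (p.1 - x, p.2) :=
  h.integrable_mul (f := fun x => f (p.1 - x, p.2)) (by fun_prop)

lemma sconv_add (h : IsKernel κ) (hf : Continuous f) (hg : Continuous g) (p : ℝ × ℝ) :
    sconv κ (fun p => f p + g p) p = sconv κ f p + sconv κ g p := by
  unfold sconv
  rw [← integral_add (integrable_sconv h hf p) (integrable_sconv h hg p)]
  congr 1; ext x; ring

lemma sconv_sub (h : IsKernel κ) (hf : Continuous f) (hg : Continuous g) (p : ℝ × ℝ) :
    sconv κ (fun p => f p - g p) p = sconv κ f p - sconv κ g p := by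
  unfold sconv
  rw [← integral_sub (integrable_sconv h hf p) (integrable_sconv h hg p)]
  congr 1; ext x; ring

/-- Functions of the angle come out of the convolution. -/
lemma sconv_mul (a : ℝ → ℝ) (f : ℝ × ℝ → ℝ) (p : ℝ × ℝ) :
    sconv κ (fun p => a p.2 * f p) p = a p.2 * sconv κ f p := by
  unfold sconv
  rw [← integral_const_mul]
  congr 1; ext x; ring

lemma hasDerivAt_sconv (h : IsKernel κ) (hf : Continuous f) (s τ : ℝ) :
    HasDerivAt (fun x => sconv κ f (x, τ)) (sconv (deriv κ) f (s, τ)) s := by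
  have hl : LocallyIntegrable (fun x => f (x, τ)) volume :=
    (by fun_prop : Continuous fun x => f (x, τ)).locallyIntegrable
  exact h.hasCompactSupport.hasDerivAt_convolution_left (ContinuousLinearMap.mul ℝ ℝ)
    (h.smooth.of_le (by exact_mod_cast le_top)) hl s

lemma sconv_deriv_eq (h : IsKernel κ) (hf : Continuous f) (hg : Continuous g)
    (hd : ∀ s τ, HasDerivAt (fun x => f (x, τ)) (g (s, τ)) s) (p : ℝ × ℝ) :
    sconv (deriv κ) f p = sconv κ g p := by
  have h1 : ∀ x, HasDerivAt (fun x => f (p.1 - x, p.2)) (-g (p.1 - x, p.2)) x := fun x => by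
    have := (hd (p.1 - x) p.2).comp x ((hasDerivAt_id x).const_sub p.1)
    simpa [Function.comp_def] using this
  have := integral_mul_deriv_eq_deriv_mul_of_integrable (u := κ) (v := fun x => f (p.1 - x, p.2))
    (u' := deriv κ) (v' := fun x => -g (p.1 - x, p.2)) (fun x _ => h.hasDerivAt x) (fun x _ => h1 x)
    (h.integrable_mul (f := fun x => -g (p.1 - x, p.2)) (by fun_prop))
    (integrable_sconv h.deriv hf p) (integrable_sconv h hf p)
  simp only [mul_neg, integral_neg, neg_inj] at this
  exact this.symm

lemma hasDerivAt_sconv_snd (h : IsKernel κ) (hf : Continuous f) (hg : Continuous g)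
    (hd : ∀ s τ, HasDerivAt (fun x => f (s, x)) (g (s, τ)) τ) (s τ : ℝ) :
    HasDerivAt (fun x => sconv κ f (s, x)) (sconv κ g (s, τ)) τ := by
  have hK : IsCompact ((Icc (s - 1) (s + 1)) ×ˢ (Icc (τ - 1) (τ + 1)) : Set (ℝ × ℝ)) :=
    isCompact_Icc.prod isCompact_Icc
  obtain ⟨B, hB⟩ := hK.exists_bound_of_continuousOn hg.continuousOn
  have hκ := h.continuous
  refine (hasDerivAt_integral_of_dominated_loc_of_deriv_le (s := Icc (τ - 1) (τ + 1))
    (F := fun t x => κ x * f (s - x, t)) (F' := fun t x => κ x * g (s - x, t))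
    (bound := fun x => |κ x| * B) (Icc_mem_nhds (by linarith) (by linarith))
    (Eventually.of_forall fun t => (integrable_sconv h hf (s, t)).1) (integrable_sconv h hf (s, τ))
    (integrable_sconv h hg (s, τ)).1 (Eventually.of_forall fun x t ht => ?_)
    (h.integrable.abs.mul_const B)
    (Eventually.of_forall fun x t _ => (hd (s - x) t).const_mul (κ x))).2
  rw [norm_mul, Real.norm_eq_abs]
  by_cases hx : 1 < |x|
  · simp [h.supp x hx]
  · have := abs_le.1 (not_lt.1 hx)
    exact mul_le_mul_of_nonneg_left (hB (s - x, t) ⟨⟨by simp; linarith, by simp; linarith⟩, ht⟩)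
      (abs_nonneg _)

lemma abs_sconv_le (h : IsKernel κ) {B : ℝ} (hB : ∀ p, |f p| ≤ B) (p : ℝ × ℝ) :
    |sconv κ f p| ≤ (∫ x, |κ x|) * B := by
  rw [← integral_mul_const, ← Real.norm_eq_abs]
  refine norm_integral_le_of_norm_le (h.integrable.abs.mul_const B)
    (Eventually.of_forall fun x => ?_)
  rw [norm_mul, Real.norm_eq_abs, Real.norm_eq_abs]
  exact mul_le_mul_of_nonneg_left (hB _) (abs_nonneg _)

lemma tendsto_sconv_snd (h : IsKernel κ) (hf : Continuous f) {B : ℝ} (hB : ∀ p, |f p| ≤ B)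
    {l : Filter ℝ} [l.IsCountablyGenerated] (hl : ∀ s, Tendsto (fun τ => f (s, τ)) l (𝓝 0)) (s : ℝ) :
    Tendsto (fun τ => sconv κ f (s, τ)) l (𝓝 0) := by
  have := tendsto_integral_filter_of_dominated_convergence (μ := volume) (l := l)
    (F := fun τ x => κ x * f (s - x, τ)) (f := fun x => κ x * 0) (fun x => |κ x| * B)
    (Eventually.of_forall fun t => (integrable_sconv h hf (s, t)).1)
    (Eventually.of_forall fun τ => Eventually.of_forall fun x => by
      rw [norm_mul, Real.norm_eq_abs, Real.norm_eq_abs]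
      exact mul_le_mul_of_nonneg_left (hB _) (abs_nonneg _))
    (h.integrable.abs.mul_const B) (Eventually.of_forall fun x => (hl (s - x)).const_mul _)
  simpa [sconv] using this

lemma abs_sconv_le_of_ge (h : IsKernel κ) {ε S : ℝ}
    (hε : ∀ s, S ≤ s → ∀ τ, |f (s, τ)| ≤ ε) {s : ℝ} (hs : S + 1 ≤ s) (τ : ℝ) :
    |sconv κ f (s, τ)| ≤ (∫ x, |κ x|) * ε := by
  rw [← integral_mul_const, ← Real.norm_eq_abs]
  refine norm_integral_le_of_norm_le (h.integrable.abs.mul_const ε)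
    (Eventually.of_forall fun x => ?_)
  rw [norm_mul, Real.norm_eq_abs, Real.norm_eq_abs]
  by_cases hx : 1 < |x|
  · simp [h.supp x hx]
  · have := abs_le.1 (not_lt.1 hx)
    exact mul_le_mul_of_nonneg_left (hε _ (by simp; linarith) _) (abs_nonneg _)

lemma wsq_sconv_le (h : IsKernel κ) (hf : Measurable f) {σ : ℝ} (h0 : 0 ≤ σ) (h2 : σ ≤ 2) :
    wsq σ (sconv κ f) ≤
      ENNReal.ofReal (∫ x, |κ x|) ^ 2 * ENNReal.ofReal (Real.exp 5) * wsq σ f := by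
  -- convolution in `s` is convolution with a measure carried by the line `τ = 0`
  let ν : Measure ℝ := volume.withDensity fun x => ‖κ x‖ₑ
  have hκm : Measurable fun x => ‖κ x‖ₑ := h.continuous.measurable.enorm
  have hν : ν univ = ENNReal.ofReal (∫ x, |κ x|) := by
    rw [withDensity_apply _ MeasurableSet.univ, Measure.restrict_univ,
      ofReal_integral_eq_lintegral_ofReal h.integrable.abs (Eventually.of_forall fun _ => abs_nonneg _)]
    simp only [Real.enorm_eq_ofReal_abs]
  have : IsFiniteMeasure ν := ⟨by rw [hν]; exact ENNReal.ofReal_lt_top⟩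
  have hι : Measurable fun x : ℝ => (x, (0 : ℝ)) := by fun_prop
  let m : Measure (ℝ × ℝ) := ν.map fun x => (x, 0)
  have hm : ∀ᵐ q ∂m, |q.1| ≤ 1 ∧ |q.2| ≤ 1 := by
    have hS : MeasurableSet {q : ℝ × ℝ | |q.1| ≤ 1 ∧ |q.2| ≤ 1} := by
      refine MeasurableSet.inter ?_ ?_
      · exact measurableSet_le (f := fun q : ℝ × ℝ => |q.1|) (by fun_prop) measurable_const
      · exact measurableSet_le (f := fun q : ℝ × ℝ => |q.2|) (by fun_prop) measurable_const
    rw [ae_map_iff hι.aemeasurable hS, ae_withDensity_iff hκm]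
    refine Eventually.of_forall fun x hx => ⟨?_, by simp⟩
    by_contra h1
    exact hx (by simp [h.supp x (not_le.1 h1)])
  have hmu : m univ = ENNReal.ofReal (∫ x, |κ x|) := by
    rw [Measure.map_apply hι MeasurableSet.univ, preimage_univ, hν]
  have key := lintegral_sq_conv_le m hm (φ := fun p => ‖f p‖ₑ) hf.enorm h0 h2
  rw [hmu, ← wsq_eq] at key
  refine le_trans ?_ key
  rw [wsq_eq]
  refine lintegral_mono fun p => ?_
  gcongr
  have hfp : Measurable fun q : ℝ × ℝ => ‖f (p - q)‖ₑ :=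
    hf.enorm.comp (measurable_const.sub measurable_id)
  have hfp' : Measurable fun x : ℝ => ‖f (p - (x, 0))‖ₑ := hfp.comp hι
  rw [lintegral_map hfp hι, lintegral_withDensity_eq_lintegral_mul _ hκm hfp']
  refine (enorm_integral_le_lintegral_enorm _).trans (lintegral_mono fun x => ?_)
  simp only [Pi.mul_apply, enorm_mul]
  have : p - (x, (0 : ℝ)) = (p.1 - x, p.2) := by ext <;> simp
  rw [this]

end sconv

/-! ### The radial energy estimate -/

/-- A truncated radial weight together with its first two derivatives: it is integrable, dominated by
`wt`, and its logarithmic derivatives are bounded. -/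
structure RadWeight (om om' om'' : ℝ → ℝ) : Prop where
  d1 : ∀ s, HasDerivAt om (om' s) s
  d2 : ∀ s, HasDerivAt om' (om'' s) s
  cont : Continuous om''
  pos : ∀ s, 0 < om s
  b1 : ∀ s, |om' s| ≤ 3 * om s
  b2 : ∀ s, |om'' s| ≤ 27 * om s
  int : Integrable om
  le : ∀ s, om s ≤ wt s

/-- Integration by parts in `s` without boundary terms. -/
lemma integral_eq_zero_of_hasDerivAt_fst {J J' : ℝ × ℝ → ℝ}
    (h : ∀ s τ, HasDerivAt (fun x => J (x, τ)) (J' (s, τ)) s) (hJ' : Integrable J')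
    (hJ : Integrable J) : ∫ p, J' p = 0 := by
  rw [Measure.volume_eq_prod] at *
  rw [integral_prod_symm _ hJ']
  have h1 := hJ'.prod_left_ae
  have h2 := hJ.prod_left_ae
  refine integral_eq_zero_of_ae ?_
  filter_upwards [h1, h2] with τ h1 h2
  exact integral_eq_zero_of_hasDerivAt_of_integrable (fun s => h s τ) h1 h2

/-- An inequality between integrals over almost every slice, integrated against a radial weight. The
integrability of `e` is part of the conclusion. -/
lemma integral_le_of_slices {om : ℝ → ℝ} (hom : Continuous om) (hpos : ∀ s, 0 < om s)
    {e G : ℝ × ℝ → ℝ} (he : Continuous e) (he0 : ∀ p, 0 ≤ e p)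
    (hG : Integrable fun p : ℝ × ℝ => om p.1 * G p)
    (h : ∀ᵐ s, Integrable (fun τ => e (s, τ)) ∧ ∫ τ, e (s, τ) ≤ ∫ τ, G (s, τ)) :
    Integrable (fun p : ℝ × ℝ => om p.1 * e p) ∧
      ∫ p : ℝ × ℝ, om p.1 * e p ≤ ∫ p : ℝ × ℝ, om p.1 * G p := by
  have hm : AEStronglyMeasurable (fun p : ℝ × ℝ => om p.1 * e p) (volume.prod volume) :=
    (by fun_prop : Continuous fun p : ℝ × ℝ => om p.1 * e p).aestronglyMeasurable
  rw [Measure.volume_eq_prod] at *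
  have hle : ∀ᵐ s, ∫ τ, om s * e (s, τ) ≤ ∫ τ, om s * G (s, τ) := by
    filter_upwards [h] with s hs
    rw [integral_const_mul, integral_const_mul]
    exact mul_le_mul_of_nonneg_left hs.2 (hpos s).le
  have hn : ∀ s τ, ‖om s * e (s, τ)‖ = om s * e (s, τ) := fun s τ =>
    Real.norm_of_nonneg (mul_nonneg (hpos s).le (he0 _))
  have hi : Integrable (fun p : ℝ × ℝ => om p.1 * e p) (volume.prod volume) := by
    refine (integrable_prod_iff hm).2 ⟨?_, ?_⟩
    · filter_upwards [h] with s hs using hs.1.const_mul _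
    · refine hG.integral_prod_left.mono' hm.norm.integral_prod_right' ?_
      filter_upwards [hle] with s hs
      simp only [hn]
      rwa [Real.norm_of_nonneg (integral_nonneg fun τ => mul_nonneg (hpos s).le (he0 _))]
  refine ⟨hi, ?_⟩
  rw [integral_prod _ hi, integral_prod _ hG]
  exact integral_mono_ae hi.integral_prod_left hG.integral_prod_left hle

namespace RadWeight

variable {om om' om'' : ℝ → ℝ}

lemma continuous (h : RadWeight om om' om'') : Continuous om :=
  continuous_iff_continuousAt.2 fun s => (h.d1 s).continuousAt

lemma continuous' (h : RadWeight om om' om'') : Continuous om' :=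
  continuous_iff_continuousAt.2 fun s => (h.d2 s).continuousAt

lemma integrable_sq_of_bounded (h : RadWeight om om' om'') {f : ℝ × ℝ → ℝ} (hf : Continuous f) {B : ℝ}
    (hB : ∀ p, |f p| ≤ B) : Integrable fun p : ℝ × ℝ => om p.1 * dens p.2 * f p ^ 2 := by
  have h1 : Integrable (fun p : ℝ × ℝ => om p.1 * dens p.2) := by
    rw [Measure.volume_eq_prod]; exact h.int.mul_prod integrable_dens
  have hom := h.continuous
  refine (h1.mul_const (B ^ 2)).mono' (by fun_prop : Continuous _).aestronglyMeasurable
    (Eventually.of_forall fun p => ?_)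
  have hp : 0 ≤ om p.1 * dens p.2 := (mul_pos (h.pos _) (dens_pos _)).le
  rw [Real.norm_of_nonneg (mul_nonneg hp (sq_nonneg _))]
  refine mul_le_mul_of_nonneg_left ?_ hp
  exact sq_le_sq' (by linarith [(abs_le.1 (hB p)).1]) (abs_le.1 (hB p)).2

lemma integrable_mul (_ : RadWeight om om' om'') {a f g : ℝ × ℝ → ℝ} (ha : Continuous a)
    (hf : Continuous f) (hg : Continuous g)
    (hfi : Integrable fun p : ℝ × ℝ => om p.1 * dens p.2 * f p ^ 2)
    (hgi : Integrable fun p : ℝ × ℝ => om p.1 * dens p.2 * g p ^ 2) (C : ℝ)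
    (hC : ∀ p, |a p| ≤ C * (om p.1 * dens p.2)) : Integrable fun p => a p * (f p * g p) := by
  refine ((integrable_fun_add hfi hgi).const_mul C).mono'
    (by fun_prop : Continuous _).aestronglyMeasurable (Eventually.of_forall fun p => ?_)
  have h1 : |f p * g p| ≤ f p ^ 2 + g p ^ 2 := by
    rw [abs_le]; constructor <;> nlinarith [sq_nonneg (f p + g p), sq_nonneg (f p - g p)]
  rw [norm_mul, Real.norm_eq_abs, Real.norm_eq_abs]
  calc |a p| * |f p * g p| ≤ (C * (om p.1 * dens p.2)) * (f p ^ 2 + g p ^ 2) :=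
        mul_le_mul (hC p) h1 (abs_nonneg _) ((abs_nonneg _).trans (hC p))
    _ = _ := by ring

/-- The quadratic inequality behind the second energy estimate; `3/4` is the bound for `3α`. -/
lemma energy_quadratic (H a b : ℝ) :
    3 / 4 * (|H| + |a| + 5 * |b|) * |b| - (H + a + 5 * b) * a ≤
      4 * H ^ 2 + 71 * b ^ 2 - 3 / 4 * a ^ 2 := by
  have m1 : -(H * a) ≤ |H| * |a| := by rw [← abs_mul]; exact neg_le_abs _
  have m2 : -(b * a) ≤ |b| * |a| := by rw [← abs_mul]; exact neg_le_abs _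
  rw [← sq_abs H, ← sq_abs b, ← sq_abs a]
  have m3 : a * a = |a| ^ 2 := by rw [sq_abs]; ring
  have k1 := sq_nonneg (|a| / 2 - |H| - 23 / 4 * |b|)
  have k2 := sq_nonneg (|H| - 49 / 24 * |b|)
  have k3 := sq_nonneg |b|
  linarith

set_option maxHeartbeats 1000000 in
/-- The energy estimates for `-α² ∂_s² - 5α ∂_s + A`, where `A` is any operator that is coercive on
almost every slice: `Y = A u`, `Y₁ = A ∂_s u`. The equation is paired with `u` and then with
`-α² ∂_s² u`. -/
theorem energy (hom : RadWeight om om' om'') {α : ℝ} (hα0 : 0 < α) (hα : α ≤ 1 / 4)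
    {u u1 u2 Y Y1 e0 e1 : ℝ × ℝ → ℝ} (hu : Continuous u) (hu1 : Continuous u1) (hu2 : Continuous u2)
    (hY : Continuous Y) (hY1 : Continuous Y1) (he0 : Continuous e0) (he1 : Continuous e1)
    (du : ∀ s τ, HasDerivAt (fun x => u (x, τ)) (u1 (s, τ)) s)
    (du1 : ∀ s τ, HasDerivAt (fun x => u1 (x, τ)) (u2 (s, τ)) s)
    (dY : ∀ s τ, HasDerivAt (fun x => Y (x, τ)) (Y1 (s, τ)) s)
    {B : ℝ} (hB : ∀ p, |u p| ≤ B) (hB1 : ∀ p, |u1 p| ≤ B) (hB2 : ∀ p, |u2 p| ≤ B)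
    (iY : Integrable fun p : ℝ × ℝ => om p.1 * dens p.2 * Y p ^ 2)
    (iY1 : Integrable fun p : ℝ × ℝ => om p.1 * dens p.2 * Y1 p ^ 2)
    (e0n : ∀ p, 0 ≤ e0 p) (e1n : ∀ p, 0 ≤ e1 p)
    (c0 : ∀ᵐ s, Integrable (fun τ => e0 (s, τ)) ∧ ∫ τ, e0 (s, τ) ≤
      ∫ τ, (Y (s, τ) * u (s, τ) - 4 * u (s, τ) ^ 2) * dens τ)
    (c1 : ∀ᵐ s, Integrable (fun τ => e1 (s, τ)) ∧ ∫ τ, e1 (s, τ) ≤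
      ∫ τ, (Y1 (s, τ) * u1 (s, τ) - 4 * u1 (s, τ) ^ 2) * dens τ) :
    let Q := ∫ p : ℝ × ℝ, om p.1 * dens p.2 * (Y p - α ^ 2 * u2 p - 5 * α * u1 p) ^ 2
    (Integrable (fun p : ℝ × ℝ => om p.1 * e0 p) ∧ ∫ p : ℝ × ℝ, om p.1 * e0 p ≤ Q) ∧
    (Integrable (fun p : ℝ × ℝ => om p.1 * e1 p) ∧ α ^ 2 * ∫ p : ℝ × ℝ, om p.1 * e1 p ≤ 60 * Q) ∧
    α ^ 2 * ∫ p : ℝ × ℝ, om p.1 * dens p.2 * u1 p ^ 2 ≤ Q ∧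
    α ^ 4 * ∫ p : ℝ × ℝ, om p.1 * dens p.2 * u2 p ^ 2 ≤ 60 * Q := by
  intro Q
  have omc := hom.continuous
  have omc' := hom.continuous'
  have omc'' := hom.cont
  let W : ℝ × ℝ → ℝ := fun p => om p.1 * dens p.2
  have Wpos : ∀ p, 0 < W p := fun p => mul_pos (hom.pos _) (dens_pos _)
  have Wc : Continuous W := by fun_prop
  let W' : ℝ × ℝ → ℝ := fun p => om' p.1 * dens p.2
  have Wc' : Continuous W' := by fun_prop
  let W'' : ℝ × ℝ → ℝ := fun p => om'' p.1 * dens p.2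
  have Wc'' : Continuous W'' := by fun_prop
  have bW : ∀ p, |W p| ≤ 1 * W p := fun p => by rw [abs_of_pos (Wpos p), one_mul]
  have bW' : ∀ p, |W' p| ≤ 3 * W p := fun p => by
    simp only [W', W]; rw [abs_mul, abs_of_pos (dens_pos _), ← mul_assoc]
    exact mul_le_mul_of_nonneg_right (hom.b1 _) (dens_pos _).le
  have bW'' : ∀ p, |W'' p| ≤ 27 * W p := fun p => by
    simp only [W'', W]; rw [abs_mul, abs_of_pos (dens_pos _), ← mul_assoc]
    exact mul_le_mul_of_nonneg_right (hom.b2 _) (dens_pos _).le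
  have iu := hom.integrable_sq_of_bounded hu hB
  have iu1 := hom.integrable_sq_of_bounded hu1 hB1
  have iu2 := hom.integrable_sq_of_bounded hu2 hB2
  let H : ℝ × ℝ → ℝ := fun p => Y p - α ^ 2 * u2 p - 5 * α * u1 p
  have hH : Continuous H := by fun_prop
  -- all quadratic expressions are integrable
  have iYu : Integrable fun p => W p * (Y p * u p) := hom.integrable_mul Wc hY hu iY iu 1 bW
  have iYu1 : Integrable fun p => W p * (Y p * u1 p) := hom.integrable_mul Wc hY hu1 iY iu1 1 bW
  have iYu1' : Integrable fun p => W' p * (Y p * u1 p) := hom.integrable_mul Wc' hY hu1 iY iu1 3 bW'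
  have iYu2 : Integrable fun p => W p * (Y p * u2 p) := hom.integrable_mul Wc hY hu2 iY iu2 1 bW
  have iY1u1 : Integrable fun p => W p * (Y1 p * u1 p) := hom.integrable_mul Wc hY1 hu1 iY1 iu1 1 bW
  have iuu : Integrable fun p => W p * (u p * u p) := hom.integrable_mul Wc hu hu iu iu 1 bW
  have iuu' : Integrable fun p => W' p * (u p * u p) := hom.integrable_mul Wc' hu hu iu iu 3 bW'
  have iuu'' : Integrable fun p => W'' p * (u p * u p) := hom.integrable_mul Wc'' hu hu iu iu 27 bW''
  have iuu1 : Integrable fun p => W p * (u p * u1 p) := hom.integrable_mul Wc hu hu1 iu iu1 1 bW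
  have iuu2 : Integrable fun p => W p * (u p * u2 p) := hom.integrable_mul Wc hu hu2 iu iu2 1 bW
  have iu1u1 : Integrable fun p => W p * (u1 p * u1 p) := hom.integrable_mul Wc hu1 hu1 iu1 iu1 1 bW
  have iu1u2 : Integrable fun p => W p * (u1 p * u2 p) := hom.integrable_mul Wc hu1 hu2 iu1 iu2 1 bW
  have iu2u2 : Integrable fun p => W p * (u2 p * u2 p) := hom.integrable_mul Wc hu2 hu2 iu2 iu2 1 bW
  have iYY : Integrable fun p => W p * (Y p * Y p) := hom.integrable_mul Wc hY hY iY iY 1 bW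
  have iH : Integrable fun p => W p * H p ^ 2 := by
    have h3 : Integrable fun p => 3 * (W p * (Y p * Y p)) + 3 * α ^ 4 * (W p * (u2 p * u2 p)) +
        75 * α ^ 2 * (W p * (u1 p * u1 p)) :=
      integrable_fun_add (integrable_fun_add (iYY.const_mul _) (iu2u2.const_mul _))
        (iu1u1.const_mul _)
    refine h3.mono' (by fun_prop : Continuous _).aestronglyMeasurable
      (Eventually.of_forall fun p => ?_)
    rw [Real.norm_of_nonneg (mul_nonneg (Wpos p).le (sq_nonneg _))]
    have := mul_le_mul_of_nonneg_left (show H p ^ 2 ≤ 3 * (Y p) ^ 2 + 3 * (α ^ 2 * u2 p) ^ 2 +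
      3 * (5 * α * u1 p) ^ 2 by
        simp only [H]
        nlinarith [sq_nonneg (Y p + α ^ 2 * u2 p), sq_nonneg (Y p + 5 * α * u1 p),
          sq_nonneg (α ^ 2 * u2 p - 5 * α * u1 p)]) (Wpos p).le
    nlinarith
  -- the first estimate
  have s0 := integral_le_of_slices omc hom.pos he0 e0n
    (G := fun p => (Y p * u p - 4 * u p ^ 2) * dens p.2)
    ((integrable_fun_sub iYu (iuu.const_mul 4)).congr (Eventually.of_forall fun p => by
      simp only [W]; ring)) c0
  have s1 := integral_le_of_slices omc hom.pos he1 e1n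
    (G := fun p => (Y1 p * u1 p - 4 * u1 p ^ 2) * dens p.2)
    ((integrable_fun_sub iY1u1 (iu1u1.const_mul 4)).congr (Eventually.of_forall fun p => by
      simp only [W]; ring)) c1
  have hD : ∀ s τ, HasDerivAt (fun x => W (x, τ)) (W' (s, τ)) s := fun s τ =>
    (hom.d1 s).mul_const (dens τ)
  have hD' : ∀ s τ, HasDerivAt (fun x => W' (x, τ)) (W'' (s, τ)) s := fun s τ =>
    (hom.d2 s).mul_const (dens τ)
  have J1 := integral_eq_zero_of_hasDerivAt_fst
    (J := fun p => α ^ 2 * (W p * (u p * u1 p)) - 1 / 2 * α ^ 2 * (W' p * (u p * u p)) +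
      5 / 2 * α * (W p * (u p * u p)))
    (J' := fun p => α ^ 2 * (W p * (u p * u2 p)) + α ^ 2 * (W p * (u1 p * u1 p)) -
      1 / 2 * α ^ 2 * (W'' p * (u p * u p)) + 5 / 2 * α * (W' p * (u p * u p)) +
      5 * α * (W p * (u p * u1 p)))
    (fun s τ => by
      refine (((((hD s τ).mul ((du s τ).mul (du1 s τ))).const_mul (α ^ 2)).sub
        (((hD' s τ).mul ((du s τ).mul (du s τ))).const_mul (1 / 2 * α ^ 2))).add
        (((hD s τ).mul ((du s τ).mul (du s τ))).const_mul (5 / 2 * α))).congr_deriv ?_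
      simp only [Pi.mul_apply]; ring)
    (integrable_fun_add (integrable_fun_add (integrable_fun_sub (integrable_fun_add
      (iuu2.const_mul _) (iu1u1.const_mul _)) (iuu''.const_mul _)) (iuu'.const_mul _))
      (iuu1.const_mul _))
    (integrable_fun_add (integrable_fun_sub (iuu1.const_mul _) (iuu'.const_mul _))
      (iuu.const_mul _))
  have iJ1 : Integrable fun p => α ^ 2 * (W p * (u p * u2 p)) + α ^ 2 * (W p * (u1 p * u1 p)) -
      1 / 2 * α ^ 2 * (W'' p * (u p * u p)) + 5 / 2 * α * (W' p * (u p * u p)) +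
      5 * α * (W p * (u p * u1 p)) :=
    integrable_fun_add (integrable_fun_add (integrable_fun_sub (integrable_fun_add
      (iuu2.const_mul _) (iu1u1.const_mul _)) (iuu''.const_mul _)) (iuu'.const_mul _))
      (iuu1.const_mul _)
  have hQ : Q = ∫ p, W p * H p ^ 2 := rfl
  have E1 : (∫ p : ℝ × ℝ, om p.1 * e0 p) + α ^ 2 * ∫ p, W p * (u1 p * u1 p) ≤ 1 / 2 * Q := by
    have : ∫ p : ℝ × ℝ, om p.1 * ((Y p * u p - 4 * u p ^ 2) * dens p.2) ≤
        ∫ p, (1 / 2 * (W p * H p ^ 2) - α ^ 2 * (W p * (u1 p * u1 p)) +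
          (α ^ 2 * (W p * (u p * u2 p)) + α ^ 2 * (W p * (u1 p * u1 p)) -
      1 / 2 * α ^ 2 * (W'' p * (u p * u p)) + 5 / 2 * α * (W' p * (u p * u p)) +
      5 * α * (W p * (u p * u1 p)))) := by
      refine integral_mono ((integrable_fun_sub iYu (iuu.const_mul 4)).congr
        (Eventually.of_forall fun p => by simp only [W]; ring)) (integrable_fun_add
          (integrable_fun_sub (iH.const_mul _) (iu1u1.const_mul _)) iJ1) fun p => ?_
      have h1 : om p.1 * ((Y p * u p - 4 * u p ^ 2) * dens p.2) =
        W p * (Y p * u p - 4 * u p ^ 2) := by simp only [W]; ring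
      have hYe : Y p = H p + α ^ 2 * u2 p + 5 * α * u1 p := by simp only [H]; ring
      have a1 := abs_le.1 (bW' p)
      have a2 := abs_le.1 (bW'' p)
      have hw := (Wpos p).le
      have uu := mul_self_nonneg (u p)
      have b1 : α ^ 2 * (W'' p * (u p * u p)) ≤ 27 / 16 * (W p * (u p * u p)) := by
        have : W'' p * (u p * u p) ≤ 27 * W p * (u p * u p) := mul_le_mul_of_nonneg_right a2.2 uu
        have h2 : α ^ 2 ≤ 1 / 16 := by nlinarith
        have h3 : 0 ≤ W p * (u p * u p) := mul_nonneg hw uu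
        nlinarith [mul_le_mul_of_nonneg_left this (sq_nonneg α)]
      have b2 : -(α * (W' p * (u p * u p))) ≤ 3 / 4 * (W p * (u p * u p)) := by
        have : -(W' p) * (u p * u p) ≤ 3 * W p * (u p * u p) :=
          mul_le_mul_of_nonneg_right (by linarith [a1.1]) uu
        have h3 : 0 ≤ W p * (u p * u p) := mul_nonneg hw uu
        nlinarith [mul_le_mul_of_nonneg_left this hα0.le]
      have b3 : W p * (H p * u p) ≤ 1 / 2 * (W p * H p ^ 2) + 1 / 2 * (W p * (u p * u p)) := by
        nlinarith [mul_nonneg hw (sq_nonneg (H p - u p))]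
      have h3 : 0 ≤ W p * (u p * u p) := mul_nonneg hw uu
      simp only [h1]
      have h5 : W p * (Y p * u p - 4 * u p ^ 2) = W p * (H p * u p) + α ^ 2 * (W p * (u p * u2 p)) +
        5 * α * (W p * (u p * u1 p)) - 4 * (W p * (u p * u p)) := by rw [hYe]; ring
      rw [h5]
      linarith
    rw [integral_add (integrable_fun_sub (iH.const_mul _) (iu1u1.const_mul _)) iJ1, J1,
      integral_sub (iH.const_mul _) (iu1u1.const_mul _), integral_const_mul, integral_const_mul]
      at this
    have := s0.2.trans this
    linarith
  -- the second estimate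
  have J2 := integral_eq_zero_of_hasDerivAt_fst
    (J := fun p => W p * (Y p * u1 p))
    (J' := fun p => W' p * (Y p * u1 p) + W p * (Y1 p * u1 p) + W p * (Y p * u2 p))
    (fun s τ => by
      refine ((hD s τ).mul ((dY s τ).mul (du1 s τ))).congr_deriv ?_
      simp only [Pi.mul_apply]; ring)
    (integrable_fun_add (integrable_fun_add iYu1' iY1u1) iYu2) iYu1
  have iJ2 : Integrable fun p => W' p * (Y p * u1 p) + W p * (Y1 p * u1 p) + W p * (Y p * u2 p) :=
    integrable_fun_add (integrable_fun_add iYu1' iY1u1) iYu2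
  have E2 : α ^ 2 * (∫ p : ℝ × ℝ, om p.1 * e1 p) + 3 / 4 * α ^ 4 * ∫ p, W p * (u2 p * u2 p) ≤
      4 * Q + 71 * (α ^ 2 * ∫ p, W p * (u1 p * u1 p)) := by
    have : ∫ p : ℝ × ℝ, α ^ 2 * (om p.1 * ((Y1 p * u1 p - 4 * u1 p ^ 2) * dens p.2)) ≤
        ∫ p, (4 * (W p * H p ^ 2) + 71 * α ^ 2 * (W p * (u1 p * u1 p)) -
          3 / 4 * α ^ 4 * (W p * (u2 p * u2 p)) + α ^ 2 *
          (W' p * (Y p * u1 p) + W p * (Y1 p * u1 p) + W p * (Y p * u2 p))) := by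
      refine integral_mono (((integrable_fun_sub iY1u1 (iu1u1.const_mul 4)).congr
        (Eventually.of_forall fun p => by simp only [W]; ring)).const_mul _) (integrable_fun_add
          (integrable_fun_sub (integrable_fun_add (iH.const_mul _) (iu1u1.const_mul _))
            (iu2u2.const_mul _)) (iJ2.const_mul _)) fun p => ?_
      have h1 : om p.1 * ((Y1 p * u1 p - 4 * u1 p ^ 2) * dens p.2) =
        W p * (Y1 p * u1 p) - 4 * (W p * (u1 p * u1 p)) := by simp only [W]; ring
      have hYe : Y p = H p + α ^ 2 * u2 p + 5 * α * u1 p := by simp only [H]; ring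
      have hw := (Wpos p).le
      simp only [h1]
      -- with `a = α² u₂`, `b = α u₁` this is a quadratic inequality in `H, a, b`
      set a := α ^ 2 * u2 p with ha
      set b := α * u1 p with hb
      have hYe' : Y p = H p + a + 5 * b := by rw [hYe, hb]; ring
      have c1 : -(α ^ 2 * (W' p * (Y p * u1 p))) ≤ W p * (3 / 4 * (|H p| + |a| + 5 * |b|) * |b|) := by
        have e : -(α ^ 2 * (W' p * (Y p * u1 p))) = α * (-(W' p) * (Y p * b)) := by rw [hb]; ring
        rw [e]
        have hYb : |Y p * b| ≤ (|H p| + |a| + 5 * |b|) * |b| := by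
          rw [abs_mul]
          refine mul_le_mul_of_nonneg_right ?_ (abs_nonneg _)
          rw [hYe']
          refine (abs_add_le _ _).trans (add_le_add (abs_add_le _ _) ?_)
          rw [abs_mul]; norm_num
        have h2 : -(W' p) * (Y p * b) ≤ 3 * W p * ((|H p| + |a| + 5 * |b|) * |b|) := by
          refine (le_abs_self _).trans ?_
          rw [abs_mul, abs_neg]
          exact mul_le_mul (bW' p) hYb (abs_nonneg _) (by linarith [Wpos p])
        have h3 : 0 ≤ 3 * W p * ((|H p| + |a| + 5 * |b|) * |b|) := by
          have := Wpos p
          positivity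
        have h4 := mul_le_mul_of_nonneg_left h2 hα0.le
        have h5 := mul_le_mul_of_nonneg_right hα h3
        linarith
      have c2 : -(α ^ 2 * (W p * (Y p * u2 p))) = W p * (-(H p + a + 5 * b) * a) := by
        rw [← hYe', ha]; ring
      have c3 : 71 * α ^ 2 * (W p * (u1 p * u1 p)) = W p * (71 * b ^ 2) := by rw [hb]; ring
      have c4 : 3 / 4 * α ^ 4 * (W p * (u2 p * u2 p)) = W p * (3 / 4 * a ^ 2) := by rw [ha]; ring
      have quad := energy_quadratic (H p) a b
      have := mul_le_mul_of_nonneg_left quad hw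
      have h0 : 0 ≤ W p * (u1 p * u1 p) := mul_nonneg hw (mul_self_nonneg _)
      have hα2 := mul_nonneg (sq_nonneg α) h0
      nlinarith
    rw [integral_add (integrable_fun_sub (integrable_fun_add (iH.const_mul _) (iu1u1.const_mul _))
        (iu2u2.const_mul _)) (iJ2.const_mul _), integral_const_mul (α ^ 2) (fun p =>
        W' p * (Y p * u1 p) + W p * (Y1 p * u1 p) + W p * (Y p * u2 p)), J2,
      integral_sub (integrable_fun_add (iH.const_mul _) (iu1u1.const_mul _)) (iu2u2.const_mul _),
      integral_add (iH.const_mul _) (iu1u1.const_mul _), integral_const_mul, integral_const_mul,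
      integral_const_mul, integral_const_mul] at this
    have h2 := mul_le_mul_of_nonneg_left s1.2 (sq_nonneg α)
    rw [hQ]
    nlinarith
  have p0 : 0 ≤ ∫ p : ℝ × ℝ, om p.1 * e0 p :=
    integral_nonneg fun p => mul_nonneg (hom.pos _).le (e0n p)
  have p1 : 0 ≤ ∫ p : ℝ × ℝ, om p.1 * e1 p :=
    integral_nonneg fun p => mul_nonneg (hom.pos _).le (e1n p)
  have p2 : 0 ≤ ∫ p, W p * (u1 p * u1 p) :=
    integral_nonneg fun p => mul_nonneg (Wpos p).le (mul_self_nonneg _)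
  have p3 : 0 ≤ ∫ p, W p * (u2 p * u2 p) :=
    integral_nonneg fun p => mul_nonneg (Wpos p).le (mul_self_nonneg _)
  have q1 : ∫ p : ℝ × ℝ, om p.1 * dens p.2 * u1 p ^ 2 = ∫ p, W p * (u1 p * u1 p) := by
    congr 1; ext p; simp only [W]; ring
  have q2 : ∫ p : ℝ × ℝ, om p.1 * dens p.2 * u2 p ^ 2 = ∫ p, W p * (u2 p * u2 p) := by
    congr 1; ext p; simp only [W]; ring
  have r2 := mul_nonneg (sq_nonneg α) p2
  have r1 := mul_nonneg (sq_nonneg α) p1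
  have r3 := mul_nonneg (pow_nonneg hα0.le 4) p3
  rw [q1, q2]
  refine ⟨⟨s0.1, by linarith⟩, ⟨s1.1, by nlinarith⟩, by linarith, by nlinarith⟩

/-- The energy estimate for `α v' + 5 v = -h`. -/
lemma energy_zero_mode (hom : RadWeight om om' om'') {α : ℝ} (hα0 : 0 < α) (hα : α ≤ 1 / 4)
    {v v' : ℝ → ℝ} (hv' : Continuous v') (dv : ∀ s, HasDerivAt v (v' s) s) {B : ℝ}
    (hB : ∀ s, |v s| ≤ B) (hB' : ∀ s, |v' s| ≤ B) :
    ∫ s, om s * v s ^ 2 ≤ ∫ s, om s * (α * v' s + 5 * v s) ^ 2 := by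
  have hv : Continuous v := continuous_iff_continuousAt.2 fun s => (dv s).continuousAt
  have omc := hom.continuous
  have omc' := hom.continuous'
  have gen : ∀ (a f : ℝ → ℝ) (K C : ℝ), Continuous a → Continuous f → (∀ s, |f s| ≤ K) →
      (∀ s, |a s| ≤ C * om s) → Integrable fun s => a s * f s := by
    intro a f K C ha hf hK hC
    refine (hom.int.const_mul (C * K)).mono' (ha.mul hf).aestronglyMeasurable
      (Eventually.of_forall fun s => ?_)
    rw [norm_mul, Real.norm_eq_abs, Real.norm_eq_abs]
    calc |a s| * |f s| ≤ (C * om s) * K :=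
          mul_le_mul (hC s) (hK s) (abs_nonneg _) ((abs_nonneg _).trans (hC s))
      _ = _ := by ring
  have hB0 : 0 ≤ B := (abs_nonneg _).trans (hB 0)
  have bom : ∀ s, |om s| ≤ 1 * om s := fun s => by rw [abs_of_pos (hom.pos s), one_mul]
  have i1 : Integrable fun s => om s * v s ^ 2 := gen om (fun s => v s ^ 2) (B ^ 2) 1 omc
    (by fun_prop) (fun s => by rw [abs_pow]; exact pow_le_pow_left₀ (abs_nonneg _) (hB s) 2) bom
  have i2 : Integrable fun s => om' s * v s ^ 2 := gen om' (fun s => v s ^ 2) (B ^ 2) 3 omc'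
    (by fun_prop) (fun s => by rw [abs_pow]; exact pow_le_pow_left₀ (abs_nonneg _) (hB s) 2) hom.b1
  have i3 : Integrable fun s => om s * (v s * v' s) := gen om (fun s => v s * v' s) (B * B) 1 omc
    (by fun_prop) (fun s => by
      rw [abs_mul]; exact mul_le_mul (hB s) (hB' s) (abs_nonneg _) hB0) bom
  have i4 : Integrable fun s => om s * (α * v' s + 5 * v s) ^ 2 :=
    gen om (fun s => (α * v' s + 5 * v s) ^ 2) ((6 * B) ^ 2) 1 omc (by fun_prop) (fun s => by
      rw [abs_pow]
      refine pow_le_pow_left₀ (abs_nonneg _) ((abs_add_le _ _).trans ?_) 2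
      rw [abs_mul, abs_mul, abs_of_pos hα0]
      norm_num
      nlinarith [hB s, hB' s, abs_nonneg (v' s)]) bom
  have J := integral_eq_zero_of_hasDerivAt_of_integrable (f := fun s => om s * v s ^ 2)
    (f' := fun s => om' s * v s ^ 2 + 2 * (om s * (v s * v' s)))
    (fun s => by
      refine ((hom.d1 s).mul ((dv s).pow 2)).congr_deriv ?_
      simp only [Pi.pow_apply]; push_cast; ring) (integrable_fun_add i2 (i3.const_mul 2)) i1
  have i5 : Integrable fun s => om' s * v s ^ 2 + 2 * (om s * (v s * v' s)) :=
    integrable_fun_add i2 (i3.const_mul 2)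
  have : ∫ s, om s * v s ^ 2 ≤ ∫ s, (om s * (α * v' s + 5 * v s) ^ 2 -
      α * (om' s * v s ^ 2 + 2 * (om s * (v s * v' s)))) := by
    refine integral_mono i1 (integrable_fun_sub i4 (i5.const_mul _)) fun s => ?_
    have hw := (hom.pos s).le
    have a1 := abs_le.1 (hom.b1 s)
    have h1 : om' s * v s ^ 2 ≤ 3 * om s * v s ^ 2 := mul_le_mul_of_nonneg_right a1.2 (sq_nonneg _)
    have h2 : 0 ≤ om s * v s ^ 2 := mul_nonneg hw (sq_nonneg _)
    have h3 : α * (om' s * v s ^ 2) ≤ 3 / 4 * (om s * v s ^ 2) := by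
      nlinarith [mul_le_mul_of_nonneg_left h1 hα0.le]
    have h4 : 0 ≤ om s * (α * v' s + 4 * v s) ^ 2 := mul_nonneg hw (sq_nonneg _)
    nlinarith
  rwa [integral_sub i4 (i5.const_mul _), integral_const_mul, J, mul_zero, sub_zero] at this

end RadWeight

/-! ### The zero mode and the radially mollified equation -/

/-- `rho dτ` is `sin 2θ cos θ dθ`, the density of the kernel element of the adjoint operator. -/
def rho (τ : ℝ) : ℝ := sn τ ^ 2 * co τ

lemma continuous_rho : Continuous rho := by unfold rho; fun_prop

attribute [fun_prop] continuous_rho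

lemma rho_pos (τ : ℝ) : 0 < rho τ := mul_pos (pow_pos (sn_pos τ) 2) (co_pos τ)

lemma rho_le (τ : ℝ) : rho τ ≤ sn τ ^ (1 - eta) :=
  (mul_le_of_le_one_right (pow_pos (sn_pos τ) 2).le (co_le_one τ)).trans
    (sn_pow_le (by norm_num [eta]) τ)

lemma integrable_sn_eta : Integrable fun τ => sn τ ^ (1 - eta) :=
  integrable_sn_rpow (by norm_num [eta])

lemma integrable_rho : Integrable rho := by
  refine integrable_sn_eta.mono' continuous_rho.aestronglyMeasurable
    (Eventually.of_forall fun τ => ?_)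
  rw [Real.norm_of_nonneg (rho_pos τ).le]; exact rho_le τ

lemma integrable_sn_cube_co : Integrable fun τ => sn τ ^ 3 * co τ := by
  refine integrable_sn_eta.mono' (by fun_prop : Continuous _).aestronglyMeasurable
    (Eventually.of_forall fun τ => ?_)
  simpa using AngSys.sn_cube_co_le τ

/-- `rho² sin(2θ)^{η-1}` is dominated by `sn³ co`. -/
lemma rho_mul_le (τ a b : ℝ) :
    2 * (a * (rho τ * b)) ≤ a ^ 2 * (sn τ ^ 3 * co τ) + b ^ 2 * sn τ ^ (1 - eta) := by
  have hs := sn_pos τ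
  have hc := co_pos τ
  have hP := sn_rpow_pos (1 - eta) τ
  have h1 : sn τ ≤ sn τ ^ (1 - eta) := by
    simpa using sn_pow_le (n := 1) (a := 1 - eta) (by norm_num [eta]) τ
  have h2 : 0 ≤ sn τ * (a * (sn τ * co τ) - b) ^ 2 := by positivity
  have h3 : b ^ 2 * sn τ ≤ b ^ 2 * sn τ ^ (1 - eta) := mul_le_mul_of_nonneg_left h1 (sq_nonneg _)
  have h4 : a ^ 2 * (sn τ ^ 3 * co τ ^ 2) ≤ a ^ 2 * (sn τ ^ 3 * co τ) := by
    refine mul_le_mul_of_nonneg_left ?_ (sq_nonneg _)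
    have : co τ ^ 2 ≤ co τ := by nlinarith [co_le_one τ]
    exact mul_le_mul_of_nonneg_left this (by positivity)
  unfold rho
  nlinarith

lemma SqInt.integrable_rho_mul {f : ℝ → ℝ} (hf : SqInt f) (hfc : Continuous f) :
    Integrable fun τ => rho τ * f τ := by
  have hf' : Integrable fun τ => f τ ^ 2 * sn τ ^ (1 - eta) := hf
  refine (integrable_fun_add integrable_sn_cube_co hf').mono'
    (by fun_prop : Continuous _).aestronglyMeasurable (Eventually.of_forall fun τ => ?_)
  have h1 := rho_mul_le τ 1 (f τ)
  have h2 := rho_mul_le τ (-1) (f τ)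
  have h3 := mul_pos (pow_pos (sn_pos τ) 3) (co_pos τ)
  have h4 := mul_nonneg (sq_nonneg (f τ)) (sn_rpow_pos (1 - eta) τ).le
  rw [Real.norm_eq_abs, abs_le]; constructor <;> linarith

/-- The coefficient of `sin 2θ` in the projection of `f(s, ·)` to the kernel of the angular
operator. -/
def mode (f : ℝ × ℝ → ℝ) (s : ℝ) : ℝ := 15 / 8 * ∫ τ, rho τ * f (s, τ)

/-- The projection to the kernel is bounded in the weighted norm. -/
lemma mode_sq_le {f : ℝ × ℝ → ℝ} {s : ℝ} (hf : SqInt fun τ => f (s, τ))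
    (hfc : Continuous fun τ => f (s, τ)) :
    mode f s ^ 2 ≤ 15 / 8 * ∫ τ, sn τ ^ (1 - eta) * f (s, τ) ^ 2 := by
  have hf' : Integrable fun τ => f (s, τ) ^ 2 * sn τ ^ (1 - eta) := hf
  have h1 := integral_mono (((hf.integrable_rho_mul hfc).const_mul (mode f s)).const_mul 2)
    (integrable_fun_add (integrable_sn_cube_co.const_mul (mode f s ^ 2)) hf') fun τ =>
      rho_mul_le τ (mode f s) (f (s, τ))
  rw [integral_add (integrable_sn_cube_co.const_mul (mode f s ^ 2)) hf', integral_const_mul,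
    integral_const_mul, integral_const_mul, integral_sn_cube_co] at h1
  have h2 : ∫ τ, rho τ * f (s, τ) = 8 / 15 * mode f s := by unfold mode; ring
  rw [h2] at h1
  have h3 : ∫ τ, sn τ ^ (1 - eta) * f (s, τ) ^ 2 = ∫ τ, f (s, τ) ^ 2 * sn τ ^ (1 - eta) := by
    congr 1; ext τ; ring
  rw [h3]; linarith

section bounded

variable {f f' g : ℝ × ℝ → ℝ} {B B' : ℝ}

lemma integrable_rho_mul_of_bounded (hf : Continuous f) (hB : ∀ p, |f p| ≤ B) (s : ℝ) :
    Integrable fun τ => rho τ * f (s, τ) :=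
  (SqInt.of_bounded (by fun_prop) B fun τ => hB (s, τ)).integrable_rho_mul (by fun_prop)

lemma hasDerivAt_mode (hf : Continuous f) (hf' : Continuous f') (hB : ∀ p, |f p| ≤ B)
    (hB' : ∀ p, |f' p| ≤ B') (hd : ∀ s τ, HasDerivAt (fun x => f (x, τ)) (f' (s, τ)) s) (s : ℝ) :
    HasDerivAt (mode f) (mode f' s) s := by
  refine HasDerivAt.const_mul (15 / 8) ?_
  refine (hasDerivAt_integral_of_dominated_loc_of_deriv_le (μ := volume) (x₀ := s)
    (F := fun x τ => rho τ * f (x, τ)) (F' := fun x τ => rho τ * f' (x, τ))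
    (bound := fun τ => rho τ * B') univ_mem
    (Eventually.of_forall fun x => (by fun_prop : Continuous _).aestronglyMeasurable)
    (integrable_rho_mul_of_bounded hf hB s) (by fun_prop : Continuous _).aestronglyMeasurable
    (Eventually.of_forall fun τ x _ => ?_) (integrable_rho.mul_const _)
    (Eventually.of_forall fun τ x _ => (hd x τ).const_mul _)).2
  rw [norm_mul, Real.norm_of_nonneg (rho_pos τ).le]
  exact mul_le_mul_of_nonneg_left (hB' _) (rho_pos τ).le

lemma continuous_mode (hf : Continuous f) (hB : ∀ p, |f p| ≤ B) : Continuous (mode f) := by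
  refine continuous_const.mul (continuous_of_dominated (bound := fun τ => rho τ * B)
    (fun s => (by fun_prop : Continuous _).aestronglyMeasurable)
    (fun s => Eventually.of_forall fun τ => ?_) (integrable_rho.mul_const _)
    (Eventually.of_forall fun τ => by fun_prop))
  rw [norm_mul, Real.norm_of_nonneg (rho_pos τ).le]
  exact mul_le_mul_of_nonneg_left (hB _) (rho_pos τ).le

lemma abs_mode_le {s : ℝ} (hB : ∀ τ, |f (s, τ)| ≤ B) : |mode f s| ≤ 15 / 8 * ((∫ τ, rho τ) * B) := by
  unfold mode
  rw [abs_mul, abs_of_pos (by norm_num : (0 : ℝ) < 15 / 8), ← integral_mul_const,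
    ← Real.norm_eq_abs]
  refine mul_le_mul_of_nonneg_left (norm_integral_le_of_norm_le (integrable_rho.mul_const _)
    (Eventually.of_forall fun τ => ?_)) (by norm_num)
  rw [norm_mul, Real.norm_of_nonneg (rho_pos τ).le]
  exact mul_le_mul_of_nonneg_left (hB _) (rho_pos τ).le

end bounded

/-- `f(s, ·)` minus its projection to the kernel of the angular operator. -/
def perp (f : ℝ × ℝ → ℝ) (p : ℝ × ℝ) : ℝ := f p - sn p.2 * mode f p.1

section perp

variable {f f' : ℝ × ℝ → ℝ} {B B' : ℝ}

lemma continuous_perp (hf : Continuous f) (hB : ∀ p, |f p| ≤ B) : Continuous (perp f) := by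
  have := continuous_mode hf hB
  unfold perp; fun_prop

lemma hasDerivAt_perp (hf : Continuous f) (hf' : Continuous f') (hB : ∀ p, |f p| ≤ B)
    (hB' : ∀ p, |f' p| ≤ B') (hd : ∀ s τ, HasDerivAt (fun x => f (x, τ)) (f' (s, τ)) s) (s τ : ℝ) :
    HasDerivAt (fun x => perp f (x, τ)) (perp f' (s, τ)) s :=
  (hd s τ).sub ((hasDerivAt_mode hf hf' hB hB' hd s).const_mul (sn τ))

lemma abs_perp_le (hB : ∀ p, |f p| ≤ B) (p : ℝ × ℝ) :
    |perp f p| ≤ B + 15 / 8 * ((∫ τ, rho τ) * B) := by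
  refine (abs_sub _ _).trans (add_le_add (hB p) ?_)
  rw [abs_mul, abs_of_pos (sn_pos _)]
  exact (mul_le_of_le_one_left (abs_nonneg _) (sn_le_one _)).trans (abs_mode_le fun τ => hB _)

lemma integral_rho_perp (hf : Continuous f) (hB : ∀ p, |f p| ≤ B) (s : ℝ) :
    ∫ τ, sn τ ^ 2 * co τ * perp f (s, τ) = 0 := by
  have e : ∀ τ, sn τ ^ 2 * co τ * perp f (s, τ) =
      rho τ * f (s, τ) - mode f s * (sn τ ^ 3 * co τ) := fun τ => by
    unfold perp rho; ring
  simp_rw [e]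
  rw [integral_sub (integrable_rho_mul_of_bounded hf hB s) (integrable_sn_cube_co.const_mul _),
    integral_const_mul, integral_sn_cube_co]
  unfold mode; ring

/-- Subtracting a multiple of the kernel element `sn` changes neither `w` nor `y`. -/
lemma AngSys.perp {w y : ℝ → ℝ} {s : ℝ} (h : AngSys (fun τ => f (s, τ)) w y) :
    AngSys (fun τ => PolarBS.perp f (s, τ)) w y where
  du τ := by
    refine ((h.du τ).sub ((hasDerivAt_sn τ).mul_const (mode f s))).congr_deriv ?_
    unfold PolarBS.perp; ring
  dw := h.dw
  cont := h.cont
  atBot := by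
    have := h.atBot.sub (tendsto_sn_atBot.mul_const (mode f s))
    rw [zero_mul, sub_zero] at this; exact this
  atTop := by
    have := h.atTop.sub (tendsto_sn_atTop.mul_const (mode f s))
    rw [zero_mul, sub_zero] at this; exact this

end perp

/-- Coercivity in the form in which the radial energy estimate uses it. -/
lemma AngSys.coercive' {u w y : ℝ → ℝ} (h : AngSys u w y) (hy : SqInt y)
    (h0 : ∫ τ, sn τ ^ 2 * co τ * u τ = 0) :
    Integrable (fun τ => 1 / 200 * ((sn τ * w τ) ^ 2 * sn τ ^ (1 - eta) +
      (u τ / sn τ) ^ 2 * sn τ ^ (1 - eta))) ∧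
    ∫ τ, 1 / 200 * ((sn τ * w τ) ^ 2 * sn τ ^ (1 - eta) +
      (u τ / sn τ) ^ 2 * sn τ ^ (1 - eta)) ≤ ∫ τ, (y τ * u τ - 4 * u τ ^ 2) * dens τ := by
  have hu := h.sqInt_u hy
  have i1 : Integrable fun τ => 1 / 200 * ((sn τ * w τ) ^ 2 * sn τ ^ (1 - eta) +
      (u τ / sn τ) ^ 2 * sn τ ^ (1 - eta)) :=
    (integrable_fun_add (sqInt_sn_mul (h.sqInt_w hy) h.continuous_w)
      (h.sqInt_quot hy)).const_mul _
  have i2 := integrable_sq_mul_dens hu h.continuous_u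
  have i3 := integrable_mul_mul_dens hy hu h.cont h.continuous_u
  refine ⟨i1, ?_⟩
  have := h.coercive hy h0
  rw [integral_add (i2.const_mul 4) i1] at this
  have e : ∀ τ, (y τ * u τ - 4 * u τ ^ 2) * dens τ = y τ * u τ * dens τ - 4 * (u τ ^ 2 * dens τ) :=
    fun τ => by ring
  simp_rw [e]
  rw [integral_sub i3 (i2.const_mul 4)]
  linarith

/-- A solution of the Biot–Savart equation in the coordinates `R = e^s`, `θ = ang τ`, as a first order
system in `τ`; `u₁` and `u₂` are the first two derivatives of `u` in `s`. The right-hand side is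
not a parameter: it is recovered from `y` as `rhs`. -/
structure PlaneSol (u u1 u2 w y : ℝ × ℝ → ℝ) : Prop where
  cu : Continuous u
  cu1 : Continuous u1
  cu2 : Continuous u2
  cw : Continuous w
  cy : Continuous y
  d1 : ∀ s τ, HasDerivAt (fun x => u (x, τ)) (u1 (s, τ)) s
  d2 : ∀ s τ, HasDerivAt (fun x => u1 (x, τ)) (u2 (s, τ)) s
  du : ∀ s τ, HasDerivAt (fun x => u (s, x)) (2 * cs τ * u (s, τ) + sn τ ^ 2 * w (s, τ)) τ
  dw : ∀ s τ, HasDerivAt (fun x => w (s, x)) ((1 - 5 * cs τ) * w (s, τ) - y (s, τ)) τ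
  bdd : ∃ B, ∀ p, |u p| ≤ B
  atBot : ∀ s, Tendsto (fun τ => u (s, τ)) atBot (𝓝 0)
  atTop : ∀ s, Tendsto (fun τ => u (s, τ)) atTop (𝓝 0)
  decay : ∀ ε > 0, ∃ S, ∀ s, S ≤ s → ∀ τ, |u (s, τ)| ≤ ε

/-- The right-hand side `F = y - α² ∂_s² u - 5α ∂_s u` of the equation. -/
def rhs (α : ℝ) (u1 u2 y : ℝ × ℝ → ℝ) (p : ℝ × ℝ) : ℝ := y p - α ^ 2 * u2 p - 5 * α * u1 p

/-- The weighted square integral of `X`, for the angular exponent `η` and the radial weight `om`, is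
at most `c`. -/
def RadBound (om : ℝ → ℝ) (X : ℝ × ℝ → ℝ) (c : ℝ) : Prop :=
  Integrable (fun p : ℝ × ℝ => om p.1 * sn p.2 ^ (1 - eta) * X p ^ 2) ∧
    ∫ p : ℝ × ℝ, om p.1 * sn p.2 ^ (1 - eta) * X p ^ 2 ≤ c

lemma continuous_radial_mul_sq {om : ℝ → ℝ} {X : ℝ × ℝ → ℝ} (hom : Continuous om)
    (hX : Continuous X) : Continuous fun p : ℝ × ℝ => om p.1 * sn p.2 ^ (1 - eta) * X p ^ 2 :=
  ((hom.comp continuous_fst).mul ((continuous_sn_rpow (1 - eta)).comp continuous_snd)).mul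
    (hX.pow 2)

namespace RadBound

variable {om om' om'' : ℝ → ℝ} {X Z : ℝ × ℝ → ℝ} {a b : ℝ}

lemma le (h : RadBound om X a) (hab : a ≤ b) : RadBound om X b := ⟨h.1, h.2.trans hab⟩

lemma const_mul (h : RadBound om X a) (c : ℝ) : RadBound om (fun p => c * X p) (c ^ 2 * a) := by
  have e : ∀ p : ℝ × ℝ, om p.1 * sn p.2 ^ (1 - eta) * (c * X p) ^ 2 =
    c ^ 2 * (om p.1 * sn p.2 ^ (1 - eta) * X p ^ 2) := fun p => by ring
  constructor
  · simp_rw [e]; exact h.1.const_mul _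
  · simp_rw [e]; rw [integral_const_mul]; exact mul_le_mul_of_nonneg_left h.2 (sq_nonneg c)

lemma mono (h : RadBound om X a) (hom : Continuous om) (hpos : ∀ s, 0 < om s) (hZ : Continuous Z)
    (hle : ∀ p, |Z p| ≤ |X p|) : RadBound om Z a := by
  have hle' : ∀ p : ℝ × ℝ, om p.1 * sn p.2 ^ (1 - eta) * Z p ^ 2 ≤
      om p.1 * sn p.2 ^ (1 - eta) * X p ^ 2 := fun p =>
    mul_le_mul_of_nonneg_left (sq_le_sq.2 (hle p)) (mul_pos (hpos _) (sn_rpow_pos _ _)).le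
  have hi : Integrable fun p : ℝ × ℝ => om p.1 * sn p.2 ^ (1 - eta) * Z p ^ 2 := by
    refine h.1.mono' (continuous_radial_mul_sq hom hZ).aestronglyMeasurable
      (Eventually.of_forall fun p => ?_)
    rw [Real.norm_of_nonneg
      (mul_nonneg (mul_pos (hpos _) (sn_rpow_pos _ _)).le (sq_nonneg _))]
    exact hle' p
  exact ⟨hi, (integral_mono hi h.1 hle').trans h.2⟩

lemma add (hX : RadBound om X a) (hZ : RadBound om Z b) (hom : Continuous om)
    (hpos : ∀ s, 0 < om s) (cX : Continuous X) (cZ : Continuous Z) :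
    RadBound om (fun p => X p + Z p) (2 * a + 2 * b) := by
  have hle' : ∀ p : ℝ × ℝ, om p.1 * sn p.2 ^ (1 - eta) * (X p + Z p) ^ 2 ≤
      2 * (om p.1 * sn p.2 ^ (1 - eta) * X p ^ 2) + 2 * (om p.1 * sn p.2 ^ (1 - eta) * Z p ^ 2) :=
    fun p => by
      have h1 : (X p + Z p) ^ 2 ≤ 2 * X p ^ 2 + 2 * Z p ^ 2 := by nlinarith [sq_nonneg (X p - Z p)]
      nlinarith [mul_le_mul_of_nonneg_left h1 (mul_pos (hpos p.1) (sn_rpow_pos (1 - eta) p.2)).le]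
  have hs := integrable_fun_add (hX.1.const_mul 2) (hZ.1.const_mul 2)
  have hi : Integrable fun p : ℝ × ℝ => om p.1 * sn p.2 ^ (1 - eta) * (X p + Z p) ^ 2 := by
    refine hs.mono' (continuous_radial_mul_sq hom (cX.add cZ)).aestronglyMeasurable
      (Eventually.of_forall fun p => ?_)
    rw [Real.norm_of_nonneg
      (mul_nonneg (mul_pos (hpos _) (sn_rpow_pos _ _)).le (sq_nonneg _))]
    exact hle' p
  refine ⟨hi, (integral_mono hi hs hle').trans ?_⟩
  rw [integral_add (hX.1.const_mul 2) (hZ.1.const_mul 2), integral_const_mul, integral_const_mul]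
  linarith [hX.2, hZ.2]

/-- Functions of `s` alone, times a bounded function of the angle. -/
lemma of_fst {φ c : ℝ → ℝ} (hom : Continuous om) (hpos : ∀ s, 0 < om s) (hφc : Continuous φ)
    (hc : Continuous c) (hc1 : ∀ τ, |c τ| ≤ 1) (hφ : Integrable fun s => om s * φ s ^ 2)
    (ha : ∫ s, om s * φ s ^ 2 ≤ a) :
    RadBound om (fun p => c p.2 * φ p.1) ((∫ τ, sn τ ^ (1 - eta)) * a) := by
  have h1 : RadBound om (fun p => φ p.1) ((∫ τ, sn τ ^ (1 - eta)) * a) := by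
    have e : ∀ p : ℝ × ℝ, om p.1 * sn p.2 ^ (1 - eta) * φ p.1 ^ 2 =
      om p.1 * φ p.1 ^ 2 * sn p.2 ^ (1 - eta) := fun p => by ring
    unfold RadBound
    simp_rw [e, Measure.volume_eq_prod]
    refine ⟨hφ.mul_prod integrable_sn_eta, ?_⟩
    rw [integral_prod_mul (fun s => om s * φ s ^ 2) fun τ => sn τ ^ (1 - eta), mul_comm]
    exact mul_le_mul_of_nonneg_left ha (integral_nonneg fun τ => (sn_rpow_pos _ τ).le)
  refine h1.mono hom hpos (by fun_prop) fun p => ?_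
  rw [abs_mul]
  exact mul_le_of_le_one_left (abs_nonneg _) (hc1 _)

lemma of_bounded (hom : RadWeight om om' om'') (hX : Continuous X) {B : ℝ} (hB : ∀ p, |X p| ≤ B) :
    Integrable fun p : ℝ × ℝ => om p.1 * sn p.2 ^ (1 - eta) * X p ^ 2 := by
  have h1 : Integrable (fun p : ℝ × ℝ => om p.1 * sn p.2 ^ (1 - eta)) := by
    rw [Measure.volume_eq_prod]; exact hom.int.mul_prod integrable_sn_eta
  have := hom.continuous
  refine (h1.mul_const (B ^ 2)).mono' (continuous_radial_mul_sq this hX).aestronglyMeasurable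
    (Eventually.of_forall fun p => ?_)
  have hp : 0 ≤ om p.1 * sn p.2 ^ (1 - eta) := (mul_pos (hom.pos _) (sn_rpow_pos _ _)).le
  rw [Real.norm_of_nonneg (mul_nonneg hp (sq_nonneg _))]
  refine mul_le_mul_of_nonneg_left ?_ hp
  exact sq_le_sq' (by linarith [(abs_le.1 (hB p)).1]) (abs_le.1 (hB p)).2

lemma ae_sqInt (hX : Integrable fun p : ℝ × ℝ => om p.1 * sn p.2 ^ (1 - eta) * X p ^ 2)
    (hpos : ∀ s, 0 < om s) : ∀ᵐ s, SqInt fun τ => X (s, τ) := by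
  rw [Measure.volume_eq_prod] at hX
  filter_upwards [hX.prod_right_ae] with s hs
  refine (hs.const_mul (om s)⁻¹).congr (Eventually.of_forall fun τ => ?_)
  have := (hpos s).ne'
  simp only; field_simp

/-- Passing between the weights `dens` and `sin(2θ)^{1-η}`. -/
lemma integrable_dens (h : Integrable fun p : ℝ × ℝ => om p.1 * sn p.2 ^ (1 - eta) * X p ^ 2)
    (hom : Continuous om) (hpos : ∀ s, 0 < om s) (hX : Continuous X) :
    Integrable (fun p : ℝ × ℝ => om p.1 * dens p.2 * X p ^ 2) ∧
      ∫ p : ℝ × ℝ, om p.1 * dens p.2 * X p ^ 2 ≤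
        (1 + bigM) * ∫ p : ℝ × ℝ, om p.1 * sn p.2 ^ (1 - eta) * X p ^ 2 := by
  have hle : ∀ p : ℝ × ℝ, om p.1 * dens p.2 * X p ^ 2 ≤
      (1 + bigM) * (om p.1 * sn p.2 ^ (1 - eta) * X p ^ 2) := fun p => by
    have := mul_le_mul_of_nonneg_left (dens_le p.2) (mul_nonneg (hpos p.1).le (sq_nonneg (X p)))
    linarith
  have hi : Integrable fun p : ℝ × ℝ => om p.1 * dens p.2 * X p ^ 2 := by
    refine (h.const_mul (1 + bigM)).mono' (by fun_prop : Continuous _).aestronglyMeasurable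
      (Eventually.of_forall fun p => ?_)
    rw [Real.norm_of_nonneg (mul_nonneg (mul_pos (hpos _) (dens_pos _)).le (sq_nonneg _))]
    exact hle p
  refine ⟨hi, ?_⟩
  rw [← integral_const_mul]
  exact integral_mono hi (h.const_mul _) hle

lemma of_dens (h : Integrable fun p : ℝ × ℝ => om p.1 * dens p.2 * X p ^ 2)
    (hom : Continuous om) (hpos : ∀ s, 0 < om s) (hX : Continuous X)
    (ha : ∫ p : ℝ × ℝ, om p.1 * dens p.2 * X p ^ 2 ≤ a) : RadBound om X a := by
  have hle : ∀ p : ℝ × ℝ, om p.1 * sn p.2 ^ (1 - eta) * X p ^ 2 ≤ om p.1 * dens p.2 * X p ^ 2 :=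
    fun p => mul_le_mul_of_nonneg_right (mul_le_mul_of_nonneg_left (le_dens _) (hpos _).le)
      (sq_nonneg _)
  have hi : Integrable fun p : ℝ × ℝ => om p.1 * sn p.2 ^ (1 - eta) * X p ^ 2 := by
    refine h.mono' (continuous_radial_mul_sq hom hX).aestronglyMeasurable
      (Eventually.of_forall fun p => ?_)
    rw [Real.norm_of_nonneg (mul_nonneg (mul_pos (hpos _) (sn_rpow_pos _ _)).le (sq_nonneg _))]
    exact hle p
  exact ⟨hi, (integral_mono hi h hle).trans ha⟩

end RadBound

/-- The constant of the radially mollified estimates. The integral enters because a function of `s`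
alone has, in the weighted space, the norm of its profile times this integral. -/
def bigC : ℝ := 10 ^ 15 * (1 + ∫ τ, sn τ ^ (1 - eta))

lemma integral_sn_eta_nonneg : 0 ≤ ∫ τ, sn τ ^ (1 - eta) :=
  integral_nonneg fun τ => (sn_rpow_pos _ τ).le

lemma bigC_pos : 0 < bigC := by
  have := integral_sn_eta_nonneg
  unfold bigC; positivity

lemma RadBound.of_le {om : ℝ → ℝ} {X g : ℝ × ℝ → ℝ} {a : ℝ} (hom : Continuous om)
    (hpos : ∀ s, 0 < om s) (hX : Continuous X) (hg : Integrable g)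
    (hle : ∀ p : ℝ × ℝ, om p.1 * sn p.2 ^ (1 - eta) * X p ^ 2 ≤ g p) (ha : ∫ p, g p ≤ a) :
    RadBound om X a := by
  have hi : Integrable fun p : ℝ × ℝ => om p.1 * sn p.2 ^ (1 - eta) * X p ^ 2 := by
    refine hg.mono' (continuous_radial_mul_sq hom hX).aestronglyMeasurable
      (Eventually.of_forall fun p => ?_)
    rw [Real.norm_of_nonneg (mul_nonneg (mul_pos (hpos _) (sn_rpow_pos _ _)).le (sq_nonneg _))]
    exact hle p
  exact ⟨hi, (integral_mono hi hg hle).trans ha⟩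

lemma AngSys.integral_w_le {u w y : ℝ → ℝ} (h : AngSys u w y) (hy : SqInt y) :
    ∫ τ, w τ ^ 2 * sn τ ^ (1 - eta) ≤ 2 * ∫ τ, y τ ^ 2 * sn τ ^ (1 - eta) := by
  have h1 := h.lintegral_w_le hy
  have p : ∀ f : ℝ → ℝ, 0 ≤ᵐ[volume] fun τ => f τ ^ 2 * sn τ ^ (1 - eta) := fun f =>
    Eventually.of_forall fun τ => mul_nonneg (sq_nonneg _) (sn_rpow_pos _ τ).le
  rw [← ofReal_integral_eq_lintegral_ofReal (h.sqInt_w hy) (p w),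
    ← ofReal_integral_eq_lintegral_ofReal hy (p y), ← ENNReal.ofReal_ofNat 2,
    ← ENNReal.ofReal_mul (by norm_num), ENNReal.ofReal_le_ofReal_iff] at h1
  · exact h1
  · exact mul_nonneg (by norm_num) (integral_nonneg fun τ =>
      mul_nonneg (sq_nonneg _) (sn_rpow_pos _ τ).le)

/-- The Hardy inequality for the transport equation on each ray, integrated over the rays. -/
lemma RadBound.w_of_y {om : ℝ → ℝ} {w y : ℝ × ℝ → ℝ} {a : ℝ} (hom : Continuous om)
    (hpos : ∀ s, 0 < om s) (hw : Continuous w) (hy : RadBound om y a)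
    (hs : ∀ s, ∃ u, AngSys u (fun τ => w (s, τ)) fun τ => y (s, τ)) : RadBound om w (2 * a) := by
  have hc : Continuous fun p : ℝ × ℝ => sn p.2 ^ (1 - eta) * w p ^ 2 := by
    simpa using continuous_radial_mul_sq (om := fun _ => 1) continuous_const hw
  obtain ⟨i, hle⟩ := integral_le_of_slices (e := fun p => sn p.2 ^ (1 - eta) * w p ^ 2)
    (G := fun p => 2 * (sn p.2 ^ (1 - eta) * y p ^ 2)) hom hpos hc
    (fun p => mul_nonneg (sn_rpow_pos _ _).le (sq_nonneg _))
    ((hy.1.const_mul 2).congr (Eventually.of_forall fun p => by simp only; ring)) (by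
      filter_upwards [RadBound.ae_sqInt hy.1 hpos] with s h1
      obtain ⟨u, hu⟩ := hs s
      have h2 := hu.integral_w_le h1
      have h3 := hu.sqInt_w h1
      unfold SqInt at h3
      have e : ∀ f : ℝ × ℝ → ℝ, (fun τ => sn τ ^ (1 - eta) * f (s, τ) ^ 2) =
        fun τ => f (s, τ) ^ 2 * sn τ ^ (1 - eta) := fun f => by ext τ; ring
      rw [integral_const_mul, e w, e y]
      exact ⟨h3, h2⟩)
  refine .of_le hom hpos hw i (fun p => le_of_eq (by ring)) (hle.trans ?_)
  have e : ∀ p : ℝ × ℝ, om p.1 * (2 * (sn p.2 ^ (1 - eta) * y p ^ 2)) =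
    2 * (om p.1 * sn p.2 ^ (1 - eta) * y p ^ 2) := fun p => by ring
  simp_rw [e]
  rw [integral_const_mul]
  exact mul_le_mul_of_nonneg_left hy.2 (by norm_num)

namespace PlaneSol

variable {u u1 u2 w y : ℝ × ℝ → ℝ} {κ : ℝ → ℝ} {α : ℝ}

lemma angSys (h : PlaneSol u u1 u2 w y) (hκ : IsKernel κ) (s : ℝ) :
    AngSys (fun τ => sconv κ u (s, τ)) (fun τ => sconv κ w (s, τ)) (fun τ => sconv κ y (s, τ)) := by
  obtain ⟨B, hB⟩ := h.bdd
  have cu := h.cu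
  have cw := h.cw
  have cy := h.cy
  refine ⟨fun τ => ?_, fun τ => ?_, ?_, tendsto_sconv_snd hκ cu hB h.atBot s,
    tendsto_sconv_snd hκ cu hB h.atTop s⟩
  · refine (hasDerivAt_sconv_snd hκ cu (g := fun p => 2 * cs p.2 * u p + sn p.2 ^ 2 * w p)
      (by fun_prop) h.du s τ).congr_deriv ?_
    rw [sconv_add hκ (f := fun p => 2 * cs p.2 * u p) (g := fun p => sn p.2 ^ 2 * w p)
      (by fun_prop) (by fun_prop), sconv_mul (fun τ => 2 * cs τ) u, sconv_mul (fun τ => sn τ ^ 2) w]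
  · refine (hasDerivAt_sconv_snd hκ cw (g := fun p => (1 - 5 * cs p.2) * w p - y p)
      (by fun_prop) h.dw s τ).congr_deriv ?_
    rw [sconv_sub hκ (f := fun p => (1 - 5 * cs p.2) * w p) (g := y)
      (by fun_prop) cy, sconv_mul (fun τ => 1 - 5 * cs τ) w]
  · exact (continuous_sconv hκ cy).comp (by fun_prop)

lemma continuous_rhs (h : PlaneSol u u1 u2 w y) (α : ℝ) : Continuous (rhs α u1 u2 y) := by
  have := h.cu1
  have := h.cu2
  have := h.cy
  unfold rhs; fun_prop

lemma sconv_u1 (h : PlaneSol u u1 u2 w y) (hκ : IsKernel κ) (p : ℝ × ℝ) :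
    sconv κ u1 p = sconv (deriv κ) u p := (sconv_deriv_eq hκ h.cu h.cu1 h.d1 p).symm

lemma sconv_u2 (h : PlaneSol u u1 u2 w y) (hκ : IsKernel κ) (p : ℝ × ℝ) :
    sconv κ u2 p = sconv (deriv (deriv κ)) u p :=
  (sconv_deriv_eq hκ h.cu1 h.cu2 h.d2 p).symm.trans (h.sconv_u1 hκ.deriv p)

lemma sconv_rhs (h : PlaneSol u u1 u2 w y) (hκ : IsKernel κ) (α : ℝ) (p : ℝ × ℝ) :
    sconv κ (rhs α u1 u2 y) p = sconv κ y p - α ^ 2 * sconv (deriv (deriv κ)) u p -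
      5 * α * sconv (deriv κ) u p := by
  have := h.cu1
  have := h.cu2
  have cy := h.cy
  unfold rhs
  rw [sconv_sub hκ (f := fun p => y p - α ^ 2 * u2 p) (g := fun p => 5 * α * u1 p) (by fun_prop)
    (by fun_prop), sconv_sub hκ (f := y) (g := fun p => α ^ 2 * u2 p) cy (by fun_prop),
    sconv_mul (fun _ => α ^ 2) u2, sconv_mul (fun _ => 5 * α) u1, h.sconv_u1 hκ, h.sconv_u2 hκ]

section radial

variable {om om' om'' : ℝ → ℝ}

lemma integrable_y (h : PlaneSol u u1 u2 w y) (hom : RadWeight om om' om'') (hκ : IsKernel κ)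
    (iH : Integrable fun p : ℝ × ℝ => om p.1 * sn p.2 ^ (1 - eta) * sconv κ (rhs α u1 u2 y) p ^ 2) :
    Integrable fun p : ℝ × ℝ => om p.1 * sn p.2 ^ (1 - eta) * sconv κ y p ^ 2 := by
  obtain ⟨B, hB⟩ := h.bdd
  have c1 := continuous_sconv hκ.deriv h.cu
  have c2 := continuous_sconv hκ.deriv.deriv h.cu
  have cH := continuous_sconv hκ (h.continuous_rhs α)
  have i1 : RadBound om (sconv (deriv κ) u) _ :=
    ⟨RadBound.of_bounded hom c1 (abs_sconv_le hκ.deriv hB), le_rfl⟩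
  have i2 : RadBound om (sconv (deriv (deriv κ)) u) _ :=
    ⟨RadBound.of_bounded hom c2 (abs_sconv_le hκ.deriv.deriv hB), le_rfl⟩
  have i3 : RadBound om (sconv κ (rhs α u1 u2 y)) _ := ⟨iH, le_rfl⟩
  have := (i3.add ((i2.const_mul (α ^ 2)).add (i1.const_mul (5 * α)) hom.continuous hom.pos
    (by fun_prop) (by fun_prop)) hom.continuous hom.pos cH (by fun_prop)).1
  refine this.congr (Eventually.of_forall fun p => ?_)
  have e := h.sconv_rhs hκ α p
  simp only
  rw [show sconv κ y p = sconv κ (rhs α u1 u2 y) p + (α ^ 2 * sconv (deriv (deriv κ)) u p +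
    5 * α * sconv (deriv κ) u p) by rw [e]; ring]

/-- The zero mode of the equation: on it the angular operator vanishes. -/
lemma ae_mode_eq (h : PlaneSol u u1 u2 w y) (hom : RadWeight om om' om'') (hκ : IsKernel κ)
    (iH : Integrable fun p : ℝ × ℝ => om p.1 * sn p.2 ^ (1 - eta) * sconv κ (rhs α u1 u2 y) p ^ 2) :
    ∀ᵐ s, α ^ 2 * mode (sconv (deriv (deriv κ)) u) s + 5 * α * mode (sconv (deriv κ) u) s =
      -mode (sconv κ (rhs α u1 u2 y)) s := by
  obtain ⟨B, hB⟩ := h.bdd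
  filter_upwards [RadBound.ae_sqInt (h.integrable_y hom hκ iH) hom.pos] with s hs
  have hy := (h.angSys hκ s).integral_flux_deriv hs
  have i1 := integrable_rho_mul_of_bounded (continuous_sconv hκ.deriv h.cu)
    (abs_sconv_le hκ.deriv hB) s
  have i2 := integrable_rho_mul_of_bounded (continuous_sconv hκ.deriv.deriv h.cu)
    (abs_sconv_le hκ.deriv.deriv hB) s
  have i3 := hs.integrable_rho_mul (h.angSys hκ s).cont
  have e : ∫ τ, rho τ * sconv κ (rhs α u1 u2 y) (s, τ) =
      ∫ τ, (rho τ * sconv κ y (s, τ) - (α ^ 2 * (rho τ * sconv (deriv (deriv κ)) u (s, τ)) +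
        5 * α * (rho τ * sconv (deriv κ) u (s, τ)))) := by
    congr 1; ext τ; rw [h.sconv_rhs hκ]; ring
  unfold mode
  rw [e, integral_sub i3 (integrable_fun_add (i2.const_mul _) (i1.const_mul _)),
    integral_add (i2.const_mul _) (i1.const_mul _), integral_const_mul, integral_const_mul]
  have hy' : ∫ τ, rho τ * sconv κ y (s, τ) = 0 := hy
  rw [hy']; ring

lemma integral_zero_mode_le (h : PlaneSol u u1 u2 w y) (hom : RadWeight om om' om'')
    (hκ : IsKernel κ)
    (iH : Integrable fun p : ℝ × ℝ => om p.1 * sn p.2 ^ (1 - eta) * sconv κ (rhs α u1 u2 y) p ^ 2) :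
    ∫ s, om s * (α ^ 2 * mode (sconv (deriv (deriv κ)) u) s +
      5 * α * mode (sconv (deriv κ) u) s) ^ 2 ≤
      15 / 8 * ∫ p : ℝ × ℝ, om p.1 * sn p.2 ^ (1 - eta) * sconv κ (rhs α u1 u2 y) p ^ 2 := by
  have cH := continuous_sconv hκ (h.continuous_rhs α)
  have iH' := iH
  rw [Measure.volume_eq_prod] at iH'
  rw [Measure.volume_eq_prod, integral_prod _ iH', ← integral_const_mul]
  refine integral_mono_of_nonneg (Eventually.of_forall fun s =>
    mul_nonneg (hom.pos s).le (sq_nonneg _)) (iH'.integral_prod_left.const_mul _) ?_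
  filter_upwards [h.ae_mode_eq hom hκ iH, RadBound.ae_sqInt iH hom.pos] with s h1 h2
  rw [h1, neg_sq]
  have := mul_le_mul_of_nonneg_left (mode_sq_le h2 (by fun_prop)) (hom.pos s).le
  refine this.trans_eq ?_
  simp_rw [mul_assoc (om s)]
  rw [integral_const_mul]; ring

/-- The estimates for a fixed truncated radial weight. -/
theorem radial_estimate (h : PlaneSol u u1 u2 w y) (hom : RadWeight om om' om'') (hα0 : 0 < α)
    (hα : α ≤ 1 / 4) (hκ : IsKernel κ)
    (iH : ∀ κ, IsKernel κ →
      Integrable fun p : ℝ × ℝ => om p.1 * sn p.2 ^ (1 - eta) * sconv κ (rhs α u1 u2 y) p ^ 2) :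
    let E := ∫ p : ℝ × ℝ, om p.1 * sn p.2 ^ (1 - eta) * sconv κ (rhs α u1 u2 y) p ^ 2
    RadBound om (fun p => α ^ 2 * sconv (deriv (deriv κ)) u p) (bigC * E) ∧
    RadBound om (fun p => α * (sconv (deriv κ) u p / sn p.2)) (bigC * E) ∧
    RadBound om (fun p => α * (sn p.2 * sconv (deriv κ) w p)) (bigC * E) ∧
    RadBound om (fun p => perp (sconv κ u) p / sn p.2 - α / 5 * mode (sconv (deriv κ) u) p.1)
      (bigC * E) ∧
    RadBound om (sconv κ y) (bigC * E) ∧ RadBound om (sconv κ w) (bigC * E) := by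
  intro E
  obtain ⟨B, hB⟩ := h.bdd
  have omc := hom.continuous
  have omp := hom.pos
  have hκ1 := hκ.deriv
  have hκ2 := hκ1.deriv
  have c0 := continuous_sconv hκ h.cu
  have c1 := continuous_sconv hκ1 h.cu
  have c2 := continuous_sconv hκ2 h.cu
  have cw0 := continuous_sconv hκ h.cw
  have cw1 := continuous_sconv hκ1 h.cw
  have cy0 := continuous_sconv hκ h.cy
  have cy1 := continuous_sconv hκ1 h.cy
  have cH := continuous_sconv hκ (h.continuous_rhs α)
  have B0 := abs_sconv_le hκ hB
  have B1 := abs_sconv_le hκ1 hB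
  have B2 := abs_sconv_le hκ2 hB
  have d1 := hasDerivAt_sconv hκ h.cu
  have d2 := hasDerivAt_sconv hκ1 h.cu
  have m1c := continuous_mode c1 B1
  have m2c := continuous_mode c2 B2
  have cp0 := continuous_perp c0 B0
  have cp1 := continuous_perp c1 B1
  have cp2 := continuous_perp c2 B2
  have cq0 : Continuous fun p : ℝ × ℝ => perp (sconv κ u) p / sn p.2 :=
    cp0.div (by fun_prop) fun p => (sn_pos p.2).ne'
  have cq1 : Continuous fun p : ℝ × ℝ => perp (sconv (deriv κ) u) p / sn p.2 :=
    cp1.div (by fun_prop) fun p => (sn_pos p.2).ne'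
  set K := ∫ τ, sn τ ^ (1 - eta) with hK
  have K0 : 0 ≤ K := integral_sn_eta_nonneg
  have E0 : 0 ≤ E := integral_nonneg fun p =>
    mul_nonneg (mul_pos (omp _) (sn_rpow_pos _ _)).le (sq_nonneg _)
  have KE0 : 0 ≤ K * E := mul_nonneg K0 E0
  have hbig : bigC * E = 10 ^ 15 * E + 10 ^ 15 * (K * E) := by unfold bigC; rw [← hK]; ring
  -- the zero mode: `v = α p'` solves `α v' + 5 v = -h`
  obtain ⟨b1, bm1⟩ : ∃ b, ∀ s, |mode (sconv (deriv κ) u) s| ≤ b :=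
    ⟨_, fun s => abs_mode_le fun τ => B1 (s, τ)⟩
  obtain ⟨b2, bm2⟩ : ∃ b, ∀ s, |mode (sconv (deriv (deriv κ)) u) s| ≤ b :=
    ⟨_, fun s => abs_mode_le fun τ => B2 (s, τ)⟩
  have ib : ∀ (φ : ℝ → ℝ) (b : ℝ), Continuous φ → (∀ s, |φ s| ≤ b) →
      Integrable fun s => om s * φ s ^ 2 := fun φ b hφ hb => by
    refine (hom.int.mul_const (b ^ 2)).mono' (by fun_prop : Continuous _).aestronglyMeasurable
      (Eventually.of_forall fun s => ?_)
    rw [Real.norm_of_nonneg (mul_nonneg (omp s).le (sq_nonneg _))]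
    exact mul_le_mul_of_nonneg_left (sq_le_sq' (by linarith [(abs_le.1 (hb s)).1])
      (abs_le.1 (hb s)).2) (omp s).le
  have zh := h.integral_zero_mode_le hom hκ (iH κ hκ)
  have i1 := ib _ _ m1c bm1
  have i2 := ib _ _ m2c bm2
  have ih0 : Integrable fun s => om s * (α ^ 2 * mode (sconv (deriv (deriv κ)) u) s +
      5 * α * mode (sconv (deriv κ) u) s) ^ 2 := by
    refine ib _ (|α ^ 2| * b2 + |5 * α| * b1) (by fun_prop) fun s => (abs_add_le _ _).trans
      (add_le_add ((abs_mul _ _).trans_le (mul_le_mul_of_nonneg_left (bm2 s) (abs_nonneg _)))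
        ((abs_mul _ _).trans_le (mul_le_mul_of_nonneg_left (bm1 s) (abs_nonneg _))))
  obtain ⟨b, hb1, hb2⟩ : ∃ b, (∀ s, |α * mode (sconv (deriv κ) u) s| ≤ b) ∧
      ∀ s, |α * mode (sconv (deriv (deriv κ)) u) s| ≤ b :=
    ⟨max (|α| * b1) (|α| * b2), fun s => le_max_of_le_left ((abs_mul _ _).trans_le
      (mul_le_mul_of_nonneg_left (bm1 s) (abs_nonneg _))), fun s => le_max_of_le_right
      ((abs_mul _ _).trans_le (mul_le_mul_of_nonneg_left (bm2 s) (abs_nonneg _)))⟩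
  have zv : ∫ s, om s * (α * mode (sconv (deriv κ) u) s) ^ 2 ≤ 15 / 8 * E := by
    have := hom.energy_zero_mode hα0 hα (v := fun s => α * mode (sconv (deriv κ) u) s)
      (v' := fun s => α * mode (sconv (deriv (deriv κ)) u) s) (by fun_prop)
      (fun s => (hasDerivAt_mode c1 c2 B1 B2 d2 s).const_mul α) hb1 hb2
    refine this.trans ((le_of_eq ?_).trans zh)
    congr 1; ext s; ring
  have zv' : ∫ s, om s * (α ^ 2 * mode (sconv (deriv (deriv κ)) u) s) ^ 2 ≤ 100 * E := by
    have i3 : Integrable fun s => om s * (α * mode (sconv (deriv κ) u) s) ^ 2 :=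
      (i1.const_mul (α ^ 2)).congr (Eventually.of_forall fun s => by simp only; ring)
    have i4 : Integrable fun s => om s * (α ^ 2 * mode (sconv (deriv (deriv κ)) u) s) ^ 2 :=
      (i2.const_mul (α ^ 4)).congr (Eventually.of_forall fun s => by simp only; ring)
    have := integral_mono i4 (integrable_fun_add (ih0.const_mul 2) (i3.const_mul 50)) fun s => by
      have h1 : (α ^ 2 * mode (sconv (deriv (deriv κ)) u) s) ^ 2 ≤
        2 * (α ^ 2 * mode (sconv (deriv (deriv κ)) u) s +
          5 * α * mode (sconv (deriv κ) u) s) ^ 2 + 50 * (α * mode (sconv (deriv κ) u) s) ^ 2 := by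
        nlinarith [sq_nonneg (α ^ 2 * mode (sconv (deriv (deriv κ)) u) s +
          10 * α * mode (sconv (deriv κ) u) s)]
      have := mul_le_mul_of_nonneg_left h1 (omp s).le
      simp only; linarith
    rw [integral_add (ih0.const_mul 2) (i3.const_mul 50), integral_const_mul,
      integral_const_mul] at this
    linarith
  have csn : ∀ τ, |sn τ| ≤ 1 := fun τ => by rw [abs_of_pos (sn_pos τ)]; exact sn_le_one τ
  have R1 : RadBound om (fun p => α * mode (sconv (deriv κ) u) p.1) (K * (15 / 8 * E)) := by
    have := RadBound.of_fst (c := fun _ => 1) (φ := fun s => α * mode (sconv (deriv κ) u) s) omc omp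
      (by fun_prop) continuous_const (by simp) (ib _ _ (by fun_prop) hb1) zv
    simpa using this
  have R2 : RadBound om (fun p => sn p.2 * (α ^ 2 * mode (sconv (deriv (deriv κ)) u) p.1))
      (K * (100 * E)) :=
    RadBound.of_fst (φ := fun s => α ^ 2 * mode (sconv (deriv (deriv κ)) u) s) omc omp
      (by fun_prop) continuous_sn csn ((i2.const_mul (α ^ 4)).congr
        (Eventually.of_forall fun s => by simp only; ring)) zv'
  -- the orthogonal part solves the same equation, with the zero mode subtracted from the right-hand
  -- side
  have RH : RadBound om (fun p => perp (sconv κ u) p * 0 + (sconv κ y p -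
      α ^ 2 * perp (sconv (deriv (deriv κ)) u) p - 5 * α * perp (sconv (deriv κ) u) p))
      (2 * E + 2 * (K * (15 / 8 * E))) := by
    have R3 := RadBound.of_fst (φ := fun s => α ^ 2 * mode (sconv (deriv (deriv κ)) u) s +
      5 * α * mode (sconv (deriv κ) u) s) omc omp
      (by fun_prop) continuous_sn csn ih0 zh
    have R4 : RadBound om (sconv κ (rhs α u1 u2 y)) E := ⟨iH κ hκ, le_rfl⟩
    refine (R4.add R3 omc omp cH (by fun_prop)).mono omc omp (by fun_prop) fun p => le_of_eq ?_
    congr 1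
    rw [h.sconv_rhs hκ]; unfold perp; ring
  simp only [mul_zero, zero_add] at RH
  have hy0 := h.integrable_y hom hκ (iH κ hκ)
  have hy1 := h.integrable_y hom hκ1 (iH _ hκ1)
  have iY := RadBound.integrable_dens hy0 omc omp cy0
  have iY1 := RadBound.integrable_dens hy1 omc omp cy1
  have ce0 : Continuous fun p : ℝ × ℝ => 1 / 200 * ((sn p.2 * sconv κ w p) ^ 2 * sn p.2 ^ (1 - eta) +
      (perp (sconv κ u) p / sn p.2) ^ 2 * sn p.2 ^ (1 - eta)) := by
    have := (continuous_sn_rpow (1 - eta)).comp (continuous_snd (X := ℝ) (Y := ℝ))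
    simp only [Function.comp_def] at this
    exact continuous_const.mul ((Continuous.mul (by fun_prop) this).add
      (Continuous.mul (cq0.pow 2) this))
  have ce1 : Continuous fun p : ℝ × ℝ => 1 / 200 * ((sn p.2 * sconv (deriv κ) w p) ^ 2 *
      sn p.2 ^ (1 - eta) + (perp (sconv (deriv κ) u) p / sn p.2) ^ 2 * sn p.2 ^ (1 - eta)) := by
    have := (continuous_sn_rpow (1 - eta)).comp (continuous_snd (X := ℝ) (Y := ℝ))
    simp only [Function.comp_def] at this
    exact continuous_const.mul ((Continuous.mul (by fun_prop) this).add
      (Continuous.mul (cq1.pow 2) this))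
  have hnn : ∀ (a b : ℝ) (p : ℝ × ℝ), 0 ≤ 1 / 200 * (a ^ 2 * sn p.2 ^ (1 - eta) +
      b ^ 2 * sn p.2 ^ (1 - eta)) := fun a b p => by
    have := sn_rpow_pos (1 - eta) p.2
    positivity
  obtain ⟨G1, G2, -, G4⟩ := hom.energy hα0 hα cp0 cp1 cp2 cy0 cy1 ce0 ce1
    (hasDerivAt_perp c0 c1 B0 B1 d1) (hasDerivAt_perp c1 c2 B1 B2 d2)
    (hasDerivAt_sconv hκ h.cy)
    (B := max (max _ _) _) (fun p => (abs_perp_le B0 p).trans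
      ((le_max_left _ _).trans (le_max_left _ _))) (fun p => (abs_perp_le B1 p).trans
      ((le_max_right _ _).trans (le_max_left _ _))) (fun p => (abs_perp_le B2 p).trans
      (le_max_right _ _)) iY.1 iY1.1 (fun p => hnn _ _ p) (fun p => hnn _ _ p)
    (by
      filter_upwards [RadBound.ae_sqInt hy0 omp] with s hs
      exact (h.angSys hκ s).perp.coercive' hs (integral_rho_perp c0 B0 s))
    (by
      filter_upwards [RadBound.ae_sqInt hy1 omp] with s hs
      exact (h.angSys hκ1 s).perp.coercive' hs (integral_rho_perp c1 B1 s))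
  set Q := ∫ p : ℝ × ℝ, om p.1 * dens p.2 * (sconv κ y p -
      α ^ 2 * perp (sconv (deriv (deriv κ)) u) p - 5 * α * perp (sconv (deriv κ) u) p) ^ 2 with hQ
  have Qle : Q ≤ 5 * 10 ^ 6 * E + 2 * (4 * 10 ^ 6) * (K * E) := by
    have h1 := (RadBound.integrable_dens RH.1 omc omp (by fun_prop)).2
    have h2 := mul_le_mul_of_nonneg_left RH.2 (by norm_num [bigM] : (0 : ℝ) ≤ 1 + bigM)
    rw [← hQ] at h1
    have h3 : Q ≤ (1 + bigM) * (2 * E + 2 * (K * (15 / 8 * E))) := h1.trans h2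
    norm_num [bigM] at h3
    linarith
  have hpos : ∀ p : ℝ × ℝ, 0 < om p.1 * sn p.2 ^ (1 - eta) := fun p =>
    mul_pos (omp _) (sn_rpow_pos _ _)
  have S0 : RadBound om (fun p => perp (sconv κ u) p / sn p.2) (200 * Q) := by
    refine .of_le omc omp cq0 (G1.1.const_mul 200) (fun p => ?_)
      (by rw [integral_const_mul]; linarith [G1.2])
    have := mul_nonneg (hpos p).le (sq_nonneg (sn p.2 * sconv κ w p))
    linarith
  have S1 : RadBound om (fun p => α * (perp (sconv (deriv κ) u) p / sn p.2)) (12000 * Q) := by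
    refine .of_le omc omp (continuous_const.mul cq1) (G2.1.const_mul (200 * α ^ 2)) (fun p => ?_)
      (by rw [integral_const_mul]; linarith [G2.2])
    have := mul_nonneg (hpos p).le (sq_nonneg (α * (sn p.2 * sconv (deriv κ) w p)))
    linarith
  have S2 : RadBound om (fun p => α * (sn p.2 * sconv (deriv κ) w p)) (12000 * Q) := by
    refine .of_le omc omp (by fun_prop) (G2.1.const_mul (200 * α ^ 2)) (fun p => ?_)
      (by rw [integral_const_mul]; linarith [G2.2])
    have := mul_nonneg (hpos p).le (sq_nonneg (α * (perp (sconv (deriv κ) u) p / sn p.2)))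
    linarith
  have S3 : RadBound om (fun p => α ^ 2 * perp (sconv (deriv (deriv κ)) u) p) (60 * Q) :=
    ((RadBound.of_dens (hom.integrable_sq_of_bounded cp2 (abs_perp_le B2)) omc omp cp2
      le_rfl).const_mul (α ^ 2)).le (le_trans (le_of_eq (by ring)) G4)
  have T1 : RadBound om (fun p => α ^ 2 * sconv (deriv (deriv κ)) u p)
      (2 * (60 * Q) + 2 * (K * (100 * E))) := by
    refine (S3.add R2 omc omp (by fun_prop) (by fun_prop)).mono omc omp (by fun_prop) fun p =>
      le_of_eq ?_
    congr 1; unfold perp; ring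
  have cq : Continuous fun p : ℝ × ℝ => sconv (deriv κ) u p / sn p.2 :=
    c1.div (by fun_prop) fun p => (sn_pos p.2).ne'
  have T2 : RadBound om (fun p => α * (sconv (deriv κ) u p / sn p.2))
      (2 * (12000 * Q) + 2 * (K * (15 / 8 * E))) := by
    refine (S1.add R1 omc omp (by fun_prop) (by fun_prop)).mono omc omp (by fun_prop) fun p =>
      le_of_eq ?_
    congr 1; unfold perp; field_simp [(sn_pos p.2).ne']; ring
  have T4 : RadBound om (fun p => perp (sconv κ u) p / sn p.2 -
      α / 5 * mode (sconv (deriv κ) u) p.1) (2 * (200 * Q) + 2 * ((-1 / 5) ^ 2 * (K * (15 / 8 * E)))) := by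
    refine (S0.add (R1.const_mul (-1 / 5)) omc omp cq0 (by fun_prop)).mono omc omp (by fun_prop)
      fun p => le_of_eq ?_
    congr 1; ring
  have T5 : RadBound om (sconv κ y) (2 * E + 2 * (2 * (2 * (60 * Q) + 2 * (K * (100 * E))) +
      2 * (5 ^ 2 * (2 * (12000 * Q) + 2 * (K * (15 / 8 * E)))))) := by
    have T2' : RadBound om (fun p => α * sconv (deriv κ) u p) _ :=
      T2.mono omc omp (by fun_prop) fun p => by
        have h1 : α * sconv (deriv κ) u p = sn p.2 * (α * (sconv (deriv κ) u p / sn p.2)) := by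
          field_simp [(sn_pos p.2).ne']
        rw [h1, abs_mul]
        exact mul_le_of_le_one_left (abs_nonneg _) (csn _)
    have T0 : RadBound om (sconv κ (rhs α u1 u2 y)) E := ⟨iH κ hκ, le_rfl⟩
    refine (T0.add (T1.add (T2'.const_mul 5) omc omp (by fun_prop) (by fun_prop)) omc omp cH
      (by fun_prop)).mono omc omp cy0 fun p => le_of_eq ?_
    congr 1; rw [h.sconv_rhs hκ]; ring
  have T6 := T5.w_of_y omc omp cw0 fun s => ⟨_, h.angSys hκ s⟩
  refine ⟨T1.le ?_, T2.le ?_, S2.le ?_, T4.le ?_, T5.le ?_, T6.le ?_⟩ <;> rw [hbig] <;> linarith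

end radial
end PlaneSol

/-! ### Removal of the truncation of the radial weight -/

/-- The truncated radial weights `1 / (e^{as} + δ e^{bs})`, which increase to `e^{-as}` as
`δ → 0`. -/
def truncWeight (a b δ s : ℝ) : ℝ := (Real.exp (a * s) + δ * Real.exp (b * s))⁻¹

lemma radWeight_trunc {a b δ : ℝ} (ha : |a| ≤ 3) (hb : |b| ≤ 3) (hδ : 0 < δ)
    (h1 : ∀ s, min (Real.exp (-(a * s))) (Real.exp (-(b * s))) ≤ Real.exp (-(1 * |s|)))
    (h2 : ∀ s, Real.exp (-(a * s)) ≤ wt s) : ∃ om' om'', RadWeight (truncWeight a b δ) om' om'' := by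
  let D : ℝ → ℝ → ℝ → ℝ := fun x y s => x * Real.exp (a * s) + y * (δ * Real.exp (b * s))
  have Dc : ∀ x y, Continuous (D x y) := fun x y => by fun_prop
  have Dd : ∀ x y s, HasDerivAt (D x y) (D (x * a) (y * b) s) s := fun x y s => by
    have e1 : HasDerivAt (fun s => Real.exp (a * s)) (Real.exp (a * s) * a) s := by
      simpa using ((hasDerivAt_id s).const_mul a).exp
    have e2 : HasDerivAt (fun s => Real.exp (b * s)) (Real.exp (b * s) * b) s := by
      simpa using ((hasDerivAt_id s).const_mul b).exp
    refine ((e1.const_mul x).add ((e2.const_mul δ).const_mul y)).congr_deriv ?_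
    simp only [D]; ring
  have pos : ∀ s, 0 < D 1 1 s := fun s => by simp only [D]; positivity
  have bd : ∀ x y c s, |x| ≤ c → |y| ≤ c → |D x y s| ≤ c * D 1 1 s := fun x y c s hx hy => by
    simp only [D]
    refine (abs_add_le _ _).trans ?_
    rw [abs_mul, abs_mul, abs_of_pos (Real.exp_pos (a * s)),
      abs_of_pos (by positivity : 0 < δ * Real.exp (b * s))]
    have := mul_le_mul_of_nonneg_right hx (Real.exp_pos (a * s)).le
    have := mul_le_mul_of_nonneg_right hy (by positivity : 0 ≤ δ * Real.exp (b * s))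
    linarith
  have eo : ∀ s, truncWeight a b δ s = (D 1 1 s)⁻¹ := fun s => by simp [truncWeight, D]
  have b1 : ∀ s, |D a b s| ≤ 3 * D 1 1 s := fun s => bd _ _ _ s ha hb
  have b2 : ∀ s, |D (a * a) (b * b) s| ≤ 9 * D 1 1 s := fun s => by
    refine bd _ _ _ s ?_ ?_ <;> rw [abs_mul] <;>
    nlinarith [abs_nonneg a, abs_nonneg b]
  have d1 : ∀ s, HasDerivAt (truncWeight a b δ) (-D a b s / D 1 1 s ^ 2) s := fun s => by
    have := (Dd 1 1 s).inv (pos s).ne'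
    rw [one_mul, one_mul] at this
    refine this.congr_of_eventuallyEq (Eventually.of_forall fun x => eo x)
  have le1 : ∀ s, truncWeight a b δ s ≤ Real.exp (-(a * s)) := fun s => by
    rw [eo, Real.exp_neg]
    refine inv_anti₀ (Real.exp_pos _) ?_
    have : 0 < δ * Real.exp (b * s) := by positivity
    simp only [D]; linarith
  have le2 : ∀ s, truncWeight a b δ s ≤ δ⁻¹ * Real.exp (-(b * s)) := fun s => by
    rw [eo, Real.exp_neg, ← mul_inv]
    refine inv_anti₀ (by positivity) ?_
    have : 0 < Real.exp (a * s) := by positivity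
    simp only [D]; linarith
  have tpos : ∀ s, 0 < truncWeight a b δ s := fun s => by rw [eo]; exact inv_pos.2 (pos s)
  have tcont : Continuous (truncWeight a b δ) :=
    continuous_iff_continuousAt.2 fun s => (d1 s).continuousAt
  refine ⟨fun s => -D a b s / D 1 1 s ^ 2, fun s => (2 * D a b s ^ 2 - D (a * a) (b * b) s * D 1 1 s) /
    D 1 1 s ^ 3, d1, fun s => ?_, ?_, tpos, fun s => ?_, fun s => ?_, ?_, fun s => (le1 s).trans (h2 s)⟩
  · refine (((Dd a b s).neg).div ((Dd 1 1 s).pow 2) (pow_pos (pos s) 2).ne').congr_deriv ?_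
    simp only [Pi.pow_apply, Pi.neg_apply, one_mul]
    field_simp [(pos s).ne']; ring
  · exact Continuous.div (by fun_prop) (by fun_prop) fun s => (pow_pos (pos s) 3).ne'
  · rw [eo, abs_div, abs_neg, abs_of_pos (pow_pos (pos s) 2), div_le_iff₀ (pow_pos (pos s) 2)]
    refine (b1 s).trans (le_of_eq ?_)
    field_simp [(pos s).ne']
  · rw [eo, abs_div, abs_of_pos (pow_pos (pos s) 3), div_le_iff₀ (pow_pos (pos s) 3)]
    have e : 27 * (D 1 1 s)⁻¹ * D 1 1 s ^ 3 = 27 * D 1 1 s ^ 2 := by field_simp [(pos s).ne']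
    rw [e]
    refine (abs_sub _ _).trans ?_
    rw [abs_mul, abs_mul, abs_pow, abs_of_pos (pos s), abs_of_pos (two_pos)]
    have h3 := mul_le_mul_of_nonneg_right (b2 s) (pos s).le
    have h4 := pow_le_pow_left₀ (abs_nonneg _) (b1 s) 2
    nlinarith
  · refine ((integrable_exp_neg_mul_abs one_pos).const_mul (1 + δ⁻¹)).mono'
      tcont.aestronglyMeasurable (Eventually.of_forall fun s => ?_)
    rw [Real.norm_of_nonneg (tpos s).le]
    have hδ' := inv_pos.2 hδ
    refine le_trans ?_ (mul_le_mul_of_nonneg_left (h1 s) (by positivity))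
    rcases le_total (Real.exp (-(a * s))) (Real.exp (-(b * s))) with h | h
    · rw [min_eq_left h]
      refine (le1 s).trans ?_
      nlinarith [Real.exp_pos (-(a * s))]
    · rw [min_eq_right h]
      refine (le2 s).trans ?_
      nlinarith [Real.exp_pos (-(b * s))]

/-- The limit `δ → 0` of the estimates with truncated weights, by Fatou's lemma. -/
lemma lintegral_exp_le_of_radBound {X H : ℝ × ℝ → ℝ} (hX : Continuous X) {c : ℝ} (hc : 0 ≤ c)
    (h : ∀ om om' om'', RadWeight om om' om'' →
      Integrable (fun p : ℝ × ℝ => om p.1 * sn p.2 ^ (1 - eta) * H p ^ 2) ∧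
      RadBound om X (c * ∫ p : ℝ × ℝ, om p.1 * sn p.2 ^ (1 - eta) * H p ^ 2)) {a b : ℝ}
    (ha : |a| ≤ 3) (hb : |b| ≤ 3)
    (h1 : ∀ s, min (Real.exp (-(a * s))) (Real.exp (-(b * s))) ≤ Real.exp (-(1 * |s|)))
    (h2 : ∀ s, Real.exp (-(a * s)) ≤ wt s) :
    ∫⁻ p : ℝ × ℝ, ENNReal.ofReal (X p ^ 2 * (Real.exp (-(a * p.1)) * sn p.2 ^ (1 - eta))) ≤
      ENNReal.ofReal c * wsq eta H := by
  have hsn : Continuous fun p : ℝ × ℝ => sn p.2 ^ (1 - eta) :=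
    (continuous_sn_rpow (1 - eta)).comp continuous_snd
  have hpos : ∀ n : ℕ, (0 : ℝ) < 1 / ((n : ℝ) + 1) := fun n => Nat.one_div_pos_of_nat
  refine lintegral_le_of_tendsto (f := fun (n : ℕ) p => ENNReal.ofReal
    (truncWeight a b (1 / ((n : ℝ) + 1)) p.1 * sn p.2 ^ (1 - eta) * X p ^ 2)) (fun n => ?_)
    (fun n => ?_) (Eventually.of_forall fun p => ?_)
  · obtain ⟨_, _, hom⟩ := radWeight_trunc ha hb (hpos n) h1 h2
    exact (continuous_radial_mul_sq hom.continuous hX).measurable.ennreal_ofReal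
  · obtain ⟨_, _, hom⟩ := radWeight_trunc ha hb (hpos n) h1 h2
    obtain ⟨iH, iX, hle⟩ := h _ _ _ hom
    have nn : ∀ (f : ℝ × ℝ → ℝ) (p : ℝ × ℝ), 0 ≤ truncWeight a b (1 / ((n : ℝ) + 1)) p.1 *
        sn p.2 ^ (1 - eta) * f p ^ 2 := fun f p =>
      mul_nonneg (mul_pos (hom.pos _) (sn_rpow_pos _ _)).le (sq_nonneg _)
    rw [← ofReal_integral_eq_lintegral_ofReal iX (Eventually.of_forall (nn X))]
    refine (ENNReal.ofReal_le_ofReal hle).trans ?_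
    rw [ENNReal.ofReal_mul hc, ofReal_integral_eq_lintegral_ofReal iH (Eventually.of_forall (nn H))]
    refine mul_le_mul_right (lintegral_mono fun p => ENNReal.ofReal_le_ofReal ?_) _
    rw [mul_comm (H p ^ 2)]
    exact mul_le_mul_of_nonneg_right (mul_le_mul_of_nonneg_right (hom.le _) (sn_rpow_pos _ _).le)
      (sq_nonneg _)
  · refine ENNReal.tendsto_ofReal ?_
    have t : Tendsto (fun n : ℕ => truncWeight a b (1 / ((n : ℝ) + 1)) p.1) atTop
        (𝓝 (Real.exp (a * p.1) + 0 * Real.exp (b * p.1))⁻¹) := by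
      refine Tendsto.inv₀ ?_ (by simp)
      exact tendsto_const_nhds.add (tendsto_one_div_add_atTop_nhds_zero_nat.mul_const _)
    have := (t.mul_const (sn p.2 ^ (1 - eta))).mul_const (X p ^ 2)
    rw [zero_mul, add_zero, ← Real.exp_neg] at this
    rwa [mul_comm (X p ^ 2)]

/-- The weight `wt` is the sum of `e^{-3s}` and `e^s`, each of which is a limit of admissible weights. -/
lemma wsq_le_of_radBound {X H : ℝ × ℝ → ℝ} (hX : Continuous X) {c : ℝ} (hc : 0 ≤ c)
    (h : ∀ om om' om'', RadWeight om om' om'' →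
      Integrable (fun p : ℝ × ℝ => om p.1 * sn p.2 ^ (1 - eta) * H p ^ 2) ∧
      RadBound om X (c * ∫ p : ℝ × ℝ, om p.1 * sn p.2 ^ (1 - eta) * H p ^ 2)) :
    wsq eta X ≤ ENNReal.ofReal (2 * c) * wsq eta H := by
  have A := lintegral_exp_le_of_radBound hX hc h (a := 3) (b := -1) (by norm_num) (by norm_num)
    (fun s => by
      rcases le_total 0 s with hs | hs
      · exact (min_le_left _ _).trans (Real.exp_le_exp.2 (by rw [abs_of_nonneg hs]; linarith))
      · exact (min_le_right _ _).trans (Real.exp_le_exp.2 (by rw [abs_of_nonpos hs]; linarith)))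
    (fun s => by unfold wt; rw [neg_mul]; linarith [Real.exp_pos s])
  have B := lintegral_exp_le_of_radBound hX hc h (a := -1) (b := 1) (by norm_num) (by norm_num)
    (fun s => by
      rcases le_total 0 s with hs | hs
      · exact (min_le_right _ _).trans (Real.exp_le_exp.2 (by rw [abs_of_nonneg hs]))
      · exact (min_le_left _ _).trans (Real.exp_le_exp.2 (by rw [abs_of_nonpos hs]; linarith)))
    (fun s => by unfold wt; rw [neg_mul, neg_neg, one_mul]; linarith [Real.exp_pos (-3 * s)])
  have hsn : Continuous fun p : ℝ × ℝ => sn p.2 ^ (1 - eta) :=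
    (continuous_sn_rpow (1 - eta)).comp continuous_snd
  have e : wsq eta X = (∫⁻ p : ℝ × ℝ,
      ENNReal.ofReal (X p ^ 2 * (Real.exp (-(3 * p.1)) * sn p.2 ^ (1 - eta)))) +
      ∫⁻ p : ℝ × ℝ, ENNReal.ofReal (X p ^ 2 * (Real.exp (-(-1 * p.1)) * sn p.2 ^ (1 - eta))) := by
    unfold wsq
    rw [← lintegral_add_left (by fun_prop : Continuous fun p : ℝ × ℝ =>
      X p ^ 2 * (Real.exp (-(3 * p.1)) * sn p.2 ^ (1 - eta))).measurable.ennreal_ofReal]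
    refine lintegral_congr fun p => ?_
    have := sn_rpow_pos (1 - eta) p.2
    rw [← ENNReal.ofReal_add (by positivity) (by positivity)]
    congr 1
    unfold wgt wt
    rw [show -(-1 * p.1) = p.1 by ring, show -3 * p.1 = -(3 * p.1) by ring]; ring
  rw [e, ENNReal.ofReal_mul (by norm_num), ENNReal.ofReal_ofNat]
  calc _ ≤ ENNReal.ofReal c * wsq eta H + ENNReal.ofReal c * wsq eta H := add_le_add A B
    _ = _ := by ring

/-! ### The operator `L₁₂` -/

lemma integrable_mul_rho_mul {a : ℝ → ℝ} {F : ℝ × ℝ → ℝ} (hF : Continuous F) (hFw : wsq eta F < ⊤)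
    (ham : Measurable a) (ha : Integrable fun x => a x ^ 2 / wt x) :
    Integrable fun p : ℝ × ℝ => a p.1 * (rho p.2 * F p) := by
  have iF : Integrable fun p : ℝ × ℝ => F p ^ 2 * wgt eta p :=
    ⟨(by fun_prop : Continuous _).aestronglyMeasurable, by
      rw [hasFiniteIntegral_iff_ofReal (Eventually.of_forall fun p =>
        mul_nonneg (sq_nonneg _) (wgt_pos _ _).le)]; exact hFw⟩
  have ia : Integrable fun p : ℝ × ℝ => a p.1 ^ 2 / wt p.1 * (sn p.2 ^ 3 * co p.2) := by
    rw [Measure.volume_eq_prod]; exact ha.mul_prod integrable_sn_cube_co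
  refine (integrable_fun_add ia iF).mono'
    ((ham.comp measurable_fst).mul (by fun_prop : Continuous _).measurable).aestronglyMeasurable
    (Eventually.of_forall fun p => ?_)
  have hw := wt_pos p.1
  have key : ∀ b, 2 * (a p.1 * (rho p.2 * b)) ≤ a p.1 ^ 2 / wt p.1 * (sn p.2 ^ 3 * co p.2) +
      b ^ 2 * wgt eta p := fun b => by
    have := mul_le_mul_of_nonneg_left (rho_mul_le p.2 (a p.1 / wt p.1) b) hw.le
    have e1 : wt p.1 * (2 * (a p.1 / wt p.1 * (rho p.2 * b))) = 2 * (a p.1 * (rho p.2 * b)) := by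
      field_simp
    have e2 : wt p.1 * ((a p.1 / wt p.1) ^ 2 * (sn p.2 ^ 3 * co p.2) + b ^ 2 * sn p.2 ^ (1 - eta)) =
        a p.1 ^ 2 / wt p.1 * (sn p.2 ^ 3 * co p.2) + b ^ 2 * wgt eta p := by
      unfold wgt; field_simp
    rwa [e1, e2] at this
  have k1 := key (F p)
  have k2 := key (-F p)
  rw [neg_sq] at k2
  have := mul_nonneg (div_nonneg (sq_nonneg (a p.1)) hw.le)
    (mul_pos (pow_pos (sn_pos p.2) 3) (co_pos p.2)).le
  have := mul_nonneg (sq_nonneg (F p)) (wgt_pos eta p).le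
  rw [Real.norm_eq_abs, abs_le]; constructor <;> linarith

/-- The operator `L₁₂` in the coordinates `R = e^s`, `θ = ang τ`. The factor is `4/5 = (3/2) · (8/15)`,
since `3 sin θ cos² θ dθ = (3/2) rho dτ` and `mode` is normalized by `15/8`. -/
def ell (F : ℝ × ℝ → ℝ) (s : ℝ) : ℝ := 4 / 5 * ∫ x in Ioi s, mode F x

section ell

variable {F : ℝ × ℝ → ℝ} {κ : ℝ → ℝ}

lemma integrable_exp_div_wt (s : ℝ) : Integrable fun x => (Ioi s).indicator (fun _ => (1 : ℝ)) x ^ 2 / wt x := by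
  have h1 : Integrable fun x => (Ioi s).indicator (fun x => Real.exp (-x)) x :=
    (integrable_indicator_iff measurableSet_Ioi).2 (integrableOn_exp_neg_Ioi s)
  refine h1.mono' ?_ (Eventually.of_forall fun x => ?_)
  · exact (((measurable_const.indicator measurableSet_Ioi).pow_const 2).div
      continuous_wt.measurable).aestronglyMeasurable
  · by_cases hx : x ∈ Ioi s
    · simp only [indicator_of_mem hx, one_pow]
      rw [Real.norm_of_nonneg (by have := wt_pos x; positivity), Real.exp_neg, ← one_div]
      refine one_div_le_one_div_of_le (Real.exp_pos _) ?_
      unfold wt; linarith [Real.exp_pos (-3 * x)]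
    · simp [indicator_of_notMem hx]

lemma integrableOn_mode (hF : Continuous F) (hFw : wsq eta F < ⊤) (s : ℝ) :
    IntegrableOn (mode F) (Ioi s) := by
  have := integrable_mul_rho_mul hF hFw (measurable_const.indicator measurableSet_Ioi)
    (integrable_exp_div_wt s)
  rw [Measure.volume_eq_prod] at this
  have h2 := this.integral_prod_left.const_mul (15 / 8)
  rw [← integrable_indicator_iff measurableSet_Ioi]
  refine h2.congr (Eventually.of_forall fun x => ?_)
  simp only [integral_const_mul]
  by_cases hx : x ∈ Ioi s
  · simp only [indicator_of_mem hx, one_mul]; rfl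
  · simp only [indicator_of_notMem hx, zero_mul, mul_zero]

lemma mode_sconv (hF : Continuous F) (hFw : wsq eta F < ⊤) (hκ : IsKernel κ) (s : ℝ) :
    mode (sconv κ F) s = ∫ x, κ x * mode F (s - x) := by
  have hκc := hκ.continuous
  have hcs : HasCompactSupport fun x => κ (s - x) :=
    hκ.hasCompactSupport.comp_homeomorph (Homeomorph.subLeft s)
  have ia : Integrable fun x => κ (s - x) ^ 2 / wt x := by
    refine Continuous.integrable_of_hasCompactSupport ?_ ?_
    · exact Continuous.div (by fun_prop) continuous_wt fun x => (wt_pos x).ne'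
    · refine hcs.mono fun x hx h0 => hx ?_
      simp only at h0 ⊢
      rw [h0]; simp
  have i := integrable_mul_rho_mul hF hFw (by fun_prop : Continuous fun x => κ (s - x)).measurable ia
  rw [Measure.volume_eq_prod] at i
  have sw := integral_integral_swap (f := fun x τ => κ (s - x) * (rho τ * F (x, τ))) i
  unfold mode
  have e1 : ∀ τ, rho τ * sconv κ F (s, τ) = ∫ x, κ (s - x) * (rho τ * F (x, τ)) := fun τ => by
    unfold sconv
    rw [← integral_const_mul, ← integral_sub_left_eq_self _ volume s]
    congr 1; ext x; simp only [sub_sub_cancel]; ring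
  simp_rw [e1]
  rw [← sw, ← integral_const_mul, ← integral_sub_left_eq_self _ volume s]
  congr 1; ext x
  rw [integral_const_mul]; simp only [sub_sub_cancel]; ring

lemma intervalIntegrable_mode (hF : Continuous F) (hFw : wsq eta F < ⊤) (a b : ℝ) :
    IntervalIntegrable (mode F) volume a b := by
  rw [intervalIntegrable_iff]
  exact (integrableOn_mode hF hFw (min a b)).mono_set fun x hx => hx.1

lemma integral_Ioi_mode (hF : Continuous F) (hFw : wsq eta F < ⊤) (s : ℝ) :
    ∫ x in Ioi s, mode F x = (∫ x in Ioi 0, mode F x) - ∫ x in (0 : ℝ)..s, mode F x := by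
  rw [← intervalIntegral.integral_Ioi_sub_Ioi' (integrableOn_mode hF hFw 0)
    (integrableOn_mode hF hFw s)]; ring

lemma continuous_integral_Ioi_mode (hF : Continuous F) (hFw : wsq eta F < ⊤) :
    Continuous fun s => ∫ x in Ioi s, mode F x := by
  rw [funext (integral_Ioi_mode hF hFw)]
  exact continuous_const.sub (intervalIntegral.continuous_primitive (intervalIntegrable_mode hF hFw) 0)

lemma continuous_ell (hF : Continuous F) (hFw : wsq eta F < ⊤) : Continuous (ell F) :=
  continuous_const.mul (continuous_integral_Ioi_mode hF hFw)

lemma tendsto_ell (hF : Continuous F) (hFw : wsq eta F < ⊤) : Tendsto (ell F) atTop (𝓝 0) := by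
  have := intervalIntegral_tendsto_integral_Ioi 0 (integrableOn_mode hF hFw 0) tendsto_id
  have h2 := (this.const_sub (∫ x in Ioi 0, mode F x)).const_mul (4 / 5)
  rw [sub_self, mul_zero] at h2
  refine h2.congr fun s => ?_
  unfold ell
  rw [integral_Ioi_mode hF hFw s]; rfl

/-- The derivative of `ell F` is `-4/5 · mode F`, tested against a kernel. -/
lemma integral_deriv_mul_ell (hF : Continuous F) (hFw : wsq eta F < ⊤) (hκ : IsKernel κ) (s : ℝ) :
    ∫ x, deriv κ x * ell F (s - x) = -(4 / 5 * mode (sconv κ F) s) := by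
  have hm := intervalIntegrable_mode hF hFw
  have hli : LocallyIntegrable (fun x => mode F (s - x)) := by
    have h0 : LocallyIntegrable (mode F) := by
      refine locallyIntegrable_iff.2 fun K hK => ?_
      obtain ⟨b, hb⟩ := hK.bddBelow
      exact (integrableOn_mode hF hFw (b - 1)).mono_set fun x hx =>
        lt_of_lt_of_le (by linarith) (hb hx)
    refine locallyIntegrable_iff.2 fun K hK => ?_
    have h1 := h0.integrableOn_isCompact (hK.image (f := fun x => s - x) (by fun_prop))
    have h2 : (fun x => s - x) ⁻¹' ((fun x => s - x) '' K) = K :=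
      preimage_image_eq K sub_right_injective
    have mp : MeasurePreserving (fun x : ℝ => s - x) volume volume :=
      Measure.measurePreserving_sub_left volume s
    have := (mp.integrableOn_comp_preimage (Homeomorph.subLeft s).measurableEmbedding).2 h1
    rwa [h2] at this
  have hψ : ∀ x, ell F (s - x) = ell F s + 4 / 5 * ∫ t in (0 : ℝ)..x, mode F (s - t) := fun x => by
    rw [intervalIntegral.integral_comp_sub_left]
    unfold ell
    rw [integral_Ioi_mode hF hFw (s - x), integral_Ioi_mode hF hFw s,
      ← intervalIntegral.integral_add_adjacent_intervals (hm 0 (s - x)) (hm (s - x) s), sub_zero]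
    ring
  have ac1 : AbsolutelyContinuousOnInterval κ (-2) 2 :=
    (hκ.smooth.of_le (by exact_mod_cast le_top)).contDiffOn.absolutelyContinuousOnInterval
  have hii : IntervalIntegrable (fun x => mode F (s - x)) volume (-2) 2 :=
    intervalIntegrable_iff.2 ((hli.integrableOn_isCompact isCompact_uIcc).mono_set uIoc_subset_uIcc)
  have ac2 : AbsolutelyContinuousOnInterval (fun x => ∫ t in (0 : ℝ)..x, mode F (s - t)) (-2) 2 :=
    hii.absolutelyContinuousOnInterval_intervalIntegral (by rw [uIcc_of_le (by norm_num)]; norm_num)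
  have ibp := ac1.integral_mul_deriv_eq_deriv_mul ac2
  have k1 : κ 2 = 0 := hκ.supp _ (by norm_num)
  have k2 : κ (-2) = 0 := hκ.supp _ (by norm_num)
  rw [k1, k2] at ibp
  have full : ∀ κ g : ℝ → ℝ, IsKernel κ → ∫ x in (-2 : ℝ)..2, κ x * g x = ∫ x, κ x * g x :=
    fun κ g hκ => intervalIntegral.integral_eq_integral_of_support_subset fun x hx => by
      by_contra hx'
      refine hx ?_
      simp only
      rw [hκ.supp x, zero_mul]
      by_contra h1
      have := abs_le.1 (not_lt.1 h1)
      exact hx' ⟨by linarith, by linarith⟩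
  have ae : ∫ x, κ x * deriv (fun x => ∫ t in (0 : ℝ)..x, mode F (s - t)) x =
      mode (sconv κ F) s := by
    rw [mode_sconv hF hFw hκ]
    refine integral_congr_ae ?_
    filter_upwards [_root_.LocallyIntegrable.ae_hasDerivAt_integral hli] with x hx
    rw [(hx 0).deriv]
  rw [full _ _ hκ, full _ _ hκ.deriv, ae] at ibp
  have cI : Continuous fun x => ∫ t in (0 : ℝ)..x, mode F (s - t) := by
    refine intervalIntegral.continuous_primitive (fun a b => ?_) 0
    exact intervalIntegrable_iff.2
      ((hli.integrableOn_isCompact isCompact_uIcc).mono_set uIoc_subset_uIcc)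
  have e : ∀ x, deriv κ x * ell F (s - x) = ell F s * deriv κ x +
      4 / 5 * (deriv κ x * ∫ t in (0 : ℝ)..x, mode F (s - t)) := fun x => by rw [hψ]; ring
  simp_rw [e]
  have z : ∫ x, deriv κ x = 0 := integral_eq_zero_of_hasDerivAt_of_integrable hκ.hasDerivAt
    hκ.deriv.integrable hκ.integrable
  rw [integral_add (hκ.deriv.integrable.const_mul _) ((hκ.deriv.integrable_mul cI).const_mul _),
    integral_const_mul, integral_const_mul, z]
  linarith

end ell

namespace PlaneSol

variable {u u1 u2 w y : ℝ × ℝ → ℝ} {κ : ℝ → ℝ} {α : ℝ}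

lemma integrable_rhs {om om' om'' : ℝ → ℝ} (h : PlaneSol u u1 u2 w y)
    (hom : RadWeight om om' om'') (hF : wsq eta (rhs α u1 u2 y) < ⊤) (hκ : IsKernel κ) :
    Integrable fun p : ℝ × ℝ =>
      om p.1 * sn p.2 ^ (1 - eta) * sconv κ (rhs α u1 u2 y) p ^ 2 := by
  have cH := continuous_sconv hκ (h.continuous_rhs α)
  refine ⟨(continuous_radial_mul_sq hom.continuous cH).aestronglyMeasurable, ?_⟩
  rw [hasFiniteIntegral_iff_ofReal (Eventually.of_forall fun p =>
    mul_nonneg (mul_pos (hom.pos _) (sn_rpow_pos _ _)).le (sq_nonneg _))]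
  have hfin : wsq eta (sconv κ (rhs α u1 u2 y)) < ⊤ :=
    (wsq_sconv_le hκ (h.continuous_rhs α).measurable eta_pos.le (by linarith [eta_lt_one])).trans_lt
      (ENNReal.mul_lt_top (ENNReal.mul_lt_top (ENNReal.pow_lt_top ENNReal.ofReal_lt_top)
        ENNReal.ofReal_lt_top) hF)
  refine lt_of_le_of_lt (lintegral_mono fun p => ENNReal.ofReal_le_ofReal ?_) hfin
  rw [mul_comm (sconv κ (rhs α u1 u2 y) p ^ 2)]
  exact mul_le_mul_of_nonneg_right (mul_le_mul_of_nonneg_right (hom.le _) (sn_rpow_pos _ _).le)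
    (sq_nonneg _)

lemma tendsto_mode_sconv (h : PlaneSol u u1 u2 w y) (hκ : IsKernel κ) :
    Tendsto (mode (sconv κ u)) Filter.atTop (𝓝 0) := by
  rw [Metric.tendsto_atTop]
  intro ε hε
  set c := 15 / 8 * ((∫ τ, rho τ) * ∫ x, |κ x|) with hc
  have hc0 : 0 ≤ c := mul_nonneg (by norm_num) (mul_nonneg (integral_nonneg fun τ => (rho_pos τ).le)
    (integral_nonneg fun x => abs_nonneg _))
  obtain ⟨S, hS⟩ := h.decay (ε / (c + 1)) (by positivity)
  refine ⟨S + 1, fun s hs => ?_⟩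
  rw [Real.dist_eq, sub_zero]
  refine (abs_mode_le fun τ => abs_sconv_le_of_ge hκ hS hs τ).trans_lt ?_
  have e : 15 / 8 * ((∫ τ, rho τ) * ((∫ x, |κ x|) * (ε / (c + 1)))) = c * (ε / (c + 1)) := by
    rw [hc]; ring
  rw [e, mul_div_assoc', div_lt_iff₀ (by positivity)]
  nlinarith

/-- The zero mode equation, integrated once: `α p' + 5 p = 5/(4α) L₁₂`. -/
lemma mode_sub_ell (h : PlaneSol u u1 u2 w y) (hα0 : 0 < α)
    (hF : wsq eta (rhs α u1 u2 y) < ⊤) (hκ : IsKernel κ) (s : ℝ) :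
    mode (sconv κ u) s - 1 / (4 * α) * ∫ x, κ x * ell (rhs α u1 u2 y) (s - x) =
      -(α / 5 * mode (sconv (deriv κ) u) s) := by
  obtain ⟨B, hB⟩ := h.bdd
  have cF := h.continuous_rhs α
  have hκ1 := hκ.deriv
  have hκ2 := hκ1.deriv
  have c0 := continuous_sconv hκ h.cu
  have c1 := continuous_sconv hκ1 h.cu
  have c2 := continuous_sconv hκ2 h.cu
  have B0 := abs_sconv_le hκ hB
  have B1 := abs_sconv_le hκ1 hB
  have B2 := abs_sconv_le hκ2 hB
  have cl := continuous_ell cF hF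
  let ℓ : ℝ × ℝ → ℝ := fun p => ell (rhs α u1 u2 y) p.1
  have cℓ : Continuous ℓ := cl.comp continuous_fst
  let G : ℝ → ℝ := fun s => α * mode (sconv (deriv κ) u) s + 5 * mode (sconv κ u) s -
    5 / (4 * α) * sconv κ ℓ (s, 0)
  let G' : ℝ → ℝ := fun s => α * mode (sconv (deriv (deriv κ)) u) s +
    5 * mode (sconv (deriv κ) u) s - 5 / (4 * α) * sconv (deriv κ) ℓ (s, 0)
  have dG : ∀ s, HasDerivAt G (G' s) s := fun s =>
    (((hasDerivAt_mode c1 c2 B1 B2 (hasDerivAt_sconv hκ1 h.cu) s).const_mul α).add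
      ((hasDerivAt_mode c0 c1 B0 B1 (hasDerivAt_sconv hκ h.cu) s).const_mul 5)).sub
      ((hasDerivAt_sconv hκ cℓ s 0).const_mul _)
  have cG' : Continuous G' := by
    have := continuous_mode c2 B2
    have := continuous_mode c1 B1
    have := continuous_sconv hκ1 cℓ
    fun_prop
  obtain ⟨_, _, hom⟩ := radWeight_trunc (a := -1) (b := 1) (δ := 1) (by norm_num) (by norm_num)
    one_pos (fun s => by
      rcases le_total 0 s with hs | hs
      · exact (min_le_right _ _).trans (Real.exp_le_exp.2 (by rw [abs_of_nonneg hs]))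
      · exact (min_le_left _ _).trans (Real.exp_le_exp.2 (by rw [abs_of_nonpos hs]; linarith)))
    (fun s => by unfold wt; rw [neg_mul, neg_neg, one_mul]; linarith [Real.exp_pos (-3 * s)])
  have iH := h.integrable_rhs hom hF hκ
  -- `G` has zero derivative and vanishes at infinity
  have G'0 : G' = fun _ => 0 := by
    refine (cG'.ae_eq_iff_eq volume continuous_const).1 ?_
    filter_upwards [h.ae_mode_eq hom hκ iH] with s hs
    have e : sconv (deriv κ) ℓ (s, 0) = -(4 / 5 * mode (sconv κ (rhs α u1 u2 y)) s) :=
      integral_deriv_mul_ell cF hF hκ s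
    simp only [G']
    rw [e]
    have : α * (α * mode (sconv (deriv (deriv κ)) u) s + 5 * mode (sconv (deriv κ) u) s) =
      -mode (sconv κ (rhs α u1 u2 y)) s := by rw [← hs]; ring
    refine mul_left_cancel₀ hα0.ne' ?_
    have h2 : α * (5 / (4 * α) * -(4 / 5 * mode (sconv κ (rhs α u1 u2 y)) s)) =
      -mode (sconv κ (rhs α u1 u2 y)) s := by field_simp
    rw [mul_sub, this, h2]; ring
  have Gt : Tendsto G Filter.atTop (𝓝 0) := by
    have t1 := (h.tendsto_mode_sconv hκ1).const_mul α
    have t2 := (h.tendsto_mode_sconv hκ).const_mul 5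
    have t3 : Tendsto (fun s => sconv κ ℓ (s, 0)) Filter.atTop (𝓝 0) := by
      rw [Metric.tendsto_atTop]
      intro ε hε
      set c := ∫ x, |κ x| with hc
      have hc0 : 0 ≤ c := integral_nonneg fun x => abs_nonneg _
      obtain ⟨S, hS⟩ := (Metric.tendsto_atTop.1 (tendsto_ell cF hF)) (ε / (c + 1)) (by positivity)
      refine ⟨S + 1, fun s hs => ?_⟩
      rw [Real.dist_eq, sub_zero]
      refine (abs_sconv_le_of_ge hκ (ε := ε / (c + 1)) (fun s hs τ => ?_) hs 0).trans_lt ?_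
      · have := hS s hs
        rw [Real.dist_eq, sub_zero] at this
        exact this.le
      · rw [← hc, mul_div_assoc', div_lt_iff₀ (by positivity)]
        nlinarith
    have := (t1.add t2).sub (t3.const_mul (5 / (4 * α)))
    simpa using this
  have Gc : ∀ x, G x = G s := fun x => is_const_of_deriv_eq_zero
    (fun x => (dG x).differentiableAt) (fun x => by rw [(dG x).deriv, G'0]) x s
  have Gs : G s = 0 := tendsto_nhds_unique (tendsto_const_nhds.congr fun x => (Gc x).symm) Gt
  have e : sconv κ ℓ (s, 0) = ∫ x, κ x * ell (rhs α u1 u2 y) (s - x) := rfl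
  simp only [G] at Gs
  rw [e] at Gs
  have e2 : 5 / (4 * α) * ∫ x, κ x * ell (rhs α u1 u2 y) (s - x) =
    5 * (1 / (4 * α) * ∫ x, κ x * ell (rhs α u1 u2 y) (s - x)) := by ring
  linarith

/-- The part of the solution that is left after subtracting its singular part
`(4α)⁻¹ sin 2θ L₁₂(F)`. -/
def regular (α : ℝ) (u : ℝ × ℝ → ℝ) (F : ℝ × ℝ → ℝ) (p : ℝ × ℝ) : ℝ :=
  u p - 1 / (4 * α) * (sn p.2 * ell F p.1)

lemma continuous_regular (h : PlaneSol u u1 u2 w y) (hF : wsq eta (rhs α u1 u2 y) < ⊤) :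
    Continuous (regular α u (rhs α u1 u2 y)) := by
  have := continuous_ell (h.continuous_rhs α) hF
  have := h.cu
  unfold regular; fun_prop

/-- After mollification, the regular part is the orthogonal part of `u` minus `(α / 5) p' sn`. -/
lemma sconv_regular (h : PlaneSol u u1 u2 w y) (hα0 : 0 < α)
    (hF : wsq eta (rhs α u1 u2 y) < ⊤) (hκ : IsKernel κ) (p : ℝ × ℝ) :
    sconv κ (regular α u (rhs α u1 u2 y)) p / sn p.2 =
      perp (sconv κ u) p / sn p.2 - α / 5 * mode (sconv (deriv κ) u) p.1 := by
  have cl := continuous_ell (h.continuous_rhs α) hF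
  have cu := h.cu
  have e1 : regular α u (rhs α u1 u2 y) =
      fun p => u p - 1 / (4 * α) * sn p.2 * ell (rhs α u1 u2 y) p.1 := by
    ext p; unfold regular; ring
  have e2 : sconv κ (fun p => ell (rhs α u1 u2 y) p.1) p =
    ∫ x, κ x * ell (rhs α u1 u2 y) (p.1 - x) := rfl
  have e3 := h.mode_sub_ell hα0 hF hκ p.1
  rw [e1, sconv_sub hκ (f := u) (g := fun p => 1 / (4 * α) * sn p.2 * ell (rhs α u1 u2 y) p.1) cu
    (by fun_prop), sconv_mul (fun τ => 1 / (4 * α) * sn τ)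
    (fun p => ell (rhs α u1 u2 y) p.1), e2]
  have hs := (sn_pos p.2).ne'
  have e4 : perp (sconv κ u) p / sn p.2 = sconv κ u p / sn p.2 - mode (sconv κ u) p.1 := by
    unfold perp; field_simp
  rw [e4, sub_div, mul_right_comm, mul_div_cancel_right₀ _ hs]
  linarith

/-- The estimates for the radially mollified solution, in the space with angular exponent `η`. The
constant does not depend on the mollifier. -/
theorem mollified_estimate (h : PlaneSol u u1 u2 w y) (hα0 : 0 < α) (hα : α ≤ 1 / 4)
    (hF : wsq eta (rhs α u1 u2 y) < ⊤) (hκ : IsKernel κ) :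
    let B := ENNReal.ofReal (2 * bigC) * wsq eta (sconv κ (rhs α u1 u2 y))
    wsq eta (fun p => α ^ 2 * sconv (deriv (deriv κ)) u p) ≤ B ∧
    wsq eta (fun p => α * (sconv (deriv κ) u p / sn p.2)) ≤ B ∧
    wsq eta (fun p => α * (sn p.2 * sconv (deriv κ) w p)) ≤ B ∧
    wsq eta (fun p => sconv κ (regular α u (rhs α u1 u2 y)) p / sn p.2) ≤ B ∧
    wsq eta (sconv κ y) ≤ B ∧ wsq eta (sconv κ w) ≤ B := by
  intro B
  obtain ⟨b, hB⟩ := h.bdd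
  have c1 := continuous_sconv hκ.deriv h.cu
  have c2 := continuous_sconv hκ.deriv.deriv h.cu
  have cw0 := continuous_sconv hκ h.cw
  have cw1 := continuous_sconv hκ.deriv h.cw
  have cy0 := continuous_sconv hκ h.cy
  have cz := continuous_sconv hκ (h.continuous_regular hF)
  have cq : Continuous fun p : ℝ × ℝ => sconv (deriv κ) u p / sn p.2 :=
    c1.div (by fun_prop) fun p => (sn_pos p.2).ne'
  have cq' : Continuous fun p : ℝ × ℝ => sconv κ (regular α u (rhs α u1 u2 y)) p / sn p.2 :=
    cz.div (by fun_prop) fun p => (sn_pos p.2).ne'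
  have key : ∀ om om' om'', RadWeight om om' om'' → _ := fun om om' om'' hom =>
    h.radial_estimate hom hα0 hα hκ fun κ hκ => h.integrable_rhs hom hF hκ
  refine ⟨?_, ?_, ?_, ?_, ?_, ?_⟩
  · exact wsq_le_of_radBound (by fun_prop) bigC_pos.le fun om om' om'' hom =>
      ⟨h.integrable_rhs hom hF hκ, (key _ _ _ hom).1⟩
  · exact wsq_le_of_radBound (by fun_prop) bigC_pos.le fun om om' om'' hom =>
      ⟨h.integrable_rhs hom hF hκ, (key _ _ _ hom).2.1⟩
  · exact wsq_le_of_radBound (by fun_prop) bigC_pos.le fun om om' om'' hom =>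
      ⟨h.integrable_rhs hom hF hκ, (key _ _ _ hom).2.2.1⟩
  · refine wsq_le_of_radBound cq' bigC_pos.le fun om om' om'' hom =>
      ⟨h.integrable_rhs hom hF hκ, ?_⟩
    rw [funext (h.sconv_regular hα0 hF hκ)]
    exact (key _ _ _ hom).2.2.2.1
  · exact wsq_le_of_radBound cy0 bigC_pos.le fun om om' om'' hom =>
      ⟨h.integrable_rhs hom hF hκ, (key _ _ _ hom).2.2.2.2.1⟩
  · exact wsq_le_of_radBound cw0 bigC_pos.le fun om om' om'' hom =>
      ⟨h.integrable_rhs hom hF hκ, (key _ _ _ hom).2.2.2.2.2⟩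

end PlaneSol

/-! ### Distributions on the plane -/

/-- The space of test functions on the plane. -/
def testSpace : Submodule ℝ (ℝ × ℝ → ℝ) where
  carrier := {φ | ContDiff ℝ ∞ φ ∧ HasCompactSupport φ}
  add_mem' h h' := ⟨h.1.add h'.1, h.2.add h'.2⟩
  zero_mem' := ⟨contDiff_const, HasCompactSupport.zero⟩
  smul_mem' c _ h := ⟨contDiff_const.smul h.1, h.2.smul_left (f := fun _ => c)⟩

/-- Test functions on the plane. -/
abbrev Test : Type := testSpace

lemma Test.smooth (φ : Test) : ContDiff ℝ ∞ φ.1 := φ.2.1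
lemma Test.cpt (φ : Test) : HasCompactSupport φ.1 := φ.2.2
lemma Test.continuous (φ : Test) : Continuous φ.1 := φ.2.1.continuous

/-- The directional derivative of test functions. -/
def dir (v : ℝ × ℝ) : Test →ₗ[ℝ] Test where
  toFun φ := ⟨fun p => fderiv ℝ φ.1 p v, by
    refine ⟨(φ.smooth.fderiv_right (m := ∞) (by simp)).clm_apply contDiff_const, ?_⟩
    refine (φ.cpt.fderiv (𝕜 := ℝ)).mono fun p hp h0 => hp ?_
    simp only; rw [h0]; rfl⟩
  map_add' φ ψ := by
    ext p
    have h1 : DifferentiableAt ℝ φ.1 p := φ.smooth.differentiable (by simp) p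
    have h2 : DifferentiableAt ℝ ψ.1 p := ψ.smooth.differentiable (by simp) p
    simp [fderiv_add h1 h2]
  map_smul' c φ := by
    ext p
    have h1 : DifferentiableAt ℝ φ.1 p := φ.smooth.differentiable (by simp) p
    simp [fderiv_const_smul h1]

lemma dir_apply (v : ℝ × ℝ) (φ : Test) (p : ℝ × ℝ) : (dir v φ).1 p = fderiv ℝ φ.1 p v := rfl

lemma dir_comm (v w : ℝ × ℝ) (φ : Test) : dir v (dir w φ) = dir w (dir v φ) := by
  ext p
  have h : ∀ a b : ℝ × ℝ, fderiv ℝ (fun q => fderiv ℝ φ.1 q b) p a =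
      fderiv ℝ (fderiv ℝ φ.1) p a b := fun a b => by
    have : DifferentiableAt ℝ (fderiv ℝ φ.1) p :=
      (φ.smooth.fderiv_right (m := ∞) (by simp)).differentiable (by simp) p
    rw [fderiv_clm_apply this (differentiableAt_const b)]
    simp
  change fderiv ℝ (fun q => fderiv ℝ φ.1 q w) p v = fderiv ℝ (fun q => fderiv ℝ φ.1 q v) p w
  rw [h, h]
  exact (φ.smooth.contDiffAt.isSymmSndFDerivAt (by simp; exact WithTop.coe_le_coe.2 le_top)).eq v w

lemma hasDerivAt_dir_fst (φ : Test) (s τ : ℝ) :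
    HasDerivAt (fun x => φ.1 (x, τ)) ((dir (1, 0) φ).1 (s, τ)) s := by
  have h1 := (φ.smooth.differentiable (by simp) (s, τ)).hasFDerivAt
  exact h1.comp_hasDerivAt s ((hasDerivAt_id s).prodMk (hasDerivAt_const s τ))

lemma hasDerivAt_dir_snd (φ : Test) (s τ : ℝ) :
    HasDerivAt (fun x => φ.1 (s, x)) ((dir (0, 1) φ).1 (s, τ)) τ := by
  have h1 := (φ.smooth.differentiable (by simp) (s, τ)).hasFDerivAt
  exact h1.comp_hasDerivAt τ ((hasDerivAt_const τ s).prodMk (hasDerivAt_id τ))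

/-- Multiplication of test functions by a smooth function of the angle. -/
def mulT (a : ℝ → ℝ) (ha : ContDiff ℝ ∞ a) : Test →ₗ[ℝ] Test where
  toFun φ := ⟨fun p => a p.2 * φ.1 p, (ha.comp contDiff_snd).mul φ.smooth, φ.cpt.mul_left⟩
  map_add' φ ψ := by ext p; simp [mul_add]
  map_smul' c φ := by ext p; simp [mul_left_comm]

/-- Distributions on the plane; no continuity is needed, since all of those that occur turn out to be
functions. -/
abbrev Dist := Test →ₗ[ℝ] ℝ

namespace Dist

/-- `∂_s`. -/
def dS (T : Dist) : Dist := -(T ∘ₗ dir (1, 0))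

/-- `∂_τ`. -/
def dT (T : Dist) : Dist := -(T ∘ₗ dir (0, 1))

/-- Multiplication by a smooth function of the angle. -/
def mul (a : ℝ → ℝ) (ha : ContDiff ℝ ∞ a) (T : Dist) : Dist := T ∘ₗ mulT a ha

variable (T S : Dist) (c : ℝ) {a b : ℝ → ℝ} (ha : ContDiff ℝ ∞ a) (hb : ContDiff ℝ ∞ b)

@[simp] lemma dS_apply (φ : Test) : dS T φ = -T (dir (1, 0) φ) := rfl
@[simp] lemma dT_apply (φ : Test) : dT T φ = -T (dir (0, 1) φ) := rfl
@[simp] lemma mul_apply (φ : Test) : mul a ha T φ = T (mulT a ha φ) := rfl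

lemma dS_add : dS (T + S) = dS T + dS S := by ext φ; simp [add_comm]
lemma dT_add : dT (T + S) = dT T + dT S := by ext φ; simp [add_comm]
lemma dS_smul : dS (c • T) = c • dS T := by ext φ; simp
lemma dT_smul : dT (c • T) = c • dT T := by ext φ; simp
lemma mul_add : mul a ha (T + S) = mul a ha T + mul a ha S := by ext φ; simp
lemma mul_smul : mul a ha (c • T) = c • mul a ha T := by ext φ; simp

lemma dS_dT : dS (dT T) = dT (dS T) := by
  ext φ; simp [dir_comm (1, 0) (0, 1)]

lemma dS_mul : dS (mul a ha T) = mul a ha (dS T) := by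
  ext φ
  have : mulT a ha (dir (1, 0) φ) = dir (1, 0) (mulT a ha φ) := by
    ext p
    have h1 := (hasDerivAt_dir_fst φ p.1 p.2).const_mul (a p.2)
    exact h1.unique (hasDerivAt_dir_fst (mulT a ha φ) p.1 p.2)
  simp [this]

lemma mul_mul : mul a ha (mul b hb T) = mul (fun τ => a τ * b τ) (ha.mul hb) T := by
  ext φ
  simp only [mul_apply]
  congr 1
  ext p
  change b p.2 * (a p.2 * φ.1 p) = a p.2 * b p.2 * φ.1 p
  ring

lemma mul_congr (h : ∀ τ, a τ = b τ) : mul a ha T = mul b hb T := by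
  obtain rfl : a = b := funext h
  rfl

lemma mul_add_left : mul (fun τ => a τ + b τ) (ha.add hb) T = mul a ha T + mul b hb T := by
  ext φ
  simp only [mul_apply, LinearMap.add_apply]
  rw [← map_add]
  congr 1
  ext p
  exact add_mul _ _ _

lemma mul_const (c : ℝ) : mul (fun _ => c) contDiff_const T = c • T := by
  ext φ
  simp only [mul_apply, LinearMap.smul_apply]
  rw [← map_smul]
  rfl

lemma mul_const_mul : mul (fun τ => c * a τ) (contDiff_const.mul ha) T = c • mul a ha T := by
  rw [← mul_const (mul a ha T), mul_mul]

/-- The Leibniz rule. -/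
lemma dT_mul (h : ∀ τ, HasDerivAt a (b τ) τ) :
    dT (mul a ha T) = mul b hb T + mul a ha (dT T) := by
  ext φ
  have : dir (0, 1) (mulT a ha φ) = mulT b hb φ + mulT a ha (dir (0, 1) φ) := by
    ext p
    have h1 := (h p.2).mul (hasDerivAt_dir_snd φ p.1 p.2)
    exact (hasDerivAt_dir_snd (mulT a ha φ) p.1 p.2).unique h1
  simp only [dT_apply, mul_apply, LinearMap.add_apply, this, map_add]
  ring

end Dist

/-- The distribution defined by a locally integrable function. -/
def toDist (f : ℝ × ℝ → ℝ) (hf : LocallyIntegrable f) : Dist where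
  toFun φ := ∫ p, f p * φ.1 p
  map_add' φ ψ := by
    have i : ∀ φ : Test, Integrable fun p => f p * φ.1 p := fun φ => by
      simpa [mul_comm] using hf.integrable_smul_left_of_hasCompactSupport φ.continuous φ.cpt
    rw [← integral_add (i φ) (i ψ)]
    simp [mul_add]
  map_smul' c φ := by
    simp only [Submodule.coe_smul, Pi.smul_apply, smul_eq_mul, RingHom.id_apply]
    rw [← integral_const_mul]
    congr 1; ext p; ring

section toDist

variable {f g : ℝ × ℝ → ℝ} (hf : LocallyIntegrable f) (hg : LocallyIntegrable g)

lemma integrable_mul_test (φ : Test) (hf : LocallyIntegrable f) :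
    Integrable fun p => f p * φ.1 p := by
  simpa [mul_comm] using hf.integrable_smul_left_of_hasCompactSupport φ.continuous φ.cpt

lemma toDist_apply (φ : Test) : toDist f hf φ = ∫ p, f p * φ.1 p := rfl

lemma toDist_congr (h : ∀ p, f p = g p) : toDist f hf = toDist g hg := by
  obtain rfl : f = g := funext h
  rfl

lemma toDist_add (h : LocallyIntegrable fun p => f p + g p) :
    toDist (fun p => f p + g p) h = toDist f hf + toDist g hg := by
  ext φ
  simp only [toDist_apply, LinearMap.add_apply]
  rw [← integral_add (integrable_mul_test φ hf) (integrable_mul_test φ hg)]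
  simp [add_mul]

lemma toDist_smul (c : ℝ) (h : LocallyIntegrable fun p => c * f p) :
    toDist (fun p => c * f p) h = c • toDist f hf := by
  ext φ
  simp only [toDist_apply, LinearMap.smul_apply, smul_eq_mul]
  rw [← integral_const_mul]
  simp [mul_assoc]

lemma toDist_mul {a : ℝ → ℝ} (ha : ContDiff ℝ ∞ a) (h : LocallyIntegrable fun p => a p.2 * f p) :
    toDist (fun p => a p.2 * f p) h = Dist.mul a ha (toDist f hf) := by
  ext φ
  simp only [toDist_apply, Dist.mul_apply]
  congr 1; ext p
  change _ = f p * (a p.2 * φ.1 p)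
  ring

/-- Integration by parts in `s`. -/
lemma dS_toDist (hf : Continuous f) (hg : Continuous g)
    (h : ∀ s τ, HasDerivAt (fun x => f (x, τ)) (g (s, τ)) s) :
    Dist.dS (toDist f hf.locallyIntegrable) = toDist g hg.locallyIntegrable := by
  ext φ
  simp only [toDist_apply, Dist.dS_apply]
  have i1 := integrable_mul_test (dir (1, 0) φ) hf.locallyIntegrable
  have i2 := integrable_mul_test φ hg.locallyIntegrable
  have := integral_eq_zero_of_hasDerivAt_fst (J := fun p => f p * φ.1 p)
    (J' := fun p => g p * φ.1 p + f p * (dir (1, 0) φ).1 p)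
    (fun s τ => (h s τ).mul (hasDerivAt_dir_fst φ s τ)) (integrable_fun_add i2 i1)
    (integrable_mul_test φ hf.locallyIntegrable)
  rw [integral_add i2 i1] at this
  linarith

/-- Integration by parts in `τ`. -/
lemma dT_toDist (hf : Continuous f) (hg : Continuous g)
    (h : ∀ s τ, HasDerivAt (fun x => f (s, x)) (g (s, τ)) τ) :
    Dist.dT (toDist f hf.locallyIntegrable) = toDist g hg.locallyIntegrable := by
  ext φ
  simp only [toDist_apply, Dist.dT_apply]
  have i1 := integrable_mul_test (dir (0, 1) φ) hf.locallyIntegrable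
  have i2 := integrable_mul_test φ hg.locallyIntegrable
  have i3 := integrable_fun_add i2 i1
  have i4 := integrable_mul_test φ hf.locallyIntegrable
  have key : ∫ p, (g p * φ.1 p + f p * (dir (0, 1) φ).1 p) = 0 := by
    rw [Measure.volume_eq_prod] at i3 i4 ⊢
    rw [integral_prod _ i3]
    refine integral_eq_zero_of_ae ?_
    filter_upwards [i3.prod_right_ae, i4.prod_right_ae] with s h3 h4
    exact integral_eq_zero_of_hasDerivAt_of_integrable
      (fun τ => (h s τ).mul (hasDerivAt_dir_snd φ s τ)) h3 h4
  rw [integral_add i2 i1] at key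
  linarith

end toDist

/-! ### Distributions in weighted `L²` spaces -/

/-- The square of the norm dual to the weighted norm. -/
def dualSq (σ : ℝ) (φ : Test) : ℝ := ∫ p, φ.1 p ^ 2 / wgt σ p

lemma integrable_dualSq (σ : ℝ) (φ : Test) : Integrable fun p => φ.1 p ^ 2 / wgt σ p := by
  have := φ.continuous
  refine Continuous.integrable_of_hasCompactSupport (Continuous.div (by fun_prop)
    (continuous_wgt σ) fun p => (wgt_pos σ p).ne') ?_
  refine φ.cpt.mono fun p hp h0 => hp ?_
  simp only; rw [h0]; simp

lemma dualSq_nonneg (σ : ℝ) (φ : Test) : 0 ≤ dualSq σ φ :=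
  integral_nonneg fun _ => div_nonneg (sq_nonneg _) (wgt_pos _ _).le

lemma dualSq_smul (σ c : ℝ) (φ : Test) : dualSq σ (c • φ) = c ^ 2 * dualSq σ φ := by
  unfold dualSq
  rw [← integral_const_mul]
  congr 1; ext p
  change (c * φ.1 p) ^ 2 / _ = _
  ring

/-- `T` belongs to the weighted `L²` space with angular exponent `σ`, and the square of its norm is at
most `B`. By homogeneity this is the same as `(T φ)² ≤ B · dualSq σ φ`. -/
def Bdd (σ : ℝ) (T : Dist) (B : ℝ) : Prop := ∀ φ, 2 * T φ ≤ B + dualSq σ φ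

namespace Bdd

variable {σ σ' : ℝ} {T S : Dist} {A B : ℝ}

lemma nonneg (h : Bdd σ T B) : 0 ≤ B := by
  have := h 0
  have e : dualSq σ 0 = 0 := by simp [dualSq]
  rw [e] at this
  simpa using this

lemma mono (h : Bdd σ T A) (hAB : A ≤ B) : Bdd σ T B := fun φ => (h φ).trans (by linarith)

lemma smul (h : Bdd σ T B) (c : ℝ) : Bdd σ (c • T) (c ^ 2 * B) := fun φ => by
  rcases eq_or_ne c 0 with rfl | hc
  · simpa using dualSq_nonneg σ φ
  have h1 := mul_le_mul_of_nonneg_left (h (c⁻¹ • φ)) (sq_nonneg c)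
  rw [dualSq_smul, map_smul, smul_eq_mul] at h1
  simp only [LinearMap.smul_apply, smul_eq_mul]
  have e1 : c ^ 2 * (2 * (c⁻¹ * T φ)) = 2 * (c * T φ) := by field_simp
  have e2 : c ^ 2 * (B + c⁻¹ ^ 2 * dualSq σ φ) = c ^ 2 * B + dualSq σ φ := by field_simp
  linarith

lemma add (hT : Bdd σ T A) (hS : Bdd σ S B) : Bdd σ (T + S) (2 * A + 2 * B) := fun φ => by
  have h1 := hT.smul 2 φ
  have h2 := hS.smul 2 φ
  simp only [LinearMap.smul_apply, smul_eq_mul, LinearMap.add_apply] at h1 h2 ⊢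
  linarith

/-- Multiplication by `a` maps one weighted space to the other if `|a|` is at most the square root of
the quotient of the weights. -/
lemma mul (h : Bdd σ T B) {a : ℝ → ℝ} (ha : ContDiff ℝ ∞ a)
    (hle : ∀ τ, a τ ^ 2 * sn τ ^ (1 - σ') ≤ sn τ ^ (1 - σ)) : Bdd σ' (Dist.mul a ha T) B :=
  fun φ => by
    refine (h (mulT a ha φ)).trans (add_le_add_right (integral_mono (integrable_dualSq _ _)
      (integrable_dualSq _ _) fun p => ?_) _)
    change (a p.2 * φ.1 p) ^ 2 / wgt σ p ≤ φ.1 p ^ 2 / wgt σ' p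
    rw [div_le_div_iff₀ (wgt_pos _ _) (wgt_pos _ _)]
    unfold wgt
    have := mul_le_mul_of_nonneg_left (hle p.2) (mul_nonneg (sq_nonneg (φ.1 p)) (wt_pos p.1).le)
    nlinarith

lemma mul_of_bounded (h : Bdd σ T B) {a : ℝ → ℝ} (ha : ContDiff ℝ ∞ a) {c : ℝ} (hc : 0 < c)
    (hle : ∀ τ, |a τ| ≤ c) : Bdd σ (Dist.mul a ha T) (c ^ 2 * B) := by
  have h1 : Bdd σ (Dist.mul (fun τ => c⁻¹ * a τ) (contDiff_const.mul ha) T) B := by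
    refine h.mul _ fun τ => mul_le_of_le_one_left (sn_rpow_pos _ _).le ?_
    rw [← sq_abs, abs_mul, abs_of_pos (inv_pos.2 hc)]
    have : c⁻¹ * |a τ| ≤ 1 := by
      rw [inv_mul_le_iff₀ hc]; simpa using hle τ
    exact pow_le_one₀ (by positivity) this
  have h2 := h1.smul c
  rwa [Dist.mul_const_mul, smul_smul, mul_inv_cancel₀ hc.ne', one_smul] at h2

lemma of_le_exponent (h : Bdd σ T B) (hσ : σ' ≤ σ) : Bdd σ' T B := by
  have := h.mul (a := fun _ => 1) (σ' := σ') contDiff_const fun τ => by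
    rw [one_pow, one_mul]; exact sn_rpow_le_rpow (by linarith) τ
  rwa [Dist.mul_const, one_smul] at this

lemma sq_le (h : Bdd σ T B) (φ : Test) : T φ ^ 2 ≤ B * dualSq σ φ := by
  have key : ∀ t : ℝ, 2 * (t * T φ) ≤ B + t ^ 2 * dualSq σ φ := fun t => by
    have := h (t • φ)
    rwa [dualSq_smul, map_smul, smul_eq_mul] at this
  rcases (dualSq_nonneg σ φ).eq_or_lt with h0 | h0
  · rw [← h0]
    by_contra h1
    have h2 : T φ ≠ 0 := fun h => h1 (by simp [h])
    have := key ((B + 1) / T φ)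
    rw [← h0, div_mul_cancel₀ _ h2] at this
    linarith [h.nonneg]
  · have := key (T φ / dualSq σ φ)
    have h3 := mul_le_mul_of_nonneg_right this h0.le
    have e1 : 2 * (T φ / dualSq σ φ * T φ) * dualSq σ φ = 2 * T φ ^ 2 := by field_simp
    have e2 : (B + (T φ / dualSq σ φ) ^ 2 * dualSq σ φ) * dualSq σ φ =
      B * dualSq σ φ + T φ ^ 2 := by field_simp
    linarith

end Bdd

/-- Functions in the weighted space. -/
lemma bdd_toDist {σ B : ℝ} {f : ℝ × ℝ → ℝ} (hf : LocallyIntegrable f) (hB : 0 ≤ B)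
    (h : wsq σ f ≤ ENNReal.ofReal B) : Bdd σ (toDist f hf) B := fun φ => by
  have nn : 0 ≤ᵐ[volume] fun p => f p ^ 2 * wgt σ p :=
    Eventually.of_forall fun p => mul_nonneg (sq_nonneg _) (wgt_pos _ _).le
  have i : Integrable fun p => f p ^ 2 * wgt σ p := by
    refine ⟨(hf.aestronglyMeasurable.pow 2).mul (continuous_wgt σ).aestronglyMeasurable, ?_⟩
    rw [hasFiniteIntegral_iff_ofReal nn]
    exact h.trans_lt ENNReal.ofReal_lt_top
  have hle : ∫ p, f p ^ 2 * wgt σ p ≤ B := by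
    rw [integral_eq_lintegral_of_nonneg_ae nn i.1]
    exact ENNReal.toReal_le_of_le_ofReal hB h
  rw [toDist_apply, ← integral_const_mul]
  refine (integral_mono ((integrable_mul_test φ hf).const_mul 2)
    (integrable_fun_add i (integrable_dualSq σ φ)) fun p => ?_).trans ?_
  · have hw := wgt_pos σ p
    have : f p ^ 2 * wgt σ p + φ.1 p ^ 2 / wgt σ p - 2 * (f p * φ.1 p) =
      (f p * wgt σ p - φ.1 p) ^ 2 / wgt σ p := by field_simp; ring
    have h2 : 0 ≤ (f p * wgt σ p - φ.1 p) ^ 2 / wgt σ p := by positivity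
    simp only; linarith
  · rw [integral_add i (integrable_dualSq σ φ)]
    exact add_le_add_left hle _

lemma memLp_div_sqrt (σ : ℝ) (φ : Test) :
    MemLp (fun p => φ.1 p / Real.sqrt (wgt σ p)) 2 (volume : Measure (ℝ × ℝ)) := by
  have := φ.continuous
  refine Continuous.memLp_of_hasCompactSupport (Continuous.div (by fun_prop) (by fun_prop)
    fun p => (Real.sqrt_pos.2 (wgt_pos σ p)).ne') (φ.cpt.mono fun p hp h0 => hp ?_)
  simp only; rw [h0]; simp

/-- The isometric embedding of the test functions, with the dual norm, into `L²`. -/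
def embL2 (σ : ℝ) : Test →ₗ[ℝ] Lp ℝ 2 (volume : Measure (ℝ × ℝ)) where
  toFun φ := (memLp_div_sqrt σ φ).toLp
  map_add' φ ψ := by
    rw [← MemLp.toLp_add]
    congr 1; ext p
    exact add_div _ _ _
  map_smul' c φ := by
    rw [RingHom.id_apply, ← MemLp.toLp_const_smul]
    congr 1; ext p
    exact mul_div_assoc _ _ _

lemma embL2_coe (σ : ℝ) (φ : Test) :
    (embL2 σ φ : ℝ × ℝ → ℝ) =ᵐ[volume] fun p => φ.1 p / Real.sqrt (wgt σ p) :=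
  (memLp_div_sqrt σ φ).coeFn_toLp

lemma norm_embL2_sq (σ : ℝ) (φ : Test) : ‖embL2 σ φ‖ ^ 2 = dualSq σ φ := by
  rw [← real_inner_self_eq_norm_sq, L2.inner_def]
  refine integral_congr_ae ?_
  filter_upwards [embL2_coe σ φ] with p hp
  rw [hp]
  simp only [inner_self_eq_norm_sq_to_K, Real.norm_eq_abs, RCLike.ofReal_real_eq_id, id_eq, sq_abs]
  rw [div_pow, Real.sq_sqrt (wgt_pos σ p).le]

/-- Riesz representation: the elements of the weighted space are functions. -/
theorem Bdd.exists_rep {σ B : ℝ} {T : Dist} (h : Bdd σ T B) :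
    ∃ g, Measurable g ∧ ∃ hg : LocallyIntegrable g, wsq σ g ≤ ENNReal.ofReal B ∧
      T = toDist g hg := by
  have hB := h.nonneg
  have hT : ∀ φ, ‖T φ‖ ≤ Real.sqrt B * ‖embL2 σ φ‖ := fun φ => by
    rw [Real.norm_eq_abs, ← Real.sqrt_sq (norm_nonneg (embL2 σ φ)), ← Real.sqrt_mul hB,
      norm_embL2_sq]
    exact Real.abs_le_sqrt (h.sq_le φ)
  have hval : ∀ φ, T.compLeftInverse (embL2 σ) ⟨embL2 σ φ, LinearMap.mem_range_self _ φ⟩ = T φ :=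
    fun φ => LinearMap.compLeftInverse_apply_of_bdd _ _ ⟨_, hT⟩ _ _ rfl
  have hnorm : ‖T.compLeftInverse (embL2 σ)‖ ≤ Real.sqrt B := by
    refine ContinuousLinearMap.opNorm_le_bound _ (Real.sqrt_nonneg _) ?_
    rintro ⟨_, φ, rfl⟩
    rw [hval]
    exact hT φ
  obtain ⟨L, hL, hLn⟩ := exists_extension_norm_eq _ (T.compLeftInverse (embL2 σ))
  let z := (InnerProductSpace.toDual ℝ _).symm L
  have hz : ‖z‖ ≤ Real.sqrt B := by
    rw [LinearIsometryEquiv.norm_map, hLn]; exact hnorm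
  have hTz : ∀ φ, T φ = inner ℝ z (embL2 σ φ) := fun φ => by
    rw [InnerProductSpace.toDual_symm_apply, ← hval φ]
    exact (hL ⟨embL2 σ φ, LinearMap.mem_range_self _ φ⟩).symm
  have hzm : Measurable (z : ℝ × ℝ → ℝ) := (Lp.stronglyMeasurable z).measurable
  have hwc : Continuous fun p => (Real.sqrt (wgt σ p))⁻¹ :=
    Continuous.inv₀ (by fun_prop) fun p => (Real.sqrt_pos.2 (wgt_pos σ p)).ne'
  have hzl : LocallyIntegrable (z : ℝ × ℝ → ℝ) := (Lp.memLp z).locallyIntegrable (by norm_num)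
  have hloc : LocallyIntegrable fun p => z p * (Real.sqrt (wgt σ p))⁻¹ := by
    simpa [mul_comm] using hzl.continuous_smul hwc
  refine ⟨fun p => z p * (Real.sqrt (wgt σ p))⁻¹, hzm.mul hwc.measurable, hloc, ?_, ?_⟩
  · have e : wsq σ (fun p => z p * (Real.sqrt (wgt σ p))⁻¹) = ENNReal.ofReal (‖z‖ ^ 2) := by
      rw [← real_inner_self_eq_norm_sq, L2.inner_def, ofReal_integral_eq_lintegral_ofReal
        (L2.integrable_inner z z) (Eventually.of_forall fun p => real_inner_self_nonneg)]
      refine lintegral_congr fun p => ?_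
      congr 1
      have hw := wgt_pos σ p
      rw [mul_pow, inv_pow, Real.sq_sqrt hw.le, mul_assoc, inv_mul_cancel₀ hw.ne', mul_one]
      simp
    rw [e]
    refine ENNReal.ofReal_le_ofReal ?_
    calc ‖z‖ ^ 2 ≤ Real.sqrt B ^ 2 := pow_le_pow_left₀ (norm_nonneg _) hz 2
      _ = B := Real.sq_sqrt hB
  · ext φ
    rw [hTz, toDist_apply, L2.inner_def]
    refine integral_congr_ae ?_
    filter_upwards [embL2_coe σ φ] with p hp
    rw [hp]
    simp only [RCLike.inner_apply, conj_trivial]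
    ring

/-- The fundamental lemma of the calculus of variations. -/
lemma ae_eq_of_toDist_eq {f g : ℝ × ℝ → ℝ} {hf : LocallyIntegrable f} {hg : LocallyIntegrable g}
    (h : toDist f hf = toDist g hg) : f =ᵐ[volume] g := by
  have key := ae_eq_zero_of_integral_contDiff_smul_eq_zero (hf.sub hg) fun φ hφ hφc => by
    have := LinearMap.congr_fun h ⟨φ, hφ, hφc⟩
    rw [toDist_apply, toDist_apply] at this
    have i1 := integrable_mul_test ⟨φ, hφ, hφc⟩ hf
    have i2 := integrable_mul_test ⟨φ, hφ, hφc⟩ hg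
    have e : ∀ p, φ p • (f - g) p = f p * φ p - g p * φ p := fun p => by
      simp only [Pi.sub_apply, smul_eq_mul]; ring
    simp_rw [e]
    rw [integral_sub i1 i2]
    exact sub_eq_zero.2 this
  filter_upwards [key] with p hp
  exact sub_eq_zero.1 hp

/-! ### Radial mollification of distributional derivatives -/

/-- The test function `κ(s - x) b(τ)`. -/
def tensor {κ b : ℝ → ℝ} (hκ : IsKernel κ) (s : ℝ) (hb : ContDiff ℝ ∞ b) (hbc : HasCompactSupport b) :
    Test :=
  ⟨fun p : ℝ × ℝ => κ (s - p.1) * b p.2, (hκ.smooth.comp (contDiff_const.sub contDiff_fst)).mul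
    (hb.comp contDiff_snd), by
    have h1 : HasCompactSupport fun x => κ (s - x) :=
      hκ.hasCompactSupport.comp_homeomorph (Homeomorph.subLeft s)
    refine HasCompactSupport.intro (h1.isCompact.prod hbc.isCompact) fun (p : ℝ × ℝ) hp => ?_
    rw [mem_prod, not_and_or] at hp
    rcases hp with hp | hp
    · rw [image_eq_zero_of_notMem_tsupport (f := fun x => κ (s - x)) hp, zero_mul]
    · rw [image_eq_zero_of_notMem_tsupport hp, mul_zero]⟩

lemma dS_iterate_tensor {κ b : ℝ → ℝ} (hκ : IsKernel κ) (s : ℝ) (hb : ContDiff ℝ ∞ b)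
    (hbc : HasCompactSupport b) (T : Dist) (j : ℕ) :
    (Dist.dS^[j] T) (tensor hκ s hb hbc) = T (tensor (hκ.iteratedDeriv j) s hb hbc) := by
  induction j generalizing κ with
  | zero => simp
  | succ j ih =>
    rw [Function.iterate_succ_apply', Dist.dS_apply]
    have : dir (1, 0) (tensor hκ s hb hbc) = -tensor hκ.deriv s hb hbc := by
      ext p
      have h1 := ((hκ.hasDerivAt (s - p.1)).comp p.1
        ((hasDerivAt_id p.1).const_sub s)).mul_const (b p.2)
      refine (hasDerivAt_dir_fst (tensor hκ s hb hbc) p.1 p.2).unique (h1.congr_deriv ?_)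
      change deriv κ (s - p.1) * -1 * b p.2 = -(deriv κ (s - p.1) * b p.2)
      ring
    rw [this, map_neg, neg_neg, ih hκ.deriv]
    congr 1
    ext p
    change iteratedDeriv j (deriv κ) (s - p.1) * b p.2 = iteratedDeriv (j + 1) κ (s - p.1) * b p.2
    rw [iteratedDeriv_succ']

section slices

variable {f g : ℝ × ℝ → ℝ} {κ b : ℝ → ℝ}

lemma toDist_tensor (hκ : IsKernel κ) (s : ℝ) (hb : ContDiff ℝ ∞ b) (hbc : HasCompactSupport b)
    (hf : LocallyIntegrable f) :
    toDist f hf (tensor hκ s hb hbc) = ∫ τ, b τ * sconv κ f (s, τ) := by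
  have i := integrable_mul_test (tensor hκ s hb hbc) hf
  rw [toDist_apply]
  rw [Measure.volume_eq_prod] at i ⊢
  rw [integral_prod_symm _ i]
  congr 1; ext τ
  unfold sconv
  rw [← integral_const_mul, ← integral_sub_left_eq_self _ volume s]
  congr 1; ext x
  change f (s - x, τ) * (κ (s - (s - x)) * b τ) = _
  rw [sub_sub_cancel]; ring

lemma locallyIntegrable_sconv_slice (hκ : IsKernel κ) (hf : LocallyIntegrable f) (s : ℝ) :
    LocallyIntegrable fun τ => sconv κ f (s, τ) := by
  refine locallyIntegrable_iff.2 fun K hK => ?_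
  have hκc := hκ.continuous
  have h1 : IntegrableOn (fun p : ℝ × ℝ => κ (s - p.1) * f p) (Icc (s - 1) (s + 1) ×ˢ K) := by
    have : LocallyIntegrable fun p : ℝ × ℝ => κ (s - p.1) * f p :=
      hf.continuous_smul (by fun_prop : Continuous fun p : ℝ × ℝ => κ (s - p.1))
    exact this.integrableOn_isCompact (isCompact_Icc.prod hK)
  rw [IntegrableOn, Measure.volume_eq_prod, ← Measure.prod_restrict] at h1
  refine h1.integral_prod_right.congr (Eventually.of_forall fun τ => ?_)
  simp only
  unfold sconv
  rw [← integral_sub_left_eq_self _ volume s]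
  simp only [sub_sub_cancel]
  refine setIntegral_eq_integral_of_forall_compl_eq_zero fun x hx => ?_
  rw [hκ.supp, zero_mul]
  by_contra h2
  have := abs_le.1 (not_lt.1 h2)
  exact hx ⟨by linarith, by linarith⟩

lemma aestronglyMeasurable_sconv (hκ : IsKernel κ) (hf : Measurable f) : Measurable (sconv κ f) := by
  have h1 : Measurable (Function.uncurry fun (p : ℝ × ℝ) (x : ℝ) => κ x * f (p.1 - x, p.2)) := by
    have := hκ.continuous.measurable
    simp only [Function.uncurry_def]
    fun_prop
  exact h1.stronglyMeasurable.integral_prod_right.measurable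

/-- Mollification of a distributional derivative. -/
lemma sconv_iteratedDeriv_ae (hf : Continuous f) (hg : LocallyIntegrable g) (hgm : Measurable g)
    {j : ℕ} (h : Dist.dS^[j] (toDist f hf.locallyIntegrable) = toDist g hg) (hκ : IsKernel κ) :
    ∀ᵐ p, sconv (iteratedDeriv j κ) f p = sconv κ g p := by
  have hκj := hκ.iteratedDeriv j
  have hm : MeasurableSet {p | sconv (iteratedDeriv j κ) f p = sconv κ g p} :=
    measurableSet_eq_fun (aestronglyMeasurable_sconv hκj hf.measurable)
      (aestronglyMeasurable_sconv hκ hgm)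
  rw [Measure.volume_eq_prod, Measure.ae_prod_iff_ae_ae hm]
  refine Eventually.of_forall fun s => ?_
  have l1 := locallyIntegrable_sconv_slice hκj hf.locallyIntegrable s
  have l2 := locallyIntegrable_sconv_slice hκ hg s
  have key := ae_eq_zero_of_integral_contDiff_smul_eq_zero (l1.sub l2) fun b hb hbc => by
    have e := dS_iterate_tensor hκ s hb hbc (toDist f hf.locallyIntegrable) j
    rw [h, toDist_tensor, toDist_tensor] at e
    have i1 := l1.integrable_smul_left_of_hasCompactSupport hb.continuous hbc
    have i2 := l2.integrable_smul_left_of_hasCompactSupport hb.continuous hbc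
    simp only [smul_eq_mul] at i1 i2
    simp only [Pi.sub_apply, smul_eq_mul, _root_.mul_sub]
    rw [integral_sub i1 i2, e, sub_self]
  filter_upwards [key] with τ hτ
  exact sub_eq_zero.1 hτ

lemma dS_iterate_toDist_sconv (hκ : IsKernel κ) (hf : Continuous f) (j : ℕ) :
    Dist.dS^[j] (toDist (sconv κ f) (continuous_sconv hκ hf).locallyIntegrable) =
      toDist (sconv (iteratedDeriv j κ) f)
        (continuous_sconv (hκ.iteratedDeriv j) hf).locallyIntegrable := by
  induction j with
  | zero => exact toDist_congr _ _ fun p => by simp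
  | succ j ih =>
    rw [Function.iterate_succ_apply', ih]
    have := dS_toDist (continuous_sconv (hκ.iteratedDeriv j) hf)
      (continuous_sconv (hκ.iteratedDeriv j).deriv hf) (hasDerivAt_sconv (hκ.iteratedDeriv j) hf)
    rw [this]
    exact toDist_congr _ _ fun p => by rw [iteratedDeriv_succ]

end slices

/-- Bump functions that shrink to the origin. -/
def bump (E : Type*) [NormedAddCommGroup E] (n : ℕ) : ContDiffBump (0 : E) where
  rIn := 1 / ((n : ℝ) + 1) / 2
  rOut := 1 / ((n : ℝ) + 1)
  rIn_pos := by positivity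
  rIn_lt_rOut := half_lt_self (by positivity)

lemma bump_rOut_le (E : Type*) [NormedAddCommGroup E] (n : ℕ) : (bump E n).rOut ≤ 1 := by
  change 1 / ((n : ℝ) + 1) ≤ 1
  rw [div_le_one (by positivity)]
  have : (0 : ℝ) ≤ n := n.cast_nonneg
  linarith

lemma tendsto_bump_rOut (E : Type*) [NormedAddCommGroup E] :
    Tendsto (fun n => (bump E n).rOut) atTop (𝓝 0) := tendsto_one_div_add_atTop_nhds_zero_nat

lemma isKernel_bump (n : ℕ) : IsKernel ((bump ℝ n).normed volume) where
  smooth := (bump ℝ n).contDiff_normed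
  supp x hx := by
    by_contra h
    have h1 : x ∈ Function.support ((bump ℝ n).normed volume) := h
    rw [ContDiffBump.support_normed_eq, mem_ball_zero_iff, Real.norm_eq_abs] at h1
    linarith [bump_rOut_le ℝ n]

lemma integral_abs_bump (n : ℕ) : ∫ x, |(bump ℝ n).normed volume x| = 1 := by
  simp_rw [fun x => abs_of_nonneg ((bump ℝ n).nonneg_normed (μ := volume) x)]
  exact (bump ℝ n).integral_normed

lemma tendsto_sconv_bump {f : ℝ × ℝ → ℝ} (hf : Continuous f) (p : ℝ × ℝ) :
    Tendsto (fun n => sconv ((bump ℝ n).normed volume) f p) atTop (𝓝 (f p)) :=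
  ContDiffBump.convolution_tendsto_right_of_continuous (φ := bump ℝ) (tendsto_bump_rOut ℝ)
    (by fun_prop : Continuous fun x => f (x, p.2)) p.1

lemma tendsto_toDist_sconv {f : ℝ × ℝ → ℝ} (hf : Continuous f) (φ : Test) :
    Tendsto (fun n => toDist (sconv ((bump ℝ n).normed volume) f)
      (continuous_sconv (isKernel_bump n) hf).locallyIntegrable φ) atTop
      (𝓝 (toDist f hf.locallyIntegrable φ)) := by
  have hK := (φ.cpt.isCompact.prod (isCompact_Icc (a := (-1 : ℝ)) (b := 1))).image
    (f := fun q : (ℝ × ℝ) × ℝ => (q.1.1 - q.2, q.1.2)) (by fun_prop)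
  obtain ⟨M, hM⟩ := hK.exists_bound_of_continuousOn hf.continuousOn
  have hφ := φ.continuous
  refine tendsto_integral_of_dominated_convergence (fun p => M * |φ.1 p|) (fun n => ?_) ?_
    (fun n => Eventually.of_forall fun p => ?_) (Eventually.of_forall fun p => ?_)
  · exact ((continuous_sconv (isKernel_bump n) hf).mul hφ).aestronglyMeasurable
  · exact ((hφ.integrable_of_hasCompactSupport φ.cpt).abs).const_mul M
  · rw [norm_mul, Real.norm_eq_abs, Real.norm_eq_abs]
    by_cases hp : p ∈ tsupport φ.1
    · refine mul_le_mul_of_nonneg_right ?_ (abs_nonneg _)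
      have hk := isKernel_bump n
      calc |sconv ((bump ℝ n).normed volume) f p| ≤ ∫ x, |(bump ℝ n).normed volume x| * M := by
            rw [← Real.norm_eq_abs]
            refine norm_integral_le_of_norm_le (hk.integrable.abs.mul_const M)
              (Eventually.of_forall fun x => ?_)
            rw [norm_mul, Real.norm_eq_abs]
            by_cases hx : 1 < |x|
            · rw [hk.supp x hx]; simp
            · refine mul_le_mul_of_nonneg_left (hM _ ⟨(p, x), ⟨hp, ?_⟩, rfl⟩) (abs_nonneg _)
              exact abs_le.1 (not_lt.1 hx)
        _ = M := by rw [integral_mul_const, integral_abs_bump, one_mul]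
    · rw [image_eq_zero_of_notMem_tsupport hp]; simp
  · exact (tendsto_sconv_bump hf p).mul_const _

/-- A bound for the mollifications, uniform in the mollifier, is a bound for the distributional
derivative. -/
lemma bdd_of_sconv {σ B : ℝ} {f : ℝ × ℝ → ℝ} (hf : Continuous f) (hB : 0 ≤ B) (j : ℕ)
    (h : ∀ n, wsq σ (sconv (iteratedDeriv j ((bump ℝ n).normed volume)) f) ≤ ENNReal.ofReal B) :
    Bdd σ (Dist.dS^[j] (toDist f hf.locallyIntegrable)) B := by
  intro φ
  have key : ∀ (i : ℕ) (φ : Test), Tendsto (fun n => (Dist.dS^[i] (toDist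
      (sconv ((bump ℝ n).normed volume) f)
      (continuous_sconv (isKernel_bump n) hf).locallyIntegrable)) φ) atTop
      (𝓝 ((Dist.dS^[i] (toDist f hf.locallyIntegrable)) φ)) := fun i => by
    induction i with
    | zero => exact tendsto_toDist_sconv hf
    | succ i ih =>
      intro φ
      simp only [Function.iterate_succ_apply', Dist.dS_apply]
      exact (ih _).neg
  refine le_of_tendsto ((key j φ).const_mul 2) (Eventually.of_forall fun n => ?_)
  rw [dS_iterate_toDist_sconv (isKernel_bump n) hf]
  exact bdd_toDist _ hB (h n) φ

/-! ### Transport in the angle -/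

lemma contDiff_bcoef : ContDiff ℝ ∞ fun τ => 5 * cs τ - 1 :=
  (contDiff_const.mul contDiff_cs).sub contDiff_const

lemma abs_cs_sub_le (τ : ℝ) {x : ℝ} (hx : |x| ≤ 1) :
    |cs τ - cs (τ - x)| ≤ 2 * Real.exp 4 * sn τ ^ 2 := by
  have hb : ∀ t ∈ uIcc (τ - x) τ, ‖-2 * sn t ^ 2‖ ≤ 2 * Real.exp 4 * sn τ ^ 2 := fun t ht => by
    have h1 := sn_comparable t (t - τ)
    rw [sub_sub_cancel] at h1
    have h2 : |t - τ| ≤ 1 := by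
      have h3 := abs_sub_left_of_mem_uIcc ht
      rw [abs_sub_comm]
      refine le_trans ?_ hx
      rw [uIcc_comm] at ht
      have h4 := abs_sub_left_of_mem_uIcc ht
      rw [show τ - x - τ = -x by ring, abs_neg] at h4
      rwa [abs_sub_comm]
    have h5 : sn t ≤ Real.exp 2 * sn τ :=
      h1.trans (mul_le_mul_of_nonneg_right (Real.exp_le_exp.2 (by linarith)) (sn_pos _).le)
    have h6 := pow_le_pow_left₀ (sn_pos t).le h5 2
    rw [mul_pow, ← Real.exp_nat_mul] at h6
    norm_num at h6
    rw [norm_mul, norm_pow, Real.norm_of_nonneg (sn_pos t).le]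
    norm_num
    linarith
  have := (convex_uIcc (τ - x) τ).norm_image_sub_le_of_norm_hasDerivWithin_le
    (fun t _ => (hasDerivAt_cs t).hasDerivWithinAt) (fun t ht => by simpa using hb t ht)
    (left_mem_uIcc) (right_mem_uIcc)
  rw [sub_sub_cancel, Real.norm_eq_abs, Real.norm_eq_abs] at this
  refine this.trans (mul_le_of_le_one_right (by positivity) hx)

/-- `hardy_lintegral` on each ray, integrated over the rays. -/
lemma hardy_plane {σ : ℝ} (hσ : 0 ≤ σ) {z h : ℝ × ℝ → ℝ} (hz : Continuous z) (hh : Continuous h)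
    (hd : ∀ s τ, HasDerivAt (fun x => z (s, x)) ((1 - 5 * cs τ) * z (s, τ) + h (s, τ)) τ)
    (hfin : wsq eta z < ⊤) : wsq σ z ≤ 2 * wsq σ h := by
  have meas : ∀ (σ : ℝ) (f : ℝ × ℝ → ℝ), Continuous f →
      Measurable fun p => ENNReal.ofReal (f p ^ 2 * wgt σ p) := fun σ f hf =>
    (by fun_prop : Continuous fun p => f p ^ 2 * wgt σ p).measurable.ennreal_ofReal
  have slice : ∀ (σ : ℝ) (f : ℝ × ℝ → ℝ) (s : ℝ), ∫⁻ τ, ENNReal.ofReal (f (s, τ) ^ 2 * wgt σ (s, τ)) =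
      ENNReal.ofReal (wt s) * ∫⁻ τ, ENNReal.ofReal (f (s, τ) ^ 2 * sn τ ^ (1 - σ)) := fun σ f s => by
    rw [← lintegral_const_mul' _ _ ENNReal.ofReal_ne_top]
    refine lintegral_congr fun τ => ?_
    rw [← ENNReal.ofReal_mul (wt_pos s).le]
    congr 1; unfold wgt; ring
  unfold wsq at *
  rw [Measure.volume_eq_prod] at *
  rw [lintegral_prod _ (meas _ _ hz).aemeasurable] at *
  rw [lintegral_prod _ (meas _ _ hh).aemeasurable, ← lintegral_const_mul' _ _ (by simp)]
  refine lintegral_mono_ae ?_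
  have hm : Measurable fun s => ∫⁻ τ, ENNReal.ofReal (z (s, τ) ^ 2 * wgt eta (s, τ)) :=
    (meas _ _ hz).lintegral_prod_right'
  filter_upwards [ae_lt_top hm hfin.ne] with s hs
  rw [slice, slice, mul_left_comm]
  refine mul_le_mul_right (hardy_lintegral hσ (hd s) (by fun_prop) ?_) _
  rw [slice] at hs
  have hw : ENNReal.ofReal (wt s) ≠ 0 := by simpa using wt_pos s
  have h1 : ∫⁻ τ, ENNReal.ofReal (z (s, τ) ^ 2 * sn τ ^ (1 - eta)) < ⊤ :=
    (ENNReal.mul_lt_top_iff.1 hs).elim (fun h => h.2) fun h => h.elim (fun h => absurd h hw)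
      fun h => h ▸ ENNReal.zero_lt_top
  have h2 : SqInt fun τ => z (s, τ) := by
    refine ⟨(by fun_prop : Continuous _).aestronglyMeasurable, ?_⟩
    rwa [hasFiniteIntegral_iff_ofReal (Eventually.of_forall fun τ =>
      mul_nonneg (sq_nonneg _) (sn_rpow_pos _ _).le)]
  refine Integrable.mono' h2 (by fun_prop : Continuous _).aestronglyMeasurable
    (Eventually.of_forall fun τ => ?_)
  rw [Real.norm_of_nonneg (mul_nonneg (sq_nonneg _) (sn_pos _).le)]
  refine mul_le_mul_of_nonneg_left ?_ (sq_nonneg _)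
  simpa using sn_pow_le (n := 1) (a := 1 - eta) (by norm_num [eta]) τ

/-- Mollification in the plane. -/
def conv2 (n : ℕ) (f : ℝ × ℝ → ℝ) (p : ℝ × ℝ) : ℝ :=
  ∫ q, (bump (ℝ × ℝ) n).normed volume q * f (p - q)

section conv2

variable {f z g : ℝ × ℝ → ℝ} (n : ℕ)

lemma contDiff_bump2 : ContDiff ℝ ∞ ((bump (ℝ × ℝ) n).normed volume) := (bump (ℝ × ℝ) n).contDiff_normed

lemma hasCompactSupport_bump2 : HasCompactSupport ((bump (ℝ × ℝ) n).normed volume) :=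
  (bump (ℝ × ℝ) n).hasCompactSupport_normed

lemma continuous_conv2 (hf : LocallyIntegrable f) : Continuous (conv2 n f) :=
  (hasCompactSupport_bump2 n).continuous_convolution_left (ContinuousLinearMap.lsmul ℝ ℝ)
    (contDiff_bump2 n).continuous hf

/-- The reflected and translated mollifier, as a test function. -/
def bumpTest (p : ℝ × ℝ) : Test :=
  ⟨fun q => (bump (ℝ × ℝ) n).normed volume (p - q),
    (contDiff_bump2 n).comp (contDiff_const.sub contDiff_id),
    (hasCompactSupport_bump2 n).comp_homeomorph (Homeomorph.subLeft p)⟩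

lemma conv2_eq_toDist (hf : LocallyIntegrable f) (p : ℝ × ℝ) :
    conv2 n f p = toDist f hf (bumpTest n p) := by
  unfold conv2
  rw [toDist_apply, ← integral_sub_left_eq_self _ volume p]
  congr 1; ext q
  change _ = f q * (bump (ℝ × ℝ) n).normed volume (p - q)
  rw [sub_sub_cancel, mul_comm]

lemma hasDerivAt_conv2 (hf : LocallyIntegrable f) (s τ : ℝ) :
    HasDerivAt (fun x => conv2 n f (s, x)) (Dist.dT (toDist f hf) (bumpTest n (s, τ))) τ := by
  have h1 := (hasCompactSupport_bump2 n).hasFDerivAt_convolution_left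
    (ContinuousLinearMap.lsmul ℝ ℝ) ((contDiff_bump2 n).of_le (by simp)) hf (s, τ)
  have h2 := h1.comp_hasDerivAt τ ((hasDerivAt_const τ s).prodMk (hasDerivAt_id τ))
  refine h2.congr_deriv ?_
  have hc := ((hasCompactSupport_bump2 n).fderiv (𝕜 := ℝ)).convolutionExists_left
    ((ContinuousLinearMap.lsmul ℝ ℝ).precompL (ℝ × ℝ))
    ((contDiff_bump2 n).continuous_fderiv (by simp)) hf (s, τ)
  rw [convolution, ContinuousLinearMap.integral_apply hc, Dist.dT_apply, toDist_apply,
    ← integral_neg, ← integral_sub_left_eq_self _ volume (s, τ)]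
  congr 1; ext q
  rw [sub_sub_cancel, ContinuousLinearMap.precompL_apply]
  have h3 : (dir (0, 1) (bumpTest n (s, τ))).1 q =
      -fderiv ℝ ((bump (ℝ × ℝ) n).normed volume) ((s, τ) - q) (0, 1) := by
    have h4 := ((contDiff_bump2 n).differentiable (by simp) ((s, τ) - q)).hasFDerivAt.comp q
      ((hasFDerivAt_const (s, τ) q).sub (hasFDerivAt_id q))
    rw [dir_apply]
    refine (DFunLike.congr_fun h4.fderiv (0, 1)).trans ?_
    simp [← map_neg]
  rw [h3]
  simp [mul_comm]

/-- Young's inequality for `conv2`. -/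
lemma lintegral_conv2_le {σ : ℝ} (h0 : 0 ≤ σ) (h2 : σ ≤ 2) (hf : Measurable f) :
    ∫⁻ p, (∫⁻ q, ‖(bump (ℝ × ℝ) n).normed volume q‖ₑ * ‖f (p - q)‖ₑ) ^ 2 * ENNReal.ofReal (wgt σ p) ≤
      ENNReal.ofReal (Real.exp 5) * wsq σ f := by
  have hχ : Measurable fun q => ‖(bump (ℝ × ℝ) n).normed volume q‖ₑ :=
    (contDiff_bump2 n).continuous.measurable.enorm
  let m : Measure (ℝ × ℝ) := volume.withDensity fun q => ‖(bump (ℝ × ℝ) n).normed volume q‖ₑ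
  have hm1 : m univ = 1 := by
    rw [withDensity_apply _ MeasurableSet.univ, Measure.restrict_univ,
      ← ofReal_integral_norm_eq_lintegral_enorm
        ((contDiff_bump2 n).continuous.integrable_of_hasCompactSupport (hasCompactSupport_bump2 n))]
    simp_rw [fun q => Real.norm_of_nonneg ((bump (ℝ × ℝ) n).nonneg_normed (μ := volume) q)]
    rw [(bump (ℝ × ℝ) n).integral_normed, ENNReal.ofReal_one]
  have : IsFiniteMeasure m := ⟨by rw [hm1]; exact ENNReal.one_lt_top⟩
  have hm : ∀ᵐ q ∂m, |q.1| ≤ 1 ∧ |q.2| ≤ 1 := by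
    rw [ae_withDensity_iff hχ]
    refine Eventually.of_forall fun q hq => ?_
    have h1 : q ∈ Function.support ((bump (ℝ × ℝ) n).normed volume) := fun h => hq (by simp [h])
    rw [ContDiffBump.support_normed_eq, mem_ball_zero_iff] at h1
    have h3 := h1.le.trans (bump_rOut_le (ℝ × ℝ) n)
    exact ⟨(norm_fst_le q).trans h3, (norm_snd_le q).trans h3⟩
  have key := lintegral_sq_conv_le m hm (φ := fun p => ‖f p‖ₑ) hf.enorm h0 h2
  rw [hm1, one_pow, one_mul, ← wsq_eq] at key
  refine le_trans (le_of_eq (lintegral_congr fun p => ?_)) key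
  have hfp : Measurable fun q => ‖f (p - q)‖ₑ :=
    (hf.comp (measurable_const.sub measurable_id)).enorm
  rw [lintegral_withDensity_eq_lintegral_mul _ hχ hfp]
  rfl

lemma wsq_conv2_le {σ : ℝ} (h0 : 0 ≤ σ) (h2 : σ ≤ 2) (hf : Measurable f) :
    wsq σ (conv2 n f) ≤ ENNReal.ofReal (Real.exp 5) * wsq σ f := by
  refine le_trans ?_ (lintegral_conv2_le n h0 h2 hf)
  rw [wsq_eq]
  refine lintegral_mono fun p => ?_
  gcongr
  refine (enorm_integral_le_lintegral_enorm _).trans_eq (lintegral_congr fun q => ?_)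
  rw [enorm_mul]

/-- The commutator of the mollification with multiplication by `cs`. It gains the factor `sn²`, since
`cs' = -2 sn²`. -/
lemma wsq_commutator_le {σ : ℝ} (h2 : σ ≤ 2) (hf : Measurable f) :
    wsq σ (fun p => ∫ q, (bump (ℝ × ℝ) n).normed volume q *
      ((cs p.2 - cs (p.2 - q.2)) * f (p - q))) ≤
      ENNReal.ofReal (4 * Real.exp 13) * wsq eta f := by
  have h1 := lintegral_conv2_le n eta_pos.le (by linarith [eta_lt_one]) hf
  have h3 : ENNReal.ofReal (4 * Real.exp 13) * wsq eta f =
      ENNReal.ofReal (4 * Real.exp 8) * (ENNReal.ofReal (Real.exp 5) * wsq eta f) := by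
    rw [← mul_assoc, ← ENNReal.ofReal_mul (by positivity), mul_assoc, ← Real.exp_add]; norm_num
  rw [h3]
  refine le_trans ?_ (mul_le_mul_right h1 _)
  rw [← lintegral_const_mul' _ _ ENNReal.ofReal_ne_top, wsq_eq]
  refine lintegral_mono fun p => ?_
  have hc : ‖∫ q, (bump (ℝ × ℝ) n).normed volume q * ((cs p.2 - cs (p.2 - q.2)) * f (p - q))‖ₑ ≤
      ENNReal.ofReal (2 * Real.exp 4 * sn p.2 ^ 2) *
        ∫⁻ q, ‖(bump (ℝ × ℝ) n).normed volume q‖ₑ * ‖f (p - q)‖ₑ := by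
    rw [← lintegral_const_mul' _ _ ENNReal.ofReal_ne_top]
    refine (enorm_integral_le_lintegral_enorm _).trans (lintegral_mono fun q => ?_)
    rw [enorm_mul, enorm_mul, mul_left_comm]
    by_cases hq : (bump (ℝ × ℝ) n).normed volume q = 0
    · simp [hq]
    · have h4 : q ∈ Function.support ((bump (ℝ × ℝ) n).normed volume) := hq
      rw [ContDiffBump.support_normed_eq, mem_ball_zero_iff] at h4
      have h5 := (norm_snd_le q).trans (h4.le.trans (bump_rOut_le (ℝ × ℝ) n))
      gcongr
      rw [Real.enorm_eq_ofReal_abs]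
      exact ENNReal.ofReal_le_ofReal (abs_cs_sub_le p.2 h5)
  have hs : 0 ≤ sn p.2 ^ 2 := sq_nonneg _
  have hw : (2 * Real.exp 4 * sn p.2 ^ 2) ^ 2 * wgt σ p ≤ 4 * Real.exp 8 * wgt eta p := by
    have h6 : sn p.2 ^ 4 * sn p.2 ^ (1 - σ) ≤ sn p.2 ^ (1 - eta) := by
      rw [sn_pow_eq_rpow, ← sn_rpow_add]
      refine sn_rpow_le_rpow ?_ _
      norm_num [eta]; linarith
    have h7 : Real.exp 8 = Real.exp 4 ^ 2 := by rw [← Real.exp_nat_mul]; norm_num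
    have h8 := mul_le_mul_of_nonneg_left h6
      (mul_nonneg (by positivity : 0 ≤ 4 * Real.exp 4 ^ 2) (wt_pos p.1).le)
    unfold wgt
    rw [h7]
    linarith
  calc _ ≤ (ENNReal.ofReal (2 * Real.exp 4 * sn p.2 ^ 2) *
        ∫⁻ q, ‖(bump (ℝ × ℝ) n).normed volume q‖ₑ * ‖f (p - q)‖ₑ) ^ 2 *
          ENNReal.ofReal (wgt σ p) := by gcongr
    _ = ENNReal.ofReal ((2 * Real.exp 4 * sn p.2 ^ 2) ^ 2 * wgt σ p) *
        (∫⁻ q, ‖(bump (ℝ × ℝ) n).normed volume q‖ₑ * ‖f (p - q)‖ₑ) ^ 2 := by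
          rw [ENNReal.ofReal_mul (sq_nonneg _), ENNReal.ofReal_pow (by positivity), mul_pow]
          exact mul_right_comm _ _ _
    _ ≤ ENNReal.ofReal (4 * Real.exp 8 * wgt eta p) *
        (∫⁻ q, ‖(bump (ℝ × ℝ) n).normed volume q‖ₑ * ‖f (p - q)‖ₑ) ^ 2 := by
          gcongr
    _ = _ := by
          rw [ENNReal.ofReal_mul (by positivity : 0 ≤ 4 * Real.exp 8), mul_assoc,
            mul_comm (ENNReal.ofReal (wgt eta p))]

end conv2

lemma locallyIntegrable_mul {a : ℝ → ℝ} (ha : Continuous a) {f : ℝ × ℝ → ℝ} (hf : LocallyIntegrable f) :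
    LocallyIntegrable fun p => a p.2 * f p := by
  rw [← locallyIntegrableOn_univ] at *
  exact hf.continuousOn_mul (ha.comp continuous_snd).continuousOn isClosed_univ.isLocallyClosed

lemma wsq_le_of_tendsto {σ : ℝ} {f : ℕ → ℝ × ℝ → ℝ} {g : ℝ × ℝ → ℝ} {C : ℝ≥0∞}
    (hm : ∀ n, Measurable (f n)) (ht : ∀ᵐ p, Tendsto (fun n => f n p) atTop (𝓝 (g p)))
    (hC : ∀ n, wsq σ (f n) ≤ C) : wsq σ g ≤ C :=
  lintegral_le_of_tendsto
    (fun n => (((hm n).pow_const 2).mul (continuous_wgt σ).measurable).ennreal_ofReal) hC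
    (ht.mono fun _ hp => (ENNReal.continuous_ofReal.tendsto _).comp
      ((hp.pow 2).mul_const _))

/-- The constant of the transport estimate. -/
def transportC : ℝ := 4 * Real.exp 5 + 400 * Real.exp 13

lemma transportC_pos : 0 < transportC := by unfold transportC; positivity

/-- Weighted bounds for the weak solutions of the transport equation `∂_τ z + (5 cs - 1) z = g`.
Mollification reduces this to `hardy_plane`; the commutator with the coefficient is small near both
ends of the angular interval. -/
lemma Bdd.of_transport {σ A B : ℝ} {T : Dist} (h0 : 0 ≤ σ) (h2 : σ ≤ 2) (hA : Bdd eta T A)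
    (hB : Bdd σ (Dist.dT T + Dist.mul (fun τ => 5 * cs τ - 1) contDiff_bcoef T) B) :
    Bdd σ T (transportC * (A + B)) := by
  have hA0 := hA.nonneg
  have hB0 := hB.nonneg
  obtain ⟨z, hzm, hz, hzA, rfl⟩ := hA.exists_rep
  obtain ⟨g, hgm, hg, hgB, hgT⟩ := hB.exists_rep
  have hbz : LocallyIntegrable fun p => (5 * cs p.2 - 1) * z p :=
    locallyIntegrable_mul contDiff_bcoef.continuous hz
  refine bdd_toDist hz (mul_nonneg transportC_pos.le (by positivity)) ?_
  refine wsq_le_of_tendsto (f := fun n => conv2 n z) (fun n => (continuous_conv2 n hz).measurable)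
    (ContDiffBump.ae_convolution_tendsto_right_of_locallyIntegrable (K := 2)
      (tendsto_bump_rOut (ℝ × ℝ)) (Eventually.of_forall fun n => ?_) hz) fun n => ?_
  · simp only [bump]
    exact le_of_eq (by ring)
  let h : ℝ × ℝ → ℝ := fun p => conv2 n g p + 5 * ∫ q, (bump (ℝ × ℝ) n).normed volume q *
    ((cs p.2 - cs (p.2 - q.2)) * z (p - q))
  have hh : ∀ p, h p = conv2 n g p + (5 * cs p.2 - 1) * conv2 n z p -
      conv2 n (fun p => (5 * cs p.2 - 1) * z p) p := fun p => by
    have i1 : Integrable fun q => (bump (ℝ × ℝ) n).normed volume q * z (p - q) :=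
      (hasCompactSupport_bump2 n).convolutionExists_left (ContinuousLinearMap.lsmul ℝ ℝ)
        (contDiff_bump2 n).continuous hz p
    have i2 : Integrable fun q => (bump (ℝ × ℝ) n).normed volume q *
        ((5 * cs (p - q).2 - 1) * z (p - q)) :=
      (hasCompactSupport_bump2 n).convolutionExists_left (ContinuousLinearMap.lsmul ℝ ℝ)
        (contDiff_bump2 n).continuous hbz p
    simp only [h, conv2, add_sub_assoc]
    rw [← integral_const_mul, ← integral_const_mul, ← integral_sub (i1.const_mul _) i2]
    congr 2; ext q
    simp only [Prod.snd_sub]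
    ring
  have hc : Continuous h := by
    rw [show h = _ from funext hh]
    have h1 := continuous_conv2 n hg
    have h2 := continuous_conv2 n hz
    have h3 := continuous_conv2 n hbz
    have h4 := continuous_cs
    fun_prop
  have hd : ∀ s τ, HasDerivAt (fun x => conv2 n z (s, x))
      ((1 - 5 * cs τ) * conv2 n z (s, τ) + h (s, τ)) τ := fun s τ => by
    refine (hasDerivAt_conv2 n hz s τ).congr_deriv ?_
    have h1 := LinearMap.congr_fun hgT (bumpTest n (s, τ))
    rw [← toDist_mul hz contDiff_bcoef hbz, LinearMap.add_apply, ← conv2_eq_toDist,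
      ← conv2_eq_toDist] at h1
    rw [hh]
    simp only
    linarith
  have e1 := wsq_conv2_le n eta_pos.le (by linarith [eta_lt_one]) hzm
  refine (hardy_plane h0 (continuous_conv2 n hz) hc hd (e1.trans_lt (ENNReal.mul_lt_top
    ENNReal.ofReal_lt_top (hzA.trans_lt ENNReal.ofReal_lt_top)))).trans ?_
  have e2 := wsq_add_le (σ := σ) (g := fun p => 5 * ∫ q, (bump (ℝ × ℝ) n).normed volume q *
    ((cs p.2 - cs (p.2 - q.2)) * z (p - q))) (continuous_conv2 n hg).measurable
  rw [wsq_const_mul] at e2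
  have e3 := (wsq_conv2_le n h0 h2 hgm).trans (mul_le_mul_right hgB _)
  have e4 := (wsq_commutator_le n h2 hzm).trans (mul_le_mul_right hzA _)
  rw [← ENNReal.ofReal_mul (by positivity)] at e3 e4
  calc 2 * wsq σ h ≤ 2 * (2 * ENNReal.ofReal (Real.exp 5 * B) +
        2 * (ENNReal.ofReal (5 ^ 2) * ENNReal.ofReal (4 * Real.exp 13 * A))) := by
        gcongr
        exact e2.trans (by gcongr)
    _ = ENNReal.ofReal (2 * (2 * (Real.exp 5 * B) + 2 * (5 ^ 2 * (4 * Real.exp 13 * A)))) := by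
        have p1 : 0 ≤ Real.exp 5 * B := by positivity
        have p2 : 0 ≤ 4 * Real.exp 13 * A := by positivity
        rw [ENNReal.ofReal_mul (p := 2) (by norm_num),
          ENNReal.ofReal_add (by positivity) (by positivity),
          ENNReal.ofReal_mul (p := 2) (by norm_num), ENNReal.ofReal_mul (p := 2) (by norm_num),
          ENNReal.ofReal_mul (p := 5 ^ 2) (by norm_num), ENNReal.ofReal_ofNat]
    _ ≤ ENNReal.ofReal (transportC * (A + B)) := by
        refine ENNReal.ofReal_le_ofReal ?_
        unfold transportC
        have p1 : 0 ≤ Real.exp 5 * A := by positivity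
        have p2 : 0 ≤ Real.exp 13 * A := by positivity
        have p3 : 0 ≤ Real.exp 13 * B := by positivity
        nlinarith

open Polynomial in
lemma contDiff_polynomial_cs (p : ℝ[X]) : ContDiff ℝ ∞ fun τ => p.eval (cs τ) := by
  have : ContDiff ℝ ∞ fun x : ℝ => p.eval x := by
    simpa [Polynomial.aeval_def, Polynomial.eval₂_eq_eval_map] using p.contDiff_aeval (𝕜 := ℝ) ∞
  exact this.comp contDiff_cs

open Polynomial in
/-- Multiplication by a polynomial in `cs`. -/
def Dist.pm (p : ℝ[X]) (T : Dist) : Dist :=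
  Dist.mul (fun τ => p.eval (cs τ)) (contDiff_polynomial_cs p) T

/-! ### Families of distributions with uniform bounds -/

/-- Families of distributions. The index ranges over all the data of the problem, which makes
"uniform in the data" a property of a family. -/
abbrev Fam (ι : Type*) := ι → Dist

namespace Fam

open Polynomial

variable {ι : Type*}

/-- `∂_τ`. -/
def dT (T : Fam ι) : Fam ι := fun x => (T x).dT

/-- Multiplication by a polynomial in `cs`. -/
def pm (p : ℝ[X]) (T : Fam ι) : Fam ι := fun x => (T x).pm p

/-- The polynomial representing `d/dτ p(cs)`; recall `cs' = -2 (1 - cs²)`. -/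
def dpoly (p : ℝ[X]) : ℝ[X] := (1 - X ^ 2) * (C (-2) * derivative p)

variable (T S : Fam ι) (p q : ℝ[X]) (c : ι → ℝ)

lemma dT_add : dT (T + S) = dT T + dT S := funext fun x => Dist.dT_add (T x) (S x)
lemma dT_smul : dT (c • T) = c • dT T := funext fun x => Dist.dT_smul (T x) (c x)
lemma pm_add : pm p (T + S) = pm p T + pm p S :=
  funext fun x => Dist.mul_add (T x) (S x) _
lemma pm_pm : pm p (pm q T) = pm (p * q) T := by
  ext1 x
  refine (Dist.mul_mul _ _ _).trans (Dist.mul_congr _ _ _ fun τ => ?_)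
  simp

lemma pm_add_left : pm (p + q) T = pm p T + pm q T := by
  ext1 x
  refine Eq.trans (Dist.mul_congr _ _ ?_ fun τ => ?_) (Dist.mul_add_left _ _ _)
  · exact (contDiff_polynomial_cs p).add (contDiff_polynomial_cs q)
  · simp

lemma pm_C (a : ℝ) : pm (C a) T = (fun _ : ι => a) • T := by
  ext1 x
  refine Eq.trans (Dist.mul_congr _ _ contDiff_const fun τ => ?_) (Dist.mul_const (T x) a)
  simp

lemma dT_pm : dT (pm p T) = pm (dpoly p) T + pm p (dT T) := by
  ext1 x
  refine Dist.dT_mul (T x) _ _ fun τ => ?_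
  refine ((p.hasDerivAt (cs τ)).comp τ (hasDerivAt_cs τ)).congr_deriv ?_
  simp only [dpoly, eval_mul, eval_sub, eval_one, eval_pow, eval_X, eval_C]
  rw [← sn_sq]
  ring

/-- The family is bounded in the weighted `L²` spaces with exponents `σ`; the norm is compared with
the gauge `N`. -/
def UB (N : ι → ℝ) (σ : ι → ℝ) (T : Fam ι) : Prop := ∃ C, 0 ≤ C ∧ ∀ x, Bdd (σ x) (T x) (C * N x)

/-- `∂_τ^m T` is bounded in the space with exponents `σ` for all `m ≤ n`. -/
def UBG (N : ι → ℝ) (σ : ι → ℝ) : ℕ → Fam ι → Prop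
  | 0, T => UB N σ T
  | n + 1, T => UB N σ T ∧ UBG N σ n (dT T)

/-- `T` is bounded in the space with exponent `η`, and `∂_τ^m T`, `1 ≤ m ≤ n`, in the space with
exponents `γ`. -/
def UBM (N : ι → ℝ) (γ : ι → ℝ) : ℕ → Fam ι → Prop
  | 0, T => UB N (fun _ => eta) T
  | n + 1, T => UB N (fun _ => eta) T ∧ UBG N γ n (dT T)

section bounds

variable {N σ γ : ι → ℝ} {T S : Fam ι} {n : ℕ}

lemma UB.add (hT : UB N σ T) (hS : UB N σ S) : UB N σ (T + S) := by
  obtain ⟨A, hA, h1⟩ := hT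
  obtain ⟨B, hB, h2⟩ := hS
  refine ⟨2 * A + 2 * B, by positivity, fun x => ((h1 x).add (h2 x)).mono (le_of_eq ?_)⟩
  ring

lemma UB.smul (hN : ∀ x, 0 ≤ N x) (hT : UB N σ T) {c : ι → ℝ} {K : ℝ} (hc : ∀ x, |c x| ≤ K) :
    UB N σ (c • T) := by
  obtain ⟨A, hA, h1⟩ := hT
  refine ⟨K ^ 2 * A, by positivity, fun x => ((h1 x).smul (c x)).mono ?_⟩
  have h2 := sq_le_sq' (by linarith [neg_abs_le (c x), hc x]) ((le_abs_self _).trans (hc x))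
  have := mul_le_mul_of_nonneg_right h2 (mul_nonneg hA (hN x))
  linarith

lemma exists_bound (p : ℝ[X]) : ∃ K, 0 < K ∧ ∀ τ, |p.eval (cs τ)| ≤ K := by
  obtain ⟨K, hK⟩ := (isCompact_Icc (a := (-1 : ℝ)) (b := 1)).exists_bound_of_continuousOn
    p.continuous.continuousOn
  refine ⟨max K 1, by positivity, fun τ => (hK (cs τ) ?_).trans (le_max_left _ _)⟩
  exact abs_le.1 (abs_cs_le_one τ)

lemma UB.pm (hT : UB N σ T) (p : ℝ[X]) : UB N σ (pm p T) := by
  obtain ⟨A, hA, h1⟩ := hT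
  obtain ⟨K, hK, h2⟩ := exists_bound p
  refine ⟨K ^ 2 * A, by positivity, fun x => ?_⟩
  rw [mul_assoc]
  exact (h1 x).mul_of_bounded _ hK h2

lemma UB.of_le (hT : UB N γ T) (h : ∀ x, σ x ≤ γ x) : UB N σ T := by
  obtain ⟨A, hA, h1⟩ := hT
  exact ⟨A, hA, fun x => (h1 x).of_le_exponent (h x)⟩

/-- The factor `sn²` maps the space with exponent `η` to the one with exponent `γ`. -/
lemma UB.pm_sn_sq (hT : UB N (fun _ => eta) T) (hγ : ∀ x, γ x ≤ 2) (p : ℝ[X]) :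
    UB N γ (Fam.pm ((1 - X ^ 2) * p) T) := by
  rw [mul_comm, ← pm_pm]
  refine UB.pm ?_ p
  obtain ⟨A, hA, h1⟩ := hT
  refine ⟨A, hA, fun x => (h1 x).mul _ fun τ => ?_⟩
  simp only [eval_sub, eval_one, eval_pow, eval_X]
  rw [← sn_sq, ← pow_mul, sn_pow_eq_rpow, ← sn_rpow_add]
  refine sn_rpow_le_rpow ?_ τ
  have := hγ x
  norm_num [eta]
  linarith

lemma UBG.pred (h : UBG N σ (n + 1) T) : UBG N σ n T := by
  induction n generalizing T with
  | zero => exact h.1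
  | succ n ih => exact ⟨h.1, ih h.2⟩

lemma UBG.of_le (h : UBG N γ n T) (hσ : ∀ x, σ x ≤ γ x) : UBG N σ n T := by
  induction n generalizing T with
  | zero => exact UB.of_le h hσ
  | succ n ih => exact ⟨h.1.of_le hσ, ih h.2⟩

lemma UBG.add (hT : UBG N σ n T) (hS : UBG N σ n S) : UBG N σ n (T + S) := by
  induction n generalizing T S with
  | zero => exact UB.add hT hS
  | succ n ih => exact ⟨hT.1.add hS.1, by rw [dT_add]; exact ih hT.2 hS.2⟩

lemma UBG.smul (hN : ∀ x, 0 ≤ N x) (hT : UBG N σ n T) {c : ι → ℝ} {K : ℝ} (hc : ∀ x, |c x| ≤ K) :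
    UBG N σ n (c • T) := by
  induction n generalizing T with
  | zero => exact UB.smul hN hT hc
  | succ n ih => exact ⟨hT.1.smul hN hc, by rw [dT_smul]; exact ih hT.2⟩

lemma UBG.pm (hT : UBG N σ n T) (p : ℝ[X]) : UBG N σ n (pm p T) := by
  induction n generalizing T p with
  | zero => exact UB.pm hT p
  | succ n ih => exact ⟨hT.1.pm p, by rw [dT_pm]; exact (ih hT.pred _).add (ih hT.2 p)⟩

lemma UBM.pred (h : UBM N γ (n + 1) T) : UBM N γ n T := by
  cases n with
  | zero => exact h.1
  | succ n => exact ⟨h.1, h.2.pred⟩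

lemma UBM.add (hT : UBM N γ n T) (hS : UBM N γ n S) : UBM N γ n (T + S) := by
  cases n with
  | zero => exact UB.add hT hS
  | succ n => exact ⟨hT.1.add hS.1, by rw [dT_add]; exact hT.2.add hS.2⟩

lemma UBM.smul (hN : ∀ x, 0 ≤ N x) (hT : UBM N γ n T) {c : ι → ℝ} {K : ℝ} (hc : ∀ x, |c x| ≤ K) :
    UBM N γ n (c • T) := by
  cases n with
  | zero => exact UB.smul hN hT hc
  | succ n => exact ⟨hT.1.smul hN hc, by rw [dT_smul]; exact hT.2.smul hN hc⟩

lemma UBM.ubg (h : UBM N γ n T) (hγ : ∀ x, eta ≤ γ x) : UBG N (fun _ => eta) n T := by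
  cases n with
  | zero => exact h
  | succ n => exact ⟨h.1, h.2.of_le hγ⟩

lemma UBG.ubm (h : UBG N γ n T) (hγ : ∀ x, eta ≤ γ x) : UBM N γ n T := by
  cases n with
  | zero => exact UB.of_le h hγ
  | succ n => exact ⟨h.1.of_le hγ, h.2⟩

/-- The derivatives of the coefficient `sn² p(cs)` contain the factor `sn²` again, so every term in
which fewer derivatives fall on `T` gains the exponent `γ`. -/
lemma UBM.pm_sn_sq (h : UBM N γ n T) (hγ : ∀ x, γ x ≤ 2) (p : ℝ[X]) :
    UBG N γ n (Fam.pm ((1 - X ^ 2) * p) T) := by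
  induction n generalizing p with
  | zero => exact UB.pm_sn_sq h hγ p
  | succ n ih =>
    refine ⟨h.1.pm_sn_sq hγ p, ?_⟩
    rw [dT_pm]
    exact (ih h.pred _).add (h.2.pm _)

lemma UBM.pm (h : UBM N γ n T) (hγ : ∀ x, γ x ≤ 2) (p : ℝ[X]) : UBM N γ n (Fam.pm p T) := by
  cases n with
  | zero => exact UB.pm h p
  | succ n =>
    refine ⟨h.1.pm p, ?_⟩
    rw [dT_pm]
    exact (h.pred.pm_sn_sq hγ _).add (h.2.pm _)

lemma UBM.iterate (h : UBM N γ n T) {i : ℕ} (hi : 1 ≤ i) (hin : i ≤ n) : UB N γ (dT^[i] T) := by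
  have key : ∀ (m i : ℕ) (S : Fam ι), UBG N γ m S → i ≤ m → UB N γ (dT^[i] S) := fun m => by
    induction m with
    | zero =>
      intro i S hS hi
      obtain rfl : i = 0 := by omega
      exact hS
    | succ m ih =>
      intro i S hS hi
      cases i with
      | zero => exact hS.1
      | succ i => exact ih i (dT S) hS.2 (by omega)
  obtain ⟨i, rfl⟩ := Nat.exists_eq_add_of_le' hi
  obtain ⟨m, rfl⟩ := Nat.exists_eq_add_of_le' (hi.trans hin)
  exact key m i (dT T) h.2 (by omega)

/-- The coefficient of the transport equation. -/
def bpoly : ℝ[X] := 5 * X - 1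

lemma dpoly_bpoly : dpoly bpoly = (1 - X ^ 2) * C (-10) := by
  simp only [dpoly, bpoly, derivative_sub, derivative_mul, derivative_X, derivative_one]
  have : (derivative (5 : ℝ[X])) = 0 := derivative_ofNat 5
  rw [this]
  have : (C (-10) : ℝ[X]) = C (-2) * 5 := by
    rw [show (5 : ℝ[X]) = C 5 from rfl, ← C_mul]; norm_num
  rw [this]; ring

/-- Regularity for the transport equation: a bound with the exponent `η` improves to the exponent of the
right-hand side. -/
lemma UBG.of_transport (h0 : ∀ x, 0 ≤ γ x) (h2 : ∀ x, γ x ≤ 2)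
    (hT : UBG N (fun _ => eta) n T) (hg : UBG N γ n (dT T + Fam.pm bpoly T)) : UBG N γ n T := by
  have base : ∀ T : Fam ι, UB N (fun _ => eta) T → UB N γ (dT T + Fam.pm bpoly T) → UB N γ T := by
    rintro T ⟨A, hA, h3⟩ ⟨B, hB, h4⟩
    refine ⟨transportC * (A + B), mul_nonneg transportC_pos.le (by positivity), fun x => ?_⟩
    refine (Bdd.of_transport (h0 x) (h2 x) (h3 x) (B := B * N x) ?_).mono (le_of_eq (by ring))
    have := h4 x
    have e : Dist.mul (fun τ => 5 * cs τ - 1) contDiff_bcoef (T x) = (T x).pm bpoly :=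
      Dist.mul_congr _ _ _ fun τ => by simp [bpoly]
    rwa [e]
  induction n generalizing T with
  | zero => exact base T hT hg
  | succ n ih =>
    refine ⟨base T hT.1 hg.1, ih hT.2 ?_⟩
    have h3 := ih hT.pred hg.pred
    have h4 := hg.2
    rw [dT_add, dT_pm] at h4
    have h5 := h4.add (h3.pm (-dpoly bpoly))
    convert h5 using 1
    have : Fam.pm (dpoly bpoly) T + Fam.pm (-dpoly bpoly) T = 0 := by
      rw [← pm_add_left, add_neg_cancel, ← C_0, pm_C]
      ext1 x; simp
    rw [add_assoc, add_assoc, add_comm (Fam.pm bpoly (dT T)), ← add_assoc (Fam.pm (dpoly bpoly) T),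
      this, zero_add]

end bounds

/-! ### The angular induction -/

/-- The relations between the `s`-derivatives of `Z`, `u₁ = α ∂_s u`, `u₂ = α² ∂_s² u`, `y` and `w`,
and the bounds that hold before any angular derivative is taken. The first argument of each sequence
is the number of `s`-derivatives. -/
structure Hierarchy (k : ℕ) (N γ α : ι → ℝ) (F Z u1 u2 y w : ℕ → Fam ι) : Prop where
  gauge : ∀ x, 0 ≤ N x
  eta_le : ∀ x, eta ≤ γ x
  le_two : ∀ x, γ x ≤ 2
  abs_le : ∀ x, |α x| ≤ 1
  dT_Z : ∀ j, dT (Z j) = pm (2 * X) (Z j) + pm (1 - X ^ 2) (w j)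
  dT_u1 : ∀ j, dT (u1 j) = pm (2 * X) (u1 j) + α • pm (1 - X ^ 2) (w (j + 1))
  dT_u2 : ∀ j, dT (u2 j) = pm (2 * X) (u2 j) + α • α • pm (1 - X ^ 2) (w (j + 2))
  u2_eq : ∀ j, u2 j = α • u1 (j + 1)
  y_eq : ∀ j, y j = F j + u2 j + pm (C 5) (u1 j)
  transport : ∀ j, dT (w j) + pm bpoly (w j) = pm (C (-1)) (y j)
  bF : ∀ n j, n + j ≤ k → UBM N γ n (F j)
  bZ : ∀ j, j ≤ k → UB N γ (Z j)
  bu1 : ∀ j, j ≤ k → UB N γ (u1 j)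
  bdw : ∀ j, j ≤ k → UB N γ (α • pm (1 - X ^ 2) (w (j + 1)))
  bu2 : ∀ j, j ≤ k → UB N (fun _ => eta) (u2 j)
  by' : ∀ j, j ≤ k → UB N (fun _ => eta) (y j)
  bw : ∀ j, j ≤ k → UB N (fun _ => eta) (w j)

/-- Induction on the number `n` of angular derivatives, for all numbers `j` of radial derivatives with
`n + j ≤ k` at once: angular derivatives of the `j`-th members involve the members `j + 1` and
`j + 2` with fewer angular derivatives. -/
lemma Hierarchy.regularity {k : ℕ} {N γ α : ι → ℝ} {F Z u1 u2 y w : ℕ → Fam ι}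
    (h : Hierarchy k N γ α F Z u1 u2 y w) (n : ℕ) : ∀ j, n + j ≤ k →
      UBG N γ n (Z j) ∧ UBG N γ n (u1 j) ∧ UBM N γ n (u2 j) ∧ UBM N γ n (y j) ∧
        UBM N γ n (w j) := by
  induction n using Nat.strong_induction_on with
  | _ n ih =>
  intro j hj
  rcases n with _ | n
  · have hj' : j ≤ k := by omega
    exact ⟨h.bZ j hj', h.bu1 j hj', h.bu2 j hj', h.by' j hj', h.bw j hj'⟩
  obtain ⟨i1, i2, -, i4, i5⟩ := ih n (by omega) j (by omega)
  obtain ⟨-, j2, -, -, j5⟩ := ih n (by omega) (j + 1) (by omega)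
  have sn1 : ∀ m T, UBM N γ m T → UBG N γ m (pm (1 - X ^ 2) T) := fun m T hT => by
    simpa using hT.pm_sn_sq h.le_two 1
  have hZ : UBG N γ (n + 1) (Z j) := by
    refine ⟨h.bZ j (by omega), ?_⟩
    rw [h.dT_Z]
    exact (i1.pm _).add (sn1 _ _ i5)
  have hu1 : UBG N γ (n + 1) (u1 j) := by
    refine ⟨h.bu1 j (by omega), ?_⟩
    rw [h.dT_u1]
    exact (i2.pm _).add ((sn1 _ _ j5).smul h.gauge h.abs_le)
  have hu2 : UBM N γ (n + 1) (u2 j) := by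
    refine ⟨h.bu2 j (by omega), ?_⟩
    rw [h.dT_u2]
    refine UBG.add ?_ (UBG.smul h.gauge ?_ h.abs_le)
    · rw [h.u2_eq]
      exact (j2.smul h.gauge h.abs_le).pm _
    -- `α sn² ∂_s^{j+2} w` itself is not covered by the induction hypothesis; its `τ`-derivative is,
    -- since the transport equation trades it for a term without derivative
    rcases n with _ | n
    · exact h.bdw (j + 1) (by omega)
    refine ⟨h.bdw (j + 1) (by omega), ?_⟩
    obtain ⟨-, -, -, l4, l5⟩ := ih n (by omega) (j + 2) (by omega)
    have e : dT (α • pm (1 - X ^ 2) (w (j + 1 + 1))) = α • (pm ((1 - X ^ 2) * (1 - X)) (w (j + 2)) +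
        pm ((1 - X ^ 2) * C (-1)) (y (j + 2))) := by
      have e1 := h.transport (j + 2)
      have e2 : dT (w (j + 2)) = pm (C (-1)) (y (j + 2)) + pm (-bpoly) (w (j + 2)) := by
        rw [← e1, add_assoc, ← pm_add_left, add_neg_cancel, ← C_0, pm_C]
        ext1 x; simp
      rw [dT_smul, dT_pm]
      congr 1
      change pm (dpoly _) (w (j + 2)) + pm _ (dT (w (j + 2))) = _
      rw [e2, pm_add, pm_pm, pm_pm, add_comm (pm _ (y _)), ← add_assoc, ← pm_add_left]
      congr 2
      simp only [dpoly, bpoly, derivative_sub, derivative_one, derivative_X_pow]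
      have e3 : (C (-2) : ℝ[X]) = -2 := by rw [C_neg]; rfl
      have e4 : (C (-1) : ℝ[X]) = -1 := by rw [C_neg]; rfl
      have e5 : (C ((2 : ℕ) : ℝ) : ℝ[X]) = 2 := by norm_num; rfl
      rw [e3, e5]
      ring
    rw [e]
    exact ((l5.pm_sn_sq h.le_two _).add (l4.pm_sn_sq h.le_two _)).smul h.gauge h.abs_le
  have hy : UBM N γ (n + 1) (y j) := by
    rw [h.y_eq]
    exact ((h.bF _ _ hj).add hu2).add ((hu1.pm _).ubm h.eta_le)
  refine ⟨hZ, hu1, hu2, hy, h.bw j (by omega), ?_⟩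
  refine UBG.of_transport (fun x => eta_pos.le.trans (h.eta_le x)) h.le_two ?_ ?_
  · have e2 : dT (w j) = pm (C (-1)) (y j) + pm (-bpoly) (w j) := by
      rw [← h.transport j, add_assoc, ← pm_add_left, add_neg_cancel, ← C_0, pm_C]
      ext1 x; simp
    rw [e2]
    exact ((i4.ubg h.eta_le).pm _).add ((i5.ubg h.eta_le).pm _)
  · have e := congrArg dT (h.transport j)
    rw [dT_add, dT_pm, dT_pm, dpoly_bpoly] at e
    have e3 : dT (dT (w j)) + pm bpoly (dT (w j)) =
        pm (C (-1)) (dT (y j)) + pm ((1 - X ^ 2) * C 10) (w j) := by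
      have e4 : pm (dpoly (C (-1))) (y j) = 0 := by
        simp only [dpoly, derivative_C, mul_zero]
        rw [← C_0, pm_C]
        ext1 x; simp
      rw [e4, zero_add] at e
      rw [← e, add_assoc, add_right_comm (pm _ (w j)), ← pm_add_left, ← mul_add, ← C_add]
      rw [show (-10 : ℝ) + 10 = 0 by norm_num, C_0, mul_zero, ← C_0, pm_C]
      ext1 x; simp
    rw [e3]
    exact (hy.2.pm _).add (i5.pm_sn_sq h.le_two _)

end Fam

/-! ### The estimate in the plane -/

/-- The distribution defined by a continuous function. -/
def ofCont (f : ℝ × ℝ → ℝ) (hf : Continuous f) : Dist := toDist f hf.locallyIntegrable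

namespace Dist

variable (T S : Dist) (c : ℝ) {a : ℝ → ℝ} (ha : ContDiff ℝ ∞ a) (j : ℕ)

lemma dS_iterate_add : dS^[j] (T + S) = dS^[j] T + dS^[j] S := by
  induction j generalizing T S with
  | zero => rfl
  | succ j ih => rw [Function.iterate_succ_apply, dS_add, ih]; rfl

lemma dS_iterate_smul : dS^[j] (c • T) = c • dS^[j] T := by
  induction j generalizing T with
  | zero => rfl
  | succ j ih => rw [Function.iterate_succ_apply, dS_smul, ih]; rfl

lemma dS_iterate_mul : dS^[j] (mul a ha T) = mul a ha (dS^[j] T) := by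
  induction j generalizing T with
  | zero => rfl
  | succ j ih => rw [Function.iterate_succ_apply, dS_mul, ih]; rfl

lemma dS_iterate_dT : dS^[j] (dT T) = dT (dS^[j] T) := by
  induction j generalizing T with
  | zero => rfl
  | succ j ih => rw [Function.iterate_succ_apply, dS_dT, ih]; rfl

end Dist

/-- A variant of `bdd_of_sconv` with a constant factor and an angular coefficient. -/
lemma bdd_iterate_of_sconv {σ B : ℝ} {f : ℝ × ℝ → ℝ} (hf : Continuous f) (hB : 0 ≤ B) (j : ℕ) {a : ℝ → ℝ}
    (ha : ContDiff ℝ ∞ a) (c : ℝ)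
    (h : ∀ n, wsq σ (fun p => c * (a p.2 *
      sconv (iteratedDeriv j ((bump ℝ n).normed volume)) f p)) ≤ ENNReal.ofReal B) :
    Bdd σ (Dist.mul a ha (c • Dist.dS^[j] (ofCont f hf))) B := by
  have hac := ha.continuous
  have h1 : Continuous fun p : ℝ × ℝ => a p.2 * f p := by fun_prop
  have hg : Continuous fun p : ℝ × ℝ => c * (a p.2 * f p) := by fun_prop
  have key := bdd_of_sconv (σ := σ) hg hB j fun n => by
    refine le_trans (le_of_eq ?_) (h n)
    congr 1; ext p
    rw [sconv_mul (fun _ => c) (fun p => a p.2 * f p), sconv_mul]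
  rw [toDist_smul h1.locallyIntegrable, toDist_mul hf.locallyIntegrable ha,
    Dist.dS_iterate_smul, Dist.dS_iterate_mul, ← Dist.mul_smul] at key
  exact key

lemma contDiff_inv_sn : ContDiff ℝ ∞ fun τ => (sn τ)⁻¹ :=
  contDiff_sn.inv fun τ => (sn_pos τ).ne'

/-- Multiplication by `sn` maps the space with exponent `η` to the one with exponent `γ ≤ 2`. -/
lemma Bdd.mul_sn {γ B : ℝ} {T : Dist} (hγ : γ ≤ 2) (h : Bdd eta T B) :
    Bdd γ (Dist.mul sn contDiff_sn T) B := by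
  refine h.mul _ fun τ => ?_
  rw [sn_pow_eq_rpow, ← sn_rpow_add]
  refine sn_rpow_le_rpow ?_ τ
  norm_num [eta]; linarith

lemma Bdd.of_mul_inv_sn {γ B : ℝ} {T : Dist} (hγ : γ ≤ 2)
    (h : Bdd eta (Dist.mul (fun τ => (sn τ)⁻¹) contDiff_inv_sn T) B) : Bdd γ T B := by
  have := h.mul_sn hγ
  rw [Dist.mul_mul, Dist.mul_congr _ _ contDiff_const fun τ => mul_inv_cancel₀ (sn_pos τ).ne',
    Dist.mul_const, one_smul] at this
  exact this

/-- A solution of the problem in the plane, with a bound `N` for the square of the norm of the right-hand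
side. -/
structure Datum (k : ℕ) where
  /-- The parameter of the equation. -/
  α : ℝ
  /-- The angular exponent of the weights for angular derivatives. -/
  γ : ℝ
  /-- The solution. -/
  u : ℝ × ℝ → ℝ
  /-- `∂_s u`. -/
  u1 : ℝ × ℝ → ℝ
  /-- `∂_s² u`. -/
  u2 : ℝ × ℝ → ℝ
  /-- `(∂_τ u - 2 cs u) / sn²`. -/
  w : ℝ × ℝ → ℝ
  /-- `(1 - 5 cs) w - ∂_τ w`. -/
  y : ℝ × ℝ → ℝ
  /-- The bound for the right-hand side. -/
  N : ℝ
  α_pos : 0 < α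
  α_le : α ≤ 1 / 4
  eta_le : eta ≤ γ
  γ_le : γ ≤ 2
  sol : PlaneSol u u1 u2 w y
  bound_zero : ∀ j ≤ k, Bdd eta (Dist.dS^[j] (ofCont (rhs α u1 u2 y) (sol.continuous_rhs α))) N
  bound_succ : ∀ i j, 1 ≤ i → i + j ≤ k →
    Bdd γ (Dist.dT^[i] (Dist.dS^[j] (ofCont (rhs α u1 u2 y) (sol.continuous_rhs α)))) N

/-- The constant of the radial estimates. -/
def radC : ℝ := 2 * bigC * Real.exp 5

lemma radC_pos : 0 < radC := by have := bigC_pos; unfold radC; positivity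

namespace Datum

variable {k : ℕ} (x : Datum k)

/-- The right-hand side of the equation. -/
def F : ℝ × ℝ → ℝ := rhs x.α x.u1 x.u2 x.y

lemma continuous_F : Continuous x.F := x.sol.continuous_rhs x.α

lemma N_nonneg : 0 ≤ x.N := (x.bound_zero 0 (Nat.zero_le _)).nonneg

lemma wsq_F_lt : wsq eta x.F < ⊤ := by
  obtain ⟨g, -, hg, hgN, h⟩ := (x.bound_zero 0 (Nat.zero_le _)).exists_rep
  have h1 : x.F =ᵐ[volume] g := ae_eq_of_toDist_eq (hf := x.continuous_F.locallyIntegrable) h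
  refine lt_of_le_of_lt (wsq_mono (h1.mono fun p hp => ?_)) (hgN.trans_lt ENNReal.ofReal_lt_top)
  rw [hp]

lemma wsq_sconv_F_le {j : ℕ} (hj : j ≤ k) (n : ℕ) :
    wsq eta (sconv (iteratedDeriv j ((bump ℝ n).normed volume)) x.F) ≤
      ENNReal.ofReal (Real.exp 5 * x.N) := by
  obtain ⟨g, hgm, hg, hgN, h⟩ := (x.bound_zero j hj).exists_rep
  have h1 := sconv_iteratedDeriv_ae x.continuous_F hg hgm h (isKernel_bump n)
  refine (wsq_mono (h1.mono fun p hp => by rw [hp])).trans ?_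
  refine (wsq_sconv_le (isKernel_bump n) hgm eta_pos.le (by linarith [eta_lt_one])).trans ?_
  rw [integral_abs_bump, ENNReal.ofReal_one, one_pow, one_mul,
    ENNReal.ofReal_mul (Real.exp_pos 5).le]
  gcongr

/-- The right-hand side of the radial estimate, for the derivatives of the mollifiers: convolution with
the `j`-th derivative of a mollifier mollifies `∂_s^j F`. -/
lemma radial {j : ℕ} (hj : j ≤ k) (n : ℕ) :
    ENNReal.ofReal (2 * bigC) * wsq eta
      (sconv (iteratedDeriv j ((bump ℝ n).normed volume)) (rhs x.α x.u1 x.u2 x.y)) ≤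
      ENNReal.ofReal (radC * x.N) := by
  refine (mul_le_mul_right (x.wsq_sconv_F_le hj n) _).trans (le_of_eq ?_)
  rw [← ENNReal.ofReal_mul (by have := bigC_pos; positivity)]
  congr 1; unfold radC; ring

/-- The solution, as a distribution. -/
def U : Dist := ofCont x.u x.sol.cu

/-- `w`, as a distribution. -/
def W : Dist := ofCont x.w x.sol.cw

/-- `y`, as a distribution. -/
def Y : Dist := ofCont x.y x.sol.cy

/-- The regular part of the solution, as a distribution. -/
def Z : Dist := ofCont (PlaneSol.regular x.α x.u x.F) (x.sol.continuous_regular x.wsq_F_lt)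

lemma radC_mul_nonneg : 0 ≤ radC * x.N := mul_nonneg radC_pos.le x.N_nonneg

/-- The radial estimate for the kernels that mollify `∂_s^j`, uniformly in the mollifier. -/
lemma estimate {j : ℕ} (hj : j ≤ k) (n : ℕ) :
    let κ := iteratedDeriv j ((bump ℝ n).normed volume)
    let B := ENNReal.ofReal (radC * x.N)
    wsq eta (fun p => x.α ^ 2 * sconv (deriv (deriv κ)) x.u p) ≤ B ∧
    wsq eta (fun p => x.α * (sconv (deriv κ) x.u p / sn p.2)) ≤ B ∧
    wsq eta (fun p => x.α * (sn p.2 * sconv (deriv κ) x.w p)) ≤ B ∧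
    wsq eta (fun p => sconv κ (PlaneSol.regular x.α x.u x.F) p / sn p.2) ≤ B ∧
    wsq eta (sconv κ x.y) ≤ B ∧ wsq eta (sconv κ x.w) ≤ B := by
  obtain ⟨h1, h2, h3, h4, h5, h6⟩ := x.sol.mollified_estimate x.α_pos x.α_le x.wsq_F_lt
    ((isKernel_bump n).iteratedDeriv j)
  have h := x.radial hj n
  exact ⟨h1.trans h, h2.trans h, h3.trans h, h4.trans h, h5.trans h, h6.trans h⟩

lemma bdd_u2 {j : ℕ} (hj : j ≤ k) : Bdd eta (x.α • x.α • Dist.dS^[j + 2] x.U) (radC * x.N) := by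
  have := bdd_iterate_of_sconv (σ := eta) x.sol.cu x.radC_mul_nonneg (j + 2) (a := fun _ => 1)
    contDiff_const (x.α ^ 2) fun n => by
      simp only [one_mul, iteratedDeriv_succ]
      exact (x.estimate hj n).1
  rwa [Dist.mul_const, one_smul, pow_two, mul_smul] at this

lemma bdd_u1 {j : ℕ} (hj : j ≤ k) : Bdd x.γ (x.α • Dist.dS^[j + 1] x.U) (radC * x.N) := by
  refine Bdd.of_mul_inv_sn x.γ_le ?_
  refine bdd_iterate_of_sconv (σ := eta) x.sol.cu x.radC_mul_nonneg (j + 1) _ _ fun n => ?_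
  simp only [iteratedDeriv_succ, ← div_eq_inv_mul]
  exact (x.estimate hj n).2.1

lemma bdd_dw {j : ℕ} (hj : j ≤ k) :
    Bdd x.γ (Dist.mul sn contDiff_sn (Dist.mul sn contDiff_sn (x.α • Dist.dS^[j + 1] x.W)))
      (radC * x.N) := by
  refine Bdd.mul_sn x.γ_le ?_
  refine bdd_iterate_of_sconv (σ := eta) x.sol.cw x.radC_mul_nonneg (j + 1) _ _ fun n => ?_
  simp only [iteratedDeriv_succ]
  exact (x.estimate hj n).2.2.1

lemma bdd_Z {j : ℕ} (hj : j ≤ k) : Bdd x.γ (Dist.dS^[j] x.Z) (radC * x.N) := by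
  refine Bdd.of_mul_inv_sn x.γ_le ?_
  have := bdd_iterate_of_sconv (σ := eta) (x.sol.continuous_regular x.wsq_F_lt) x.radC_mul_nonneg j
    contDiff_inv_sn 1 fun n => by
      simp only [one_mul, ← div_eq_inv_mul]
      exact (x.estimate hj n).2.2.2.1
  rwa [one_smul] at this

lemma bdd_Y {j : ℕ} (hj : j ≤ k) : Bdd eta (Dist.dS^[j] x.Y) (radC * x.N) :=
  bdd_of_sconv x.sol.cy x.radC_mul_nonneg j fun n =>
    (x.estimate hj n).2.2.2.2.1

lemma bdd_W {j : ℕ} (hj : j ≤ k) : Bdd eta (Dist.dS^[j] x.W) (radC * x.N) :=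
  bdd_of_sconv x.sol.cw x.radC_mul_nonneg j fun n =>
    (x.estimate hj n).2.2.2.2.2

open Polynomial in
lemma pm_two_mul_X {f : ℝ × ℝ → ℝ} (hf : Continuous f) (hg : Continuous fun p : ℝ × ℝ => 2 * cs p.2 * f p) :
    (ofCont f hf).pm (2 * X) = ofCont _ hg := by
  have h2 : ContDiff ℝ ∞ fun τ => 2 * cs τ := contDiff_const.mul contDiff_cs
  refine Eq.trans (Dist.mul_congr _ _ h2 fun τ => ?_) (toDist_mul hf.locallyIntegrable h2 _).symm
  simp

open Polynomial in
lemma pm_one_sub {f : ℝ × ℝ → ℝ} (hf : Continuous f) (hg : Continuous fun p : ℝ × ℝ => sn p.2 ^ 2 * f p) :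
    (ofCont f hf).pm (1 - X ^ 2) = ofCont _ hg := by
  have h2 : ContDiff ℝ ∞ fun τ => sn τ ^ 2 := contDiff_sn.pow 2
  refine Eq.trans (Dist.mul_congr _ _ h2 fun τ => ?_) (toDist_mul hf.locallyIntegrable h2 _).symm
  simp [sn_sq]

open Polynomial in
lemma dT_ofCont {f w : ℝ × ℝ → ℝ} (hf : Continuous f) (hw : Continuous w)
    (h : ∀ s τ, HasDerivAt (fun x => f (s, x)) (2 * cs τ * f (s, τ) + sn τ ^ 2 * w (s, τ)) τ) :
    (ofCont f hf).dT = (ofCont f hf).pm (2 * X) + (ofCont w hw).pm (1 - X ^ 2) := by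
  have h1 : Continuous fun p : ℝ × ℝ => 2 * cs p.2 * f p := by fun_prop
  have h2 : Continuous fun p : ℝ × ℝ => sn p.2 ^ 2 * w p := by fun_prop
  rw [pm_two_mul_X hf h1, pm_one_sub hw h2]
  exact (dT_toDist hf (g := fun p => 2 * cs p.2 * f p + sn p.2 ^ 2 * w p) (by fun_prop) h).trans
    (toDist_add h1.locallyIntegrable h2.locallyIntegrable _)

open Polynomial in
lemma dT_U : x.U.dT = x.U.pm (2 * X) + x.W.pm (1 - X ^ 2) := dT_ofCont _ _ x.sol.du

open Polynomial in
lemma dT_Z : x.Z.dT = x.Z.pm (2 * X) + x.W.pm (1 - X ^ 2) := by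
  refine dT_ofCont _ _ fun s τ => ?_
  unfold PlaneSol.regular
  refine ((x.sol.du s τ).sub (((hasDerivAt_sn τ).mul_const (ell x.F s)).const_mul
    (1 / (4 * x.α)))).congr_deriv ?_
  ring

lemma dS_U : x.U.dS = ofCont x.u1 x.sol.cu1 := dS_toDist x.sol.cu x.sol.cu1 x.sol.d1

lemma dS_dS_U : x.U.dS.dS = ofCont x.u2 x.sol.cu2 := by
  rw [dS_U]; exact dS_toDist x.sol.cu1 x.sol.cu2 x.sol.d2

open Polynomial in
lemma dT_W : x.W.dT + x.W.pm Fam.bpoly = x.Y.pm (C (-1)) := by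
  have hw := x.sol.cw
  have hy := x.sol.cy
  have h1 : Continuous fun p : ℝ × ℝ => (5 * cs p.2 - 1) * x.w p := by fun_prop
  have h2 : Continuous fun p : ℝ × ℝ => (1 - 5 * cs p.2) * x.w p - x.y p := by fun_prop
  have h3 : Continuous fun p : ℝ × ℝ => -1 * x.y p := by fun_prop
  have e1 : x.W.dT = ofCont _ h2 := dT_toDist hw h2 x.sol.dw
  have e2 : x.W.pm Fam.bpoly = ofCont _ h1 :=
    Eq.trans (Dist.mul_congr _ _ contDiff_bcoef fun τ => by simp [Fam.bpoly])
      (toDist_mul hw.locallyIntegrable contDiff_bcoef _).symm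
  have e3 : x.Y.pm (C (-1)) = ofCont _ h3 :=
    Eq.trans (Dist.mul_congr _ _ contDiff_const fun τ => by simp)
      (toDist_mul hy.locallyIntegrable contDiff_const h3.locallyIntegrable).symm
  rw [e1, e2, e3]
  refine (toDist_add h2.locallyIntegrable h1.locallyIntegrable
    (h2.add h1).locallyIntegrable).symm.trans (toDist_congr _ _ fun p => ?_)
  ring

open Polynomial in
lemma Y_eq : x.Y = ofCont x.F x.continuous_F + x.α • x.α • x.U.dS.dS + (x.α • x.U.dS).pm (C 5) := by
  have c0 := x.continuous_F
  have c1 := x.sol.cu1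
  have c2 := x.sol.cu2
  rw [dS_dS_U, dS_U]
  ext φ
  have e : ((x.α • ofCont x.u1 x.sol.cu1).pm (C 5)) φ = 5 * (x.α * ofCont x.u1 x.sol.cu1 φ) := by
    have : (x.α • ofCont x.u1 x.sol.cu1).pm (C 5) = (5 : ℝ) • x.α • ofCont x.u1 x.sol.cu1 :=
      Eq.trans (Dist.mul_congr _ _ contDiff_const fun τ => by simp) (Dist.mul_const _ 5)
    rw [this]; rfl
  rw [LinearMap.add_apply, LinearMap.add_apply, e]
  simp only [LinearMap.smul_apply, smul_eq_mul, Y, ofCont, toDist_apply]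
  rw [← integral_const_mul, ← integral_const_mul, ← integral_const_mul, ← integral_const_mul]
  have i0 := integrable_mul_test φ c0.locallyIntegrable
  have i1 := integrable_mul_test φ c1.locallyIntegrable
  have i2 := integrable_mul_test φ c2.locallyIntegrable
  rw [← integral_add i0 ((i2.const_mul _).const_mul _), ← integral_add
    (integrable_fun_add i0 ((i2.const_mul _).const_mul _)) ((i1.const_mul _).const_mul _)]
  congr 1; ext p
  simp only [F, rhs]; ring

end Datum

lemma Fam.ubm_of_iterate {ι : Type*} {N γ : ι → ℝ} {n : ℕ} {T : Fam ι} (h0 : Fam.UB N (fun _ => eta) T)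
    (h : ∀ i, 1 ≤ i → i ≤ n → Fam.UB N γ (Fam.dT^[i] T)) : Fam.UBM N γ n T := by
  have key : ∀ (n : ℕ) (S : Fam ι), (∀ i ≤ n, Fam.UB N γ (Fam.dT^[i] S)) → Fam.UBG N γ n S := by
    intro n
    induction n with
    | zero => exact fun S hS => hS 0 le_rfl
    | succ n ih => exact fun S hS => ⟨hS 0 (Nat.zero_le _), ih _ fun i hi => hS (i + 1) (by omega)⟩
  cases n with
  | zero => exact h0
  | succ n => exact ⟨h0, key n _ fun i hi => h (i + 1) (by omega) (by omega)⟩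

lemma Fam.dT_iterate_apply {ι : Type*} (T : Fam ι) (i : ℕ) (x : ι) :
    (Fam.dT^[i] T) x = Dist.dT^[i] (T x) := by
  induction i generalizing T with
  | zero => rfl
  | succ i ih => rw [Function.iterate_succ_apply, ih]; rfl

open Polynomial in
lemma hierarchy (k : ℕ) : Fam.Hierarchy (ι := Datum k) k (fun x => x.N) (fun x => x.γ) (fun x => x.α)
    (fun j x => Dist.dS^[j] (ofCont x.F x.continuous_F)) (fun j x => Dist.dS^[j] x.Z)
    (fun j x => x.α • Dist.dS^[j + 1] x.U) (fun j x => x.α • x.α • Dist.dS^[j + 2] x.U)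
    (fun j x => Dist.dS^[j] x.Y) (fun j x => Dist.dS^[j] x.W) where
  gauge x := x.N_nonneg
  eta_le x := x.eta_le
  le_two x := x.γ_le
  abs_le x := by rw [abs_of_pos x.α_pos]; linarith [x.α_le]
  dT_Z j := by
    ext1 x
    change Dist.dT (Dist.dS^[j] x.Z) = (Dist.dS^[j] x.Z).pm (2 * X) + (Dist.dS^[j] x.W).pm (1 - X ^ 2)
    rw [← Dist.dS_iterate_dT, x.dT_Z, Dist.dS_iterate_add]
    exact congrArg₂ _ (Dist.dS_iterate_mul _ _ _) (Dist.dS_iterate_mul _ _ _)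
  dT_u1 j := by
    ext1 x
    change Dist.dT (x.α • Dist.dS^[j + 1] x.U) = (x.α • Dist.dS^[j + 1] x.U).pm (2 * X) +
      x.α • (Dist.dS^[j + 1] x.W).pm (1 - X ^ 2)
    rw [Dist.dT_smul, ← Dist.dS_iterate_dT, x.dT_U, Dist.dS_iterate_add, smul_add]
    refine congrArg₂ _ ?_ (congrArg _ (Dist.dS_iterate_mul _ _ _))
    exact (congrArg _ (Dist.dS_iterate_mul _ _ _)).trans (Dist.mul_smul _ _ _).symm
  dT_u2 j := by
    ext1 x
    change Dist.dT (x.α • x.α • Dist.dS^[j + 2] x.U) = (x.α • x.α • Dist.dS^[j + 2] x.U).pm (2 * X) +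
      x.α • x.α • (Dist.dS^[j + 2] x.W).pm (1 - X ^ 2)
    rw [Dist.dT_smul, Dist.dT_smul, ← Dist.dS_iterate_dT, x.dT_U, Dist.dS_iterate_add, smul_add,
      smul_add]
    refine congrArg₂ _ ?_ (congrArg _ (congrArg _ (Dist.dS_iterate_mul _ _ _)))
    refine (congrArg (fun T => x.α • x.α • T) (Dist.dS_iterate_mul _ _ _)).trans ?_
    exact (congrArg _ (Dist.mul_smul _ _ _).symm).trans (Dist.mul_smul _ _ _).symm
  u2_eq j := rfl
  y_eq j := by
    ext1 x
    change Dist.dS^[j] x.Y = Dist.dS^[j] (ofCont x.F x.continuous_F) + x.α • x.α • Dist.dS^[j + 2] x.U +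
      (x.α • Dist.dS^[j + 1] x.U).pm (C 5)
    rw [x.Y_eq, Dist.dS_iterate_add, Dist.dS_iterate_add, Dist.dS_iterate_smul, Dist.dS_iterate_smul]
    refine congrArg₂ _ rfl ((Dist.dS_iterate_mul _ _ _).trans ?_)
    rw [Dist.dS_iterate_smul]
    rfl
  transport j := by
    ext1 x
    change Dist.dT (Dist.dS^[j] x.W) + (Dist.dS^[j] x.W).pm Fam.bpoly = (Dist.dS^[j] x.Y).pm (C (-1))
    have := congrArg (Dist.dS^[j]) x.dT_W
    rw [Dist.dS_iterate_add, Dist.dS_iterate_dT] at this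
    refine Eq.trans (congrArg₂ _ rfl ?_) (this.trans ?_)
    · exact (Dist.dS_iterate_mul _ _ _).symm
    · exact Dist.dS_iterate_mul _ _ _
  bF n j hnj := by
    refine Fam.ubm_of_iterate ⟨1, zero_le_one, fun x => ?_⟩ fun i h1 hi => ⟨1, zero_le_one, fun x => ?_⟩
    · rw [one_mul]; exact x.bound_zero j (by omega)
    · rw [one_mul, Fam.dT_iterate_apply]; exact x.bound_succ i j h1 (by omega)
  bZ j hj := ⟨radC, radC_pos.le, fun x => x.bdd_Z hj⟩
  bu1 j hj := ⟨radC, radC_pos.le, fun x => x.bdd_u1 hj⟩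
  bdw j hj := by
    refine ⟨radC, radC_pos.le, fun x => ?_⟩
    have := x.bdd_dw hj
    rw [Dist.mul_mul, Dist.mul_smul] at this
    convert this using 1
    change x.α • (Dist.dS^[j + 1] x.W).pm (1 - X ^ 2) = _
    refine congrArg _ (Dist.mul_congr _ _ _ fun τ => ?_)
    rw [← sq, sn_sq]; simp
  bu2 j hj := ⟨radC, radC_pos.le, fun x => x.bdd_u2 hj⟩
  by' j hj := ⟨radC, radC_pos.le, fun x => x.bdd_Y hj⟩
  bw j hj := ⟨radC, radC_pos.le, fun x => x.bdd_W hj⟩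

namespace Datum

/-- `α² (∂_s² - ∂_s) u`, which is `α² R² ∂_RR Ψ`. -/
def radialTarget {k : ℕ} (x : Datum k) : Dist := x.α • x.α • (x.U.dS.dS + (-1 : ℝ) • x.U.dS)

open Polynomial in
/-- `-4 Z + (1 - cs) w - y`, which is `∂_θθ` of the regular part. -/
def angularTarget {k : ℕ} (x : Datum k) : Dist := x.Z.pm (C (-4)) + x.W.pm (1 - X) + x.Y.pm (C (-1))

end Datum

open Polynomial in
lemma ubm_targets {k n j : ℕ} (h : n + j ≤ k) :
    Fam.UBM (ι := Datum k) (fun x => x.N) (fun x => x.γ) n (fun x => Dist.dS^[j] x.radialTarget) ∧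
    Fam.UBM (ι := Datum k) (fun x => x.N) (fun x => x.γ) n (fun x => Dist.dS^[j] x.angularTarget) := by
  have H := hierarchy k
  obtain ⟨h1, h2, h3, h4, h5⟩ := H.regularity n j h
  constructor
  · have := h3.add ((h2.ubm H.eta_le).smul H.gauge (c := fun x => -x.α) (K := 1) fun x => by
      rw [abs_neg]; exact H.abs_le x)
    convert this using 1
    ext1 x
    simp only [Datum.radialTarget, Dist.dS_iterate_smul, Dist.dS_iterate_add, Pi.add_apply,
      Pi.smul_apply', smul_add, smul_smul, Function.iterate_succ_apply]
    congr 2; ring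
  · have := (((h1.ubm H.eta_le).pm H.le_two (C (-4))).add (h5.pm H.le_two (1 - X))).add
      (h4.pm H.le_two (C (-1)))
    convert this using 1
    ext1 x
    simp only [Datum.angularTarget, Dist.dS_iterate_add]
    refine congrArg₂ _ (congrArg₂ _ ?_ ?_) ?_ <;> exact Dist.dS_iterate_mul _ _ _

/-- All the derivatives in the norm of `𝓗^k` of the two target quantities are bounded by the right-hand
side, uniformly in the data. -/
theorem exists_bound_targets (k : ℕ) : ∃ C : ℝ, 0 ≤ C ∧ ∀ x : Datum k,
    (∀ j ≤ k, Bdd eta (Dist.dS^[j] x.radialTarget) (C * x.N) ∧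
      Bdd eta (Dist.dS^[j] x.angularTarget) (C * x.N)) ∧
    ∀ i j, 1 ≤ i → i + j ≤ k → Bdd x.γ (Dist.dT^[i] (Dist.dS^[j] x.radialTarget)) (C * x.N) ∧
      Bdd x.γ (Dist.dT^[i] (Dist.dS^[j] x.angularTarget)) (C * x.N) := by
  have key : ∀ i j : ℕ, ∃ C : ℝ, 0 ≤ C ∧ (i + j ≤ k → ∀ x : Datum k,
      Bdd (if i = 0 then eta else x.γ) (Dist.dT^[i] (Dist.dS^[j] x.radialTarget)) (C * x.N) ∧
      Bdd (if i = 0 then eta else x.γ) (Dist.dT^[i] (Dist.dS^[j] x.angularTarget)) (C * x.N)) := by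
    intro i j
    by_cases hij : i + j ≤ k
    swap
    · exact ⟨0, le_rfl, fun h => absurd h hij⟩
    obtain ⟨h1, h2⟩ := ubm_targets hij
    have : ∀ T : Fam (Datum k), Fam.UBM (fun x => x.N) (fun x => x.γ) i T → ∃ C : ℝ, 0 ≤ C ∧
        ∀ x, Bdd (if i = 0 then eta else x.γ) (Dist.dT^[i] (T x)) (C * x.N) := fun T hT => by
      rcases Nat.eq_zero_or_pos i with rfl | hi
      · exact hT
      · obtain ⟨C, hC, h⟩ := hT.iterate hi le_rfl
        refine ⟨C, hC, fun x => ?_⟩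
        rw [if_neg hi.ne', ← Fam.dT_iterate_apply]
        exact h x
    obtain ⟨A, hA, h3⟩ := this _ h1
    obtain ⟨B, hB, h4⟩ := this _ h2
    refine ⟨A + B, by positivity, fun _ x => ⟨(h3 x).mono ?_, (h4 x).mono ?_⟩⟩
    · nlinarith [mul_nonneg hB x.N_nonneg]
    · nlinarith [mul_nonneg hA x.N_nonneg]
  choose C hC h using key
  have hle : ∀ i j, i + j ≤ k → C i j ≤ ∑ i ∈ Finset.range (k + 1), ∑ j ∈ Finset.range (k + 1), C i j :=
    fun i j hij => by
      refine le_trans ?_ (Finset.single_le_sum (f := fun i => ∑ j ∈ Finset.range (k + 1), C i j)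
        (fun i _ => Finset.sum_nonneg fun j _ => hC i j) (Finset.mem_range.2 (by omega : i < k + 1)))
      exact Finset.single_le_sum (f := fun j => C i j) (fun j _ => hC i j)
        (Finset.mem_range.2 (by omega : j < k + 1))
  refine ⟨∑ i ∈ Finset.range (k + 1), ∑ j ∈ Finset.range (k + 1), C i j,
    Finset.sum_nonneg fun i _ => Finset.sum_nonneg fun j _ => hC i j, fun x => ⟨?_, ?_⟩⟩
  · intro j hj
    have h1 := h 0 j (by omega) x
    have h2 := mul_le_mul_of_nonneg_right (hle 0 j (by omega)) x.N_nonneg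
    exact ⟨h1.1.mono h2, h1.2.mono h2⟩
  · intro i j hi hij
    have h1 := h i j hij x
    rw [if_neg (by omega)] at h1
    have h2 := mul_le_mul_of_nonneg_right (hle i j hij) x.N_nonneg
    exact ⟨h1.1.mono h2, h1.2.mono h2⟩

/-! ### The change of variables from polar coordinates to the plane -/

/-- The coordinates `R = exp s`, `θ = ang τ`, a diffeomorphism of the plane onto `dom`. -/
def toPolar (q : ℝ × ℝ) : ℝ × ℝ := (Real.exp q.1, ang q.2)

/-- The inverse of `toPolar`. -/
def ofPolar (p : ℝ × ℝ) : ℝ × ℝ := (Real.log p.1, Real.log (Real.tan p.2) / 2)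

/-- The Jacobian of `toPolar`. -/
def jac (q : ℝ × ℝ) : ℝ := Real.exp q.1 * sn q.2

lemma jac_pos (q : ℝ × ℝ) : 0 < jac q := mul_pos (Real.exp_pos _) (sn_pos _)

lemma contDiff_jac : ContDiff ℝ ∞ jac :=
  (Real.contDiff_exp.comp contDiff_fst).mul (contDiff_sn.comp contDiff_snd)

lemma toPolar_mem (q : ℝ × ℝ) : toPolar q ∈ dom := ⟨Real.exp_pos _, ang_mem _⟩

lemma isOpen_dom : IsOpen dom := isOpen_Ioi.prod isOpen_Ioo

lemma ofPolar_toPolar (q : ℝ × ℝ) : ofPolar (toPolar q) = q := by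
  ext
  · exact Real.log_exp _
  · simp only [ofPolar, toPolar, ang]
    rw [Real.tan_arctan, Real.log_exp]; ring

lemma toPolar_ofPolar {p : ℝ × ℝ} (hp : p ∈ dom) : toPolar (ofPolar p) = p := by
  have h2 := hp.2
  rw [← range_ang] at h2
  obtain ⟨τ, hτ⟩ := h2
  have : p = toPolar (Real.log p.1, τ) := by
    ext
    · exact (Real.exp_log hp.1).symm
    · exact hτ.symm
  rw [this, ofPolar_toPolar]

lemma contDiff_toPolar : ContDiff ℝ ∞ toPolar :=
  (Real.contDiff_exp.comp contDiff_fst).prodMk (contDiff_ang.comp contDiff_snd)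

lemma continuous_toPolar : Continuous toPolar := contDiff_toPolar.continuous

lemma contDiffAt_ofPolar {p : ℝ × ℝ} (hp : p ∈ dom) : ContDiffAt ℝ ∞ ofPolar p := by
  have h1 : (0 : ℝ) < p.1 := hp.1
  have h2 : Real.cos p.2 ≠ 0 := (Real.cos_pos_of_mem_Ioo
    ⟨by linarith [hp.2.1, Real.pi_pos], hp.2.2⟩).ne'
  have h3 : Real.tan p.2 ≠ 0 := (Real.tan_pos_of_pos_of_lt_pi_div_two hp.2.1 hp.2.2).ne'
  refine (contDiffAt_fst.log h1.ne').prodMk ?_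
  exact (((Real.contDiffAt_tan.2 h2).comp p contDiffAt_snd).log h3).div_const 2

lemma continuousOn_ofPolar : ContinuousOn ofPolar dom := fun _ hp =>
  (contDiffAt_ofPolar hp).continuousAt.continuousWithinAt

lemma injective_toPolar : Function.Injective toPolar := fun a b h => by
  rw [← ofPolar_toPolar a, h, ofPolar_toPolar]

lemma image_toPolar : toPolar '' univ = dom := by
  ext p
  constructor
  · rintro ⟨q, -, rfl⟩; exact toPolar_mem q
  · exact fun hp => ⟨ofPolar p, mem_univ _, toPolar_ofPolar hp⟩

/-- The derivative of `toPolar`. -/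
def fderivToPolar (q : ℝ × ℝ) : ℝ × ℝ →L[ℝ] ℝ × ℝ :=
  ((Real.exp q.1 • ContinuousLinearMap.id ℝ ℝ).prodMap (sn q.2 • ContinuousLinearMap.id ℝ ℝ))

lemma hasFDerivAt_toPolar (q : ℝ × ℝ) : HasFDerivAt toPolar (fderivToPolar q) q := by
  have h1 := HasDerivAt.comp_hasFDerivAt (f := Prod.fst) q (Real.hasDerivAt_exp q.1)
    (hasFDerivAt_fst (𝕜 := ℝ) (p := q))
  have h2 := HasDerivAt.comp_hasFDerivAt (f := Prod.snd) q (hasDerivAt_ang q.2)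
    (hasFDerivAt_snd (𝕜 := ℝ) (p := q))
  refine (h1.prodMk h2).congr_fderiv ?_
  ext <;> simp [fderivToPolar]

lemma abs_det_fderivToPolar (q : ℝ × ℝ) : |(fderivToPolar q).det| = jac q := by
  have : ((fderivToPolar q : ℝ × ℝ →L[ℝ] ℝ × ℝ) : ℝ × ℝ →ₗ[ℝ] ℝ × ℝ) =
      (Real.exp q.1 • LinearMap.id).prodMap (sn q.2 • LinearMap.id) := rfl
  rw [ContinuousLinearMap.det, this, LinearMap.det_prodMap]
  simp only [LinearMap.det_smul, LinearMap.det_id, Module.finrank_self, pow_one, mul_one]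
  exact abs_of_pos (jac_pos q)

lemma integral_dom (g : ℝ × ℝ → ℝ) : ∫ p in dom, g p = ∫ q, jac q * g (toPolar q) := by
  rw [← image_toPolar, integral_image_eq_integral_abs_det_fderiv_smul volume MeasurableSet.univ
    (fun q _ => (hasFDerivAt_toPolar q).hasFDerivWithinAt) injective_toPolar.injOn,
    Measure.restrict_univ]
  simp only [abs_det_fderivToPolar, smul_eq_mul]

lemma lintegral_dom (g : ℝ × ℝ → ℝ≥0∞) :
    ∫⁻ p in dom, g p = ∫⁻ q, ENNReal.ofReal (jac q) * g (toPolar q) := by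
  rw [← image_toPolar, lintegral_image_eq_lintegral_abs_det_fderiv_mul volume MeasurableSet.univ
    (fun q _ => (hasFDerivAt_toPolar q).hasFDerivWithinAt) injective_toPolar.injOn,
    Measure.restrict_univ]
  simp only [abs_det_fderivToPolar]

lemma integrableOn_image_toPolar (f : ℝ × ℝ → ℝ) {K : Set (ℝ × ℝ)} (hK : IsCompact K) :
    IntegrableOn f (toPolar '' K) ↔ IntegrableOn (fun q => f (toPolar q)) K := by
  rw [integrableOn_image_iff_integrableOn_abs_det_fderiv_smul volume hK.measurableSet
    (fun q _ => (hasFDerivAt_toPolar q).hasFDerivWithinAt) injective_toPolar.injOn]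
  simp only [abs_det_fderivToPolar, smul_eq_mul]
  constructor
  · intro h
    have := h.continuousOn_mul (contDiff_jac.continuous.inv₀ fun q => (jac_pos q).ne').continuousOn hK
    refine this.congr_fun (fun q _ => ?_) hK.measurableSet
    exact inv_mul_cancel_left₀ (jac_pos q).ne' _
  · exact fun h => h.continuousOn_mul contDiff_jac.continuous.continuousOn hK

lemma locallyIntegrableOn_dom_iff (f : ℝ × ℝ → ℝ) :
    LocallyIntegrableOn f dom ↔ LocallyIntegrable fun q => f (toPolar q) := by
  rw [locallyIntegrableOn_iff isOpen_dom.isLocallyClosed, locallyIntegrable_iff]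
  constructor
  · intro h K hK
    refine (integrableOn_image_toPolar f hK).1 (h _ ?_ (hK.image continuous_toPolar))
    rintro _ ⟨q, -, rfl⟩; exact toPolar_mem q
  · intro h K hK hKc
    have h1 := hKc.image_of_continuousOn (continuousOn_ofPolar.mono hK)
    have h2 := (integrableOn_image_toPolar f h1).2 (h _ h1)
    rwa [image_image, image_congr fun p hp => toPolar_ofPolar (hK hp), image_id'] at h2

lemma ae_dom_iff {P : ℝ × ℝ → Prop} (h : ∀ᵐ p ∂volume.restrict dom, P p) : ∀ᵐ q, P (toPolar q) := by
  rw [ae_iff] at h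
  obtain ⟨t, hst, htm, ht⟩ := exists_measurable_superset_of_null h
  have h1 := lintegral_dom (t.indicator 1)
  rw [lintegral_indicator_one htm, ht] at h1
  have hm : Measurable fun q => ENNReal.ofReal (jac q) * t.indicator (1 : ℝ × ℝ → ℝ≥0∞) (toPolar q) :=
    contDiff_jac.continuous.measurable.ennreal_ofReal.mul
      ((measurable_one.indicator htm).comp continuous_toPolar.measurable)
  filter_upwards [(lintegral_eq_zero_iff hm).1 h1.symm] with q hq
  by_contra hP
  have h2 : toPolar q ∈ t := hst hP
  simp only [indicator_of_mem h2, Pi.one_apply, mul_one, Pi.zero_apply, ENNReal.ofReal_eq_zero] at hq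
  exact absurd (jac_pos q) (not_lt.2 hq)

/-! ### Weak derivatives in the two coordinate systems -/

/-- The pullback of test functions, including the Jacobian. -/
def pull (φ : ℝ × ℝ → ℝ) (h : IsTest φ) : Test :=
  ⟨fun q => jac q * φ (toPolar q), contDiff_jac.mul (h.smooth.comp contDiff_toPolar), by
    have h1 : IsCompact (tsupport φ) := h.compact
    refine HasCompactSupport.intro
      (h1.image_of_continuousOn (continuousOn_ofPolar.mono h.support)) fun q hq => ?_
    rw [image_eq_zero_of_notMem_tsupport fun hq' => hq ⟨_, hq', ofPolar_toPolar q⟩, mul_zero]⟩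

lemma exists_pull (ψ : Test) : ∃ φ, ∃ h : IsTest φ, pull φ h = ψ := by
  have hK := ψ.cpt.isCompact.image continuous_toPolar
  have hKd : toPolar '' tsupport ψ.1 ⊆ dom := by rintro _ ⟨q, -, rfl⟩; exact toPolar_mem q
  let φ := dom.indicator fun p => ψ.1 (ofPolar p) / jac (ofPolar p)
  have h0 : ∀ p, p ∉ toPolar '' tsupport ψ.1 → φ p = 0 := fun p hp => by
    by_cases hd : p ∈ dom
    · simp only [φ, indicator_of_mem hd]
      rw [image_eq_zero_of_notMem_tsupport fun h => hp ⟨_, h, toPolar_ofPolar hd⟩, zero_div]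
    · exact indicator_of_notMem hd _
  have hφ : IsTest φ := by
    refine ⟨contDiff_iff_contDiffAt.2 fun p => ?_, HasCompactSupport.intro hK h0, ?_⟩
    · by_cases hd : p ∈ dom
      · have h1 : ContDiffAt ℝ ∞ (fun p => ψ.1 (ofPolar p) / jac (ofPolar p)) p :=
          (ψ.smooth.contDiffAt.comp p (contDiffAt_ofPolar hd)).div
            (contDiff_jac.contDiffAt.comp p (contDiffAt_ofPolar hd)) (jac_pos _).ne'
        refine h1.congr_of_eventuallyEq ?_
        filter_upwards [isOpen_dom.mem_nhds hd] with q hq using indicator_of_mem hq _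
      · refine contDiffAt_const (c := (0 : ℝ)) |>.congr_of_eventuallyEq ?_
        filter_upwards [hK.isClosed.isOpen_compl.mem_nhds fun h => hd (hKd h)] with q hq using h0 q hq
    · refine (closure_minimal (fun p hp => ?_) hK.isClosed).trans hKd
      by_contra hp'
      exact hp (h0 p hp')
  refine ⟨φ, hφ, ?_⟩
  ext q
  change jac q * φ (toPolar q) = ψ.1 q
  simp only [φ, indicator_of_mem (toPolar_mem q), ofPolar_toPolar]
  exact mul_div_cancel₀ _ (jac_pos q).ne'

lemma IsTest.adjointDR {φ : ℝ × ℝ → ℝ} (h : IsTest φ) : IsTest (adjointDR φ) := by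
  let χ : Test := ⟨fun q => q.1 * φ q, contDiff_fst.mul h.smooth, h.compact.mul_left⟩
  have e : PolarBS.adjointDR φ = (-dir (1, 0) χ).1 := by
    ext p
    exact congrArg Neg.neg (hasDerivAt_dir_fst χ p.1 p.2).deriv
  have hs : Function.support (PolarBS.adjointDR φ) ⊆ tsupport φ := by
    intro p hp
    by_contra h1
    have h2 : φ =ᶠ[𝓝 p] 0 := notMem_tsupport_iff_eventuallyEq.1 h1
    have h3 : χ.1 =ᶠ[𝓝 p] fun _ => 0 := h2.mono fun q hq => by
      change q.1 * φ q = 0; rw [hq]; simp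
    refine hp ?_
    rw [e]
    change -(fderiv ℝ χ.1 p (1, 0)) = 0
    rw [h3.fderiv_eq]; simp
  refine ⟨by rw [e]; exact (-dir (1, 0) χ).smooth, by rw [e]; exact (-dir (1, 0) χ).cpt, ?_⟩
  exact (closure_minimal hs (isClosed_tsupport φ)).trans h.support

lemma IsTest.adjointDTheta {φ : ℝ × ℝ → ℝ} (h : IsTest φ) : IsTest (adjointDTheta φ) := by
  let χ : Test := ⟨fun q => Real.sin (2 * q.2) * φ q,
    (Real.contDiff_sin.comp (contDiff_const.mul contDiff_snd)).mul h.smooth, h.compact.mul_left⟩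
  have e : PolarBS.adjointDTheta φ = (-dir (0, 1) χ).1 := by
    ext p
    exact congrArg Neg.neg (hasDerivAt_dir_snd χ p.1 p.2).deriv
  have hs : Function.support (PolarBS.adjointDTheta φ) ⊆ tsupport φ := by
    intro p hp
    by_contra h1
    have h2 : φ =ᶠ[𝓝 p] 0 := notMem_tsupport_iff_eventuallyEq.1 h1
    have h3 : χ.1 =ᶠ[𝓝 p] fun _ => 0 := h2.mono fun q hq => by
      change Real.sin (2 * q.2) * φ q = 0; rw [hq]; simp
    refine hp ?_
    rw [e]
    change -(fderiv ℝ χ.1 p (0, 1)) = 0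
    rw [h3.fderiv_eq]; simp
  refine ⟨by rw [e]; exact (-dir (0, 1) χ).smooth, by rw [e]; exact (-dir (0, 1) χ).cpt, ?_⟩
  exact (closure_minimal hs (isClosed_tsupport φ)).trans h.support

lemma pull_adjointDR {φ : ℝ × ℝ → ℝ} (h : IsTest φ) :
    pull (adjointDR φ) h.adjointDR = -dir (1, 0) (pull φ h) := by
  ext ⟨s, τ⟩
  change Real.exp s * sn τ * -(deriv (fun r => r * φ (r, ang τ)) (Real.exp s)) = -_
  have h1 : DifferentiableAt ℝ (fun r => r * φ (r, ang τ)) (Real.exp s) := by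
    have := h.smooth.differentiable (by simp)
    fun_prop
  have h2 := (h1.hasDerivAt.comp s (Real.hasDerivAt_exp s)).const_mul (sn τ)
  have h3 : (fun x => sn τ * ((fun r => r * φ (r, ang τ)) ∘ Real.exp) x) =
      fun x => (pull φ h).1 (x, τ) := by
    ext x
    change sn τ * (Real.exp x * φ (Real.exp x, ang τ)) = Real.exp x * sn τ * φ (Real.exp x, ang τ)
    ring
  rw [h3] at h2
  rw [(hasDerivAt_dir_fst (pull φ h) s τ).unique h2]
  ring

lemma pull_adjointDTheta {φ : ℝ × ℝ → ℝ} (h : IsTest φ) :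
    pull (adjointDTheta φ) h.adjointDTheta = -dir (0, 1) (pull φ h) := by
  ext ⟨s, τ⟩
  change Real.exp s * sn τ * -(deriv (fun t => Real.sin (2 * t) * φ (Real.exp s, t)) (ang τ)) = -_
  have h1 : DifferentiableAt ℝ (fun t => Real.sin (2 * t) * φ (Real.exp s, t)) (ang τ) := by
    have := h.smooth.differentiable (by simp)
    fun_prop
  have h2 := (h1.hasDerivAt.comp τ (hasDerivAt_ang τ)).const_mul (Real.exp s)
  have h3 : (fun x => Real.exp s * ((fun t => Real.sin (2 * t) * φ (Real.exp s, t)) ∘ ang) x) =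
      fun x => (pull φ h).1 (s, x) := by
    ext x
    change Real.exp s * (Real.sin (2 * ang x) * φ (Real.exp s, ang x)) =
      Real.exp s * sn x * φ (Real.exp s, ang x)
    rw [sin_two_ang]; ring
  rw [h3] at h2
  rw [(hasDerivAt_dir_snd (pull φ h) s τ).unique h2]
  ring

lemma integral_dom_mul {g φ : ℝ × ℝ → ℝ} (hg : LocallyIntegrable fun q => g (toPolar q)) (h : IsTest φ) :
    ∫ p in dom, g p * φ p = toDist _ hg (pull φ h) := by
  rw [integral_dom, toDist_apply]
  congr 1; ext q
  change _ = g (toPolar q) * (jac q * φ (toPolar q))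
  ring

/-- The adjoint operators on test functions are carried to those of `∂_s` and `∂_τ`. -/
lemma integral_dom_adjoint {f : ℝ × ℝ → ℝ} (hf : LocallyIntegrable fun q => f (toPolar q)) (i j : ℕ)
    {φ : ℝ × ℝ → ℝ} (h : IsTest φ) :
    ∫ p in dom, f p * (adjointDTheta^[i] (adjointDR^[j] φ)) p =
      Dist.dS^[j] (Dist.dT^[i] (toDist _ hf)) (pull φ h) := by
  have key : ∀ (T : Dist) (i : ℕ) (φ : ℝ × ℝ → ℝ) (h : IsTest φ),
      ∃ h' : IsTest (adjointDTheta^[i] φ), T (pull _ h') = Dist.dT^[i] T (pull φ h) := by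
    intro T i
    induction i generalizing T with
    | zero => exact fun φ h => ⟨h, rfl⟩
    | succ i ih =>
      intro φ h
      obtain ⟨h', e⟩ := ih T _ h.adjointDTheta
      refine ⟨h', e.trans ?_⟩
      rw [pull_adjointDTheta, map_neg, Function.iterate_succ_apply']
      rfl
  have key2 : ∀ (T : Dist) (j : ℕ) (φ : ℝ × ℝ → ℝ) (h : IsTest φ),
      ∃ h' : IsTest (adjointDR^[j] φ), T (pull _ h') = Dist.dS^[j] T (pull φ h) := by
    intro T j
    induction j generalizing T with
    | zero => exact fun φ h => ⟨h, rfl⟩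
    | succ j ih =>
      intro φ h
      obtain ⟨h', e⟩ := ih T _ h.adjointDR
      refine ⟨h', e.trans ?_⟩
      rw [pull_adjointDR, map_neg, Function.iterate_succ_apply']
      rfl
  obtain ⟨h1, e1⟩ := key2 (Dist.dT^[i] (toDist _ hf)) j φ h
  obtain ⟨h2, e2⟩ := key (toDist _ hf) i _ h1
  rw [integral_dom_mul hf h2, e2, e1]

lemma Dist.dS_iterate_dT_iterate (i j : ℕ) (T : Dist) :
    Dist.dS^[j] (Dist.dT^[i] T) = Dist.dT^[i] (Dist.dS^[j] T) := by
  induction i generalizing T with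
  | zero => rfl
  | succ i ih =>
    rw [Function.iterate_succ_apply, ih, Dist.dS_iterate_dT, Function.iterate_succ_apply]

/-- Weak derivatives on `dom` are distributional derivatives in the plane. -/
lemma isWeakDeriv_iff {f g : ℝ × ℝ → ℝ} (i j : ℕ) (hf : LocallyIntegrable fun q => f (toPolar q)) :
    IsWeakDeriv i j f g ↔ ∃ hg : LocallyIntegrable fun q => g (toPolar q),
      Dist.dT^[i] (Dist.dS^[j] (toDist _ hf)) = toDist _ hg := by
  rw [← Dist.dS_iterate_dT_iterate]
  constructor
  · intro h
    refine ⟨(locallyIntegrableOn_dom_iff g).1 h.locInt_right, ?_⟩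
    ext ψ
    obtain ⟨φ, hφ, rfl⟩ := exists_pull ψ
    rw [← integral_dom_adjoint, ← integral_dom_mul]
    exact (h.integral_eq φ hφ).symm
  · rintro ⟨hg, h⟩
    refine ⟨(locallyIntegrableOn_dom_iff f).2 hf, (locallyIntegrableOn_dom_iff g).2 hg, fun φ hφ => ?_⟩
    rw [integral_dom_adjoint hf i j hφ, integral_dom_mul hg hφ, h]

/-- The radial weight, including the Jacobian, is comparable to `wt`. -/
lemma wt_le_radialWeight (s : ℝ) : wt s ≤ Real.exp s * radialWeight (Real.exp s) ^ 2 ∧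
    Real.exp s * radialWeight (Real.exp s) ^ 2 ≤ 8 * wt s := by
  have he := Real.exp_pos s
  have e1 : wt s = (1 + Real.exp s ^ 4) / Real.exp s ^ 3 := by
    unfold wt
    rw [show -3 * s = -(3 * s) by ring, Real.exp_neg,
      show Real.exp (3 * s) = Real.exp s ^ 3 by rw [← Real.exp_nat_mul]; norm_num]
    field_simp
  have e2 : Real.exp s * radialWeight (Real.exp s) ^ 2 = (1 + Real.exp s) ^ 4 / Real.exp s ^ 3 := by
    unfold radialWeight; field_simp
  rw [e1, e2, mul_div_assoc']
  set x := Real.exp s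
  have hx2 : 0 < x ^ 2 := by positivity
  have hx3 : 0 < x ^ 3 := by positivity
  constructor
  · gcongr
    nlinarith
  · gcongr
    nlinarith [sq_nonneg (x - 1), sq_nonneg (x ^ 2 - 1), sq_nonneg (x * (x - 1)), sq_nonneg (x ^ 2 - x)]

/-- The weighted integral over `dom` of the definition of the norm. -/
def domSq (σ : ℝ) (g : ℝ × ℝ → ℝ) : ℝ≥0∞ :=
  ∫⁻ p in dom, ENNReal.ofReal ((g p * (radialWeight p.1 * Real.sin (2 * p.2) ^ (-σ / 2))) ^ 2)

lemma domSq_eq (σ : ℝ) (g : ℝ × ℝ → ℝ) : domSq σ g = ∫⁻ q, ENNReal.ofReal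
    (g (toPolar q) ^ 2 * (Real.exp q.1 * radialWeight (Real.exp q.1) ^ 2 * sn q.2 ^ (1 - σ))) := by
  unfold domSq
  rw [lintegral_dom]
  refine lintegral_congr fun q => ?_
  rw [← ENNReal.ofReal_mul (jac_pos q).le]
  congr 1
  simp only [toPolar, sin_two_ang, jac]
  have h1 : sn q.2 ^ (1 - σ) = sn q.2 * (sn q.2 ^ (-σ / 2)) ^ 2 := by
    rw [sub_eq_add_neg, sn_rpow_add, Real.rpow_one, ← Real.rpow_natCast, ← Real.rpow_mul (sn_pos _).le]
    congr 2; norm_num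
  rw [h1]; ring

lemma wsq_le_domSq (σ : ℝ) (g : ℝ × ℝ → ℝ) : wsq σ (fun q => g (toPolar q)) ≤ domSq σ g := by
  rw [domSq_eq]
  refine lintegral_mono fun q => ENNReal.ofReal_le_ofReal (mul_le_mul_of_nonneg_left ?_ (sq_nonneg _))
  exact mul_le_mul_of_nonneg_right (wt_le_radialWeight q.1).1 (sn_rpow_pos _ _).le

lemma domSq_le (σ : ℝ) (g : ℝ × ℝ → ℝ) :
    domSq σ g ≤ ENNReal.ofReal 8 * wsq σ (fun q => g (toPolar q)) := by
  rw [domSq_eq, wsq, ← lintegral_const_mul' _ _ ENNReal.ofReal_ne_top]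
  refine lintegral_mono fun q => ?_
  rw [← ENNReal.ofReal_mul (by norm_num)]
  refine ENNReal.ofReal_le_ofReal ?_
  have := mul_le_mul_of_nonneg_right (wt_le_radialWeight q.1).2 (sn_rpow_pos (1 - σ) q.2).le
  have h2 := mul_le_mul_of_nonneg_left this (sq_nonneg (g (toPolar q)))
  unfold wgt
  linarith

/-- A finite weighted norm on `dom` bounds the corresponding distribution. -/
lemma bdd_of_weightedSq {σ : ℝ} {f : ℝ × ℝ → ℝ} {i j : ℕ} (hf : LocallyIntegrable fun q => f (toPolar q))
    {H : ℝ≥0∞} (hH : H < ⊤) (h : weightedSq σ i j f ≤ H) :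
    Bdd σ (Dist.dT^[i] (Dist.dS^[j] (toDist _ hf))) H.toReal := by
  intro φ
  refine le_of_forall_pos_le_add fun ε hε => ?_
  have h1 : weightedSq σ i j f < H + ENNReal.ofReal ε :=
    h.trans_lt (ENNReal.lt_add_right hH.ne (by simpa using hε))
  unfold weightedSq at h1
  simp only [iInf_lt_iff] at h1
  obtain ⟨g, hg, hlt⟩ := h1
  obtain ⟨hgl, e⟩ := (isWeakDeriv_iff i j hf).1 hg
  rw [e]
  have h2 : wsq σ (fun q => g (toPolar q)) ≤ ENNReal.ofReal (H.toReal + ε) := by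
    refine (wsq_le_domSq σ g).trans (hlt.le.trans (le_of_eq ?_))
    rw [ENNReal.ofReal_add ENNReal.toReal_nonneg hε.le, ENNReal.ofReal_toReal hH.ne]
  have := bdd_toDist hgl (add_nonneg ENNReal.toReal_nonneg hε.le) h2 φ
  linarith

/-- A bound for the distribution gives a weak derivative on `dom` and bounds its weighted norm. The factor
`8` compares the radial weights, `(1 + R)⁴ ≤ 8 (1 + R⁴)`. -/
lemma weightedSq_le_of_bdd {σ B : ℝ} {f : ℝ × ℝ → ℝ} {i j : ℕ}
    (hf : LocallyIntegrable fun q => f (toPolar q))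
    (h : Bdd σ (Dist.dT^[i] (Dist.dS^[j] (toDist _ hf))) B) :
    weightedSq σ i j f ≤ ENNReal.ofReal (8 * B) := by
  obtain ⟨g, -, hg, hgB, e⟩ := h.exists_rep
  have e1 : (fun q => (g ∘ ofPolar) (toPolar q)) = g := by
    ext q; simp [ofPolar_toPolar]
  have hw : IsWeakDeriv i j f (g ∘ ofPolar) := by
    refine (isWeakDeriv_iff i j hf).2 ⟨by rwa [e1], e.trans (toDist_congr _ _ fun p => ?_)⟩
    exact (congrFun e1 p).symm
  refine (iInf₂_le _ hw).trans ((domSq_le σ _).trans ?_)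
  rw [e1, ENNReal.ofReal_mul (by norm_num)]
  gcongr

/-! ### The equation in the plane -/

lemma partialR_toPolar {f v : ℝ × ℝ → ℝ} (h : ∀ q, f (toPolar q) = v q) {s τ v1 : ℝ}
    (hd : HasDerivAt (fun x => v (x, τ)) v1 s) : partialR f (toPolar (s, τ)) = v1 / Real.exp s := by
  have he := Real.exp_pos s
  have h1 : HasDerivAt (fun r => v (Real.log r, τ)) (v1 * (Real.exp s)⁻¹) (Real.exp s) := by
    refine HasDerivAt.comp (h₂ := fun x => v (x, τ)) (Real.exp s) ?_ (Real.hasDerivAt_log he.ne')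
    rwa [Real.log_exp]
  have h2 : (fun r => f (r, ang τ)) =ᶠ[𝓝 (Real.exp s)] fun r => v (Real.log r, τ) := by
    filter_upwards [isOpen_Ioi.mem_nhds he] with r hr
    rw [← h]
    change _ = f (Real.exp (Real.log r), ang τ)
    rw [Real.exp_log hr]
  exact (h1.congr_of_eventuallyEq h2).deriv.trans (div_eq_mul_inv _ _).symm

lemma log_tan_ang (τ : ℝ) : Real.log (Real.tan (ang τ)) / 2 = τ :=
  congrArg Prod.snd (ofPolar_toPolar (0, τ))

lemma hasDerivAt_log_tan (τ : ℝ) :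
    HasDerivAt (fun θ => Real.log (Real.tan θ) / 2) (sn τ)⁻¹ (ang τ) := by
  have hm : ((1 : ℝ), ang τ) ∈ dom := ⟨zero_lt_one' ℝ, ang_mem τ⟩
  have h1 : ContinuousAt (fun θ => Real.log (Real.tan θ) / 2) (ang τ) :=
    ((contDiffAt_ofPolar hm).continuousAt.snd).comp (f := fun θ : ℝ => ((1 : ℝ), θ)) (by fun_prop)
  refine HasDerivAt.of_local_left_inverse (f := ang) h1 ?_ (sn_pos τ).ne' ?_
  · rw [log_tan_ang]; exact hasDerivAt_ang τ
  · filter_upwards [isOpen_Ioo.mem_nhds (ang_mem τ)] with θ hθ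
    exact congrArg Prod.snd (toPolar_ofPolar (p := (1, θ)) ⟨zero_lt_one' ℝ, hθ⟩)

lemma partialTheta_toPolar {f v : ℝ × ℝ → ℝ} (h : ∀ q, f (toPolar q) = v q) {s τ v1 : ℝ}
    (hd : HasDerivAt (fun x => v (s, x)) v1 τ) : partialTheta f (toPolar (s, τ)) = v1 / sn τ := by
  have h1 : HasDerivAt (fun θ => v (s, Real.log (Real.tan θ) / 2)) (v1 * (sn τ)⁻¹) (ang τ) := by
    refine HasDerivAt.comp (h₂ := fun x => v (s, x)) (ang τ) ?_ (hasDerivAt_log_tan τ)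
    rwa [log_tan_ang]
  have h2 : (fun θ => f (Real.exp s, θ)) =ᶠ[𝓝 (ang τ)]
      fun θ => v (s, Real.log (Real.tan θ) / 2) := by
    filter_upwards [isOpen_Ioo.mem_nhds (ang_mem τ)] with θ hθ
    have h3 : toPolar (s, Real.log (Real.tan θ) / 2) = (Real.exp s, θ) := by
      have := toPolar_ofPolar (p := (Real.exp s, θ)) ⟨Real.exp_pos s, hθ⟩
      simpa [ofPolar, Real.log_exp] using this
    rw [← h, h3]
  exact (h1.congr_of_eventuallyEq h2).deriv.trans (div_eq_mul_inv _ _).symm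

/-- The second angular derivative of a function that satisfies the angular system. -/
lemma partialTheta_partialTheta_toPolar {f Z w y : ℝ × ℝ → ℝ} (h : ∀ q, f (toPolar q) = Z q)
    (hZ : ∀ s τ, HasDerivAt (fun x => Z (s, x)) (2 * cs τ * Z (s, τ) + sn τ ^ 2 * w (s, τ)) τ)
    (hw : ∀ s τ, HasDerivAt (fun x => w (s, x)) ((1 - 5 * cs τ) * w (s, τ) - y (s, τ)) τ)
    (q : ℝ × ℝ) :
    partialTheta (partialTheta f) (toPolar q) = -4 * Z q + (1 - cs q.2) * w q - y q := by
  obtain ⟨s, τ⟩ := q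
  have h1 : ∀ q, partialTheta f (toPolar q) = 2 * cs q.2 * (Z q / sn q.2) + sn q.2 * w q := fun q => by
    have hs := (sn_pos q.2).ne'
    refine (partialTheta_toPolar h (hZ q.1 q.2)).trans ?_
    field_simp
  have hs := (sn_pos τ).ne'
  have d := (((hasDerivAt_cs τ).const_mul 2).mul ((hZ s τ).div (hasDerivAt_sn τ) hs)).add
    ((hasDerivAt_sn τ).mul (hw s τ))
  refine (partialTheta_toPolar h1 (s := s) (τ := τ) d).trans ?_
  simp only [Pi.div_apply]
  have e := sn_sq τ
  field_simp
  ring_nf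

/-- The weight `tan θ` of the equation. -/
lemma partialTheta_tan_toPolar {Ψ u w : ℝ × ℝ → ℝ} (h : ∀ q, Ψ (toPolar q) = u q)
    (hu : ∀ s τ, HasDerivAt (fun x => u (s, x)) (2 * cs τ * u (s, τ) + sn τ ^ 2 * w (s, τ)) τ)
    (q : ℝ × ℝ) :
    partialTheta (fun p => Real.tan p.2 * Ψ p) (toPolar q) = 2 * u q + (1 - cs q.2) * w q := by
  obtain ⟨s, τ⟩ := q
  have h1 : ∀ q, (fun p => Real.tan p.2 * Ψ p) (toPolar q) = Real.exp (2 * q.2) * u q := fun q => by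
    simp only [h]
    rw [toPolar]
    simp only [ang, Real.tan_arctan]
  refine (partialTheta_toPolar h1 ((hasDerivAt_exp_two τ).mul (hu s τ))).trans ?_
  have ht : Real.exp (2 * τ) * (1 + cs τ) = sn τ := by
    have := one_add_exp_sq_pos τ
    unfold cs sn; field_simp; ring
  have hs := sn_pos τ
  have hc : 0 < 1 + cs τ := by linarith [neg_one_lt_cs τ]
  have e : sn τ ^ 2 = (1 - cs τ) * (1 + cs τ) := by rw [sn_sq]; ring
  rw [div_eq_iff hs.ne', e, ← ht]
  ring

lemma contDiff_fderiv_apply_const {n : ℕ} {u : ℝ × ℝ → ℝ} (hu : ContDiff ℝ (n + 1 : ℕ) u) (v : ℝ × ℝ) :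
    ContDiff ℝ n (fun p => fderiv ℝ u p v) :=
  (hu.fderiv_right (m := n) (by norm_cast)).clm_apply contDiff_const

/-- A solution in polar coordinates is a solution in the plane. All functions are obtained from the
Fréchet derivatives of `u = Ψ ∘ toPolar`; the conditions at infinity and at the boundary are read off
from the continuity of `Ψ` on the closed domain and its decay. -/
lemma IsSolution.exists_planeSol {α : ℝ} {F Ψ : ℝ × ℝ → ℝ} (h : IsSolution α F Ψ) :
    ∃ u1 u2 w y, PlaneSol (fun q => Ψ (toPolar q)) u1 u2 w y ∧
      (∀ q, polarL α Ψ (toPolar q) = rhs α u1 u2 y q) ∧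
      ∀ q, (toPolar q).1 ^ 2 * partialR (partialR Ψ) (toPolar q) = u2 q - u1 q := by
  set u : ℝ × ℝ → ℝ := fun q => Ψ (toPolar q) with hu
  have cu : ContDiff ℝ (1 + 1 : ℕ) u := by
    refine contDiff_iff_contDiffAt.2 fun q => ?_
    have h1 := (h.contDiffOn.contDiffAt (isOpen_dom.mem_nhds (toPolar_mem q)))
    exact ContDiffAt.comp q h1 (contDiff_infty.1 contDiff_toPolar (1 + 1)).contDiffAt
  have du : Differentiable ℝ u := cu.differentiable (by norm_num)
  have c1 := contDiff_fderiv_apply_const cu (1, 0)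
  have cT := contDiff_fderiv_apply_const cu (0, 1)
  set u1 : ℝ × ℝ → ℝ := fun p => fderiv ℝ u p (1, 0) with hu1
  set uT : ℝ × ℝ → ℝ := fun p => fderiv ℝ u p (0, 1) with huT
  have c2 := contDiff_fderiv_apply_const (n := 0) (by exact_mod_cast c1) (1, 0)
  have cTT := contDiff_fderiv_apply_const (n := 0) (by exact_mod_cast cT) (0, 1)
  set u2 : ℝ × ℝ → ℝ := fun p => fderiv ℝ u1 p (1, 0) with hu2
  set uTT : ℝ × ℝ → ℝ := fun p => fderiv ℝ uT p (0, 1) with huTT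
  have k0 := cu.continuous
  have k1 := c1.continuous
  have kT := cT.continuous
  have k2 := c2.continuous
  have kTT := cTT.continuous
  have fst : ∀ {f : ℝ × ℝ → ℝ}, Differentiable ℝ f → ∀ s τ,
      HasDerivAt (fun x => f (x, τ)) (fderiv ℝ f (s, τ) (1, 0)) s := fun hf s τ =>
    (hf (s, τ)).hasFDerivAt.comp_hasDerivAt s ((hasDerivAt_id s).prodMk (hasDerivAt_const s τ))
  have snd : ∀ {f : ℝ × ℝ → ℝ}, Differentiable ℝ f → ∀ s τ,
      HasDerivAt (fun x => f (s, x)) (fderiv ℝ f (s, τ) (0, 1)) τ := fun hf s τ =>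
    (hf (s, τ)).hasFDerivAt.comp_hasDerivAt τ ((hasDerivAt_const τ s).prodMk (hasDerivAt_id τ))
  have d1 : ∀ s τ, HasDerivAt (fun x => u (x, τ)) (u1 (s, τ)) s := fst du
  have d2 : ∀ s τ, HasDerivAt (fun x => u1 (x, τ)) (u2 (s, τ)) s := fst (c1.differentiable (by norm_num))
  have dT : ∀ s τ, HasDerivAt (fun x => u (s, x)) (uT (s, τ)) τ := snd du
  have dTT : ∀ s τ, HasDerivAt (fun x => uT (s, x)) (uTT (s, τ)) τ :=
    snd (cT.differentiable (by norm_num))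
  let w : ℝ × ℝ → ℝ := fun p => (uT p - 2 * cs p.2 * u p) / sn p.2 ^ 2
  let w' : ℝ × ℝ → ℝ := fun p => (uTT p - 2 * cs p.2 * uT p + 4 * sn p.2 ^ 2 * u p) / sn p.2 ^ 2 -
    4 * cs p.2 * w p
  let y : ℝ × ℝ → ℝ := fun p => (1 - 5 * cs p.2) * w p - w' p
  have hsn : ∀ p : ℝ × ℝ, sn p.2 ^ 2 ≠ 0 := fun p => pow_ne_zero 2 (sn_pos p.2).ne'
  have cw : Continuous w := Continuous.div (by fun_prop) (by fun_prop) hsn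
  have cy : Continuous y := by
    have : Continuous w' := (Continuous.div (by fun_prop) (by fun_prop) hsn).sub (by fun_prop)
    fun_prop
  have hdu : ∀ s τ, HasDerivAt (fun x => u (s, x)) (2 * cs τ * u (s, τ) + sn τ ^ 2 * w (s, τ)) τ :=
    fun s τ => (dT s τ).congr_deriv (by
      simp only [w]; rw [mul_div_cancel₀ _ (hsn (s, τ))]; ring)
  have hdw : ∀ s τ, HasDerivAt (fun x => w (s, x)) ((1 - 5 * cs τ) * w (s, τ) - y (s, τ)) τ := by
    intro s τ
    have hs := (sn_pos τ).ne'
    refine (((dTT s τ).sub (((hasDerivAt_cs τ).const_mul 2).mul (dT s τ))).div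
      ((hasDerivAt_sn τ).pow 2) (hsn (s, τ))).congr_deriv ?_
    simp only [Pi.sub_apply, Pi.mul_apply, Pi.pow_apply, y, w', w]
    field_simp
    ring
  have R1 : ∀ q, partialR Ψ (toPolar q) = u1 q / Real.exp q.1 := fun q =>
    partialR_toPolar (v := u) (fun _ => rfl) (d1 q.1 q.2)
  have R2 : ∀ q, (toPolar q).1 ^ 2 * partialR (partialR Ψ) (toPolar q) = u2 q - u1 q := by
    rintro ⟨s, τ⟩
    have he := (Real.exp_pos s).ne'
    rw [partialR_toPolar R1 ((d2 s τ).div (Real.hasDerivAt_exp s) he)]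
    simp only [toPolar]
    field_simp
  refine ⟨u1, u2, w, y, ⟨k0, k1, k2, cw, cy, d1, d2, hdu, hdw, ?_, ?_, ?_, ?_⟩, fun q => ?_, R2⟩
  · have h1 := (Metric.tendstoUniformlyOn_iff.1 h.decay 1 one_pos).exists_forall_of_atTop
    obtain ⟨R, hR⟩ := h1
    have hK : IsCompact (Icc 0 R ×ˢ Icc 0 (Real.pi / 2)) := isCompact_Icc.prod isCompact_Icc
    obtain ⟨B, hB⟩ := hK.exists_bound_of_continuousOn
      (h.continuousOn.mono (prod_mono_left Icc_subset_Ici_self))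
    refine ⟨max B 1, fun q => ?_⟩
    have h2 := toPolar_mem q
    have h3 : (toPolar q).2 ∈ Icc 0 (Real.pi / 2) := Ioo_subset_Icc_self h2.2
    rcases le_total (toPolar q).1 R with hle | hle
    · exact (hB _ ⟨⟨h2.1.le, hle⟩, h3⟩).trans (le_max_left _ _)
    · have := (hR _ hle _ h3).le
      rw [dist_zero_left] at this
      exact this.trans (le_max_right _ _)
  · intro s
    have h1 : Tendsto ang atBot (𝓝 0) := by
      have := (Real.continuous_arctan.tendsto 0).comp (Real.tendsto_exp_atBot.comp
        (tendsto_id.const_mul_atBot (two_pos : (0 : ℝ) < 2)))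
      rwa [Real.arctan_zero] at this
    have h2 := h.continuousOn (Real.exp s, 0) ⟨(Real.exp_pos s).le, left_mem_Icc.2 (by positivity)⟩
    rw [ContinuousWithinAt, h.zero_left _ (Real.exp_pos s).le] at h2
    refine h2.comp (tendsto_nhdsWithin_iff.2 ⟨tendsto_const_nhds.prodMk_nhds h1, ?_⟩)
    exact Eventually.of_forall fun τ => ⟨(Real.exp_pos s).le, Ioo_subset_Icc_self (ang_mem τ)⟩
  · intro s
    have h1 : Tendsto ang atTop (𝓝 (Real.pi / 2)) :=
      (tendsto_nhds_of_tendsto_nhdsWithin Real.tendsto_arctan_atTop).comp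
        (Real.tendsto_exp_atTop.comp (tendsto_id.const_mul_atTop (two_pos : (0 : ℝ) < 2)))
    have h2 := h.continuousOn (Real.exp s, Real.pi / 2)
      ⟨(Real.exp_pos s).le, right_mem_Icc.2 (by positivity)⟩
    rw [ContinuousWithinAt, h.zero_right _ (Real.exp_pos s).le] at h2
    refine h2.comp (tendsto_nhdsWithin_iff.2 ⟨tendsto_const_nhds.prodMk_nhds h1, ?_⟩)
    exact Eventually.of_forall fun τ => ⟨(Real.exp_pos s).le, Ioo_subset_Icc_self (ang_mem τ)⟩
  · intro ε hε
    obtain ⟨R, hR⟩ := (Metric.tendstoUniformlyOn_iff.1 h.decay ε hε).exists_forall_of_atTop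
    obtain ⟨S, hS⟩ := (Real.tendsto_exp_atTop.eventually_ge_atTop R).exists_forall_of_atTop
    refine ⟨S, fun s hs τ => ?_⟩
    have := (hR _ (hS s hs) _ (Ioo_subset_Icc_self (ang_mem τ))).le
    rwa [dist_zero_left] at this
  · unfold polarL
    rw [partialTheta_partialTheta_toPolar (Z := u) (fun _ => rfl) hdu hdw,
      partialTheta_tan_toPolar (u := u) (fun _ => rfl) hdu, mul_assoc (-α ^ 2), R2, R1]
    have he := (Real.exp_pos q.1).ne'
    have e : α * (5 + α) * (toPolar q).1 * (u1 q / Real.exp q.1) = α * (5 + α) * u1 q := by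
      simp only [toPolar]; field_simp
    rw [e]
    change _ - 6 * u q = _
    unfold rhs
    ring

/-- `L₁₂` in the coordinates of the plane. -/
lemma L12_exp {F G : ℝ × ℝ → ℝ} (h : ∀ᵐ q, F (toPolar q) = G q) (s : ℝ) :
    L12 F (Real.exp s) = ell G s := by
  have hinner : ∀ x, Real.exp x * ∫ θ in (0 : ℝ)..(Real.pi / 2), F (Real.exp x, θ) * kernelK θ / Real.exp x =
      3 / 2 * ∫ τ, rho τ * F (toPolar (x, τ)) := fun x => by
    rw [intervalIntegral.integral_of_le (by positivity), integral_Ioc_eq_integral_Ioo, ← range_ang,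
      ← image_univ, integral_image_eq_integral_abs_deriv_smul MeasurableSet.univ
        (fun τ _ => (hasDerivAt_ang τ).hasDerivWithinAt) strictMono_ang.injective.injOn,
      Measure.restrict_univ, ← integral_const_mul, ← integral_const_mul]
    congr 1; ext τ
    have he := (Real.exp_pos x).ne'
    have hk : kernelK (ang τ) = 3 / 2 * (sn τ * co τ) := by
      rw [kernelK, ← sin_two_ang, Real.sin_two_mul, ← cos_ang]; ring
    rw [hk, abs_of_pos (sn_pos τ), smul_eq_mul]
    change _ = 3 / 2 * (sn τ ^ 2 * co τ * F (Real.exp x, ang τ))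
    field_simp
  have himg : Real.exp '' Ioi s = Ioi (Real.exp s) := by
    ext r; constructor
    · rintro ⟨x, hx, rfl⟩; exact Real.exp_lt_exp.2 hx
    · intro hr
      have h0 : 0 < r := (Real.exp_pos s).trans hr
      exact ⟨Real.log r, (Real.lt_log_iff_exp_lt h0).2 hr, Real.exp_log h0⟩
  unfold L12 ell
  rw [← himg, integral_image_eq_integral_abs_deriv_smul measurableSet_Ioi
    (fun x _ => (Real.hasDerivAt_exp x).hasDerivWithinAt) Real.exp_injective.injOn,
    ← integral_const_mul]
  rw [Measure.volume_eq_prod] at h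
  refine setIntegral_congr_ae measurableSet_Ioi ?_
  filter_upwards [Measure.ae_ae_of_ae_prod h] with x hx _
  rw [abs_of_pos (Real.exp_pos x), smul_eq_mul, hinner, mode,
    integral_congr_ae (hx.mono fun τ hτ => by simp only [hτ] : (fun τ => rho τ * F (toPolar (x, τ))) =ᵐ[volume] fun τ => rho τ * G (x, τ))]
  ring

/-! ### The norms -/

/-- The square of the norm of `𝓗^k`. -/
def hSq (γ : ℝ) (k : ℕ) (f : ℝ × ℝ → ℝ) : ℝ≥0∞ :=
  (∑ j ∈ Finset.range (k + 1), weightedSq eta 0 j f) +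
    ∑ ij ∈ (Finset.range (k + 1) ×ˢ Finset.range (k + 1)).filter
        (fun ij => 1 ≤ ij.1 ∧ ij.1 + ij.2 ≤ k), weightedSq γ ij.1 ij.2 f

lemma hNorm_eq (γ : ℝ) (k : ℕ) (f : ℝ × ℝ → ℝ) : hNorm γ k f = hSq γ k f ^ (1 / 2 : ℝ) := rfl

lemma weightedSq_zero_le_hSq {γ : ℝ} {k j : ℕ} (f : ℝ × ℝ → ℝ) (hj : j ≤ k) :
    weightedSq eta 0 j f ≤ hSq γ k f :=
  (Finset.single_le_sum (f := fun j => weightedSq eta 0 j f) (fun _ _ => zero_le)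
    (Finset.mem_range.2 (Nat.lt_succ_of_le hj))).trans le_self_add

lemma weightedSq_le_hSq {γ : ℝ} {k i j : ℕ} (f : ℝ × ℝ → ℝ) (hi : 1 ≤ i) (hij : i + j ≤ k) :
    weightedSq γ i j f ≤ hSq γ k f := by
  refine le_trans ?_ le_add_self
  exact Finset.single_le_sum (f := fun ij : ℕ × ℕ => weightedSq γ ij.1 ij.2 f) (fun _ _ => zero_le)
    (by simp only [Finset.mem_filter, Finset.mem_product, Finset.mem_range]; omega :
      (i, j) ∈ (Finset.range (k + 1) ×ˢ Finset.range (k + 1)).filter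
        (fun ij => 1 ≤ ij.1 ∧ ij.1 + ij.2 ≤ k))

/-- A bound for the number of terms in the norm. -/
def numTerms (k : ℕ) : ℝ := (k + 1) + (k + 1) * (k + 1)

lemma hNorm_le {γ B : ℝ} {k : ℕ} {f : ℝ × ℝ → ℝ} (hB : 0 ≤ B)
    (h0 : ∀ j ≤ k, weightedSq eta 0 j f ≤ ENNReal.ofReal B)
    (h1 : ∀ i j, 1 ≤ i → i + j ≤ k → weightedSq γ i j f ≤ ENNReal.ofReal B) :
    hNorm γ k f ≤ ENNReal.ofReal (√(numTerms k * B)) := by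
  have hS : hSq γ k f ≤ ENNReal.ofReal (numTerms k * B) := by
    have e1 : ∑ j ∈ Finset.range (k + 1), weightedSq eta 0 j f ≤ ENNReal.ofReal ((k + 1) * B) := by
      refine (Finset.sum_le_card_nsmul _ _ (ENNReal.ofReal B) fun j hj =>
        h0 j (Nat.lt_succ_iff.1 (Finset.mem_range.1 hj))).trans (le_of_eq ?_)
      rw [Finset.card_range, nsmul_eq_mul, ENNReal.ofReal_mul (by positivity)]
      congr 1
      rw [← Nat.cast_succ, ENNReal.ofReal_natCast]
    have e2 : ∑ ij ∈ (Finset.range (k + 1) ×ˢ Finset.range (k + 1)).filter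
        (fun ij => 1 ≤ ij.1 ∧ ij.1 + ij.2 ≤ k), weightedSq γ ij.1 ij.2 f ≤
        ENNReal.ofReal ((k + 1) * (k + 1) * B) := by
      refine (Finset.sum_le_card_nsmul _ _ (ENNReal.ofReal B) fun ij hij =>
        h1 _ _ (Finset.mem_filter.1 hij).2.1 (Finset.mem_filter.1 hij).2.2).trans ?_
      refine (nsmul_le_nsmul_left zero_le (Finset.card_filter_le _ _)).trans (le_of_eq ?_)
      rw [Finset.card_product, Finset.card_range, nsmul_eq_mul, ENNReal.ofReal_mul (by positivity)]
      congr 1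
      rw [← Nat.cast_succ, ← Nat.cast_mul, ENNReal.ofReal_natCast]
    refine (add_le_add e1 e2).trans (le_of_eq ?_)
    rw [← ENNReal.ofReal_add (by positivity) (by positivity), numTerms]
    congr 1; ring
  rw [hNorm_eq, Real.sqrt_eq_rpow, ← ENNReal.ofReal_rpow_of_nonneg
    (mul_nonneg (by unfold numTerms; positivity) hB) (by norm_num)]
  exact ENNReal.rpow_le_rpow hS (by norm_num)

/-- The data in the plane that belong to a solution in polar coordinates. -/
lemma exists_datum {α γ : ℝ} {k : ℕ} {F Ψ : ℝ × ℝ → ℝ} (hα0 : 0 < α) (hα : α ≤ 1 / 4) (hγ1 : eta ≤ γ)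
    (hγ2 : γ ≤ 2) (hF : hSq γ k F < ⊤) (h : IsSolution α F Ψ) :
    ∃ x : Datum k, x.α = α ∧ x.γ = γ ∧ x.N = (hSq γ k F).toReal ∧ (∀ q, Ψ (toPolar q) = x.u q) ∧
      (∀ᵐ q, F (toPolar q) = x.F q) ∧
      ∀ q, (toPolar q).1 ^ 2 * partialR (partialR Ψ) (toPolar q) = x.u2 q - x.u1 q := by
  obtain ⟨u1, u2, w, y, sol, hL, hR⟩ := h.exists_planeSol
  have cr := sol.continuous_rhs α
  have hFe : ∀ᵐ q, F (toPolar q) = rhs α u1 u2 y q :=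
    (ae_dom_iff h.equation).mono fun q hq => by rw [← hq, hL]
  have hFl : LocallyIntegrable fun q => F (toPolar q) :=
    cr.locallyIntegrable.congr (hFe.mono fun q hq => hq.symm)
  have eF : toDist _ hFl = ofCont _ cr := by
    ext φ
    exact integral_congr_ae (hFe.mono fun q hq => by simp only [hq])
  have b0 : ∀ j ≤ k, Bdd eta (Dist.dS^[j] (ofCont (rhs α u1 u2 y) cr)) (hSq γ k F).toReal :=
    fun j hj => by
      rw [← eF]; exact bdd_of_weightedSq (i := 0) hFl hF (weightedSq_zero_le_hSq F hj)
  have b1 : ∀ i j, 1 ≤ i → i + j ≤ k →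
      Bdd γ (Dist.dT^[i] (Dist.dS^[j] (ofCont (rhs α u1 u2 y) cr))) (hSq γ k F).toReal :=
    fun i j hi hij => by
      rw [← eF]; exact bdd_of_weightedSq hFl hF (weightedSq_le_hSq F hi hij)
  exact ⟨⟨α, γ, _, u1, u2, w, y, _, hα0, hα, hγ1, hγ2, sol, b0, b1⟩, rfl, rfl, rfl, fun _ => rfl,
    hFe, hR⟩

/-- The distribution `radialTarget` is `α² R² ∂_RR Ψ`. -/
lemma Datum.exists_radialTarget_eq {k : ℕ} (x : Datum k) {f : ℝ × ℝ → ℝ}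
    (h : ∀ q, f (toPolar q) = x.u2 q - x.u1 q) :
    ∃ hf : LocallyIntegrable fun q => f (toPolar q), x.radialTarget = x.α • x.α • toDist _ hf := by
  have c1 := x.sol.cu1
  have c2 := x.sol.cu2
  have c3 : Continuous fun q => f (toPolar q) := by simp_rw [h]; fun_prop
  have c4 : Continuous fun q => -1 * x.u1 q := by fun_prop
  refine ⟨c3.locallyIntegrable, ?_⟩
  have e1 : (-1 : ℝ) • ofCont x.u1 c1 = ofCont _ c4 :=
    (toDist_smul c1.locallyIntegrable _ c4.locallyIntegrable).symm
  have e2 : ofCont x.u2 c2 + ofCont _ c4 = toDist _ c3.locallyIntegrable :=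
    (toDist_add c2.locallyIntegrable c4.locallyIntegrable
      (c2.add c4).locallyIntegrable).symm.trans (toDist_congr _ _ fun q => by rw [h]; ring)
  rw [Datum.radialTarget, x.dS_dS_U, x.dS_U, e1, e2]

/-- The distribution `angularTarget` is `∂_θθ (Ψ - (4α)⁻¹ sin 2θ L₁₂(F))`. -/
lemma Datum.exists_angularTarget_eq {k : ℕ} (x : Datum k) {F Ψ : ℝ × ℝ → ℝ}
    (hΨ : ∀ q, Ψ (toPolar q) = x.u q) (hF : ∀ᵐ q, F (toPolar q) = x.F q) :
    ∃ hf : LocallyIntegrable fun q => (partialTheta (partialTheta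
        (fun p => Ψ p - 1 / (4 * x.α) * Real.sin (2 * p.2) * L12 F p.1))) (toPolar q),
      x.angularTarget = toDist _ hf := by
  have hell : ∀ s, L12 F (Real.exp s) = ell x.F s := L12_exp hF
  have cw := x.sol.cw
  have cy := x.sol.cy
  have cZ : Continuous (PlaneSol.regular x.α x.u x.F) := x.sol.continuous_regular x.wsq_F_lt
  have hZ : ∀ s τ, HasDerivAt (fun t => PlaneSol.regular x.α x.u x.F (s, t))
      (2 * cs τ * PlaneSol.regular x.α x.u x.F (s, τ) + sn τ ^ 2 * x.w (s, τ)) τ := fun s τ => by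
    unfold PlaneSol.regular
    refine ((x.sol.du s τ).sub (((hasDerivAt_sn τ).mul_const (ell x.F s)).const_mul
      (1 / (4 * x.α)))).congr_deriv ?_
    ring
  have key := partialTheta_partialTheta_toPolar
    (f := fun p => Ψ p - 1 / (4 * x.α) * Real.sin (2 * p.2) * L12 F p.1) (fun q => by
      simp only [PlaneSol.regular]
      rw [hΨ, toPolar, sin_two_ang, hell, mul_assoc]) hZ x.sol.dw
  have c1 : Continuous fun q => -4 * PlaneSol.regular x.α x.u x.F q := by fun_prop
  have c2 : Continuous fun q : ℝ × ℝ => (1 - cs q.2) * x.w q := by fun_prop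
  have c3 : Continuous fun q => -1 * x.y q := by fun_prop
  have c4 : Continuous fun q => (partialTheta (partialTheta
      (fun p => Ψ p - 1 / (4 * x.α) * Real.sin (2 * p.2) * L12 F p.1))) (toPolar q) := by
    simp_rw [key]; fun_prop
  refine ⟨c4.locallyIntegrable, ?_⟩
  have e1 : x.Z.pm (Polynomial.C (-4)) = ofCont _ c1 :=
    Eq.trans (Dist.mul_congr _ _ contDiff_const fun τ => by simp)
      (toDist_mul cZ.locallyIntegrable contDiff_const c1.locallyIntegrable).symm
  have e2 : x.W.pm (1 - Polynomial.X) = ofCont _ c2 :=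
    Eq.trans (Dist.mul_congr _ _ (contDiff_const.sub contDiff_cs) fun τ => by simp)
      (toDist_mul cw.locallyIntegrable (contDiff_const.sub contDiff_cs) c2.locallyIntegrable).symm
  have e3 : x.Y.pm (Polynomial.C (-1)) = ofCont _ c3 :=
    Eq.trans (Dist.mul_congr _ _ contDiff_const fun τ => by simp)
      (toDist_mul cy.locallyIntegrable contDiff_const c3.locallyIntegrable).symm
  have e4 : ofCont _ c1 + ofCont _ c2 = ofCont _ (c1.add c2) :=
    (toDist_add c1.locallyIntegrable c2.locallyIntegrable (c1.add c2).locallyIntegrable).symm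
  have e5 : ofCont _ (c1.add c2) + ofCont _ c3 = ofCont _ ((c1.add c2).add c3) :=
    (toDist_add (c1.add c2).locallyIntegrable c3.locallyIntegrable
      ((c1.add c2).add c3).locallyIntegrable).symm
  rw [Datum.angularTarget, e1, e2, e3, e4, e5]
  refine toDist_congr _ _ fun q => ?_
  rw [key]; simp only [Pi.add_apply]; ring

lemma Dist.dT_iterate_smul (T : Dist) (c : ℝ) (i : ℕ) : dT^[i] (c • T) = c • dT^[i] T := by
  induction i generalizing T with
  | zero => rfl
  | succ i ih => rw [Function.iterate_succ_apply, dT_smul, ih]; rfl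

/-- The two estimates, for the whole range `η ≤ γ ≤ 2` of exponents. Both follow by transporting
`exists_bound_targets` back to `dom`; the factor `α²` is divided out of the first target, because the
norm is applied to `R² ∂_RR Ψ` itself. -/
theorem hNorm_estimate (k : ℕ) : ∃ C : ℝ, 0 ≤ C ∧ ∀ α γ : ℝ, 0 < α → α ≤ 1 / 4 → eta ≤ γ → γ ≤ 2 →
      ∀ F Ψ : ℝ × ℝ → ℝ, hNorm γ k F < ⊤ → IsSolution α F Ψ →
        ENNReal.ofReal (α ^ 2) * hNorm γ k (fun p => p.1 ^ 2 * partialR (partialR Ψ) p) ≤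
            ENNReal.ofReal C * hNorm γ k F ∧
          hNorm γ k (partialTheta (partialTheta
              (fun p => Ψ p - 1 / (4 * α) * Real.sin (2 * p.2) * L12 F p.1))) ≤
            ENNReal.ofReal C * hNorm γ k F := by
  obtain ⟨C, hC, hx⟩ := exists_bound_targets k
  have hn : 0 ≤ numTerms k := by unfold numTerms; positivity
  refine ⟨√(numTerms k * (8 * C)), Real.sqrt_nonneg _, fun α γ hα0 hα hγ1 hγ2 F Ψ hF h => ?_⟩
  have hS : hSq γ k F < ⊤ := by
    rw [hNorm_eq] at hF
    exact (ENNReal.rpow_lt_top_iff_of_pos (by norm_num)).1 hF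
  obtain ⟨x, rfl, rfl, hN, hΨ, hFx, hR⟩ := exists_datum hα0 hα hγ1 hγ2 hS h
  obtain ⟨hf1, e1⟩ := x.exists_radialTarget_eq
    (f := fun p => p.1 ^ 2 * partialR (partialR Ψ) p) hR
  obtain ⟨hf2, e2⟩ := x.exists_angularTarget_eq hΨ hFx
  obtain ⟨b0, b1⟩ := hx x
  have hN0 := x.N_nonneg
  have hα2 : 0 < x.α ^ 2 := by positivity
  have fin : ENNReal.ofReal (√(numTerms k * (8 * (C * x.N)))) =
      ENNReal.ofReal (√(numTerms k * (8 * C))) * hNorm x.γ k F := by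
    rw [← mul_assoc 8, ← mul_assoc, Real.sqrt_mul (by positivity), ENNReal.ofReal_mul (Real.sqrt_nonneg _)]
    congr 1
    rw [hN, hNorm_eq, Real.sqrt_eq_rpow, ← ENNReal.ofReal_rpow_of_nonneg ENNReal.toReal_nonneg
      (by norm_num), ENNReal.ofReal_toReal hS.ne]
  constructor
  · have unscale : ∀ {σ : ℝ} {T : Dist}, Bdd σ (x.α • x.α • T) (C * x.N) →
        Bdd σ T ((x.α ^ 2)⁻¹ ^ 2 * (C * x.N)) := fun hT => by
      have := hT.smul (x.α ^ 2)⁻¹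
      rwa [smul_smul, smul_smul, mul_assoc, ← pow_two, inv_mul_cancel₀ hα2.ne', one_smul] at this
    have hB : 0 ≤ (x.α ^ 2)⁻¹ ^ 2 * (C * x.N) := by positivity
    have key := hNorm_le (γ := x.γ) (k := k) (B := 8 * ((x.α ^ 2)⁻¹ ^ 2 * (C * x.N)))
      (f := fun p => p.1 ^ 2 * partialR (partialR Ψ) p) (by positivity)
      (fun j hj => weightedSq_le_of_bdd (i := 0) hf1 (unscale (by
        have := (b0 j hj).1
        rwa [e1, Dist.dS_iterate_smul, Dist.dS_iterate_smul] at this)))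
      (fun i j hi hij => weightedSq_le_of_bdd hf1 (unscale (by
        have := (b1 i j hi hij).1
        rwa [e1, Dist.dS_iterate_smul, Dist.dS_iterate_smul, Dist.dT_iterate_smul,
          Dist.dT_iterate_smul] at this)))
    refine (mul_le_mul_right key _).trans (le_of_eq ?_)
    rw [← fin, ← ENNReal.ofReal_mul hα2.le]
    congr 1
    rw [show numTerms k * (8 * ((x.α ^ 2)⁻¹ ^ 2 * (C * x.N))) =
      (x.α ^ 2)⁻¹ ^ 2 * (numTerms k * (8 * (C * x.N))) by ring, Real.sqrt_mul (sq_nonneg _),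
      Real.sqrt_sq (by positivity), mul_inv_cancel_left₀ hα2.ne']
  · have key := hNorm_le (γ := x.γ) (k := k) (B := 8 * (C * x.N)) (by positivity)
      (fun j hj => weightedSq_le_of_bdd (i := 0) hf2 (by
        have := (b0 j hj).2
        rwa [e2] at this))
      (fun i j hi hij => weightedSq_le_of_bdd hf2 (by
        have := (b1 i j hi hij).2
        rwa [e2] at this))
    exact key.trans fin.le

end PolarBS

end

theorem mainTheorem2 (k : ℕ) :
    ∃ C : ℝ≥0, ∀ α γ : ℝ, 0 < α → α ≤ 1 / 4 → 1 < γ → γ ≤ 5 / 4 →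
      ∀ F Ψ : ℝ × ℝ → ℝ, PolarBS.hNorm γ k F < ⊤ → PolarBS.IsSolution α F Ψ →
        ENNReal.ofReal (α ^ 2) *
            PolarBS.hNorm γ k
              (fun p => p.1 ^ 2 * PolarBS.partialR (PolarBS.partialR Ψ) p) +
          PolarBS.hNorm γ k
            (PolarBS.partialTheta (PolarBS.partialTheta
              (fun p => Ψ p - 1 / (4 * α) * Real.sin (2 * p.2) * PolarBS.L12 F p.1)))
        ≤ C * PolarBS.hNorm γ k F := by
  obtain ⟨C, hC, h⟩ := PolarBS.hNorm_estimate k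
  refine ⟨2 * C.toNNReal, fun α γ hα0 hα hγ1 hγ2 F Ψ hF hΨ => ?_⟩
  obtain ⟨h1, h2⟩ := h α γ hα0 hα (PolarBS.eta_lt_one.le.trans hγ1.le) (by linarith) F Ψ hF hΨ
  refine (add_le_add h1 h2).trans (le_of_eq ?_)
  rw [← add_mul, ← two_mul]
  rfl
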